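/- **Setup.** Fix $n\ge 0$. A crossingless matching of $2n$ points on a line $\ell$ is drawn in the right half-plane bounded by $\ell$ (written $b$), and its mirror image in the left half-plane is written $W(b)$. Let $\beta$ be the finite set of pairs $h=(W(a)b,\sigma)$, where $a,b$ are crossingless matchings and $\sigma$ labels every circle of $W(a)b$ by $+$ or $-$; $a$ is the left and $b$ the right matching of $h$. Put $m(h)=(W(b)a,m(\sigma))$ (mirror image) and $\deg h=n+\#\{\text{circles }-\}-\#\{\text{circles }+\}$. Khovanov's arc algebra $H^n$ has $\mathbb Z$-basis $\beta$; the product of $(W(a)b,\sigma)$ and $(W(b)c,\tau)$ is given by the minimal saddle cobordism from $W(a)b\,W(b)c$ to $W(a)c$, with merge map $++\mapsto +$, $+-,-+\mapsto -$, $--\mapsto 0$ and split map $+\mapsto (+-)+(-+)$, $-\mapsto --$; other products vanish. A *bridge* $\gamma$ on $b$ is an arc joining two distinct arcs of $b$ without meeting $b$ elsewhere; $b_\gamma$ is the result of surgery along $\gamma$, and $\gamma^\dagger$ is the bridge on $b_\gamma$ whose surgery gives $b$ back. Bridges are taken up to isotopy, so that $\gamma$ is determined by $(b,b_\gamma)$.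 If $\gamma$ and $\eta$ are bridges on $b$ and $\eta$ survives the surgery along $\gamma$, the corresponding bridge on $b_\gamma$ is written $\eta'$. The multiplicative generators of $H^n$ are $h_\gamma=(W(b)b_\gamma,\text{all }+)$ and $h_\alpha=(W(b)b,\ -\text{ on the circle of the arc }\alpha,\ +\text{ elsewhere})$. **The algebra $B=B_R(H^n)$.** Let $I_n$ be the idempotent ring of $H^n$. For $h_1,h_2\in\beta$ with equal left matchings let $e(h_1,h_2)$ be the endomorphism of the left $I_n$-module $H^n$ with $h_1\mapsto h_2$ and all other basis elements $\mapsto 0$, composed so that $e(h_1,h_2)e(h_2,h_3)=e(h_1,h_3)$. $B$ is the ring generated by the idempotents $e(h,h)$, which span $I_\beta$, and by all $e(h_1,h_2)$ such that $h_2$ occurs in $h_1h_\gamma$ (generator $b_{\gamma;h_1,h_2}$) or in $h_1h_\alpha$ (generator $b_{C;h_1,h_2}$, where $C$ is the circle whose label changes). Generators have bidegree (intrinsic, homological) $\left(\tfrac12(\deg h_1-\deg h_2),0\right)$. Let $V$ be the free $\mathbb Z$-module on the generators, $T(V)$ its tensor algebra over $I_\beta$, $B=T(V)/J$; let $I\subset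 T^2(V)$ be the image of $J\cap(T^1(V)\oplus T^2(V))$, and $\varphi:I\to V$ the map with $r+\varphi(r)\in J$. The quadratic dual is $B^!=T(V^*)/(I^\perp)$, where $b^*$ has bidegree minus that of $b$ plus $(0,1)$, with differential $b^*\mapsto\varphi^*(b^*)=b^*\circ\varphi\in I^*=T^2(V^*)/I^\perp$. Differentials satisfy $d(xy)=(-1)^{\deg y}d(x)y+x\,d(y)$ with $\deg$ the homological degree. $m(B)^!$ is the same ring, elements written $m(x)$, with idempotents mirrored: $m(b^*_{*;m(h_1),m(h_2)})$ has left idempotent $h_1$ and right idempotent $h_2$. **The product algebra.** $B\odot m(B)^!=T(V_{full})/J_{full}$, where $V_{full}=V_B\oplus V_{m(B)^!}$ and $J_{full}$ is the two-sided ideal generated by the elements of $J_B$ and of $J_{m(B)^!}$ lying in $T^1\oplus T^2$ and by the following elements, for all generators and elements of $\beta$ for which the expressions make sense: 1. $b_{\gamma;h_1,h_2}\,m(b^*_{\eta';m(h_2),m(h_3)})-m(b^*_{\eta;m(h_1),m(h_2')})\,b_{\gamma';h_2',h_3}$; 2. $b_{C;h_1,h_2}\,m(b^*_{\eta;m(h_2),m(h_3)})-m(b^*_{\eta;m(h_1),m(h_2')})\,b_{C';h_2',h_3}$;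 3. $b_{\gamma;h_1,h_2}\,m(b^*_{C;m(h_2),m(h_3)})-m(b^*_{C;m(h_1),m(h_2')})\,b_{\gamma;h_2',h_3}$ if $C$ is disjoint from the circles involved in surgery on $\gamma$; 4. $b_{C;h_1,h_2}\,m(b^*_{C';m(h_2),m(h_3)})-m(b^*_{C';m(h_1),m(h_2')})\,b_{C;h_2',h_3}$ if $C\ne C'$; 5. $b_{\gamma;h_1,h_2}\,m(b^*_{C;m(h_2),m(h_3)})-m(b^*_{C';m(h_1),m(h_2')})\,b_{\gamma;h_2',h_3}-m(b^*_{C'';m(h_1),m(h_2'')})\,b_{\gamma;h_2'',h_3}$ if $\gamma$ joins $C'\ne C''$ to form $C$, and $b_{\gamma;h_1,h_2'}\,m(b^*_{C';m(h_2'),m(h_3)})+b_{\gamma;h_1,h_2''}\,m(b^*_{C'';m(h_2''),m(h_3)})-m(b^*_{C;m(h_1),m(h_2)})\,b_{\gamma;h_2,h_3}$ if $\gamma$ splits $C$ to form $C'\ne C''$. The differential $d$ is zero on generators of $B$ and is the differential of $m(B)^!$ on generators of $m(B)^!$. **Tetrahedron relations.** Let $h_1,h_3\in\beta$, let $\gamma,\eta$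 be different bridges on the left matching of $h_1$ such that the surgeries along $\gamma,\eta'$ and along $\eta,\gamma'$ both lead to the left matching of $h_3$, which is not that of $h_1$, and assume that $\gamma$ splits a circle labelled $+$ and $\eta'$ joins the two new circles to a circle labelled $-$. There are two labellings $h_2,h_2'$ after $\gamma$ and two labellings $h_2'',h_2'''$ after $\eta$. With $a=m(b^*_{\gamma;m(h_1),m(h_2)})m(b^*_{\eta';m(h_2),m(h_3)})$, $b=m(b^*_{\gamma;m(h_1),m(h_2')})m(b^*_{\eta';m(h_2'),m(h_3)})$, $c=m(b^*_{\eta;m(h_1),m(h_2'')})m(b^*_{\gamma';m(h_2''),m(h_3)})$, $d=m(b^*_{\eta;m(h_1),m(h_2''')})m(b^*_{\gamma';m(h_2'''),m(h_3)})$, the extra relations are $a+c=a+d=b+c=b+d=0$. **Roberts' algebra $B\Gamma_n$.** It is the quotient of the path algebra over $\mathbb Z$ of the following quiver with vertex set $\beta$ (products of paths are read from left to right). For each side $s\in\{\text{left},\text{right}\}$ there is a *decoration edge* $e^s_{C;h_1,h_2}$ whenever $h_2$ is obtained from $h_1$ by changing the label of one circle $C$ from $+$ to $-$. There is a *bridge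 edge* $e^s_{\gamma;h_1,h_2}$ whenever the diagram of $h_2$ is obtained from that of $h_1$ by surgery along a bridge $\gamma$ on the matching on side $s$ and the labels are related by the merge and split maps above. Right edges have homological degree $0$ and left edges $1$; the intrinsic degrees are $-1$ and $-\frac12$ for right decoration and bridge edges, and $1$ and $\frac12$ for left ones. Write $\epsilon_{st}=-1$ if $s=t=\text{left}$ and $\epsilon_{st}=1$ otherwise. Indices $h_i$ are suppressed where they are clear. The relations, for all paths between two fixed vertices $h_1,h_3$ as indicated, are: * $e^s_Ce^t_{D}=\epsilon_{st}\,e^t_{D}e^s_C$ for distinct circles $C,D$. * $e^s_\gamma e^t_{\eta'}=\epsilon_{st}\,e^t_\eta e^s_{\gamma'}$, for all choices of labels in between, if $s\ne t$, or if $s=t$, $\gamma\ne\eta$ do not cross, and they do not meet a common arc from the same side. * If $\gamma,\eta$ are distinct right bridges that meet a common arc from the same side, then the products $e_{\gamma}e_{*}$ and $e_{\eta}e_{*}$ from $h_1$ to $h_3$ are equal (where the right matchings of $h_1$ and $h_3$ differ). If $\gamma_1,\gamma_2,\gamma_3$ are left bridges that connect three arcs pairwise, with each two of them meeting their common arc from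 the same side, then $e_{\gamma_1}e_{*}+e_{\gamma_2}e_{*}+e_{\gamma_3}e_{*}=0$ for the products from $h_1$ to $h_3$ (where the left matchings of $h_1$ and $h_3$ differ). * If $\eta$ is a bridge after surgery on $\gamma$ that has its ends on arcs other than those of $\gamma^\dagger$ and crosses $\gamma^\dagger$: for right bridges, the product $e_{\gamma;h_1,h_2}e_{\eta;h_2,h_3}$ does not depend on the labels of $h_2$; for left bridges, $\sum_{h_2}e_{\gamma;h_1,h_2}e_{\eta;h_2,h_3}=0$, summed over all possible labels of $h_2$. * $e^s_Ce^t_\gamma=\epsilon_{st}\,e^t_\gamma e^s_C$ if $C$ is not involved in the surgery on $\gamma$. * If a right decoration edge changes a circle involved in the surgery on $\gamma$ (on side $t$), then $e^{\rm right}_{C}e^t_\gamma=e^t_\gamma e^{\rm right}_{C'}$ for all such products from $h_1$ to $h_3$. For left decoration edges, $e^{\rm left}_{C'}e^t_\gamma+e^{\rm left}_{C''}e^t_\gamma=\epsilon_{{\rm left},t}\,e^t_\gamma e^{\rm left}_C$ if $\gamma$ joins $C'\ne C''$ to $C$, and $e^{\rm left}_{C}e^t_\gamma=\epsilon_{{\rm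 left},t}(e^t_\gamma e^{\rm left}_{C'}+e^t_\gamma e^{\rm left}_{C''})$ if $\gamma$ splits $C$ into $C'\neq C''$. * $e_{\gamma;h_1,h_2}e_{\gamma^\dagger;h_2,h_3}=e^{\rm right}_{C;h_1,h_3}$ for right bridges $\gamma$, where $C$ is the circle whose label differs in $h_1$ and $h_3$. The differential is zero on right edges and on left bridge edges, and $d(e^{\rm left}_{C;h_1,h_3})=-\sum e_{\gamma;h_1,h_2}e_{\gamma^\dagger;h_2,h_3}$, the sum over all left bridges $\gamma$ and all $h_2$ for which these edges exist. **Theorem.** Let $n\ge0$. With the differentials, bigradings and idempotents above, $B\odot m(B)^!$ and $B\Gamma_n$ are (well-defined) differential bigraded algebras over $I_\beta$. The ideal of $B\odot m(B)^!$ generated by the tetrahedron relations is preserved by the differential, and the quotient of $B\odot m(B)^!$ by this ideal is isomorphic to $B\Gamma_n$ as a differential bigraded algebra over $I_\beta$, by an isomorphism that sends $b_{*;h_1,h_2}$ to the right edge and $m(b^*_{*;m(h_1),m(h_2)})$ to the left edge from $h_1$ to $h_2$. -/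

import Mathlib

namespace BorderedKh

/-! ### Circle diagrams made of two involutions

A planar diagram is recorded by a finite set of points together with two fixed-point-free
involutions `f` and `m` (the arcs of the diagram).  Its circles are the classes of the equivalence
relation generated by `p ~ f p` and `p ~ m p`. -/

/-- `p` and `q` lie on the same circle of the diagram with arcs `f` and `m`. -/
def SameCircle {X : Type} (f m : X → X) : X → X → Prop :=
  Relation.EqvGen fun p q => q = f p ∨ q = m p

/-- The set of circles of the diagram with arcs `f` and `m`. -/
def Circles {X : Type} (f m : X → X) : Type :=
  Quotient (Relation.EqvGen.setoid fun p q => q = f p ∨ q = m p)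

open Classical in
/-- Surgery: the arcs `{i, m i}` and `{j, m j}` are replaced by `{i, j}` and `{m i, m j}`. -/
noncomputable def surger {X : Type} (m : X → X) (i j : X) : X → X := fun k =>
  if k = i then j else if k = j then i
  else if k = m i then m j else if k = m j then m i else m k

/-- `m'` is obtained from `m` by a surgery on the two distinct arcs through `i` and `j`. -/
def SurgeryAt {X : Type} (m m' : X → X) (i j : X) : Prop :=
  j ≠ i ∧ j ≠ m i ∧ m' = surger m i j

/-- `m'` is obtained from `m` by a surgery on two distinct arcs. -/
def IsSurgery {X : Type} (m m' : X → X) : Prop := ∃ i j, SurgeryAt m m' i j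

/-- The surgery from `m` to `m'` joins two circles of the diagram `(f, m)`. -/
def Joins {X : Type} (f m m' : X → X) : Prop :=
  ∃ i j, SurgeryAt m m' i j ∧ ¬ SameCircle f m i j

/-- The surgery from `m` to `m'` splits a circle of the diagram `(f, m)`. -/
def Splits {X : Type} (f m m' : X → X) : Prop :=
  ∃ i j, SurgeryAt m m' i j ∧ SameCircle f m i j

open Classical in
/-- Khovanov's rule for the surgery of `m` at `i, j`: the labelling `σ'` (`true` is plus, `false` is
minus) occurs, with coefficient one, in the image of the labelling `σ` under the merge map
`++ ↦ +`, `+- ↦ -`, `-+ ↦ -`, `-- ↦ 0`, or the split map `+ ↦ (+-) + (-+)`, `- ↦ --`.  Labellings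
are functions on points that are constant on circles; after a splitting, the two new circles are
the circle of `i` and the circle of `m i`. -/
def SaddleRule {X : Type} (f m : X → X) (i j : X) (σ σ' : X → Bool) : Prop :=
  (∀ k, ¬ SameCircle f m i k → ¬ SameCircle f m j k → σ' k = σ k) ∧
  if SameCircle f m i j then
    (σ i = true ∧ σ' i ≠ σ' (m i)) ∨ (σ i = false ∧ σ' i = false ∧ σ' (m i) = false)
  else
    (σ i = true ∧ σ' i = σ j) ∨ (σ i = false ∧ σ j = true ∧ σ' i = false)

/-! ### Crossingless matchings and labelled circle diagrams -/

/-- A crossingless matching of `2n` points on a line. -/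
structure NCMatching (n : ℕ) where
  toFun : Fin (2 * n) → Fin (2 * n)
  invol : ∀ i, toFun (toFun i) = i
  noFix : ∀ i, toFun i ≠ i
  noCross : ∀ i j, ¬ (i < j ∧ j < toFun i ∧ toFun i < toFun j)

instance (n : ℕ) : CoeFun (NCMatching n) (fun _ => Fin (2 * n) → Fin (2 * n)) :=
  ⟨NCMatching.toFun⟩

/-- The set `β` of pairs `(W(a)b, σ)`: `left` is `a`, `right` is `b`, and `sign` is `σ`, a function
on the `2n` points that is constant on the circles of `W(a)b` (`true` is plus). -/
@[ext] structure DecLink (n : ℕ) where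
  left : NCMatching n
  right : NCMatching n
  sign : Fin (2 * n) → Bool
  sign_left : ∀ p, sign (left p) = sign p
  sign_right : ∀ p, sign (right p) = sign p

noncomputable instance (n : ℕ) : Fintype (DecLink n) :=
  Fintype.ofInjective (fun h : DecLink n => (h.left.toFun, h.right.toFun, h.sign)) (by
    rintro ⟨⟨a, _, _, _⟩, ⟨b, _, _, _⟩, s, _, _⟩ ⟨⟨a', _, _, _⟩, ⟨b', _, _, _⟩, s', _, _⟩ h
    simp only [Prod.mk.injEq] at h
    obtain ⟨rfl, rfl, rfl⟩ := h
    rfl)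

noncomputable instance (n : ℕ) : DecidableEq (DecLink n) := Classical.decEq _

/-- The mirror `(W(b)a, m(σ))` of `(W(a)b, σ)`. -/
def DecLink.mirror {n : ℕ} (h : DecLink n) : DecLink n :=
  ⟨h.right, h.left, h.sign, h.sign_right, h.sign_left⟩

theorem DecLink.mirror_mirror {n : ℕ} (h : DecLink n) : h.mirror.mirror = h := rfl

/-- `p` and `q` lie on the same circle of `W(a)b`. -/
def DecLink.SameCirc {n : ℕ} (h : DecLink n) (p q : Fin (2 * n)) : Prop :=
  SameCircle h.left h.right p q

/-- The number of circles of `W(a)b` labelled `s`. -/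
noncomputable def DecLink.count {n : ℕ} (h : DecLink n) (s : Bool) : ℕ :=
  Set.ncard {c : Circles h.left h.right | ∃ p, Quotient.mk _ p = c ∧ h.sign p = s}

/-- The degree of `(W(a)b, σ)` in `H^n`. -/
noncomputable def DecLink.deg {n : ℕ} (h : DecLink n) : ℤ :=
  n + h.count false - h.count true

/-! ### The arc algebra `H^n` -/

open Classical in
/-- The matrix coefficient, from `ℓ` to `ℓ'`, of the composition of the saddle maps that perform the
surgeries in the list one after the other, starting with the diagram `(f, m)`. -/
noncomputable def saddleCoeff {X : Type} [Fintype X] (f : X → X) :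
    List (X × X) → (X → X) → (X → Bool) → (X → Bool) → ℤ
  | [], _, ℓ, ℓ' => if ℓ = ℓ' then 1 else 0
  | (i, j) :: rest, m, ℓ, ℓ' =>
      ∑ ℓ₁ : X → Bool,
        if (∀ k, ℓ₁ (f k) = ℓ₁ k) ∧ (∀ k, ℓ₁ (surger m i j k) = ℓ₁ k) ∧ SaddleRule f m i j ℓ ℓ₁
        then saddleCoeff f rest (surger m i j) ℓ₁ ℓ' else 0

/-- The saddles of the minimal cobordism from `W(a)b W(b)c` to `W(a)c`, one for each arc of `b`,
with outer arcs before inner ones.  The points of the diagram `W(a)b` are `Sum.inl p`, those of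
`W(b)c` are `Sum.inr p`. -/
noncomputable def saddleList {n : ℕ} (b : NCMatching n) :
    List ((Fin (2 * n) ⊕ Fin (2 * n)) × (Fin (2 * n) ⊕ Fin (2 * n))) :=
  ((List.finRange (2 * n)).filter fun i => i < b i).map fun i => (Sum.inl i, Sum.inr i)

/-- The coefficient of `h₃` in the `β`-expansion of the product `h₁ · h₂` in `H^n`. -/
noncomputable def arcMulCoeff {n : ℕ} (h₁ h₂ h₃ : DecLink n) : ℤ :=
  open Classical in
  if h₁.right = h₂.left ∧ h₃.left = h₁.left ∧ h₃.right = h₂.right then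
    saddleCoeff (Sum.map h₁.left h₂.right) (saddleList h₁.right) (Sum.map h₁.right h₂.left)
      (Sum.elim h₁.sign h₂.sign) (Sum.elim h₃.sign h₃.sign)
  else 0

/-- The generators `h_γ = (W(a)a', all plus)`, where `a'` comes from `a` by surgery on a bridge. -/
def IsBridgeH {n : ℕ} (h : DecLink n) : Prop :=
  IsSurgery h.left h.right ∧ ∀ p, h.sign p = true

/-- The generators `h_α = (W(a)a, minus on the circle of α)`, where `α = {p, a p}`. -/
def IsArcH {n : ℕ} (h : DecLink n) : Prop :=
  h.left = h.right ∧ ∃ p, ∀ q, h.sign q = false ↔ (q = p ∨ q = h.left p)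

/-! ### The algebra `B = B_R(H^n)` -/

/-- There is a generator `b_{γ;h₁,h₂}` of `B`. -/
def IsBridgeGen {n : ℕ} (h₁ h₂ : DecLink n) : Prop :=
  ∃ h, IsBridgeH h ∧ arcMulCoeff h₁ h h₂ ≠ 0

/-- There is a generator `b_{C;h₁,h₂}` of `B`. -/
def IsCircleGen {n : ℕ} (h₁ h₂ : DecLink n) : Prop :=
  ∃ h, IsArcH h ∧ arcMulCoeff h₁ h h₂ ≠ 0

/-- There is a generator `e(h₁,h₂)` of `B`: `h₂` occurs in `h₁ · h` for some multiplicative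
generator `h` of `H^n`. -/
def IsGen {n : ℕ} (h₁ h₂ : DecLink n) : Prop := IsBridgeGen h₁ h₂ ∨ IsCircleGen h₁ h₂

/-- The ring `Hom_{I_n}(H^n, H^n)` of endomorphisms of `H^n` that are linear over the left action
of the idempotent ring `I_n`.  An endomorphism is written as a matrix in the basis `β` acting on row
vectors, so that `e(h₁,h₂)` is a matrix unit and `e(h₁,h₂) e(h₂,h₃) = e(h₁,h₃)`. -/
noncomputable def arcHom (n : ℕ) : Subalgebra ℤ (Matrix (DecLink n) (DecLink n) ℤ) where
  carrier := {M | ∀ h₁ h₂ : DecLink n, h₁.left ≠ h₂.left → M h₁ h₂ = 0}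
  mul_mem' := by
    intro A B hA hB h₁ h₂ hne
    rw [Matrix.mul_apply]
    refine Finset.sum_eq_zero fun k _ => ?_
    by_cases hk : h₁.left = k.left
    · rw [hB k h₂ (fun h => hne (hk.trans h)), mul_zero]
    · rw [hA h₁ k hk, zero_mul]
  add_mem' := by
    intro A B hA hB h₁ h₂ hne
    rw [Matrix.add_apply, hA h₁ h₂ hne, hB h₁ h₂ hne, add_zero]
  algebraMap_mem' := by
    intro r h₁ h₂ hne
    rw [Matrix.algebraMap_matrix_apply, if_neg]
    rintro rfl
    exact hne rfl

/-- The idempotents of `I_β` and the generators `e(h₁,h₂)`. -/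
def brGenSet (n : ℕ) : Set (Matrix (DecLink n) (DecLink n) ℤ) :=
  {M | (∃ h, M = Matrix.single h h 1) ∨ ∃ h₁ h₂, IsGen h₁ h₂ ∧ M = Matrix.single h₁ h₂ 1}

/-- The algebra `B_R(H^n)`. -/
noncomputable def BR (n : ℕ) : Subalgebra ℤ (Matrix (DecLink n) (DecLink n) ℤ) :=
  Algebra.adjoin ℤ (brGenSet n)

theorem IsGen.left_eq {n : ℕ} {h₁ h₂ : DecLink n} (h : IsGen h₁ h₂) : h₁.left = h₂.left := by
  obtain ⟨k, _, hk⟩ | ⟨k, _, hk⟩ := h <;>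
  · unfold arcMulCoeff at hk
    split_ifs at hk with hc
    · exact hc.2.1.symm
    · exact absurd rfl hk

theorem BR_le_arcHom (n : ℕ) : BR n ≤ arcHom n := by
  refine Algebra.adjoin_le ?_
  rintro M (⟨h, rfl⟩ | ⟨h₁, h₂, hg, rfl⟩) k₁ k₂ hne
  · rw [Matrix.single_apply, if_neg]
    rintro ⟨rfl, rfl⟩
    exact hne rfl
  · rw [Matrix.single_apply, if_neg]
    rintro ⟨rfl, rfl⟩
    exact hne hg.left_eq

/-! ### Tensor algebras over the idempotent ring

Let `V` be the free `ℤ`-module on a finite set of generators, each with a left and a right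
elementary idempotent (`src` and `tgt`).  The tensor algebra `T(V)` over the ring of idempotents
has as a `ℤ`-basis the composable words in the generators, and an elementary idempotent for each
empty word; the product is concatenation, and zero for words that cannot be composed. -/

/-- Generators with a left and a right idempotent in `I`. -/
structure Gens (I : Type) where
  E : Type
  src : E → I
  tgt : E → I

variable {I : Type}

/-- `w` is a composable word with left idempotent `u` and right idempotent `v`. -/
def Gens.IsWord (Q : Gens I) : I → List Q.E → I → Prop
  | u, [], v => u = v
  | u, e :: w, v => Q.src e = u ∧ Q.IsWord (Q.tgt e) w v

/-- The composable words. -/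
@[ext] structure Gens.Word (Q : Gens I) where
  start : I
  finish : I
  letters : List Q.E
  isWord : Q.IsWord start letters finish

theorem Gens.IsWord.append {Q : Gens I} {u v x : I} {w w' : List Q.E}
    (h : Q.IsWord u w v) (h' : Q.IsWord v w' x) : Q.IsWord u (w ++ w') x := by
  induction w generalizing u with
  | nil => cases h; exact h'
  | cons e w ih => exact ⟨h.1, ih h.2⟩

/-- The empty word at an idempotent. -/
def Gens.Word.nil {Q : Gens I} (u : I) : Q.Word := ⟨u, u, [], rfl⟩

/-- The word with one letter. -/
def Gens.Word.letter {Q : Gens I} (e : Q.E) : Q.Word := ⟨Q.src e, Q.tgt e, [e], rfl, rfl⟩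

/-- Concatenation. -/
def Gens.Word.comp {Q : Gens I} (p q : Q.Word) (h : p.finish = q.start) : Q.Word :=
  ⟨p.start, q.finish, p.letters ++ q.letters, p.isWord.append (h ▸ q.isWord)⟩

/-- The tensor algebra `T(V)` over the ring of idempotents. -/
def TAlg (Q : Gens I) : Type := Q.Word →₀ ℤ

namespace TAlg

variable {Q : Gens I}

noncomputable instance : AddCommGroup (TAlg Q) := inferInstanceAs (AddCommGroup (Q.Word →₀ ℤ))

/-- The coefficients of an element of `T(V)`. -/
def coeffs (x : TAlg Q) : Q.Word →₀ ℤ := x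

/-- A word as an element of `T(V)`. -/
noncomputable def ofWord (p : Q.Word) : TAlg Q := (Finsupp.single p 1 : Q.Word →₀ ℤ)

open Classical in
/-- The product of two words. -/
noncomputable def wordMul (p q : Q.Word) : TAlg Q :=
  if h : p.finish = q.start then ofWord (p.comp q h) else 0

/-- The product of `T(V)` as a bilinear map. -/
noncomputable def mulLin : TAlg Q →ₗ[ℤ] TAlg Q →ₗ[ℤ] TAlg Q :=
  Finsupp.lift (TAlg Q →ₗ[ℤ] TAlg Q) ℤ Q.Word fun p =>
    Finsupp.lift (TAlg Q) ℤ Q.Word fun q => wordMul p q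

theorem lift_ofWord {M : Type} [AddCommGroup M] (g : Q.Word → M) (p : Q.Word) :
    Finsupp.lift M ℤ Q.Word g (Finsupp.single p 1) = g p := by
  simp [Finsupp.lift_apply]

theorem mulLin_ofWord (p q : Q.Word) : mulLin (ofWord p) (ofWord q) = wordMul p q := by
  exact (congrArg (fun f : TAlg Q →ₗ[ℤ] TAlg Q => f (ofWord q)) (lift_ofWord _ p)).trans
    (lift_ofWord _ q)

theorem induction {P : TAlg Q → Prop} (x : TAlg Q) (h0 : P 0)
    (hadd : ∀ x y, P x → P y → P (x + y)) (hneg : ∀ x, P x → P (-x))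
    (hw : ∀ p, P (ofWord p)) : P x := by
  have hc : ∀ (c : ℤ) (p : Q.Word), P (c • ofWord p) := by
    intro c p
    induction c using Int.induction_on with
    | zero => rw [zero_smul]; exact h0
    | succ i hi => rw [add_smul, one_smul]; exact hadd _ _ hi (hw p)
    | pred i hi => rw [sub_smul, one_smul, sub_eq_add_neg]; exact hadd _ _ hi (hneg _ (hw p))
  refine Finsupp.induction_linear (motive := P) x h0 (fun f g => hadd f g) fun p c => ?_
  have : (Finsupp.single p c : Q.Word →₀ ℤ) = c • (Finsupp.single p 1 : Q.Word →₀ ℤ) := by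
    rw [Finsupp.smul_single, smul_eq_mul, mul_one]
  rw [this]
  exact hc c p

theorem mulLin_assoc (x y z : TAlg Q) : mulLin (mulLin x y) z = mulLin x (mulLin y z) := by
  induction x using TAlg.induction with
  | h0 => simp
  | hadd x x' hx hx' => simp [hx, hx']
  | hneg x hx => simp [hx]
  | hw p =>
  induction y using TAlg.induction with
  | h0 => simp
  | hadd x x' hx hx' => simp [hx, hx']
  | hneg x hx => simp [hx]
  | hw q =>
  induction z using TAlg.induction with
  | h0 => simp
  | hadd x x' hx hx' => simp [hx, hx']
  | hneg x hx => simp [hx]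
  | hw r =>
  rw [mulLin_ofWord, mulLin_ofWord]
  unfold wordMul
  by_cases h : p.finish = q.start <;> by_cases h' : q.finish = r.start
  · have h1 : (p.comp q h).finish = r.start := h'
    have h2 : p.finish = (q.comp r h').start := h
    rw [dif_pos h, dif_pos h', mulLin_ofWord, mulLin_ofWord, wordMul, wordMul, dif_pos h1,
      dif_pos h2]
    congr 1
    ext1
    · rfl
    · rfl
    · exact List.append_assoc _ _ _
  · have h1 : ¬ (p.comp q h).finish = r.start := h'
    rw [dif_pos h, dif_neg h', mulLin_ofWord, map_zero, wordMul, dif_neg h1]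
  · have h2 : ¬ p.finish = (q.comp r h').start := h
    rw [dif_neg h, dif_pos h', mulLin_ofWord, map_zero, LinearMap.zero_apply, wordMul, dif_neg h2]
  · rw [dif_neg h, dif_neg h', map_zero, map_zero, LinearMap.zero_apply]

/-- The elementary idempotents. -/
noncomputable def idem (u : I) : TAlg Q := ofWord (Gens.Word.nil u)

/-- The generators. -/
noncomputable def gen (e : Q.E) : TAlg Q := ofWord (Gens.Word.letter e)

theorem sum_idem_mul [Fintype I] (x : TAlg Q) : mulLin (∑ u, idem u) x = x := by
  induction x using TAlg.induction with
  | h0 => simp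
  | hadd x x' hx hx' => rw [map_add, hx, hx']
  | hneg x hx => rw [map_neg, hx]
  | hw p =>
  rw [map_sum, LinearMap.sum_apply, Finset.sum_eq_single p.start]
  · rw [idem, mulLin_ofWord, wordMul, dif_pos (show (Gens.Word.nil p.start).finish = p.start from rfl)]
    rfl
  · intro u _ hu
    rw [idem, mulLin_ofWord, wordMul, dif_neg]
    exact hu
  · intro h
    exact absurd (Finset.mem_univ _) h

theorem mul_sum_idem [Fintype I] (x : TAlg Q) : mulLin x (∑ u, idem u) = x := by
  induction x using TAlg.induction with
  | h0 => simp
  | hadd x x' hx hx' => rw [map_add, LinearMap.add_apply, hx, hx']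
  | hneg x hx => rw [map_neg, LinearMap.neg_apply, hx]
  | hw p =>
  rw [map_sum, Finset.sum_eq_single p.finish]
  · rw [idem, mulLin_ofWord, wordMul, dif_pos (show p.finish = (Gens.Word.nil p.finish).start from rfl)]
    congr 1
    ext1
    · rfl
    · rfl
    · exact List.append_nil _
  · intro u _ hu
    rw [idem, mulLin_ofWord, wordMul, dif_neg]
    exact fun h => hu h.symm
  · intro h
    exact absurd (Finset.mem_univ _) h

noncomputable instance [Fintype I] : Ring (TAlg Q) where
  __ := (inferInstance : AddCommGroup (TAlg Q))
  mul x y := mulLin x y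
  one := ∑ u, idem u
  mul_assoc := mulLin_assoc
  one_mul := sum_idem_mul
  mul_one := mul_sum_idem
  left_distrib x y z := map_add (mulLin x) y z
  right_distrib x y z := by
    change mulLin (x + y) z = mulLin x z + mulLin y z
    rw [map_add, LinearMap.add_apply]
  zero_mul x := by
    change mulLin 0 x = 0
    rw [map_zero, LinearMap.zero_apply]
  mul_zero x := map_zero (mulLin x)

/-- `x` lies in `T^k(V)`. -/
def InT (k : ℕ) (x : TAlg Q) : Prop := ∀ p, coeffs x p ≠ 0 → p.letters.length = k

/-- `x` lies in `T^1(V) ⊕ T^2(V)`. -/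
def InT12 (x : TAlg Q) : Prop :=
  ∀ p, coeffs x p ≠ 0 → p.letters.length = 1 ∨ p.letters.length = 2

/-- The evaluation of `f ∈ T(V*)` on `r ∈ T(V)`; the dual generators `b*` have the same idempotents
as the generators `b`, so `T(V*)` is written with the same words. -/
def pairing (f r : TAlg Q) : ℤ := (coeffs r).sum fun p c => coeffs f p * c

/-- The summand in bidegree `d`, for given bidegrees of the generators. -/
noncomputable def grading (deg : Q.E → ℚ × ℤ) (d : ℚ × ℤ) : AddSubgroup (TAlg Q) :=
  AddSubgroup.closure {x | ∃ p : Q.Word, (p.letters.map deg).sum = d ∧ x = ofWord p}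

end TAlg

/-- A map of generators that respects idempotents, up to a map of the idempotents. -/
structure Gens.Hom {I I' : Type} (Q : Gens I) (Q' : Gens I') where
  onI : I → I'
  onE : Q.E → Q'.E
  src_eq : ∀ e, Q'.src (onE e) = onI (Q.src e)
  tgt_eq : ∀ e, Q'.tgt (onE e) = onI (Q.tgt e)

theorem Gens.IsWord.map {I I' : Type} {Q : Gens I} {Q' : Gens I'} (φ : Q.Hom Q') {u v : I}
    {w : List Q.E} (h : Q.IsWord u w v) : Q'.IsWord (φ.onI u) (w.map φ.onE) (φ.onI v) := by
  induction w generalizing u with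
  | nil => cases h; exact rfl
  | cons e w ih =>
    refine ⟨(φ.src_eq e).trans (congrArg _ h.1), ?_⟩
    rw [φ.tgt_eq e]
    exact ih h.2

/-- The image of a word. -/
def Gens.Word.map {I I' : Type} {Q : Gens I} {Q' : Gens I'} (φ : Q.Hom Q') (p : Q.Word) : Q'.Word :=
  ⟨φ.onI p.start, φ.onI p.finish, p.letters.map φ.onE, p.isWord.map φ⟩

/-- The map of tensor algebras induced by a map of generators. -/
noncomputable def TAlg.map {I I' : Type} {Q : Gens I} {Q' : Gens I'} (φ : Q.Hom Q')
    (x : TAlg Q) : TAlg Q' :=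
  (Finsupp.mapDomain (Gens.Word.map φ) x.coeffs : Q'.Word →₀ ℤ)

/-! ### Differential bigraded algebras -/

/-- `A`, with elementary idempotents `e`, bigrading `gr` (intrinsic degree, homological degree) and
differential `d`, is a differential bigraded algebra. -/
structure IsDGAlgebra {B A : Type} [Fintype B] [Ring A] (e : B → A)
    (gr : ℚ × ℤ → AddSubgroup A) (d : A →+ A) : Prop where
  isInternal : DirectSum.IsInternal gr
  mul_mem : ∀ i j x y, x ∈ gr i → y ∈ gr j → x * y ∈ gr (i + j)
  idem_mul_self : ∀ u, e u * e u = e u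
  idem_mul_ne : ∀ u v, u ≠ v → e u * e v = 0
  idem_sum : ∑ u, e u = 1
  idem_indep : LinearIndependent ℤ e
  degree_zero : gr 0 = (Submodule.span ℤ (Set.range e)).toAddSubgroup
  d_mem : ∀ i j x, x ∈ gr (i, j) → d x ∈ gr (i, j + 1)
  d_idem_mul : ∀ u x, d (e u * x) = e u * d x
  d_mul_idem : ∀ u x, d (x * e u) = d x * e u
  leibniz : ∀ x i j y, y ∈ gr (i, j) →
    d (x * y) = ((Int.negOnePow j : ℤˣ) : ℤ) • (d x * y) + x * d y
  d_d : ∀ x, d (d x) = 0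

/-! ### The linear-quadratic relations of `B` and the dual `B^!` -/

section dual

variable (n : ℕ)

/-- The generators of `B`. -/
def gensB : Gens (DecLink n) where
  E := {x : DecLink n × DecLink n // IsGen x.1 x.2}
  src x := x.1.1
  tgt x := x.1.2

/-- The elementary idempotents in `B`. -/
noncomputable def idemB (h : DecLink n) : BR n :=
  ⟨Matrix.single h h 1, Algebra.subset_adjoin (Or.inl ⟨h, rfl⟩)⟩

/-- The generators as elements of `B`. -/
noncomputable def genB (x : (gensB n).E) : BR n :=
  ⟨Matrix.single x.1.1 x.1.2 1, Algebra.subset_adjoin (Or.inr ⟨x.1.1, x.1.2, x.2, rfl⟩)⟩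

/-- The natural map from `T(V)` to `B`. -/
noncomputable def evalB (x : TAlg (gensB n)) : BR n :=
  x.coeffs.sum fun p c => c • (idemB n p.start * (p.letters.map (genB n)).prod)

/-- The ideal `J` of relations of `B = T(V)/J`. -/
def relJ : Set (TAlg (gensB n)) := {x | evalB n x = 0}

/-- `I ⊆ T²(V)`, the image of `J ∩ (V ⊕ T²(V))` under the projection to `T²(V)`. -/
def relI : Set (TAlg (gensB n)) :=
  {r | r.InT 2 ∧ ∃ v : TAlg (gensB n), v.InT 1 ∧ v + r ∈ relJ n}

/-- `I^⊥ ⊆ T²(V*)`. -/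
def relIPerp : Set (TAlg (gensB n)) :=
  {f | f.InT 2 ∧ ∀ r ∈ relI n, f.pairing r = 0}

/-- `f ∈ T²(V*)` restricts on `I` to the functional `φ*(b*) = b* ∘ φ`, where `φ(r) ∈ V` is
characterized by `φ(r) + r ∈ J`. -/
def IsPhiStar (b : (gensB n).E) (f : TAlg (gensB n)) : Prop :=
  f.InT 2 ∧ ∀ v r : TAlg (gensB n), v.InT 1 → r.InT 2 → v + r ∈ relJ n →
    f.pairing r = v.coeffs (Gens.Word.letter b)

/-! ### The mirrored dual `m(B)^!` -/

/-- The generators `m(b*_{m(h₁),m(h₂)})` of `m(B)^!`. -/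
def gensL : Gens (DecLink n) where
  E := {x : DecLink n × DecLink n // IsGen x.1.mirror x.2.mirror}
  src x := x.1.1
  tgt x := x.1.2

/-- The map `b* ↦ m(b*)`. -/
def mirrorHom : (gensB n).Hom (gensL n) where
  onI := DecLink.mirror
  onE x := ⟨(x.1.1.mirror, x.1.2.mirror), x.2⟩
  src_eq _ := rfl
  tgt_eq _ := rfl

/-- The ideal of relations of `m(B)^!`, generated by the mirror of `I^⊥`. -/
noncomputable def relL : TwoSidedIdeal (TAlg (gensL n)) :=
  TwoSidedIdeal.span (TAlg.map (mirrorHom n) '' relIPerp n)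

/-! ### The product algebra of `B` and `m(B)^!` -/

/-- The generators of `B` (`Sum.inl`) and of `m(B)^!` (`Sum.inr`). -/
def gensFull : Gens (DecLink n) where
  E := (gensB n).E ⊕ (gensL n).E
  src := Sum.elim (gensB n).src (gensL n).src
  tgt := Sum.elim (gensB n).tgt (gensL n).tgt

/-- The inclusion of `T(V_B)`. -/
def inclB : (gensB n).Hom (gensFull n) where
  onI := id
  onE := Sum.inl
  src_eq _ := rfl
  tgt_eq _ := rfl

/-- The inclusion of `T(V_{m(B)^!})`. -/
def inclL : (gensL n).Hom (gensFull n) where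
  onI := id
  onE := Sum.inr
  src_eq _ := rfl
  tgt_eq _ := rfl

variable {n}

/-- The generator `b_{γ;h₁,h₂}`. -/
noncomputable def rB {h₁ h₂ : DecLink n} (x : IsBridgeGen h₁ h₂) : TAlg (gensFull n) :=
  TAlg.gen (Q := gensFull n) (Sum.inl ⟨(h₁, h₂), Or.inl x⟩)

/-- The generator `b_{C;h₁,h₂}`. -/
noncomputable def rC {h₁ h₂ : DecLink n} (x : IsCircleGen h₁ h₂) : TAlg (gensFull n) :=
  TAlg.gen (Q := gensFull n) (Sum.inl ⟨(h₁, h₂), Or.inr x⟩)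

/-- The generator `m(b*_{γ;m(h₁),m(h₂)})`. -/
noncomputable def lB {h₁ h₂ : DecLink n} (x : IsBridgeGen h₁.mirror h₂.mirror) :
    TAlg (gensFull n) :=
  TAlg.gen (Q := gensFull n) (Sum.inr ⟨(h₁, h₂), Or.inl x⟩)

/-- The generator `m(b*_{C;m(h₁),m(h₂)})`. -/
noncomputable def lC {h₁ h₂ : DecLink n} (x : IsCircleGen h₁.mirror h₂.mirror) :
    TAlg (gensFull n) :=
  TAlg.gen (Q := gensFull n) (Sum.inr ⟨(h₁, h₂), Or.inr x⟩)

/-- The relations `J_extra`.  The circle `C` of a generator `b_{C;h₁,h₂}` or `m(b*_{C;m(h₁),m(h₂)})`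
consists of the points where the signs of `h₁` and `h₂` differ, and the circles involved in the
surgery of a generator `b_{γ;h₁,h₂}` are those through points where the right matchings of `h₁` and
`h₂` differ. -/
inductive JExtra : TAlg (gensFull n) → Prop
  | bridge_bridge {h₁ h₂ h₂' h₃ : DecLink n}
      (x : IsBridgeGen h₁ h₂) (y' : IsBridgeGen h₂.mirror h₃.mirror)
      (y : IsBridgeGen h₁.mirror h₂'.mirror) (x' : IsBridgeGen h₂' h₃) :
      JExtra (rB x * lB y' - lB y * rB x')
  | circle_bridge {h₁ h₂ h₂' h₃ : DecLink n}
      (x : IsCircleGen h₁ h₂) (y' : IsBridgeGen h₂.mirror h₃.mirror)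
      (y : IsBridgeGen h₁.mirror h₂'.mirror) (x' : IsCircleGen h₂' h₃) :
      JExtra (rC x * lB y' - lB y * rC x')
  | bridge_circle_disjoint {h₁ h₂ h₂' h₃ : DecLink n}
      (x : IsBridgeGen h₁ h₂) (y' : IsCircleGen h₂.mirror h₃.mirror)
      (y : IsCircleGen h₁.mirror h₂'.mirror) (x' : IsBridgeGen h₂' h₃)
      (hdisj : ∀ p, h₂.sign p ≠ h₃.sign p → h₁.right p = h₂.right p) :
      JExtra (rB x * lC y' - lC y * rB x')
  | circle_circle {h₁ h₂ h₂' h₃ : DecLink n}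
      (x : IsCircleGen h₁ h₂) (y' : IsCircleGen h₂.mirror h₃.mirror)
      (y : IsCircleGen h₁.mirror h₂'.mirror) (x' : IsCircleGen h₂' h₃)
      (hne : h₂ ≠ h₂') :
      JExtra (rC x * lC y' - lC y * rC x')
  | join {h₁ h₂ h₂' h₂'' h₃ : DecLink n}
      (x : IsBridgeGen h₁ h₂) (y' : IsCircleGen h₂.mirror h₃.mirror)
      (y₁ : IsCircleGen h₁.mirror h₂'.mirror) (x₁ : IsBridgeGen h₂' h₃)
      (y₂ : IsCircleGen h₁.mirror h₂''.mirror) (x₂ : IsBridgeGen h₂'' h₃)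
      (hjoin : Joins h₁.left h₁.right h₂.right)
      (hC : ∃ p, h₂.sign p ≠ h₃.sign p ∧ h₁.right p ≠ h₂.right p)
      (hne : h₂' ≠ h₂'') :
      JExtra (rB x * lC y' - lC y₁ * rB x₁ - lC y₂ * rB x₂)
  | split {h₁ h₂ h₂' h₂'' h₃ : DecLink n}
      (x₁ : IsBridgeGen h₁ h₂') (y₁ : IsCircleGen h₂'.mirror h₃.mirror)
      (x₂ : IsBridgeGen h₁ h₂'') (y₂ : IsCircleGen h₂''.mirror h₃.mirror)
      (y : IsCircleGen h₁.mirror h₂.mirror) (x' : IsBridgeGen h₂ h₃)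
      (hsplit : Splits h₂.left h₂.right h₃.right)
      (hC : ∃ p, h₁.sign p ≠ h₂.sign p ∧ h₂.right p ≠ h₃.right p)
      (hne : h₂' ≠ h₂'') :
      JExtra (rB x₁ * lC y₁ + rB x₂ * lC y₂ - lC y * rB x')

variable (n)

/-- The ideal `J_full`. -/
noncomputable def relFull : TwoSidedIdeal (TAlg (gensFull n)) :=
  TwoSidedIdeal.span
    (TAlg.map (inclB n) '' {x | x ∈ relJ n ∧ x.InT12} ∪
      TAlg.map (inclL n) '' {x | x ∈ relL n ∧ x.InT12} ∪ {x | JExtra x})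

/-- The product algebra of `B` and `m(B)^!`. -/
abbrev ProductAlg : Type := (relFull n).ringCon.Quotient

/-- The projection from `T(V_full)`. -/
noncomputable def toProduct : TAlg (gensFull n) →+* ProductAlg n := (relFull n).ringCon.mk'

/-- Bidegrees (intrinsic, homological) of the generators of the product algebra. -/
noncomputable def degFull : (gensFull n).E → ℚ × ℤ :=
  Sum.elim (fun x => (((x.1.1.deg : ℚ) - x.1.2.deg) / 2, 0))
    (fun y => (-(((y.1.1.mirror.deg : ℚ) - y.1.2.mirror.deg) / 2), 1))

/-- The bigrading of the product algebra. -/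
noncomputable def gradingProduct (d : ℚ × ℤ) : AddSubgroup (ProductAlg n) :=
  (TAlg.grading (degFull n) d).map (toProduct n).toAddMonoidHom

/-- The elementary idempotents of the product algebra. -/
noncomputable def idemProduct (h : DecLink n) : ProductAlg n := toProduct n (TAlg.idem h)

/-- On generators, `d` is zero on `B`, and on `m(B)^!` it is the mirror of the differential
`b* ↦ φ*(b*)` of `B^!`. -/
def IsProductDifferential (d : ProductAlg n →+ ProductAlg n) : Prop :=
  (∀ b : (gensB n).E, d (toProduct n (TAlg.gen (Q := gensFull n) (Sum.inl b))) = 0) ∧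
  ∀ b : (gensB n).E, ∃ f, IsPhiStar n b f ∧
    d (toProduct n (TAlg.gen (Q := gensFull n) (Sum.inr ((mirrorHom n).onE b)))) =
      toProduct n (TAlg.map (inclL n) (TAlg.map (mirrorHom n) f))

/-! ### The extra relations -/

variable {n}

/-- The extra relations `a + c` for the tetrahedra.  Here `γ` is a left bridge of `h₁`, with ends on
the arcs through `i` and `j`, that splits a plus-labelled circle; `η'`, with ends on the arcs through
`k` and `l`, joins the two circles that `γ` creates (the circle of `i` and the circle of the other
end of the arc of `i`) to a minus-labelled circle; and `η`, `γ'` are the same two surgeries in the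
other order. -/
inductive TetrahedronRel : TAlg (gensFull n) → Prop
  | mk {h₁ h₂ h₂' h₃ : DecLink n}
      (γ : IsBridgeGen h₁.mirror h₂.mirror) (η' : IsBridgeGen h₂.mirror h₃.mirror)
      (η : IsBridgeGen h₁.mirror h₂'.mirror) (γ' : IsBridgeGen h₂'.mirror h₃.mirror)
      (hne : h₂.left ≠ h₂'.left) (hne' : h₁.left ≠ h₃.left)
      (i j k l : Fin (2 * n))
      (hγ : SurgeryAt h₁.left h₂.left i j) (hsplit : h₁.SameCirc i j) (hplus : h₁.sign i = true)
      (hη : SurgeryAt h₂.left h₃.left k l) (hk : h₂.SameCirc k i)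
      (hl : h₂.SameCirc l (h₁.left i)) (hjoin : ¬ h₂.SameCirc k l) (hminus : h₃.sign k = false) :
      TetrahedronRel (lB γ * lB η' + lB η * lB γ')

variable (n)

/-- The ideal of the product algebra generated by the extra relations. -/
noncomputable def tetrahedronIdeal : TwoSidedIdeal (ProductAlg n) :=
  TwoSidedIdeal.span (toProduct n '' {x | TetrahedronRel x})

/-- The quotient of the product algebra by the extra relations. -/
abbrev QuotientAlg : Type := (tetrahedronIdeal n).ringCon.Quotient

/-- The projection from the product algebra. -/
noncomputable def toQuotient : ProductAlg n →+* QuotientAlg n := (tetrahedronIdeal n).ringCon.mk'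

end dual

/-! ### Roberts' algebra `BΓ_n` -/

/-- The two half-planes. -/
inductive Side
  | left
  | right

section roberts

variable {n : ℕ}

/-- The planar matching of a decorated cleaved link in the given half-plane. -/
def DecLink.inner (h : DecLink n) : Side → NCMatching n
  | .left => h.left
  | .right => h.right

/-- The planar matching in the other half-plane. -/
def DecLink.outer (h : DecLink n) : Side → NCMatching n
  | .left => h.right
  | .right => h.left

/-- `h₂` is obtained from `h₁` by changing the decoration of one circle from plus to minus. -/
def IsDecoEdge (h₁ h₂ : DecLink n) : Prop :=
  h₁.left = h₂.left ∧ h₁.right = h₂.right ∧ ∃ p, h₁.sign p = true ∧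
    ∀ q, (h₁.SameCirc p q → h₂.sign q = false) ∧ (¬ h₁.SameCirc p q → h₂.sign q = h₁.sign q)

/-- `h₂` is obtained from `h₁` by surgery along a bridge in the half-plane `s`, with decorations
related by Khovanov's rule. -/
def IsBridgeEdge (s : Side) (h₁ h₂ : DecLink n) : Prop :=
  h₁.outer s = h₂.outer s ∧ ∃ i j, SurgeryAt (h₁.inner s) (h₂.inner s) i j ∧
    SaddleRule (h₁.outer s) (h₁.inner s) i j h₁.sign h₂.sign

variable (n) in
/-- The edges of the quiver `Γ_n`: for each half-plane, the decoration edges and the bridge edges.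
An edge is determined by its side and its ends. -/
def gensGamma : Gens (DecLink n) where
  E := {x : Side × DecLink n × DecLink n // IsDecoEdge x.2.1 x.2.2 ∨ IsBridgeEdge x.1 x.2.1 x.2.2}
  src x := x.1.2.1
  tgt x := x.1.2.2

/-- The decoration edge `e_C` on the side `s`. -/
noncomputable def eC (s : Side) {h₁ h₂ : DecLink n} (x : IsDecoEdge h₁ h₂) : TAlg (gensGamma n) :=
  TAlg.gen (Q := gensGamma n) ⟨(s, h₁, h₂), Or.inl x⟩

/-- The bridge edge `e_γ`. -/
noncomputable def eB {s : Side} {h₁ h₂ : DecLink n} (x : IsBridgeEdge s h₁ h₂) :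
    TAlg (gensGamma n) :=
  TAlg.gen (Q := gensGamma n) ⟨(s, h₁, h₂), Or.inr x⟩

/-- `(-1)^{jk}` for edges of homological degrees `j` and `k`, on the sides `s` and `t`. -/
def sgn : Side → Side → ℤ
  | .left, .left => -1
  | _, _ => 1

/-- The surgeries from `a` to `a₁`, `a₂`, `a₃` take place along the three bridges that connect three
arcs of `a` pairwise: the arcs moved by the third are those moved by exactly one of the first
two.  In this case the three arcs border a common region. -/
def IsTriad (a a₁ a₂ a₃ : NCMatching n) : Prop :=
  IsSurgery a a₁ ∧ IsSurgery a a₂ ∧ IsSurgery a a₃ ∧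
    ∀ p, a₃ p ≠ a p ↔ Xor (a₁ p ≠ a p) (a₂ p ≠ a p)

/-- The bridges from `a` to `a₁` and to `a₂` have their ends on exactly three arcs, and lie on the
same side of the arc they share. -/
def SameSide (a a₁ a₂ : NCMatching n) : Prop := ∃ a₃, IsTriad a a₁ a₂ a₃

/-- The bridges from `a` to `a₁` and to `a₂` have their ends on four different arcs and cross each
other: the two surgeries together do not give a crossingless matching. -/
def Crossing (a a₁ a₂ : NCMatching n) : Prop :=
  (∀ p, a₁ p = a p ∨ a₂ p = a p) ∧
    ¬ ∃ a' : NCMatching n, ∀ p, (a₁ p ≠ a p → a' p = a₁ p) ∧ (a₁ p = a p → a' p = a₂ p)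

/-- The circle whose decoration changes from `h₁` to `h₂` is one of those involved in the surgery
from `h₃` to `h₄` in the half-plane `t`. -/
def Touches (t : Side) (h₁ h₂ h₃ h₄ : DecLink n) : Prop :=
  ∃ p, h₁.sign p ≠ h₂.sign p ∧ h₃.inner t p ≠ h₄.inner t p

open Classical in
/-- The relations of `BΓ_n`. -/
inductive GammaRel : TAlg (gensGamma n) → Prop
  /- two distinct circles -/
  | deco_deco (s t : Side) {h₁ h₂ h₂' h₃ : DecLink n}
      (x : IsDecoEdge h₁ h₂) (y' : IsDecoEdge h₂ h₃)
      (y : IsDecoEdge h₁ h₂') (x' : IsDecoEdge h₂' h₃) (hne : h₂ ≠ h₂') :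
      GammaRel (eC s x * eC t y' - sgn s t • (eC t y * eC s x'))
  /- two bridges in different half-planes -/
  | bridge_bridge {s t : Side} (hst : s ≠ t) {h₁ h₂ h₂' h₃ : DecLink n}
      (x : IsBridgeEdge s h₁ h₂) (y' : IsBridgeEdge t h₂ h₃)
      (y : IsBridgeEdge t h₁ h₂') (x' : IsBridgeEdge s h₂' h₃) :
      GammaRel (eB x * eB y' - sgn s t • (eB y * eB x'))
  /- two bridges in the same half-plane, on four arcs or on opposite sides of a common arc -/
  | bridge_bridge_same {s : Side} {h₁ h₂ h₂' h₃ : DecLink n}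
      (x : IsBridgeEdge s h₁ h₂) (y' : IsBridgeEdge s h₂ h₃)
      (y : IsBridgeEdge s h₁ h₂') (x' : IsBridgeEdge s h₂' h₃)
      (hne : h₂.inner s ≠ h₂'.inner s) (hne' : h₁.inner s ≠ h₃.inner s)
      (hside : ¬ SameSide (h₁.inner s) (h₂.inner s) (h₂'.inner s)) :
      GammaRel (eB x * eB y' - sgn s s • (eB y * eB x'))
  /- two right bridges on the same side of a common arc -/
  | triad_right {h₁ h₂ h₂' h₃ : DecLink n}
      (x : IsBridgeEdge .right h₁ h₂) (y' : IsBridgeEdge .right h₂ h₃)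
      (y : IsBridgeEdge .right h₁ h₂') (x' : IsBridgeEdge .right h₂' h₃)
      (hne' : h₁.right ≠ h₃.right) (hside : SameSide h₁.right h₂.right h₂'.right) :
      GammaRel (eB x * eB y' - eB y * eB x')
  /- three left bridges that connect three arcs pairwise -/
  | triad_left {h₁ h₂ h₂' h₂'' h₃ : DecLink n}
      (x : IsBridgeEdge .left h₁ h₂) (x' : IsBridgeEdge .left h₂ h₃)
      (y : IsBridgeEdge .left h₁ h₂') (y' : IsBridgeEdge .left h₂' h₃)
      (z : IsBridgeEdge .left h₁ h₂'') (z' : IsBridgeEdge .left h₂'' h₃)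
      (hne' : h₁.left ≠ h₃.left) (htriad : IsTriad h₁.left h₂.left h₂'.left h₂''.left) :
      GammaRel (eB x * eB x' + eB y * eB y' + eB z * eB z')
  /- a right bridge followed by a right bridge that crosses its dual: the product does not depend on
  the decoration in between -/
  | crossing_right {h₁ h₂ h₂' h₃ : DecLink n}
      (x : IsBridgeEdge .right h₁ h₂) (y : IsBridgeEdge .right h₂ h₃)
      (x' : IsBridgeEdge .right h₁ h₂') (y' : IsBridgeEdge .right h₂' h₃)
      (hright : h₂.right = h₂'.right) (hcross : Crossing h₂.right h₁.right h₃.right) :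
      GammaRel (eB x * eB y - eB x' * eB y')
  /- a left bridge followed by a left bridge that crosses its dual: the sum over the decorations in
  between -/
  | crossing_left (h₁ h₃ : DecLink n) (a : NCMatching n) (hcross : Crossing a h₁.left h₃.left) :
      GammaRel (∑ h₂ : DecLink n,
        if h : h₂.left = a ∧ IsBridgeEdge .left h₁ h₂ ∧ IsBridgeEdge .left h₂ h₃ then
          eB h.2.1 * eB h.2.2 else 0)
  /- a circle and a bridge that does not touch it -/
  | deco_bridge (s : Side) {t : Side} {h₁ h₂ h₂' h₃ : DecLink n}
      (x : IsDecoEdge h₁ h₂) (y' : IsBridgeEdge t h₂ h₃)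
      (y : IsBridgeEdge t h₁ h₂') (x' : IsDecoEdge h₂' h₃)
      (hdisj : ¬ Touches t h₁ h₂ h₂ h₃) :
      GammaRel (eC s x * eB y' - sgn s t • (eB y * eC s x'))
  /- a right decoration edge for a circle touched by a bridge -/
  | deco_bridge_right {t : Side} {h₁ h₂ h₂' h₃ : DecLink n}
      (x : IsDecoEdge h₁ h₂) (y' : IsBridgeEdge t h₂ h₃)
      (y : IsBridgeEdge t h₁ h₂') (x' : IsDecoEdge h₂' h₃)
      (htouch : Touches t h₁ h₂ h₂ h₃) :
      GammaRel (eC .right x * eB y' - eB y * eC .right x')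
  /- left decoration edges for the circles touched by a bridge that joins two circles -/
  | deco_join_left {t : Side} {h₁ h₂ h₂' h₂'' h₃ : DecLink n}
      (x₁ : IsDecoEdge h₁ h₂') (y₁ : IsBridgeEdge t h₂' h₃)
      (x₂ : IsDecoEdge h₁ h₂'') (y₂ : IsBridgeEdge t h₂'' h₃)
      (y : IsBridgeEdge t h₁ h₂) (x : IsDecoEdge h₂ h₃)
      (hjoin : Joins (h₁.outer t) (h₁.inner t) (h₂.inner t))
      (htouch : Touches t h₂ h₃ h₁ h₂) (hne : h₂' ≠ h₂'') :
      GammaRel (eC .left x₁ * eB y₁ + eC .left x₂ * eB y₂ - sgn .left t • (eB y * eC .left x))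
  /- left decoration edges for the circles touched by a bridge that splits a circle -/
  | deco_split_left {t : Side} {h₁ h₂ h₂' h₂'' h₃ : DecLink n}
      (x : IsDecoEdge h₁ h₂) (y : IsBridgeEdge t h₂ h₃)
      (y₁ : IsBridgeEdge t h₁ h₂') (x₁ : IsDecoEdge h₂' h₃)
      (y₂ : IsBridgeEdge t h₁ h₂'') (x₂ : IsDecoEdge h₂'' h₃)
      (hsplit : Splits (h₂.outer t) (h₂.inner t) (h₃.inner t))
      (htouch : Touches t h₁ h₂ h₂ h₃) (hne : h₂' ≠ h₂'') :
      GammaRel (eC .left x * eB y - sgn .left t • (eB y₁ * eC .left x₁ + eB y₂ * eC .left x₂))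
  /- a right bridge followed by the dual bridge -/
  | bridge_dual {h₁ h₂ h₃ : DecLink n}
      (x : IsBridgeEdge .right h₁ h₂) (x' : IsBridgeEdge .right h₂ h₃) (z : IsDecoEdge h₁ h₃) :
      GammaRel (eB x * eB x' - eC .right z)

variable (n)

/-- The ideal of relations of `BΓ_n`. -/
noncomputable def relGamma : TwoSidedIdeal (TAlg (gensGamma n)) :=
  TwoSidedIdeal.span {x | GammaRel x}

/-- Roberts' algebra `BΓ_n`. -/
abbrev BGamma : Type := (relGamma n).ringCon.Quotient

/-- The projection from the path algebra of `Γ_n`. -/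
noncomputable def toBGamma : TAlg (gensGamma n) →+* BGamma n := (relGamma n).ringCon.mk'

open Classical in
/-- Bidegrees (intrinsic, homological) of the edges of `Γ_n`. -/
noncomputable def degGamma (x : (gensGamma n).E) : ℚ × ℤ :=
  match x.1.1 with
  | .right => if IsDecoEdge x.1.2.1 x.1.2.2 then (-1, 0) else (-1 / 2, 0)
  | .left => if IsDecoEdge x.1.2.1 x.1.2.2 then (1, 1) else (1 / 2, 1)

/-- The bigrading of `BΓ_n`. -/
noncomputable def gradingGamma (d : ℚ × ℤ) : AddSubgroup (BGamma n) :=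
  (TAlg.grading (degGamma n) d).map (toBGamma n).toAddMonoidHom

/-- The elementary idempotents of `BΓ_n`. -/
noncomputable def idemGamma (h : DecLink n) : BGamma n := toBGamma n (TAlg.idem h)

open Classical in
/-- The differential of `BΓ_n` on edges: it is zero on right-pointing edges and on left bridge
edges, and it sends the left decoration edge from `h₁` to `h₃` to minus the sum of all
`e_γ e_{γ†}` from `h₁` to `h₃`, with `γ` a left bridge. -/
def IsGammaDifferential (d : BGamma n →+ BGamma n) : Prop :=
  (∀ (h₁ h₂ : DecLink n) (x : IsDecoEdge h₁ h₂), d (toBGamma n (eC .right x)) = 0) ∧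
  (∀ (s : Side) (h₁ h₂ : DecLink n) (x : IsBridgeEdge s h₁ h₂), d (toBGamma n (eB x)) = 0) ∧
  ∀ (h₁ h₃ : DecLink n) (x : IsDecoEdge h₁ h₃),
    d (toBGamma n (eC .left x)) = - ∑ h₂ : DecLink n,
      if hx : IsBridgeEdge .left h₁ h₂ ∧ IsBridgeEdge .left h₂ h₃ then
        toBGamma n (eB hx.1 * eB hx.2) else 0

/-- The half-plane of a generator of the product algebra: `B` is on the right, `m(B)^!` on the
left. -/
def sideFull : (gensFull n).E → Side := Sum.elim (fun _ => .right) (fun _ => .left)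

end roberts

end BorderedKh

set_option linter.unusedSectionVars false

namespace BorderedKh

/-! ### Tensor algebras: universal property -/

section tensor

variable {I : Type} {Q : Gens I}

theorem Gens.Word.induction {P : Q.Word → Prop} (nil : ∀ u, P (Gens.Word.nil u))
    (cons : ∀ (x : Q.E) (p : Q.Word) (h : (Gens.Word.letter x).finish = p.start), P p →
      P ((Gens.Word.letter x).comp p h)) (p : Q.Word) : P p := by
  obtain ⟨u, v, w, hw⟩ := p
  induction w generalizing u with
  | nil =>
    cases hw
    exact nil _
  | cons x w ih =>
    obtain ⟨rfl, hw'⟩ := hw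
    exact cons x ⟨Q.tgt x, v, w, hw'⟩ rfl (ih _ hw')

namespace TAlg

theorem lift_single {M : Type} [AddCommGroup M] (g : Q.Word → M) (p : Q.Word) :
    Finsupp.lift M ℤ Q.Word g (ofWord p) = g p := lift_ofWord g p

variable [Fintype I]

theorem ofWord_mul_ofWord (p q : Q.Word) : (ofWord p * ofWord q : TAlg Q) = wordMul p q :=
  mulLin_ofWord p q

theorem one_def : (1 : TAlg Q) = ∑ u, idem u := rfl

theorem ofWord_mul_of_eq (p q : Q.Word) (h : p.finish = q.start) :
    (ofWord p * ofWord q : TAlg Q) = ofWord (p.comp q h) := by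
  rw [ofWord_mul_ofWord, wordMul, dif_pos h]

theorem ofWord_mul_of_ne (p q : Q.Word) (h : p.finish ≠ q.start) :
    (ofWord p * ofWord q : TAlg Q) = 0 := by
  rw [ofWord_mul_ofWord, wordMul, dif_neg h]

theorem idem_mul_ofWord (p : Q.Word) : (idem p.start * ofWord p : TAlg Q) = ofWord p :=
  ofWord_mul_of_eq (Gens.Word.nil p.start) p rfl

theorem ofWord_mul_idem (p : Q.Word) : (ofWord p * idem p.finish : TAlg Q) = ofWord p := by
  rw [idem, ofWord_mul_of_eq p (Gens.Word.nil p.finish) rfl]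
  congr 1
  ext1
  · rfl
  · rfl
  · exact List.append_nil _

theorem idem_mul_self (u : I) : (idem u * idem u : TAlg Q) = idem u :=
  idem_mul_ofWord (Gens.Word.nil u)

theorem idem_mul_of_ne {u v : I} (h : u ≠ v) : (idem u * idem v : TAlg Q) = 0 :=
  ofWord_mul_of_ne (Gens.Word.nil u) (Gens.Word.nil v) h

theorem idem_mul_gen (x : Q.E) : (idem (Q.src x) * gen x : TAlg Q) = gen x :=
  idem_mul_ofWord (Gens.Word.letter x)

theorem gen_mul_idem (x : Q.E) : (gen x * idem (Q.tgt x) : TAlg Q) = gen x :=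
  ofWord_mul_idem (Gens.Word.letter x)

theorem ofWord_cons (x : Q.E) (p : Q.Word) (h : (Gens.Word.letter x).finish = p.start) :
    (ofWord ((Gens.Word.letter x).comp p h) : TAlg Q) = gen x * ofWord p :=
  (ofWord_mul_of_eq _ _ h).symm

/-- Orthogonal idempotents and elements of a ring that are compatible with them. -/
structure LiftData (Q : Gens I) (A : Type) [Ring A] where
  e : I → A
  g : Q.E → A
  e_self : ∀ u, e u * e u = e u
  e_ne : ∀ u v, u ≠ v → e u * e v = 0
  e_sum : ∑ u, e u = 1
  e_g : ∀ x, e (Q.src x) * g x = g x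
  g_e : ∀ x, g x * e (Q.tgt x) = g x

namespace LiftData

variable {A : Type} [Ring A] (d : LiftData Q A)

/-- The value of a word. -/
def wordVal (p : Q.Word) : A := d.e p.start * (p.letters.map d.g).prod

theorem wordVal_nil (u : I) : d.wordVal (Gens.Word.nil u) = d.e u := mul_one _

theorem wordVal_cons (x : Q.E) (p : Q.Word) (h : (Gens.Word.letter x).finish = p.start) :
    d.wordVal ((Gens.Word.letter x).comp p h) = d.g x * d.wordVal p := by
  have h' : Q.tgt x = p.start := h
  change d.e (Q.src x) * (d.g x * (p.letters.map d.g).prod) = _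
  rw [wordVal, ← mul_assoc, ← mul_assoc, d.e_g, ← h', d.g_e]

theorem wordVal_letter (x : Q.E) : d.wordVal (Gens.Word.letter x) = d.g x := by
  change d.e (Q.src x) * (d.g x * 1) = _
  rw [mul_one, d.e_g]

theorem wordVal_mul_e (p : Q.Word) : d.wordVal p * d.e p.finish = d.wordVal p := by
  induction p using Gens.Word.induction with
  | nil u => rw [wordVal_nil]; exact d.e_self u
  | cons x p h ih =>
    rw [wordVal_cons, mul_assoc]
    exact congrArg _ ih

theorem wordVal_comp (p q : Q.Word) (h : p.finish = q.start) :
    d.wordVal (p.comp q h) = d.wordVal p * d.wordVal q := by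
  conv_rhs => rw [wordVal, wordVal]
  rw [← h, ← mul_assoc, ← wordVal, wordVal_mul_e, wordVal, wordVal]
  change d.e p.start * ((p.letters ++ q.letters).map d.g).prod = _
  rw [List.map_append, List.prod_append, mul_assoc]

theorem e_mul_wordVal (p : Q.Word) : d.e p.start * d.wordVal p = d.wordVal p := by
  rw [wordVal, ← mul_assoc, d.e_self]

/-- The additive map underlying the ring homomorphism given by `d`. -/
noncomputable def liftAdd : TAlg Q →ₗ[ℤ] A := Finsupp.lift A ℤ Q.Word d.wordVal

theorem liftAdd_ofWord (p : Q.Word) : d.liftAdd (ofWord p) = d.wordVal p := lift_single _ p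

theorem liftAdd_mul (x y : TAlg Q) : d.liftAdd (x * y) = d.liftAdd x * d.liftAdd y := by
  induction x using TAlg.induction with
  | h0 => simp
  | hadd x x' hx hx' => simp only [add_mul, map_add, hx, hx']
  | hneg x hx => simp only [neg_mul, map_neg, hx]
  | hw p =>
  induction y using TAlg.induction with
  | h0 => simp
  | hadd x x' hx hx' => simp only [mul_add, map_add, hx, hx']
  | hneg x hx => simp only [mul_neg, map_neg, hx]
  | hw q =>
  by_cases h : p.finish = q.start
  · rw [ofWord_mul_of_eq p q h, liftAdd_ofWord, liftAdd_ofWord, liftAdd_ofWord, wordVal_comp]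
  · rw [ofWord_mul_of_ne p q h, map_zero, liftAdd_ofWord, liftAdd_ofWord, ← d.wordVal_mul_e p,
      ← d.e_mul_wordVal q, mul_assoc, ← mul_assoc (d.e _) (d.e _), d.e_ne _ _ h, zero_mul, mul_zero]

/-- The ring homomorphism given by `d`. -/
noncomputable def lift : TAlg Q →+* A where
  toFun := d.liftAdd
  map_one' := by
    rw [one_def, map_sum, ← d.e_sum]
    exact Finset.sum_congr rfl fun u _ => (d.liftAdd_ofWord _).trans (d.wordVal_nil u)
  map_mul' := d.liftAdd_mul
  map_zero' := map_zero _
  map_add' := map_add _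

theorem lift_ofWord (p : Q.Word) : d.lift (ofWord p) = d.wordVal p := d.liftAdd_ofWord p

@[simp] theorem lift_idem (u : I) : d.lift (idem u) = d.e u :=
  (d.lift_ofWord _).trans (d.wordVal_nil u)

@[simp] theorem lift_gen (x : Q.E) : d.lift (gen x) = d.g x :=
  (d.lift_ofWord _).trans (d.wordVal_letter x)

end LiftData

theorem ringHom_ext {A : Type} [Ring A] {φ ψ : TAlg Q →+* A} (h : ∀ u, φ (idem u) = ψ (idem u))
    (h' : ∀ x, φ (gen x) = ψ (gen x)) : φ = ψ := by
  ext x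
  induction x using TAlg.induction with
  | h0 => simp
  | hadd x x' hx hx' => rw [map_add, map_add, hx, hx']
  | hneg x hx => rw [map_neg, map_neg, hx]
  | hw p =>
    induction p using Gens.Word.induction with
    | nil u => exact h u
    | cons x p _ ih => rw [ofWord_cons, map_mul, map_mul, h', ih]

/-- The data of a ring homomorphism out of `T(V)`. -/
@[simps] noncomputable def LiftData.ofHom {A : Type} [Ring A] (φ : TAlg Q →+* A) : LiftData Q A where
  e u := φ (idem u)
  g x := φ (gen x)
  e_self u := by rw [← map_mul, idem_mul_self]
  e_ne u v h := by rw [← map_mul, idem_mul_of_ne h, map_zero]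
  e_sum := by rw [← map_sum, ← one_def, map_one]
  e_g x := by rw [← map_mul, idem_mul_gen]
  g_e x := by rw [← map_mul, gen_mul_idem]

theorem map_zero' {I' : Type} {Q' : Gens I'} (φ : Q.Hom Q') : TAlg.map φ (0 : TAlg Q) = 0 :=
  Finsupp.mapDomain_zero

theorem map_add' {I' : Type} {Q' : Gens I'} (φ : Q.Hom Q') (x y : TAlg Q) :
    TAlg.map φ (x + y) = TAlg.map φ x + TAlg.map φ y :=
  Finsupp.mapDomain_add

theorem map_ofWord {I' : Type} {Q' : Gens I'} (φ : Q.Hom Q') (p : Q.Word) :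
    TAlg.map φ (ofWord p) = ofWord (p.map φ) :=
  Finsupp.mapDomain_single

/-- `TAlg.map` as an additive map. -/
noncomputable def mapAdd {I' : Type} {Q' : Gens I'} (φ : Q.Hom Q') : TAlg Q →+ TAlg Q' where
  toFun := TAlg.map φ
  map_zero' := map_zero' φ
  map_add' := map_add' φ

theorem sum_coeffs (x : TAlg Q) : x = ∑ p ∈ (coeffs x).support, coeffs x p • ofWord p := by
  have h : (coeffs x).sum (fun p c => (Finsupp.single p c : Q.Word →₀ ℤ)) = coeffs x :=
    Finsupp.sum_single _
  refine h.symm.trans (Finset.sum_congr rfl fun p _ => ?_)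
  have h' : (Finsupp.single p (coeffs x p) : Q.Word →₀ ℤ) =
      coeffs x p • (Finsupp.single p 1 : Q.Word →₀ ℤ) := by
    rw [Finsupp.smul_single, smul_eq_mul, mul_one]
  exact h'

end TAlg

end tensor

/-! ### Bigraded quotients of tensor algebras -/

section graded

variable {I : Type} [Fintype I] {Q : Gens I} (J : TwoSidedIdeal (TAlg Q)) (deg : Q.E → ℚ × ℤ)

open TAlg

/-- The projection to a quotient. -/
noncomputable def quo {R : Type} [Ring R] (J : TwoSidedIdeal R) : R →+* J.ringCon.Quotient :=
  J.ringCon.mk'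

theorem quo_surjective {R : Type} [Ring R] (J : TwoSidedIdeal R) : Function.Surjective (quo J) :=
  J.ringCon.mk'_surjective

theorem quo_eq_zero {R : Type} [Ring R] (J : TwoSidedIdeal R) {x : R} : quo J x = 0 ↔ x ∈ J := by
  rw [quo, ← TwoSidedIdeal.mem_ker, TwoSidedIdeal.ker_ringCon_mk']

/-- Ring homomorphisms out of a quotient. -/
noncomputable def quoLift {R S : Type} [Ring R] [Ring S] (J : TwoSidedIdeal R) (φ : R →+* S)
    (h : ∀ x ∈ J, φ x = 0) : J.ringCon.Quotient →+* S :=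
  J.ringCon.lift φ fun x y hxy => by
    rw [TwoSidedIdeal.rel_iff] at hxy
    exact sub_eq_zero.1 ((map_sub φ x y).symm.trans (h _ hxy))

theorem map_eq_zero_of_mem_span {R S : Type} [Ring R] [Ring S] {s : Set R} (φ : R →+* S)
    (h : ∀ x ∈ s, φ x = 0) {x : R} (hx : x ∈ TwoSidedIdeal.span s) : φ x = 0 := by
  have : TwoSidedIdeal.span s ≤ TwoSidedIdeal.ker φ :=
    TwoSidedIdeal.span_le.2 fun x hx => (TwoSidedIdeal.mem_ker φ).2 (h x hx)
  exact (TwoSidedIdeal.mem_ker φ).1 (this hx)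

/-- The bigrading of a quotient of `T(V)`. -/
noncomputable def quoGrading (d : ℚ × ℤ) : AddSubgroup J.ringCon.Quotient :=
  (TAlg.grading deg d).map (quo J).toAddMonoidHom

/-- The degree of a word. -/
def wdeg (p : Q.Word) : ℚ × ℤ := (p.letters.map deg).sum

variable {deg} in
theorem ofWord_mem_grading (p : Q.Word) : ofWord p ∈ TAlg.grading deg (wdeg deg p) :=
  AddSubgroup.subset_closure ⟨p, rfl, rfl⟩

theorem wdeg_cons (x : Q.E) (p : Q.Word) (h : (Gens.Word.letter x).finish = p.start) :
    wdeg deg ((Gens.Word.letter x).comp p h) = deg x + wdeg deg p := by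
  simp [wdeg, Gens.Word.comp, Gens.Word.letter]

theorem wdeg_comp (p q : Q.Word) (h : p.finish = q.start) :
    wdeg deg (p.comp q h) = wdeg deg p + wdeg deg q := by
  simp [wdeg, Gens.Word.comp]

theorem wdeg_nil (u : I) : wdeg deg (Gens.Word.nil u : Q.Word) = 0 := by
  simp [wdeg, Gens.Word.nil]

variable {deg} in
theorem gen_mem_grading (x : Q.E) : gen x ∈ TAlg.grading deg (deg x) := by
  have h : wdeg deg (Gens.Word.letter x) = deg x := by simp [wdeg, Gens.Word.letter]
  exact h ▸ ofWord_mem_grading (deg := deg) (Gens.Word.letter x)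

variable {deg} in
theorem grading_mul_mem {i j : ℚ × ℤ} {x y : TAlg Q} (hx : x ∈ TAlg.grading deg i)
    (hy : y ∈ TAlg.grading deg j) : x * y ∈ TAlg.grading deg (i + j) := by
  induction hx using AddSubgroup.closure_induction with
  | zero => rw [zero_mul]; exact zero_mem _
  | add _ _ _ _ h h' => rw [add_mul]; exact add_mem h h'
  | neg _ _ h => rw [neg_mul]; exact neg_mem h
  | mem x hx =>
  induction hy using AddSubgroup.closure_induction with
  | zero => rw [mul_zero]; exact zero_mem _
  | add _ _ _ _ h h' => rw [mul_add]; exact add_mem h h'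
  | neg _ _ h => rw [mul_neg]; exact neg_mem h
  | mem y hy =>
  obtain ⟨p, rfl, rfl⟩ := hx
  obtain ⟨q, rfl, rfl⟩ := hy
  by_cases h : p.finish = q.start
  · rw [ofWord_mul_of_eq p q h]
    exact (wdeg_comp deg p q h) ▸ ofWord_mem_grading (deg := deg) _
  · rw [ofWord_mul_of_ne p q h]
    exact zero_mem _

/-- The coaction of the grading group. -/
noncomputable def coactData : LiftData Q (AddMonoidAlgebra J.ringCon.Quotient (ℚ × ℤ)) where
  e u := AddMonoidAlgebra.single 0 (quo J (idem u))
  g x := AddMonoidAlgebra.single (deg x) (quo J (gen x))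
  e_self u := by rw [AddMonoidAlgebra.single_mul_single, ← map_mul, idem_mul_self, add_zero]
  e_ne u v h := by
    rw [AddMonoidAlgebra.single_mul_single, ← map_mul, idem_mul_of_ne h, map_zero,
      AddMonoidAlgebra.single_zero]
  e_sum := by
    rw [AddMonoidAlgebra.one_def, ← map_one (quo J), one_def, map_sum]
    exact (map_sum (AddMonoidAlgebra.singleAddHom (0 : ℚ × ℤ)) _ _).symm
  e_g x := by rw [AddMonoidAlgebra.single_mul_single, ← map_mul, idem_mul_gen, zero_add]
  g_e x := by rw [AddMonoidAlgebra.single_mul_single, ← map_mul, gen_mul_idem, add_zero]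

theorem coact_of_mem {d : ℚ × ℤ} {x : TAlg Q} (hx : x ∈ TAlg.grading deg d) :
    (coactData J deg).lift x = AddMonoidAlgebra.single d (quo J x) := by
  induction hx using AddSubgroup.closure_induction with
  | zero => rw [map_zero, map_zero, AddMonoidAlgebra.single_zero]
  | add _ _ _ _ h h' => rw [map_add, map_add, h, h', AddMonoidAlgebra.single_add]
  | neg _ _ h => rw [map_neg, map_neg, h]; exact (AddMonoidAlgebra.single_neg _ _).symm
  | mem x hx =>
    obtain ⟨p, rfl, rfl⟩ := hx
    change _ = AddMonoidAlgebra.single (wdeg deg p) _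
    induction p using Gens.Word.induction with
    | nil u => rw [wdeg_nil]; exact (coactData J deg).lift_idem u
    | cons x p h ih =>
      rw [ofWord_cons, map_mul, ih, LiftData.lift_gen, wdeg_cons, map_mul]
      exact AddMonoidAlgebra.single_mul_single ..

open Classical in
/-- The augmentation. -/
noncomputable def augData (Q : Gens I) : LiftData Q (I → ℤ) where
  e u := Pi.single u 1
  g _ := 0
  e_self u := by rw [← Pi.single_mul, one_mul]
  e_ne u v h := by
    classical
    ext w
    simp only [Pi.mul_apply, Pi.single_apply, Pi.zero_apply]
    split_ifs with h1 h2 <;> simp_all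
  e_sum := by
    classical
    ext w
    simp [Finset.sum_apply, Pi.single_apply]
  e_g _ := mul_zero _
  g_e _ := zero_mul _

/-- A homogeneous ideal without components of length zero, whose quotient is to be bigraded. -/
structure IsGradedIdeal : Prop where
  coact : ∀ x ∈ J, (coactData J deg).lift x = 0
  aug : ∀ x ∈ J, (augData Q).lift x = 0
  pos : ∀ p : Q.Word, wdeg deg p = 0 → p.letters = []

variable {J deg}

theorem quo_mem_quoGrading {d : ℚ × ℤ} {x : TAlg Q} (hx : x ∈ TAlg.grading deg d) :
    quo J x ∈ quoGrading J deg d := ⟨x, hx, rfl⟩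

theorem quoGrading_mul_mem {i j : ℚ × ℤ} {x y : J.ringCon.Quotient}
    (hx : x ∈ quoGrading J deg i) (hy : y ∈ quoGrading J deg j) :
    x * y ∈ quoGrading J deg (i + j) := by
  obtain ⟨x, hx, rfl⟩ := hx
  obtain ⟨y, hy, rfl⟩ := hy
  exact ⟨x * y, grading_mul_mem hx hy, map_mul (quo J) _ _⟩

theorem quoGrading_induction {d : ℚ × ℤ} {P : J.ringCon.Quotient → Prop}
    (h0 : P 0) (hadd : ∀ x y, P x → P y → P (x + y)) (hneg : ∀ x, P x → P (-x))
    (hw : ∀ p : Q.Word, wdeg deg p = d → P (quo J (ofWord p))) {x : J.ringCon.Quotient}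
    (hx : x ∈ quoGrading J deg d) : P x := by
  obtain ⟨x, hx, rfl⟩ := hx
  change P (quo J x)
  induction hx using AddSubgroup.closure_induction with
  | zero => rw [map_zero]; exact h0
  | add _ _ _ _ h h' => rw [map_add]; exact hadd _ _ h h'
  | neg _ _ h => rw [map_neg]; exact hneg _ h
  | mem x hx =>
    obtain ⟨p, hp, rfl⟩ := hx
    exact hw p hp

theorem quo_induction {P : J.ringCon.Quotient → Prop}
    (h0 : P 0) (hadd : ∀ x y, P x → P y → P (x + y)) (hneg : ∀ x, P x → P (-x))
    (hw : ∀ p : Q.Word, P (quo J (ofWord p))) (x : J.ringCon.Quotient) : P x := by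
  obtain ⟨x, rfl⟩ := quo_surjective J x
  induction x using TAlg.induction with
  | h0 => rw [map_zero]; exact h0
  | hadd x y hx hy => rw [map_add]; exact hadd _ _ hx hy
  | hneg x hx => rw [map_neg]; exact hneg _ hx
  | hw p => exact hw p

namespace IsGradedIdeal

variable (hJ : IsGradedIdeal J deg)
include hJ

theorem isInternal : DirectSum.IsInternal (quoGrading J deg) := by
  classical
  let co := quoLift J (coactData J deg).lift hJ.coact
  have hco : ∀ d x, x ∈ quoGrading J deg d → co x = AddMonoidAlgebra.single d x := by
    rintro d _ ⟨x, hx, rfl⟩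
    exact coact_of_mem J deg hx
  constructor
  · rw [injective_iff_map_eq_zero]
    intro x hx
    have h1 : ∀ y : DirectSum (ℚ × ℤ) fun d => quoGrading J deg d,
        ∀ d, (co (DirectSum.coeAddMonoidHom (quoGrading J deg) y)).coeff d = y d := by
      intro y
      induction y using DirectSum.induction_on with
      | zero => intro d; simp
      | of i z =>
        intro d
        rw [DirectSum.coeAddMonoidHom_of, hco i _ z.2]
        by_cases hd : i = d
        · subst hd
          rw [DirectSum.of_eq_same]
          exact Finsupp.single_eq_same
        · rw [DirectSum.of_eq_of_ne _ _ _ (fun h => hd h.symm)]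
          exact Finsupp.single_eq_of_ne (fun h => hd h.symm)
      | add y z hy hz =>
        intro d
        rw [map_add, map_add, DirectSum.add_apply, AddSubgroup.coe_add, ← hy, ← hz]
        rfl
    ext d
    rw [← h1 x d, hx, map_zero]
    rfl
  · intro x
    induction x using quo_induction with
    | h0 => exact ⟨0, map_zero _⟩
    | hadd x y hx hy =>
      obtain ⟨a, rfl⟩ := hx
      obtain ⟨b, rfl⟩ := hy
      exact ⟨a + b, map_add _ _ _⟩
    | hneg x hx =>
      obtain ⟨a, rfl⟩ := hx
      exact ⟨-a, map_neg _ _⟩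
    | hw p =>
      exact ⟨DirectSum.of (fun d => quoGrading J deg d) (wdeg deg p)
        ⟨_, quo_mem_quoGrading (ofWord_mem_grading p)⟩, DirectSum.coeAddMonoidHom_of ..⟩

theorem idem_indep : LinearIndependent ℤ fun u : I => quo J (idem u) := by
  classical
  let ε : J.ringCon.Quotient →+* (I → ℤ) := quoLift J (augData Q).lift hJ.aug
  refine LinearIndependent.of_comp ε.toAddMonoidHom.toIntLinearMap ?_
  have h : (ε.toAddMonoidHom.toIntLinearMap ∘ fun u : I => quo J (idem u)) = Pi.basisFun ℤ I := by
    funext u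
    refine ((augData Q).lift_idem u).trans ?_
    rw [Pi.basisFun_apply, augData]
  rw [h]
  exact (Pi.basisFun ℤ I).linearIndependent

theorem degree_zero : quoGrading J deg 0 =
    (Submodule.span ℤ (Set.range fun u : I => quo J (idem u))).toAddSubgroup := by
  apply le_antisymm
  · intro x hx
    change x ∈ Submodule.span ℤ (Set.range fun u : I => quo J (idem u))
    refine quoGrading_induction (zero_mem _) (fun x y hx hy => add_mem hx hy)
      (fun x hx => neg_mem hx) (fun p hp => ?_) hx
    · refine Submodule.subset_span ⟨p.start, ?_⟩
      have h1 : p = Gens.Word.nil p.start := by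
        have h2 := hJ.pos p hp
        obtain ⟨u, v, w, hw⟩ := p
        cases h2
        cases hw
        rfl
      rw [h1]
      rfl
  · have : Submodule.span ℤ (Set.range fun u : I => quo J (idem u)) ≤
        AddSubgroup.toIntSubmodule (quoGrading J deg 0) := by
      rw [Submodule.span_le]
      rintro _ ⟨u, rfl⟩
      exact quo_mem_quoGrading ((wdeg_nil deg u) ▸ ofWord_mem_grading (Gens.Word.nil u))
    exact this

/-- A quotient by a homogeneous ideal with a differential is a differential bigraded algebra. -/
theorem isDGAlgebra (D : J.ringCon.Quotient →+ J.ringCon.Quotient)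
    (d_mem : ∀ i j x, x ∈ quoGrading J deg (i, j) → D x ∈ quoGrading J deg (i, j + 1))
    (d_idem_mul : ∀ u x, D (quo J (idem u) * x) = quo J (idem u) * D x)
    (d_mul_idem : ∀ u x, D (x * quo J (idem u)) = D x * quo J (idem u))
    (leibniz : ∀ x i j y, y ∈ quoGrading J deg (i, j) →
      D (x * y) = ((Int.negOnePow j : ℤˣ) : ℤ) • (D x * y) + x * D y)
    (d_d : ∀ x, D (D x) = 0) :
    IsDGAlgebra (fun u => quo J (idem u)) (quoGrading J deg) D where
  isInternal := hJ.isInternal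
  mul_mem _ _ _ _ hx hy := quoGrading_mul_mem hx hy
  idem_mul_self u := by rw [← map_mul, idem_mul_self]
  idem_mul_ne u v h := by rw [← map_mul, idem_mul_of_ne h, map_zero]
  idem_sum := by rw [← map_sum, ← one_def, map_one]
  idem_indep := hJ.idem_indep
  degree_zero := hJ.degree_zero
  d_mem := d_mem
  d_idem_mul := d_idem_mul
  d_mul_idem := d_mul_idem
  leibniz := leibniz
  d_d := d_d

end IsGradedIdeal

end graded

end BorderedKh

namespace BorderedKh

/-! ### Differentials on quotients of tensor algebras -/

section derivation

open TAlg

variable {I : Type} [Fintype I] {Q : Gens I} {J : TwoSidedIdeal (TAlg Q)} (deg : Q.E → ℚ × ℤ)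

/-- The sign of an integer. -/
def isgn (j : ℤ) : ℤ := ((Int.negOnePow j : ℤˣ) : ℤ)

theorem isgn_add (i j : ℤ) : isgn (i + j) = isgn i * isgn j := by
  simp [isgn, Int.negOnePow_add]

theorem isgn_zero : isgn 0 = 1 := by simp [isgn]

theorem isgn_one : isgn 1 = -1 := by simp [isgn]

/-- Values `δ` of a differential on the generators, with values between the right idempotents,
as a homomorphism to upper triangular matrices. -/
noncomputable def derData (J : TwoSidedIdeal (TAlg Q)) (δ : Q.E → J.ringCon.Quotient)
    (hl : ∀ x, quo J (idem (Q.src x)) * δ x = δ x)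
    (hr : ∀ x, δ x * quo J (idem (Q.tgt x)) = δ x) :
    LiftData Q (Matrix (Fin 2) (Fin 2) J.ringCon.Quotient) where
  e u := !![quo J (idem u), 0; 0, quo J (idem u)]
  g x := !![quo J (gen x), δ x; 0, isgn (deg x).2 • quo J (gen x)]
  e_self u := by simp [← map_mul, idem_mul_self]
  e_ne u v h := by
    ext i j
    fin_cases i <;> fin_cases j <;> simp [← map_mul, idem_mul_of_ne h]
  e_sum := by
    ext i j
    have h : ∑ u, quo J (idem u) = 1 := by rw [← map_sum, ← one_def, map_one]
    rw [Matrix.sum_apply]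
    fin_cases i <;> fin_cases j <;> simp [h]
  e_g x := by
    have h : ∀ k : ℤ, quo J (idem (Q.src x)) * (k • quo J (gen x)) = k • quo J (gen x) := by
      intro k
      rw [mul_smul_comm, ← map_mul, idem_mul_gen]
    simp only [Matrix.mul_fin_two, h, hl, ← map_mul, idem_mul_gen, mul_zero, zero_mul, add_zero,
      zero_add]
  g_e x := by
    have h : ∀ k : ℤ, (k • quo J (gen x)) * quo J (idem (Q.tgt x)) = k • quo J (gen x) := by
      intro k
      rw [smul_mul_assoc, ← map_mul, gen_mul_idem]
    simp only [Matrix.mul_fin_two, h, hr, ← map_mul, gen_mul_idem, mul_zero, zero_mul, add_zero,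
      zero_add]

/-- A differential on a quotient of a tensor algebra. -/
structure DerSpec (J : TwoSidedIdeal (TAlg Q)) (deg : Q.E → ℚ × ℤ) where
  δ : Q.E → J.ringCon.Quotient
  hl : ∀ x, quo J (idem (Q.src x)) * δ x = δ x
  hr : ∀ x, δ x * quo J (idem (Q.tgt x)) = δ x
  kill : ∀ x ∈ J, (derData deg J δ hl hr).lift x = 0
  hδ : ∀ x, δ x ∈ quoGrading J deg (deg x + (0, 1))

namespace DerSpec

variable {deg} (s : DerSpec J deg)

/-- The homomorphism to matrices. -/
noncomputable def mat : J.ringCon.Quotient →+* Matrix (Fin 2) (Fin 2) J.ringCon.Quotient :=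
  quoLift J (derData deg J s.δ s.hl s.hr).lift s.kill

/-- The differential. -/
noncomputable def D : J.ringCon.Quotient →+ J.ringCon.Quotient where
  toFun x := s.mat x 0 1
  map_zero' := by rw [map_zero]; rfl
  map_add' x y := by rw [map_add]; rfl

/-- The grading automorphism. -/
noncomputable def τ (x : J.ringCon.Quotient) : J.ringCon.Quotient := s.mat x 1 1

theorem mat_idem (u : I) : s.mat (quo J (idem u)) = !![quo J (idem u), 0; 0, quo J (idem u)] :=
  (derData deg J s.δ s.hl s.hr).lift_idem u

theorem mat_gen (x : Q.E) : s.mat (quo J (gen x)) =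
    !![quo J (gen x), s.δ x; 0, isgn (deg x).2 • quo J (gen x)] :=
  (derData deg J s.δ s.hl s.hr).lift_gen x

theorem mat_zero_zero_and (x : J.ringCon.Quotient) : s.mat x 0 0 = x ∧ s.mat x 1 0 = 0 := by
  induction x using quo_induction with
  | h0 => simp
  | hadd x y hx hy => simp [Matrix.add_apply, hx, hy]
  | hneg x hx => simp [Matrix.neg_apply, hx]
  | hw p =>
    induction p using Gens.Word.induction with
    | nil u =>
      change s.mat (quo J (idem u)) 0 0 = quo J (idem u) ∧ s.mat (quo J (idem u)) 1 0 = 0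
      rw [mat_idem]
      simp
    | cons x p h ih =>
      rw [ofWord_cons, map_mul, map_mul, Matrix.mul_apply, Matrix.mul_apply]
      simp only [Fin.sum_univ_two]
      rw [ih.1, ih.2, mat_gen]
      simp

theorem D_mul (x y : J.ringCon.Quotient) : s.D (x * y) = x * s.D y + s.D x * s.τ y := by
  change s.mat (x * y) 0 1 = x * s.mat y 0 1 + s.mat x 0 1 * s.mat y 1 1
  rw [map_mul, Matrix.mul_apply, Fin.sum_univ_two, (s.mat_zero_zero_and x).1]

theorem D_idem (u : I) : s.D (quo J (idem u)) = 0 := by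
  change s.mat (quo J (idem u)) 0 1 = 0
  rw [mat_idem]
  rfl

theorem D_gen (x : Q.E) : s.D (quo J (gen x)) = s.δ x := by
  change s.mat (quo J (gen x)) 0 1 = _
  rw [mat_gen]
  rfl

theorem τ_mul (x y : J.ringCon.Quotient) : s.τ (x * y) = s.τ x * s.τ y := by
  change s.mat (x * y) 1 1 = s.mat x 1 1 * s.mat y 1 1
  rw [map_mul, Matrix.mul_apply, Fin.sum_univ_two, (s.mat_zero_zero_and x).2, zero_mul, zero_add]

theorem τ_idem (u : I) : s.τ (quo J (idem u)) = quo J (idem u) := by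
  change s.mat _ 1 1 = _
  rw [mat_idem]
  rfl

theorem τ_gen (x : Q.E) : s.τ (quo J (gen x)) = isgn (deg x).2 • quo J (gen x) := by
  change s.mat _ 1 1 = _
  rw [mat_gen]
  rfl

theorem τ_add (x y : J.ringCon.Quotient) : s.τ (x + y) = s.τ x + s.τ y := by
  change s.mat (x + y) 1 1 = s.mat x 1 1 + s.mat y 1 1
  rw [map_add]
  rfl

theorem τ_neg (x : J.ringCon.Quotient) : s.τ (-x) = -s.τ x := by
  change s.mat (-x) 1 1 = -s.mat x 1 1
  rw [map_neg]
  rfl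

theorem τ_zero : s.τ 0 = 0 := by
  change s.mat 0 1 1 = 0
  rw [map_zero]
  rfl

theorem τ_ofWord (p : Q.Word) :
    s.τ (quo J (ofWord p)) = isgn (wdeg deg p).2 • quo J (ofWord p) := by
  induction p using Gens.Word.induction with
  | nil u =>
    rw [wdeg_nil]
    exact (s.τ_idem u).trans (by rw [Prod.snd_zero, isgn_zero, one_smul]; rfl)
  | cons x p h ih =>
    rw [ofWord_cons, map_mul, τ_mul, ih, τ_gen, wdeg_cons, Prod.snd_add, isgn_add,
      smul_mul_smul_comm]

theorem τ_of_mem {d : ℚ × ℤ} {x : J.ringCon.Quotient} (hx : x ∈ quoGrading J deg d) :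
    s.τ x = isgn d.2 • x := by
  refine quoGrading_induction (P := fun x => s.τ x = isgn d.2 • x) ?_ ?_ ?_ ?_ hx
  · rw [τ_zero, smul_zero]
  · intro x y hx hy
    rw [τ_add, hx, hy, smul_add]
  · intro x hx
    rw [τ_neg, hx, smul_neg]
  · rintro p rfl
    exact s.τ_ofWord p

theorem D_ofWord_mem (p : Q.Word) :
    s.D (quo J (ofWord p)) ∈ quoGrading J deg (wdeg deg p + (0, 1)) := by
  induction p using Gens.Word.induction with
  | nil u =>
    have : s.D (quo J (ofWord (Gens.Word.nil u))) = 0 := s.D_idem u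
    rw [this]
    exact zero_mem _
  | cons x p h ih =>
    rw [ofWord_cons, map_mul, D_mul, τ_ofWord, D_gen, wdeg_cons, add_assoc]
    refine add_mem (quoGrading_mul_mem (quo_mem_quoGrading (gen_mem_grading x)) ih) ?_
    rw [mul_smul_comm]
    refine zsmul_mem ?_ _
    have := quoGrading_mul_mem (s.hδ x) (quo_mem_quoGrading (J := J) (ofWord_mem_grading (deg := deg) p))
    rwa [add_assoc, add_comm _ (wdeg deg p)] at this

theorem D_mem {d : ℚ × ℤ} {x : J.ringCon.Quotient} (hx : x ∈ quoGrading J deg d) :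
    s.D x ∈ quoGrading J deg (d + (0, 1)) := by
  refine quoGrading_induction (P := fun x => s.D x ∈ quoGrading J deg (d + (0, 1))) ?_ ?_ ?_ ?_ hx
  · rw [map_zero]
    exact zero_mem _
  · intro x y hx hy
    rw [map_add]
    exact add_mem hx hy
  · intro x hx
    rw [map_neg]
    exact neg_mem hx
  · rintro p rfl
    exact s.D_ofWord_mem p

theorem D_D (h : ∀ x, s.D (s.δ x) = 0) (x : J.ringCon.Quotient) : s.D (s.D x) = 0 := by
  induction x using quo_induction with
  | h0 => simp
  | hadd x y hx hy => rw [map_add, map_add, hx, hy, add_zero]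
  | hneg x hx => rw [map_neg, map_neg, hx, neg_zero]
  | hw p =>
    induction p using Gens.Word.induction with
    | nil u =>
      have : s.D (quo J (ofWord (Gens.Word.nil u))) = 0 := s.D_idem u
      rw [this, map_zero]
    | cons x p hp ih =>
      rw [ofWord_cons, map_mul, D_mul, map_add, D_mul, D_mul, ih, D_gen, h, zero_mul, add_zero,
        mul_zero, zero_add, s.τ_of_mem (s.D_ofWord_mem p), τ_ofWord, map_zsmul, Prod.snd_add,
        isgn_add, isgn_one, mul_neg_one, neg_smul, mul_neg, mul_smul_comm,
        neg_add_cancel]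

theorem isDGAlgebra (hJ : IsGradedIdeal J deg) (h : ∀ x, s.D (s.δ x) = 0) :
    IsDGAlgebra (fun u => quo J (idem u)) (quoGrading J deg) s.D :=
  hJ.isDGAlgebra s.D
    (fun i j x hx => by
      have := s.D_mem hx
      rwa [Prod.mk_add_mk, add_zero] at this)
    (fun u x => by rw [D_mul, D_idem, zero_mul, add_zero])
    (fun u x => by rw [D_mul, D_idem, mul_zero, zero_add, τ_idem])
    (fun x i j y hy => by
      rw [D_mul, s.τ_of_mem hy, add_comm, mul_smul_comm]
      rfl)
    (s.D_D h)

end DerSpec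

end derivation

end BorderedKh

namespace BorderedKh

/-! ### Circles and surgeries -/

section circles

variable {X : Type}

namespace SameCircle

variable {f m : X → X}

theorem refl (p : X) : SameCircle f m p p := Relation.EqvGen.refl p

theorem symm {p q : X} (h : SameCircle f m p q) : SameCircle f m q p := Relation.EqvGen.symm _ _ h

theorem trans {p q r : X} (h : SameCircle f m p q) (h' : SameCircle f m q r) :
    SameCircle f m p r := Relation.EqvGen.trans _ _ _ h h'

theorem left (p : X) : SameCircle f m p (f p) := Relation.EqvGen.rel _ _ (Or.inl rfl)

theorem right (p : X) : SameCircle f m p (m p) := Relation.EqvGen.rel _ _ (Or.inr rfl)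

theorem of_le {r : X → X → Prop} (hr : Equivalence r) (hf : ∀ p, r p (f p)) (hm : ∀ p, r p (m p))
    {p q : X} (h : SameCircle f m p q) : r p q := by
  induction h with
  | rel x y h => obtain rfl | rfl := h; exacts [hf x, hm x]
  | refl x => exact hr.refl x
  | symm x y _ h => exact hr.symm h
  | trans x y z _ _ h h' => exact hr.trans h h'

theorem mem_iff {K : X → Prop} (hf : ∀ p, K p ↔ K (f p)) (hm : ∀ p, K p ↔ K (m p)) {p q : X}
    (h : SameCircle f m p q) : K p ↔ K q :=
  of_le (r := fun p q => (K p ↔ K q)) ⟨fun _ => Iff.rfl, Iff.symm, Iff.trans⟩ hf hm h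

theorem swap {p q : X} (h : SameCircle f m p q) : SameCircle m f p q :=
  of_le ⟨refl, symm, trans⟩ right left h

theorem swap_iff {p q : X} : SameCircle f m p q ↔ SameCircle m f p q := ⟨swap, swap⟩

end SameCircle

/-- An involution that changes the colours of points. -/
structure IsArcs (col : X → Bool) (f : X → X) : Prop where
  invol : ∀ p, f (f p) = p
  col_eq : ∀ p, col (f p) = !col p

namespace IsArcs

variable {col : X → Bool} {f : X → X} (hf : IsArcs col f)
include hf

theorem ne (p : X) : f p ≠ p := by
  intro h
  have := hf.col_eq p
  rw [h] at this
  cases h' : col p <;> simp [h'] at this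

theorem inj {p q : X} (h : f p = f q) : p = q := by rw [← hf.invol p, h, hf.invol]

theorem eq_iff {p q : X} : f p = q ↔ p = f q :=
  ⟨fun h => by rw [← h, hf.invol], fun h => by rw [h, hf.invol]⟩

end IsArcs

theorem even_card_of_invol [DecidableEq X] (s : Finset X) (g : X → X) (hg : ∀ x ∈ s, g x ∈ s)
    (hi : ∀ x, g (g x) = x) (hn : ∀ x, g x ≠ x) : Even s.card := by
  have h : ∑ _x ∈ s, (1 : ZMod 2) = 0 :=
    Finset.sum_involution (fun x _ => g x) (fun _ _ => by decide) (fun x _ _ => hn x) hg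
      (fun x _ => hi x)
  rw [Finset.sum_const, nsmul_eq_mul, mul_one] at h
  exact (ZMod.natCast_eq_zero_iff_even).1 h

/-- The classes of `i` and `j` under `r` are joined in `r'`. -/
def IsJoin (r r' : X → X → Prop) (i j : X) : Prop :=
  ¬ r i j ∧ ∀ p q, r' p q ↔ r p q ∨ ((r p i ∨ r p j) ∧ (r q i ∨ r q j))

/-- A surgery on coloured matchings, given by the points it connects. -/
structure Surg (col : X → Bool) (m m' : X → X) (i j : X) : Prop where
  arcs : IsArcs col m
  arcs' : IsArcs col m'
  at_i : m' i = j
  at_mi : m' (m i) = m j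
  col_eq : col j = !col i
  ne : j ≠ m i
  other : ∀ k, k ≠ i → k ≠ j → k ≠ m i → k ≠ m j → m' k = m k

namespace Surg

variable {col : X → Bool} {m m' : X → X} {i j : X}

theorem of_surgeryAt (hm : IsArcs col m) (hm' : IsArcs col m') (h : SurgeryAt m m' i j) :
    Surg col m m' i j := by
  classical
  obtain ⟨h1, h2, h3⟩ := h
  have hi : m' i = j := by simp [h3, surger]
  have hne := hm.ne
  have h4 : m i ≠ j := fun h => h2 h.symm
  refine ⟨hm, hm', hi, ?_, ?_, h2, ?_⟩
  · simp [h3, surger, hne, h4]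
  · rw [← hi, hm'.col_eq]
  · intro k k1 k2 k3 k4
    simp [h3, surger, k1, k2, k3, k4]

variable (h : Surg col m m' i j)
include h

theorem ne_i : j ≠ i := by
  intro e
  have := h.col_eq
  rw [e] at this
  cases h' : col i <;> simp [h'] at this

theorem at_j : m' j = i := by rw [← h.at_i, h.arcs'.invol]

theorem at_mj : m' (m j) = m i := by rw [← h.at_mi, h.arcs'.invol]

theorem surgeryAt : SurgeryAt m m' i j := by
  classical
  refine ⟨h.ne_i, h.ne, funext fun k => ?_⟩
  unfold surger
  split_ifs with h1 h2 h3 h4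
  · rw [h1, h.at_i]
  · rw [h2, h.at_j]
  · rw [h3, h.at_mi]
  · rw [h4, h.at_mj]
  · exact h.other k h1 h2 h3 h4

theorem symm : Surg col m m' j i where
  arcs := h.arcs
  arcs' := h.arcs'
  at_i := h.at_j
  at_mi := h.at_mj
  col_eq := by rw [h.col_eq, Bool.not_not]
  ne := fun e => h.ne (by rw [e, h.arcs.invol])
  other k h1 h2 h3 h4 := h.other k h2 h1 h4 h3

theorem opp : Surg col m m' (m i) (m j) where
  arcs := h.arcs
  arcs' := h.arcs'
  at_i := h.at_mi
  at_mi := by rw [h.arcs.invol, h.arcs.invol, h.at_i]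
  col_eq := by rw [h.arcs.col_eq, h.arcs.col_eq, h.col_eq]
  ne := fun e => h.ne (by rw [← h.arcs.invol j, e, h.arcs.invol])
  other k h1 h2 h3 h4 := by
    rw [h.arcs.invol] at h3
    rw [h.arcs.invol] at h4
    exact h.other k h3 h4 h1 h2

theorem reverse : Surg col m' m i (m i) where
  arcs := h.arcs'
  arcs' := h.arcs
  at_i := rfl
  at_mi := by rw [h.at_i, h.at_mi]
  col_eq := h.arcs.col_eq i
  ne := fun e => h.ne (by rw [← h.at_i, e])
  other k h1 h2 h3 h4 := by
    rw [h.at_i] at h3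
    rw [h.at_mi] at h4
    exact (h.other k h1 h3 h2 h4).symm

theorem moved_iff (k : X) : m' k ≠ m k ↔ k = i ∨ k = j ∨ k = m i ∨ k = m j := by
  constructor
  · intro hk
    by_contra hc
    push Not at hc
    exact hk (h.other k hc.1 hc.2.1 hc.2.2.1 hc.2.2.2)
  · have e1 : m i ≠ j := fun e => h.ne e.symm
    rintro (rfl | rfl | rfl | rfl)
    · rw [h.at_i]
      exact h.ne
    · rw [h.at_j]
      exact fun e => h.ne (by rw [e, h.arcs.invol])
    · rw [h.at_mi, h.arcs.invol]
      exact fun e => h.ne (by rw [← e, h.arcs.invol])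
    · rw [h.at_mj, h.arcs.invol]
      exact fun e => h.ne (by rw [← e])

theorem of_moved {k : X} (hk : m' k ≠ m k) : Surg col m m' k (m' k) := by
  obtain rfl | rfl | rfl | rfl := (h.moved_iff k).1 hk
  · rw [h.at_i]; exact h
  · rw [h.at_j]; exact h.symm
  · rw [h.at_mi]; exact h.opp
  · rw [h.at_mj]; exact h.symm.opp

/-- A surgery on coloured matchings is determined by two of the points it moves. -/
theorem unique {m'' : X → X} {i' j' : X} (h' : Surg col m m'' i' j') {p q : X}
    (hp : m' p ≠ m p) (hp' : m'' p ≠ m p) (hq : m' q ≠ m q) (hq' : m'' q ≠ m q)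
    (hqp : q ≠ p) (hqp' : q ≠ m p) : m' = m'' := by
  have key : m' p = m'' p := by
    have a := (h.of_moved hp)
    have b := (h'.of_moved hp')
    have c := (a.moved_iff q).1 hq
    have d := (b.moved_iff q).1 hq'
    have e1 := a.col_eq
    have e2 := b.col_eq
    have e3 := h.arcs.col_eq (m' p)
    have e4 := h.arcs.col_eq (m'' p)
    rcases c with c | c | c | c
    · exact absurd c hqp
    · rcases d with d | d | d | d
      · exact absurd d hqp
      · rw [← c, ← d]
      · exact absurd d hqp'
      · rw [← c, d, e4, e2] at e1
        cases hh : col p <;> simp [hh] at e1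
    · exact absurd c hqp'
    · rcases d with d | d | d | d
      · exact absurd d hqp
      · rw [← d, c, e3, e1] at e2
        cases hh : col p <;> simp [hh] at e2
      · exact absurd d hqp'
      · exact h.arcs.inj (by rw [← c, ← d])
  have a := (h.of_moved hp).surgeryAt
  have b := (h'.of_moved hp').surgeryAt
  rw [← key] at b
  rw [a.2.2, b.2.2]

variable {f : X → X} (hf : IsArcs col f)
include hf

/-- The ends of an arc stay connected if it is joined to an arc of another circle. -/
theorem sameCircle_of_not [Fintype X] (hij : ¬ SameCircle f m i j) : SameCircle f m' i (m i) := by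
  classical
  by_contra hc
  let K : Finset X := Finset.univ.filter fun p => SameCircle f m' i p ∧ SameCircle f m i p
  have hK : ∀ p, p ∈ K ↔ SameCircle f m' i p ∧ SameCircle f m i p := fun p => by simp [K]
  have h1 : Even K.card := by
    refine even_card_of_invol K f (fun p hp => ?_) hf.invol hf.ne
    rw [hK] at hp ⊢
    exact ⟨hp.1.trans (.left p), hp.2.trans (.left p)⟩
  have hi : i ∈ K := (hK i).2 ⟨.refl i, .refl i⟩
  have h2 : Even (K.erase i).card := by
    refine even_card_of_invol _ m (fun p hp => ?_) h.arcs.invol h.arcs.ne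
    rw [Finset.mem_erase, hK] at hp ⊢
    have e1 : p ≠ m i := fun e => hc (e ▸ hp.2.1)
    have e2 : p ≠ j := fun e => hij (e ▸ hp.2.2)
    have e3 : p ≠ m j := fun e => hij ((e ▸ hp.2.2 : SameCircle f m i (m j)).trans
      (SameCircle.right j).symm)
    refine ⟨fun e => e1 (by rw [← e, h.arcs.invol]), ?_, hp.2.2.trans (.right p)⟩
    rw [← h.other p hp.1 e2 e1 e3]
    exact hp.2.1.trans (.right p)
  rw [Finset.card_erase_of_mem hi] at h2
  have h3 : 0 < K.card := Finset.card_pos.2 ⟨i, hi⟩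
  obtain ⟨a, ha⟩ := h1
  obtain ⟨b, hb⟩ := h2
  omega

/-- A surgery along a bridge between different circles joins them. -/
theorem isJoin [Fintype X] (hij : ¬ SameCircle f m i j) :
    IsJoin (SameCircle f m) (SameCircle f m') i j := by
  classical
  refine ⟨hij, ?_⟩
  have hji : ¬ SameCircle f m j i := fun h => hij h.symm
  have hi := h.sameCircle_of_not hf hij
  have hj := h.symm.sameCircle_of_not hf hji
  have hmj : SameCircle f m' i j := h.at_i ▸ SameCircle.right i
  have hE : Equivalence (SameCircle f m') := ⟨.refl, .symm, .trans⟩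
  have hle : ∀ p q, SameCircle f m p q → SameCircle f m' p q := by
    intro p q hpq
    refine SameCircle.of_le hE SameCircle.left (fun k => ?_) hpq
    by_cases hk : m' k = m k
    · rw [← hk]
      exact .right k
    · obtain rfl | rfl | rfl | rfl := (h.moved_iff k).1 hk
      · exact hi
      · exact hj
      · rw [h.arcs.invol]; exact hi.symm
      · rw [h.arcs.invol]; exact hj.symm
  intro p q
  constructor
  · intro hpq
    let r : X → X → Prop := fun p q => SameCircle f m p q ∨
      ((SameCircle f m p i ∨ SameCircle f m p j) ∧ (SameCircle f m q i ∨ SameCircle f m q j))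
    have hr : Equivalence r := by
      refine ⟨fun x => Or.inl (.refl x), ?_, ?_⟩
      · rintro x y (h | h)
        · exact Or.inl h.symm
        · exact Or.inr ⟨h.2, h.1⟩
      · rintro x y z (h | h) (h' | h')
        · exact Or.inl (h.trans h')
        · exact Or.inr ⟨h'.1.imp h.trans h.trans, h'.2⟩
        · exact Or.inr ⟨h.1, h.2.imp h'.symm.trans h'.symm.trans⟩
        · exact Or.inr ⟨h.1, h'.2⟩
    refine SameCircle.of_le hr (fun p => Or.inl (.left p)) (fun k => ?_) hpq
    by_cases hk : m' k = m k
    · rw [hk]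
      exact Or.inl (.right k)
    · right
      have a1 : SameCircle f m (m i) i := (SameCircle.right i).symm
      have a2 : SameCircle f m (m j) j := (SameCircle.right j).symm
      obtain rfl | rfl | rfl | rfl := (h.moved_iff k).1 hk
      · rw [h.at_i]; exact ⟨Or.inl (.refl _), Or.inr (.refl _)⟩
      · rw [h.at_j]; exact ⟨Or.inr (.refl _), Or.inl (.refl _)⟩
      · rw [h.at_mi]; exact ⟨Or.inl a1, Or.inr a2⟩
      · rw [h.at_mj]; exact ⟨Or.inr a2, Or.inl a1⟩
  · rintro (h | ⟨h1, h2⟩)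
    · exact hle p q h
    · have e1 : SameCircle f m' p i := h1.elim (hle _ _) fun h => (hle _ _ h).trans hmj.symm
      have e2 : SameCircle f m' q i := h2.elim (hle _ _) fun h => (hle _ _ h).trans hmj.symm
      exact e1.trans e2.symm

/-- A surgery along a bridge with both ends on one circle splits it. -/
theorem not_sameCircle [Finite X] (hij : SameCircle f m i j) : ¬ SameCircle f m' i (m i) := by
  classical
  intro hc
  let t : ℕ → X := fun k => (f ∘ m)^[k] i
  have ht : ∀ k, t (k + 1) = f (m (t k)) := fun k => Function.iterate_succ_apply' (f ∘ m) k i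
  have hcol : ∀ k, col (t k) = col i := by
    intro k
    induction k with
    | zero => rfl
    | succ k ih => rw [ht, hf.col_eq, h.arcs.col_eq, ih, Bool.not_not]
  have hfm : ∀ k, f (t (k + 1)) = m (t k) := fun k => by rw [ht, hf.invol]
  have hinj : Function.Injective (f ∘ m) := fun x y e => h.arcs.inj (hf.inj e)
  have hex : ∃ k, 0 < k ∧ (t k = i ∨ t k = m j) := by
    obtain ⟨k, hk, hk'⟩ := hinj.mem_periodicPts i
    exact ⟨k, hk, Or.inl hk'⟩
  obtain ⟨hk0, hk⟩ := Nat.find_spec hex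
  have hmin : ∀ s, 0 < s → s < Nat.find hex → t s ≠ i ∧ t s ≠ m j := by
    intro s hs hs'
    have := Nat.find_min hex hs'
    push Not at this
    exact this hs
  generalize Nat.find hex = k at hk0 hk hmin
  obtain ⟨k, rfl⟩ : ∃ k', k = k' + 1 := ⟨k - 1, by omega⟩
  have hcj : ∀ s, t s ≠ j := by
    intro s e
    have := hcol s
    rw [e, h.col_eq] at this
    cases hh : col i <;> simp [hh] at this
  have hcmi : ∀ s, t s ≠ m i := by
    intro s e
    have := hcol s
    rw [e, h.arcs.col_eq] at this
    cases hh : col i <;> simp [hh] at this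
  have hiff : ∀ {K : X → Prop} {g : X → X}, (∀ p, g (g p) = p) → (∀ p, K p → K (g p)) →
      ∀ p, K p ↔ K (g p) := by
    intro K g hg hK p
    refine ⟨hK p, fun hp => ?_⟩
    rw [← hg p]
    exact hK _ hp
  obtain hk | hk := hk
  · let K : X → Prop := fun p => ∃ s, s < k + 1 ∧ (p = t s ∨ p = m (t s))
    have hKm : ∀ p, K p → K (m p) := by
      rintro p ⟨s, hs, rfl | rfl⟩
      · exact ⟨s, hs, Or.inr rfl⟩
      · exact ⟨s, hs, Or.inl (h.arcs.invol _)⟩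
    have hKf : ∀ p, K p → K (f p) := by
      rintro p ⟨s, hs, rfl | rfl⟩
      · cases s with
        | zero =>
          refine ⟨k, by omega, Or.inr ?_⟩
          change f i = _
          rw [← hfm, hk]
        | succ s => exact ⟨s, by omega, Or.inr (hfm s)⟩
      · rw [← ht]
        by_cases hs' : s + 1 = k + 1
        · exact ⟨0, by omega, Or.inl (by rw [hs', hk]; rfl)⟩
        · exact ⟨s + 1, by omega, Or.inl rfl⟩
    obtain ⟨s, hs, hs' | hs'⟩ :=
      (hij.mem_iff (hiff hf.invol hKf) (hiff h.arcs.invol hKm)).1 ⟨0, by omega, Or.inl rfl⟩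
    · exact hcj s hs'.symm
    · have e : t s = m j := by rw [hs', h.arcs.invol]
      cases s with
      | zero => exact h.ne (by rw [hs']; rfl)
      | succ s => exact (hmin (s + 1) (by omega) hs).2 e
  · let K : X → Prop := fun p => (∃ s, s < k + 1 ∧ p = t (s + 1)) ∨ ∃ s, s < k + 1 ∧ p = m (t s)
    have hKf : ∀ p, K p → K (f p) := by
      rintro p (⟨s, hs, rfl⟩ | ⟨s, hs, rfl⟩)
      · exact Or.inr ⟨s, hs, hfm s⟩
      · exact Or.inl ⟨s, hs, (ht s).symm⟩
    have hKm : ∀ p, K p → K (m' p) := by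
      rintro p (⟨s, hs, rfl⟩ | ⟨s, hs, rfl⟩)
      · by_cases hs' : s = k
        · rw [hs', hk, h.at_mj]
          exact Or.inr ⟨0, by omega, rfl⟩
        · have a := hmin (s + 1) (by omega) (by omega)
          rw [h.other _ a.1 (hcj _) (hcmi _) a.2]
          exact Or.inr ⟨s + 1, by omega, rfl⟩
      · cases s with
        | zero =>
          change K (m' (m i))
          rw [h.at_mi, ← hk]
          exact Or.inl ⟨k, by omega, rfl⟩
        | succ s =>
          have a := hmin (s + 1) (by omega) hs
          rw [h.other _ (fun e => hcmi (s + 1) (by rw [← e, h.arcs.invol]))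
            (fun e => a.2 (by rw [← e, h.arcs.invol])) (fun e => a.1 (h.arcs.inj e))
            (fun e => hcj (s + 1) (h.arcs.inj e)), h.arcs.invol]
          exact Or.inl ⟨s, by omega, rfl⟩
    obtain ⟨s, hs, hs'⟩ | ⟨s, hs, hs'⟩ :=
      (hc.mem_iff (hiff hf.invol hKf) (hiff h.arcs'.invol hKm)).2 (Or.inr ⟨0, by omega, rfl⟩)
    · by_cases e : s = k
      · rw [e, hk] at hs'
        exact h.ne (by rw [hs', h.arcs.invol])
      · exact (hmin (s + 1) (by omega) (by omega)).1 hs'.symm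
    · exact hcmi s (by rw [hs', h.arcs.invol])

/-- A surgery joins two circles or splits a circle. -/
theorem isJoin_or [Fintype X] : IsJoin (SameCircle f m) (SameCircle f m') i j ∨
    (SameCircle f m i j ∧ IsJoin (SameCircle f m') (SameCircle f m) i (m i)) := by
  by_cases hij : SameCircle f m i j
  · exact Or.inr ⟨hij, h.reverse.isJoin hf (h.not_sameCircle hf hij)⟩
  · exact Or.inl (h.isJoin hf hij)

end Surg

end circles

end BorderedKh

namespace BorderedKh

/-! ### Crossingless matchings change the parity of points -/

namespace NCMatching

variable {n : ℕ} (a : NCMatching n)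

/-- The number of points, in a set closed under a crossingless matching, between the ends of an arc
outside the set is even. -/
theorem even_between (S : Finset (Fin (2 * n))) (hS : ∀ x ∈ S, a x ∈ S) {p : Fin (2 * n)}
    (hp : p ∉ S) : Even (S.filter fun q => p < q ∧ q < a p).card := by
  classical
  have hap : a p ∉ S := fun h => hp (by have := hS _ h; rwa [a.invol] at this)
  refine even_card_of_invol _ a (fun x hx => ?_) a.invol a.noFix
  rw [Finset.mem_filter] at hx ⊢
  obtain ⟨hx, h1, h2⟩ := hx
  refine ⟨hS x hx, ?_, ?_⟩
  · rcases lt_trichotomy p (a x) with h | h | h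
    · exact h
    · exact absurd (h ▸ hS x hx) hp
    · exact absurd ⟨h, by rwa [a.invol], by rwa [a.invol]⟩ (a.noCross (a x) p)
  · rcases lt_trichotomy (a x) (a p) with h | h | h
    · exact h
    · exact absurd (h ▸ hS x hx) hap
    · exact absurd ⟨h1, h2, h⟩ (a.noCross p x)

/-- The colour of a point: its parity. -/
def col (p : Fin (2 * n)) : Bool := decide ((p : ℕ) % 2 = 0)

theorem col_eq (p : Fin (2 * n)) : col (a p) = !col p := by
  classical
  have key : ∀ p : Fin (2 * n), p < a p → col (a p) = !col p := by
    intro p hlt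
    have h := a.even_between (Finset.univ.filter fun q => q ≠ p ∧ q ≠ a p)
      (fun x hx => by
        simp only [Finset.mem_filter, Finset.mem_univ, true_and] at hx ⊢
        exact ⟨fun h => hx.2 (by rw [← h, a.invol]),
          fun h => hx.1 (by rw [← a.invol x, h, a.invol])⟩)
      (p := p) (by simp)
    have e : ((Finset.univ.filter fun q => q ≠ p ∧ q ≠ a p).filter fun q => p < q ∧ q < a p) =
        Finset.Ioo p (a p) := by
      ext q
      simp only [Finset.mem_filter, Finset.mem_univ, true_and, Finset.mem_Ioo]
      exact ⟨fun h => h.2, fun h => ⟨⟨h.1.ne', h.2.ne⟩, h⟩⟩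
    rw [e, Fin.card_Ioo] at h
    have hlt' : (p : ℕ) < a p := hlt
    obtain ⟨k, hk⟩ := h
    simp only [col]
    rcases Nat.mod_two_eq_zero_or_one (p : ℕ) with h1 | h1
    · have : ((a p : Fin (2 * n)) : ℕ) % 2 = 1 := by omega
      simp [h1, this]
    · have : ((a p : Fin (2 * n)) : ℕ) % 2 = 0 := by omega
      simp [h1, this]
  rcases lt_or_gt_of_ne (a.noFix p) with h | h
  · have := key (a p) (by rwa [a.invol])
    rw [a.invol] at this
    rw [this, Bool.not_not]
  · exact key p h

theorem isArcs : IsArcs col a := ⟨a.invol, a.col_eq⟩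

variable {a} in
@[ext] theorem ext {b : NCMatching n} (h : ∀ p, a p = b p) : a = b := by
  obtain ⟨a, _, _, _⟩ := a
  obtain ⟨b, _, _, _⟩ := b
  have : a = b := funext h
  subst this
  rfl

variable {a} in
theorem toFun_inj {b : NCMatching n} (h : a.toFun = b.toFun) : a = b := ext fun p => congrFun h p

end NCMatching

/-! ### Joins of classes and Khovanov's merge rule -/

section joins

variable {X : Type}

namespace IsJoin

variable {r r' : X → X → Prop} {i j : X}

theorem congr (hr : Equivalence r) (h : IsJoin r r' i j) {i' j' : X} (hi : r i i') (hj : r j j') :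
    IsJoin r r' i' j' := by
  have e1 : ∀ p, r p i ↔ r p i' := fun p => ⟨fun h => hr.trans h hi, fun h => hr.trans h (hr.symm hi)⟩
  have e2 : ∀ p, r p j ↔ r p j' := fun p => ⟨fun h => hr.trans h hj, fun h => hr.trans h (hr.symm hj)⟩
  refine ⟨fun h' => h.1 (hr.trans hi (hr.trans h' (hr.symm hj))), fun p q => ?_⟩
  rw [h.2, e1, e1, e2, e2]

theorem symm (hr : Equivalence r) (h : IsJoin r r' i j) : IsJoin r r' j i := by
  refine ⟨fun h' => h.1 (hr.symm h'), fun p q => ?_⟩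
  rw [h.2, or_comm (a := r p i), or_comm (a := r q i)]

theorem le (h : IsJoin r r' i j) {p q : X} (hpq : r p q) : r' p q := (h.2 p q).2 (Or.inl hpq)

theorem joined (hr : Equivalence r) (h : IsJoin r r' i j) : r' i j :=
  (h.2 i j).2 (Or.inr ⟨Or.inl (hr.refl i), Or.inr (hr.refl j)⟩)

end IsJoin

/-- The merge rule for labels, where the classes of `i` and `j` are joined. -/
def MRule (r : X → X → Prop) (i j : X) (σ σ' : X → Bool) : Prop :=
  (∀ k, ¬ r i k → ¬ r j k → σ' k = σ k) ∧
    ((σ i = true ∧ σ' i = σ j) ∨ (σ i = false ∧ σ j = true ∧ σ' i = false))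

open Classical in
/-- Change the label of the class of `p`. -/
noncomputable def relabel (r : X → X → Prop) (p : X) (v : Bool) (σ : X → Bool) : X → Bool :=
  fun q => if r p q then v else σ q

theorem mRule_relabel {r r' : X → X → Prop} (hr : Equivalence r) {i j : X} (h : IsJoin r r' i j)
    {σ σ' : X → Bool} (hσ : ∀ p q, r p q → σ p = σ q) (hσ' : ∀ p q, r' p q → σ' p = σ' q) (p : X) :
    (σ p = true ∧ MRule r i j (relabel r p false σ) σ') ↔
      (σ' p = false ∧ MRule r i j σ (relabel r' p true σ')) := by
  have hij := h.1
  have hc : ∀ x y, r x y → r y x := fun x y => hr.symm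
  by_cases hp : r p i
  · have hpj : ¬ r p j := fun h' => hij (hr.trans (hr.symm hp) h')
    have hp' : r' p i := h.le hp
    have e1 : ∀ k, ¬ r i k → ¬ r j k → ¬ r p k := fun k h1 _ h3 => h1 (hr.trans (hr.symm hp) h3)
    have e2 : ∀ k, ¬ r i k → ¬ r j k → ¬ r' p k := by
      intro k h1 h2 h3
      rcases (h.2 p k).1 h3 with h4 | ⟨-, h4 | h4⟩
      exacts [e1 k h1 h2 h4, h1 (hr.symm h4), h2 (hr.symm h4)]
    have e3 : (∀ k, ¬ r i k → ¬ r j k → σ' k = relabel r p false σ k) ↔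
        (∀ k, ¬ r i k → ¬ r j k → relabel r' p true σ' k = σ k) := by
      refine forall_congr' fun k => forall_congr' fun h1 => forall_congr' fun h2 => ?_
      rw [relabel, if_neg (e1 k h1 h2), relabel, if_neg (e2 k h1 h2)]
    rw [MRule, MRule, e3]
    simp only [relabel, hp, hpj, hp', if_true, if_false]
    rw [hσ p i hp, hσ' p i hp']
    cases σ i <;> cases σ j <;> cases σ' i <;> simp
  by_cases hpj : r p j
  · have hp' : r' p i := (h.2 p i).2 (Or.inr ⟨Or.inr hpj, Or.inl (hr.refl i)⟩)
    have e1 : ∀ k, ¬ r i k → ¬ r j k → ¬ r p k := fun k _ h1 h3 => h1 (hr.trans (hr.symm hpj) h3)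
    have e2 : ∀ k, ¬ r i k → ¬ r j k → ¬ r' p k := by
      intro k h1 h2 h3
      rcases (h.2 p k).1 h3 with h4 | ⟨-, h4 | h4⟩
      exacts [e1 k h1 h2 h4, h1 (hr.symm h4), h2 (hr.symm h4)]
    have e3 : (∀ k, ¬ r i k → ¬ r j k → σ' k = relabel r p false σ k) ↔
        (∀ k, ¬ r i k → ¬ r j k → relabel r' p true σ' k = σ k) := by
      refine forall_congr' fun k => forall_congr' fun h1 => forall_congr' fun h2 => ?_
      rw [relabel, if_neg (e1 k h1 h2), relabel, if_neg (e2 k h1 h2)]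
    rw [MRule, MRule, e3]
    simp only [relabel, hp, hpj, hp', if_true, if_false]
    rw [hσ p j hpj, hσ' p i hp']
    cases σ i <;> cases σ j <;> cases σ' i <;> simp
  · have hrr : ∀ k, r' p k ↔ r p k := by
      intro k
      rw [h.2]
      exact ⟨fun h' => h'.elim id fun h' => absurd h'.1 (not_or.2 ⟨hp, hpj⟩), Or.inl⟩
    have hi' : ¬ r' p i := fun h' => hp ((hrr i).1 h')
    have e0 : ¬ r i p := fun h' => hp (hr.symm h')
    have e0' : ¬ r j p := fun h' => hpj (hr.symm h')
    rw [MRule, MRule]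
    simp only [relabel, hp, hpj, hi', if_false]
    constructor
    · rintro ⟨h1, h2, h3⟩
      refine ⟨?_, fun k hk hk' => ?_, h3⟩
      · have := h2 p e0 e0'
        simpa [hr.refl p] using this
      · by_cases hk2 : r p k
        · rw [if_pos ((hrr k).2 hk2), ← hσ p k hk2, h1]
        · rw [if_neg (fun h => hk2 ((hrr k).1 h)), h2 k hk hk', if_neg hk2]
    · rintro ⟨h1, h2, h3⟩
      refine ⟨?_, fun k hk hk' => ?_, h3⟩
      · have := h2 p e0 e0'
        rw [if_pos ((hrr p).2 (hr.refl p))] at this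
        exact this.symm
      · by_cases hk2 : r p k
        · rw [if_pos hk2, ← hσ' p k ((hrr k).2 hk2), h1]
        · rw [if_neg hk2, ← h2 k hk hk', if_neg (fun h => hk2 ((hrr k).1 h))]

end joins

/-! ### Labelled circle diagrams -/

namespace DecLink

variable {n : ℕ} (h : DecLink n)

theorem sameCirc_equiv : Equivalence h.SameCirc := ⟨.refl, .symm, .trans⟩

theorem sign_eq {p q : Fin (2 * n)} (hpq : h.SameCirc p q) : h.sign p = h.sign q :=
  SameCircle.of_le (r := fun p q => h.sign p = h.sign q) ⟨fun _ => rfl, Eq.symm, Eq.trans⟩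
    (fun p => (h.sign_left p).symm) (fun p => (h.sign_right p).symm) hpq

theorem sameCirc_left (p : Fin (2 * n)) : h.SameCirc p (h.left p) := SameCircle.left p

theorem sameCirc_right (p : Fin (2 * n)) : h.SameCirc p (h.right p) := SameCircle.right p

theorem sameCirc_inner (s : Side) (p : Fin (2 * n)) : h.SameCirc p (h.inner s p) := by
  cases s
  exacts [h.sameCirc_left p, h.sameCirc_right p]

theorem sameCircle_outer_inner (s : Side) :
    SameCircle (h.outer s) (h.inner s) = h.SameCirc := by
  ext p q
  cases s
  · exact SameCircle.swap_iff
  · exact Iff.rfl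

/-- The diagram without the labels. -/
def diag : NCMatching n × NCMatching n := (h.left, h.right)

variable {h} in
theorem sameCirc_of_diag {k : DecLink n} (hd : h.diag = k.diag) : h.SameCirc = k.SameCirc := by
  have h1 : h.left = k.left := congrArg Prod.fst hd
  have h2 : h.right = k.right := congrArg Prod.snd hd
  ext p q
  rw [SameCirc, SameCirc, h1, h2]

variable {h} in
theorem inner_of_diag {k : DecLink n} (hd : h.diag = k.diag) (s : Side) : h.inner s = k.inner s := by
  cases s
  exacts [congrArg Prod.fst hd, congrArg Prod.snd hd]

variable {h} in
theorem outer_of_diag {k : DecLink n} (hd : h.diag = k.diag) (s : Side) : h.outer s = k.outer s := by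
  cases s
  exacts [congrArg Prod.snd hd, congrArg Prod.fst hd]

variable {h} in
theorem diag_ext {k : DecLink n} (s : Side) (h1 : h.inner s = k.inner s)
    (h2 : h.outer s = k.outer s) : h.diag = k.diag := by
  cases s
  exacts [Prod.ext h1 h2, Prod.ext h2 h1]

variable {h} in
theorem ext_diag {k : DecLink n} (hd : h.diag = k.diag) (hs : ∀ p, h.sign p = k.sign p) : h = k :=
  DecLink.ext (congrArg Prod.fst hd) (congrArg Prod.snd hd) (funext hs)

/-- All labels reversed. -/
@[simps] def neg : DecLink n := ⟨h.left, h.right, fun p => !h.sign p,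
  fun p => by rw [h.sign_left], fun p => by rw [h.sign_right]⟩

theorem neg_neg : h.neg.neg = h := by
  ext p
  · rfl
  · rfl
  · simp

/-- The label of the circle of `p` changed to `v`. -/
@[simps] noncomputable def set (p : Fin (2 * n)) (v : Bool) : DecLink n :=
  ⟨h.left, h.right, relabel h.SameCirc p v h.sign,
    fun q => by
      have : h.SameCirc p (h.left q) ↔ h.SameCirc p q :=
        ⟨fun h' => h'.trans (h.sameCirc_left q).symm, fun h' => h'.trans (h.sameCirc_left q)⟩
      rw [relabel, relabel, h.sign_left]
      by_cases hq : h.SameCirc p q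
      · rw [if_pos (this.2 hq), if_pos hq]
      · rw [if_neg (fun e => hq (this.1 e)), if_neg hq],
    fun q => by
      have : h.SameCirc p (h.right q) ↔ h.SameCirc p q :=
        ⟨fun h' => h'.trans (h.sameCirc_right q).symm, fun h' => h'.trans (h.sameCirc_right q)⟩
      rw [relabel, relabel, h.sign_right]
      by_cases hq : h.SameCirc p q
      · rw [if_pos (this.2 hq), if_pos hq]
      · rw [if_neg (fun e => hq (this.1 e)), if_neg hq]⟩

theorem set_sign_of_sameCirc {p q : Fin (2 * n)} {v : Bool} (hpq : h.SameCirc p q) :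
    (h.set p v).sign q = v := if_pos hpq

theorem set_sign_self (p : Fin (2 * n)) (v : Bool) : (h.set p v).sign p = v :=
  h.set_sign_of_sameCirc (.refl p)

theorem set_sign_of_not {p q : Fin (2 * n)} {v : Bool} (hpq : ¬ h.SameCirc p q) :
    (h.set p v).sign q = h.sign q := if_neg hpq

theorem set_set (p : Fin (2 * n)) (v : Bool) (w : Bool) : (h.set p v).set p w = h.set p w := by
  refine ext_diag rfl fun q => ?_
  by_cases hq : h.SameCirc p q
  · rw [set_sign_of_sameCirc _ hq]
    exact (h.set p v).set_sign_of_sameCirc hq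
  · rw [set_sign_of_not _ hq]
    exact ((h.set p v).set_sign_of_not hq).trans (h.set_sign_of_not hq)

theorem set_eq_self {p : Fin (2 * n)} {v : Bool} (hp : h.sign p = v) : h.set p v = h := by
  refine ext_diag rfl fun q => ?_
  by_cases hq : h.SameCirc p q
  · rw [set_sign_of_sameCirc _ hq, ← hp, h.sign_eq hq]
  · rw [set_sign_of_not _ hq]

theorem set_congr {p q : Fin (2 * n)} (hpq : h.SameCirc p q) (v : Bool) : h.set p v = h.set q v := by
  refine ext_diag rfl fun x => ?_
  by_cases hq : h.SameCirc p x
  · rw [set_sign_of_sameCirc _ hq, set_sign_of_sameCirc _ (hpq.symm.trans hq)]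
  · rw [set_sign_of_not _ hq, set_sign_of_not _ (fun h' => hq (hpq.trans h'))]

theorem set_neg (p : Fin (2 * n)) (v : Bool) : (h.set p v).neg = h.neg.set p (!v) := by
  refine ext_diag rfl fun q => ?_
  by_cases hq : h.SameCirc p q
  · rw [neg_sign, set_sign_of_sameCirc _ hq]
    exact (h.neg.set_sign_of_sameCirc hq).symm
  · rw [neg_sign, set_sign_of_not _ hq]
    exact (h.neg.set_sign_of_not hq).symm

theorem set_comm {p q : Fin (2 * n)} (hpq : ¬ h.SameCirc p q) (v w : Bool) :
    (h.set p v).set q w = (h.set q w).set p v := by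
  refine ext_diag rfl fun x => ?_
  change relabel h.SameCirc q w (relabel h.SameCirc p v h.sign) x =
    relabel h.SameCirc p v (relabel h.SameCirc q w h.sign) x
  unfold relabel
  split_ifs with h1 h2 <;> try rfl
  exact absurd (h2.trans h1.symm) hpq

end DecLink

section edges

variable {n : ℕ}

/-- The decoration edges that change the label of the circle of `p`. -/
def DecoAt (p : Fin (2 * n)) (h k : DecLink n) : Prop := h.sign p = true ∧ k = h.set p false

theorem decoAt_iff' {p : Fin (2 * n)} {h k : DecLink n} :
    DecoAt p h k ↔ k.sign p = false ∧ h = k.set p true := by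
  constructor
  · rintro ⟨h1, rfl⟩
    exact ⟨h.set_sign_self p _, by rw [h.set_set, h.set_eq_self h1]⟩
  · rintro ⟨h1, rfl⟩
    exact ⟨k.set_sign_self p _, by rw [k.set_set, k.set_eq_self h1]⟩

theorem DecoAt.diag {p : Fin (2 * n)} {h k : DecLink n} (hp : DecoAt p h k) : h.diag = k.diag := by
  obtain ⟨_, rfl⟩ := hp
  rfl

theorem isDecoEdge_iff {h k : DecLink n} : IsDecoEdge h k ↔ ∃ p, DecoAt p h k := by
  constructor
  · rintro ⟨h1, h2, p, h3, h4⟩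
    refine ⟨p, h3, DecLink.ext h1.symm h2.symm (funext fun q => ?_)⟩
    by_cases hq : h.SameCirc p q
    · rw [(h4 q).1 hq, h.set_sign_of_sameCirc hq]
    · rw [(h4 q).2 hq, h.set_sign_of_not hq]
  · rintro ⟨p, h1, rfl⟩
    exact ⟨rfl, rfl, p, h1, fun q => ⟨h.set_sign_of_sameCirc, h.set_sign_of_not⟩⟩

theorem DecoAt.sign_ne_iff {p q : Fin (2 * n)} {h k : DecLink n} (hp : DecoAt p h k) :
    h.sign q ≠ k.sign q ↔ h.SameCirc p q := by
  obtain ⟨h1, rfl⟩ := hp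
  by_cases hq : h.SameCirc p q
  · rw [h.set_sign_of_sameCirc hq, ← h.sign_eq hq, h1]
    simp [hq]
  · rw [h.set_sign_of_not hq]
    simp [hq]

/-- The circles of `i` and `j` in the diagram of `h` are joined in the diagram of `k`, and the labels
follow the merge rule. -/
def JoinStep (h k : DecLink n) (i j : Fin (2 * n)) : Prop :=
  IsJoin h.SameCirc k.SameCirc i j ∧ MRule h.SameCirc i j h.sign k.sign

namespace JoinStep

variable {h k : DecLink n} {i j : Fin (2 * n)}

theorem symm (hs : JoinStep h k i j) : JoinStep h k j i := by
  obtain ⟨h1, h2, h3⟩ := hs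
  refine ⟨h1.symm h.sameCirc_equiv, fun p hp hp' => h2 p hp' hp, ?_⟩
  have h4 := k.sign_eq (h1.joined h.sameCirc_equiv)
  rw [← h4]
  revert h3
  cases h.sign i <;> cases h.sign j <;> cases k.sign i <;> simp

theorem congr (hs : JoinStep h k i j) {i' j' : Fin (2 * n)} (hi : h.SameCirc i i')
    (hj : h.SameCirc j j') : JoinStep h k i' j' := by
  obtain ⟨h1, h2, h3⟩ := hs
  refine ⟨h1.congr h.sameCirc_equiv hi hj,
    fun p hp hp' => h2 p (fun e => hp (hi.symm.trans e)) (fun e => hp' (hj.symm.trans e)), ?_⟩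
  rwa [← h.sign_eq hi, ← h.sign_eq hj, ← k.sign_eq (h1.le hi)]

theorem set_iff (p : Fin (2 * n)) : (h.sign p = true ∧ JoinStep (h.set p false) k i j) ↔
    (k.sign p = false ∧ JoinStep h (k.set p true) i j) := by
  by_cases hj : IsJoin h.SameCirc k.SameCirc i j
  · have := mRule_relabel h.sameCirc_equiv hj (fun p q => h.sign_eq) (fun p q => k.sign_eq) p
    constructor
    · rintro ⟨h1, -, h2⟩
      exact ⟨(this.1 ⟨h1, h2⟩).1, hj, (this.1 ⟨h1, h2⟩).2⟩
    · rintro ⟨h1, -, h2⟩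
      exact ⟨(this.2 ⟨h1, h2⟩).1, hj, (this.2 ⟨h1, h2⟩).2⟩
  · exact ⟨fun h => absurd h.2.1 hj, fun h => absurd h.2.1 hj⟩

end JoinStep

theorem saddleRule_iff {h k : DecLink n} {s : Side} {i j : Fin (2 * n)}
    (ho : h.outer s = k.outer s) (hs : Surg NCMatching.col (h.inner s) (k.inner s) i j) :
    SaddleRule (h.outer s) (h.inner s) i j h.sign k.sign ↔
      (JoinStep h k i j ∨ JoinStep k.neg h.neg i (h.inner s i)) := by
  have e : SameCircle (h.outer s) (k.inner s) = k.SameCirc := by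
    rw [ho]
    exact k.sameCircle_outer_inner s
  have hj := hs.isJoin_or (h.outer s).isArcs
  have hne := hs.not_sameCircle (h.outer s).isArcs
  rw [e, h.sameCircle_outer_inner] at hj hne
  unfold SaddleRule
  rw [h.sameCircle_outer_inner]
  by_cases hij : h.SameCirc i j
  · have hj' : IsJoin k.SameCirc h.SameCirc i (h.inner s i) :=
      (hj.resolve_left fun h' => h'.1 hij).2
    rw [if_pos hij]
    have e1 : ∀ x, (¬ h.SameCirc i x ∧ ¬ h.SameCirc j x) ↔
        (¬ k.SameCirc i x ∧ ¬ k.SameCirc (h.inner s i) x) := by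
      intro x
      have e2 : h.SameCirc j x ↔ h.SameCirc i x := ⟨hij.trans, hij.symm.trans⟩
      rw [e2, and_self, hj'.2, ← not_or]
      refine not_congr ⟨?_, ?_⟩
      · rintro (h' | ⟨-, h' | h'⟩)
        exacts [Or.inl h', Or.inl h'.symm, Or.inr h'.symm]
      · rintro (h' | h')
        exacts [Or.inl h', Or.inr ⟨Or.inl (.refl i), Or.inr h'.symm⟩]
    constructor
    · rintro ⟨h1, h2⟩
      refine Or.inr ⟨hj', fun x hx hx' => ?_, ?_⟩
      · have := (e1 x).2 ⟨hx, hx'⟩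
        rw [DecLink.neg_sign, DecLink.neg_sign, h1 x this.1 this.2]
      · simp only [DecLink.neg_sign]
        revert h2
        cases h.sign i <;> cases k.sign i <;> cases k.sign (h.inner s i) <;> simp
    · rintro (h' | ⟨-, h1, h2⟩)
      · exact absurd hij h'.1.1
      · refine ⟨fun x hx hx' => ?_, ?_⟩
        · have := (e1 x).1 ⟨hx, hx'⟩
          have := h1 x this.1 this.2
          simp only [DecLink.neg_sign] at this
          exact (Bool.not_inj this).symm
        · simp only [DecLink.neg_sign] at h2
          revert h2
          cases h.sign i <;> cases k.sign i <;> cases k.sign (h.inner s i) <;> simp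
  · have hj' : IsJoin h.SameCirc k.SameCirc i j := hj.resolve_right fun h' => hij h'.1
    rw [if_neg hij]
    refine ⟨fun h' => Or.inl ⟨hj', h'⟩, ?_⟩
    rintro (h' | ⟨h', -⟩)
    · exact h'.2
    · exact absurd ((hj'.2 _ _).2 (Or.inl (h.sameCirc_inner s i))) h'.1

theorem isBridgeEdge_iff {h k : DecLink n} {s : Side} {i j : Fin (2 * n)}
    (ho : h.outer s = k.outer s) (hs : Surg NCMatching.col (h.inner s) (k.inner s) i j) :
    IsBridgeEdge s h k ↔ (JoinStep h k i j ∨ JoinStep k.neg h.neg i (h.inner s i)) := by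
  constructor
  · rintro ⟨-, i', j', h1, h2⟩
    have hs' := Surg.of_surgeryAt (h.inner s).isArcs (k.inner s).isArcs h1
    have hi : i = i' ∨ i = j' ∨ i = h.inner s i' ∨ i = h.inner s j' :=
      (hs'.moved_iff i).1 ((hs.moved_iff i).2 (Or.inl rfl))
    rw [saddleRule_iff ho hs'] at h2
    have e1 : k.SameCirc i' j' := hs'.at_i ▸ k.sameCirc_inner s i'
    have e2 : k.SameCirc (h.inner s i') (h.inner s j') := hs'.at_mi ▸ k.sameCirc_inner s _
    rcases hi with rfl | rfl | rfl | rfl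
    · obtain rfl : j = j' := hs.at_i.symm.trans hs'.at_i
      exact h2
    · obtain rfl : j = i' := hs.at_i.symm.trans hs'.at_j
      exact h2.imp JoinStep.symm fun h' => h'.congr e1 e2
    · obtain rfl : j = h.inner s j' := hs.at_i.symm.trans hs'.at_mi
      refine h2.imp (fun h' => h'.congr (h.sameCirc_inner s _) (h.sameCirc_inner s _)) fun h' => ?_
      rw [(h.inner s).invol]
      exact h'.symm
    · obtain rfl : j = h.inner s i' := hs.at_i.symm.trans hs'.at_mj
      refine h2.imp (fun h' => h'.symm.congr (h.sameCirc_inner s _) (h.sameCirc_inner s _))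
        fun h' => ?_
      rw [(h.inner s).invol]
      exact h'.symm.congr e2 e1
  · intro h'
    exact ⟨ho, i, j, hs.surgeryAt, (saddleRule_iff ho hs).2 h'⟩

theorem IsBridgeEdge.exists_surg {s : Side} {h k : DecLink n} (hb : IsBridgeEdge s h k) :
    ∃ i j, Surg NCMatching.col (h.inner s) (k.inner s) i j := by
  obtain ⟨-, i, j, h1, -⟩ := hb
  exact ⟨i, j, .of_surgeryAt (h.inner s).isArcs (k.inner s).isArcs h1⟩

theorem IsBridgeEdge.inner_ne {s : Side} {h k : DecLink n} (hb : IsBridgeEdge s h k) :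
    h.inner s ≠ k.inner s := by
  obtain ⟨i, j, hs⟩ := hb.exists_surg
  intro e
  exact (hs.moved_iff i).2 (Or.inl rfl) (by rw [e])

theorem isBridgeEdge_set_iff {s : Side} {h k : DecLink n} (p : Fin (2 * n)) :
    (h.sign p = true ∧ IsBridgeEdge s (h.set p false) k) ↔
      (k.sign p = false ∧ IsBridgeEdge s h (k.set p true)) := by
  by_cases hc : h.outer s = k.outer s ∧ ∃ i j, Surg NCMatching.col (h.inner s) (k.inner s) i j
  · obtain ⟨ho, i, j, hs⟩ := hc
    have hi : ∀ p v, (h.set p v).inner s = h.inner s := fun p v => by cases s <;> rfl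
    have hk : ∀ p v, (k.set p v).inner s = k.inner s := fun p v => by cases s <;> rfl
    have hi' : ∀ p v, (h.set p v).outer s = h.outer s := fun p v => by cases s <;> rfl
    have hk' : ∀ p v, (k.set p v).outer s = k.outer s := fun p v => by cases s <;> rfl
    rw [isBridgeEdge_iff (i := i) (j := j) (by rw [hi', ho]) (by rw [hi]; exact hs),
      isBridgeEdge_iff (i := i) (j := j) (by rw [hk', ho]) (by rw [hk]; exact hs), and_or_left,
      and_or_left, JoinStep.set_iff, hi, DecLink.set_neg, DecLink.set_neg]
    refine or_congr Iff.rfl ?_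
    have := JoinStep.set_iff (h := k.neg) (k := h.neg) (i := i) (j := h.inner s i) p
    simp only [DecLink.neg_sign, Bool.not_eq_true', Bool.not_eq_false'] at this
    exact this.symm
  · constructor
    · rintro ⟨-, hb⟩
      refine absurd ⟨?_, ?_⟩ hc
      · have := hb.1
        cases s <;> exact this
      · have := hb.exists_surg
        cases s <;> exact this
    · rintro ⟨-, hb⟩
      refine absurd ⟨?_, ?_⟩ hc
      · have := hb.1
        cases s <;> exact this
      · have := hb.exists_surg
        cases s <;> exact this

end edges

end BorderedKh

namespace BorderedKh

/-! ### Counting paths of edges by matrices -/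

section wsum

variable {X : Type} [Fintype X]

open Classical in
/-- The sum over the classes of `r` of a function that is constant on classes. -/
noncomputable def wsum (r : X → X → Prop) (w : X → ℚ) : ℚ :=
  ∑ p, w p / ((Finset.univ.filter fun q => r p q).card : ℚ)

open Classical in
theorem sum_class {r : X → X → Prop} (hr : Equivalence r) {w : X → ℚ}
    (hw : ∀ p q, r p q → w p = w q) (i : X) :
    ∑ p ∈ Finset.univ.filter (fun q => r i q),
      w p / ((Finset.univ.filter fun q => r p q).card : ℚ) = w i := by
  have h1 : ∀ p ∈ Finset.univ.filter (fun q => r i q),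
      w p / ((Finset.univ.filter fun q => r p q).card : ℚ) =
        w i / ((Finset.univ.filter fun q => r i q).card : ℚ) := by
    intro p hp
    have hp' : r i p := (Finset.mem_filter.1 hp).2
    rw [← hw i p hp']
    have : (Finset.univ.filter fun q => r p q) = Finset.univ.filter fun q => r i q := by
      ext q
      simp only [Finset.mem_filter, Finset.mem_univ, true_and]
      exact ⟨hr.trans hp', hr.trans (hr.symm hp')⟩
    rw [this]
  rw [Finset.sum_congr rfl h1, Finset.sum_const, nsmul_eq_mul]
  have h2 : ((Finset.univ.filter fun q => r i q).card : ℚ) ≠ 0 := by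
    have : 0 < (Finset.univ.filter fun q => r i q).card :=
      Finset.card_pos.2 ⟨i, Finset.mem_filter.2 ⟨Finset.mem_univ _, hr.refl i⟩⟩
    exact_mod_cast this.ne'
  field_simp

theorem wsum_join {r r' : X → X → Prop} (hr : Equivalence r) (hr' : Equivalence r') {i j : X}
    (h : IsJoin r r' i j) {w w' : X → ℚ} (hw : ∀ p q, r p q → w p = w q)
    (hw' : ∀ p q, r' p q → w' p = w' q) (hoff : ∀ k, ¬ r i k → ¬ r j k → w' k = w k) :
    wsum r' w' = wsum r w - w i - w j + w' i := by
  classical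
  have hcl : ∀ q, r' i q ↔ r i q ∨ r j q := by
    intro q
    rw [h.2]
    constructor
    · rintro (h' | ⟨-, h' | h'⟩)
      exacts [Or.inl h', Or.inl (hr.symm h'), Or.inr (hr.symm h')]
    · rintro (h' | h')
      exacts [Or.inl h', Or.inr ⟨Or.inl (hr.refl i), Or.inr (hr.symm h')⟩]
  unfold wsum
  rw [← Finset.sum_filter_add_sum_filter_not Finset.univ (fun q => r' i q),
    sum_class hr' hw',
    ← Finset.sum_filter_add_sum_filter_not (s := Finset.univ) (p := fun q => r' i q)
      (f := fun p => w p / _)]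
  have e1 : Finset.univ.filter (fun q => r' i q) =
      Finset.univ.filter (fun q => r i q) ∪ Finset.univ.filter (fun q => r j q) := by
    ext q
    simp [hcl]
  have e2 : Disjoint (Finset.univ.filter (fun q => r i q))
      (Finset.univ.filter (fun q => r j q)) := by
    rw [Finset.disjoint_filter]
    exact fun q _ h1 h2 => h.1 (hr.trans h1 (hr.symm h2))
  have e3 : ∑ p ∈ Finset.univ.filter (fun q => r' i q),
      w p / ((Finset.univ.filter fun q => r p q).card : ℚ) = w i + w j := by
    rw [e1, Finset.sum_union e2, sum_class hr hw, sum_class hr hw]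
  have e4 : ∑ p ∈ Finset.univ.filter (fun q => ¬ r' i q),
      w' p / ((Finset.univ.filter fun q => r' p q).card : ℚ) =
      ∑ p ∈ Finset.univ.filter (fun q => ¬ r' i q),
      w p / ((Finset.univ.filter fun q => r p q).card : ℚ) := by
    refine Finset.sum_congr rfl fun p hp => ?_
    have hp' : ¬ r' i p := (Finset.mem_filter.1 hp).2
    rw [hcl, not_or] at hp'
    rw [hoff p hp'.1 hp'.2]
    have : (Finset.univ.filter fun q => r' p q) = Finset.univ.filter fun q => r p q := by
      ext q
      simp only [Finset.mem_filter, Finset.mem_univ, true_and, h.2]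
      refine ⟨fun h' => h'.elim id fun h' => ?_, Or.inl⟩
      exact absurd h'.1 (not_or.2 ⟨fun e => hp'.1 (hr.symm e), fun e => hp'.2 (hr.symm e)⟩)
    rw [this]
  rw [e3, e4]
  ring

end wsum

section matrices

variable {n : ℕ}

open Classical in
/-- The matrix of a relation. -/
noncomputable def rm (R : DecLink n → DecLink n → Prop) : Matrix (DecLink n) (DecLink n) ℤ :=
  Matrix.of fun h k => if R h k then 1 else 0

open Classical in
theorem rm_apply (R : DecLink n → DecLink n → Prop) (h k : DecLink n) :
    rm R h k = if R h k then 1 else 0 := rfl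

open Classical in
theorem rm_mul_rm_apply (R R' : DecLink n → DecLink n → Prop) (h k : DecLink n) :
    (rm R * rm R') h k = ((Finset.univ.filter fun l => R h l ∧ R' l k).card : ℤ) := by
  rw [Matrix.mul_apply, Finset.card_filter, Nat.cast_sum]
  refine Finset.sum_congr rfl fun l _ => ?_
  rw [rm_apply, rm_apply]
  by_cases h1 : R h l <;> by_cases h2 : R' l k <;> simp [h1, h2]

open Classical in
theorem rm_ne_zero {R : DecLink n → DecLink n → Prop} {h k : DecLink n} : rm R h k ≠ 0 ↔ R h k := by
  rw [rm_apply]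
  split_ifs with h' <;> simp [h']

theorem ite_ite_congr {A B C D : Prop} {_ : Decidable A} {_ : Decidable B} {_ : Decidable C}
    {_ : Decidable D}
    (h : A ∧ B ↔ C ∧ D) :
    (if A then if B then (1 : ℤ) else 0 else 0) = if C then if D then (1 : ℤ) else 0 else 0 := by
  by_cases a : A <;> by_cases b : B <;> by_cases c : C <;> by_cases d : D <;> simp_all

theorem rm_mul_rm_ne_zero {R R' : DecLink n → DecLink n → Prop} {h k : DecLink n} :
    (rm R * rm R') h k ≠ 0 ↔ ∃ l, R h l ∧ R' l k := by
  classical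
  rw [rm_mul_rm_apply, Nat.cast_ne_zero, Finset.card_ne_zero]
  simp [Finset.Nonempty]

/-- The matrix of the decoration edges at a point. -/
noncomputable def decoMat (p : Fin (2 * n)) : Matrix (DecLink n) (DecLink n) ℤ := rm (DecoAt p)

theorem decoMat_mul_apply (p : Fin (2 * n)) (M : Matrix (DecLink n) (DecLink n) ℤ)
    (h k : DecLink n) :
    (decoMat p * M) h k = if h.sign p = true then M (h.set p false) k else 0 := by
  rw [Matrix.mul_apply, Finset.sum_eq_single (h.set p false)]
  · rw [decoMat, rm_apply]
    by_cases hp : h.sign p = true <;> simp [hp, DecoAt]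
  · intro l _ hl
    rw [decoMat, rm_apply, if_neg (fun h' => hl h'.2), zero_mul]
  · exact fun h' => absurd (Finset.mem_univ _) h'

theorem mul_decoMat_apply (p : Fin (2 * n)) (M : Matrix (DecLink n) (DecLink n) ℤ)
    (h k : DecLink n) :
    (M * decoMat p) h k = if k.sign p = false then M h (k.set p true) else 0 := by
  rw [Matrix.mul_apply, Finset.sum_eq_single (k.set p true)]
  · rw [decoMat, rm_apply, decoAt_iff']
    by_cases hp : k.sign p = false <;> simp [hp]
  · intro l _ hl
    rw [decoMat, rm_apply, decoAt_iff', if_neg (fun h' => hl h'.2), mul_zero]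
  · exact fun h' => absurd (Finset.mem_univ _) h'

theorem decoMat_mul_comm (p q : Fin (2 * n)) :
    decoMat p * decoMat q = decoMat q * decoMat p := by
  ext h k
  rw [decoMat_mul_apply, decoMat_mul_apply, decoMat, decoMat, rm_apply, rm_apply, DecoAt, DecoAt]
  by_cases hpq : h.SameCirc p q
  · rw [h.set_sign_of_sameCirc hpq, h.set_sign_of_sameCirc hpq.symm]
    simp
  · rw [h.set_sign_of_not hpq, h.set_sign_of_not (fun e => hpq e.symm), h.set_comm hpq]
    by_cases h1 : h.sign p = true <;> by_cases h2 : h.sign q = true <;> simp [h1, h2]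

theorem decoMat_congr {h : DecLink n} {p q : Fin (2 * n)} (hpq : h.SameCirc p q)
    (M : Matrix (DecLink n) (DecLink n) ℤ) (k : DecLink n) :
    (decoMat p * M) h k = (decoMat q * M) h k := by
  rw [decoMat_mul_apply, decoMat_mul_apply, h.set_congr hpq, h.sign_eq hpq]

/-- The matrix of all bridge edges on one side. -/
noncomputable def bridgeMat (n : ℕ) (s : Side) : Matrix (DecLink n) (DecLink n) ℤ :=
  rm (IsBridgeEdge s)

theorem decoMat_mul_bridgeMat (p : Fin (2 * n)) (s : Side) :
    decoMat p * bridgeMat n s = bridgeMat n s * decoMat p := by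
  ext h k
  rw [decoMat_mul_apply, mul_decoMat_apply, bridgeMat, rm_apply, rm_apply]
  have := isBridgeEdge_set_iff (s := s) (h := h) (k := k) p
  split_ifs <;> simp_all

/-- The matrix of the bridge edges between given diagrams. -/
noncomputable def moveMat (D D' : NCMatching n × NCMatching n) :
    Matrix (DecLink n) (DecLink n) ℤ :=
  rm fun h k => h.diag = D ∧ k.diag = D' ∧ ∃ s, IsBridgeEdge s h k

theorem decoMat_mul_moveMat (p : Fin (2 * n)) (D D' : NCMatching n × NCMatching n) :
    decoMat p * moveMat D D' = moveMat D D' * decoMat p := by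
  classical
  ext h k
  rw [decoMat_mul_apply, mul_decoMat_apply, moveMat, rm_apply, rm_apply]
  have hh : (h.set p false).diag = h.diag := rfl
  have hk : (k.set p true).diag = k.diag := rfl
  rw [hh, hk]
  have key : (h.sign p = true ∧ ∃ s, IsBridgeEdge s (h.set p false) k) ↔
      (k.sign p = false ∧ ∃ s, IsBridgeEdge s h (k.set p true)) := by
    constructor
    · rintro ⟨h1, s, h2⟩
      exact ⟨((isBridgeEdge_set_iff p).1 ⟨h1, h2⟩).1, s, ((isBridgeEdge_set_iff p).1 ⟨h1, h2⟩).2⟩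
    · rintro ⟨h1, s, h2⟩
      exact ⟨((isBridgeEdge_set_iff p).2 ⟨h1, h2⟩).1, s, ((isBridgeEdge_set_iff p).2 ⟨h1, h2⟩).2⟩
  refine ite_ite_congr ?_
  constructor
  · rintro ⟨h1, h2, h3, h4⟩
    exact ⟨(key.1 ⟨h1, h4⟩).1, h2, h3, (key.1 ⟨h1, h4⟩).2⟩
  · rintro ⟨h1, h2, h3, h4⟩
    exact ⟨(key.2 ⟨h1, h4⟩).1, h2, h3, (key.2 ⟨h1, h4⟩).2⟩

/-- The diagram with all labels plus. -/
@[simps] def plus (D : NCMatching n × NCMatching n) : DecLink n :=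
  ⟨D.1, D.2, fun _ => true, fun _ => rfl, fun _ => rfl⟩

theorem plus_diag (D : NCMatching n × NCMatching n) : (plus D).diag = D := rfl

/-- Matrices that commute with all `decoMat p` are determined by the rows of the diagrams with all
labels plus. -/
theorem ext_of_comm {M M' : Matrix (DecLink n) (DecLink n) ℤ}
    (hM : ∀ p, decoMat p * M = M * decoMat p) (hM' : ∀ p, decoMat p * M' = M' * decoMat p)
    (D : NCMatching n × NCMatching n) (hD : ∀ h k, h.diag ≠ D → M h k = M' h k)
    (hp : ∀ k, M (plus D) k = M' (plus D) k) : M = M' := by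
  classical
  ext h k
  by_cases hh : h.diag = D
  swap
  · exact hD h k hh
  induction hc : (Finset.univ.filter fun q => h.sign q = false).card using
    Nat.strong_induction_on generalizing h k with
  | _ c ih =>
    by_cases hs : ∃ p, h.sign p = false
    · obtain ⟨p, hp'⟩ := hs
      have e1 : h = (h.set p true).set p false := by rw [h.set_set, h.set_eq_self hp']
      have e2 : ∀ N : Matrix (DecLink n) (DecLink n) ℤ, decoMat p * N = N * decoMat p →
          N h k = if k.sign p = false then N (h.set p true) (k.set p true) else 0 := by
        intro N hN
        rw [← mul_decoMat_apply, ← hN, decoMat_mul_apply, if_pos (h.set_sign_self p true), ← e1]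
      rw [e2 M (hM p), e2 M' (hM' p)]
      split_ifs with h1
      · refine ih _ ?_ _ _ hh rfl
        rw [← hc]
        refine Finset.card_lt_card ⟨fun q hq => ?_, fun hq => ?_⟩
        · rw [Finset.mem_filter] at hq ⊢
          refine ⟨hq.1, ?_⟩
          by_cases hpq : h.SameCirc p q
          · rw [← h.sign_eq hpq, hp']
          · have := hq.2
            rwa [h.set_sign_of_not hpq] at this
        · have := hq (Finset.mem_filter.2 ⟨Finset.mem_univ p, hp'⟩)
          rw [Finset.mem_filter, h.set_sign_self] at this
          exact absurd this.2 (by simp)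
      · rfl
    · have : h = plus D := by
        push Not at hs
        exact DecLink.ext_diag hh fun p => by simpa using hs p
      rw [this]
      exact hp k

/-- A surgery of diagrams. -/
def IsMove (s : Side) (D D' : NCMatching n × NCMatching n) (i j : Fin (2 * n)) : Prop :=
  (plus D).outer s = (plus D').outer s ∧
    Surg NCMatching.col ((plus D).inner s) ((plus D').inner s) i j

namespace IsMove

variable {s : Side} {D D' : NCMatching n × NCMatching n} {i j : Fin (2 * n)}

theorem isJoin_or (h : IsMove s D D' i j) :
    IsJoin (plus D).SameCirc (plus D').SameCirc i j ∨
      ((plus D).SameCirc i j ∧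
        IsJoin (plus D').SameCirc (plus D).SameCirc i ((plus D).inner s i)) := by
  have := h.2.isJoin_or ((plus D).outer s).isArcs
  rw [(plus D).sameCircle_outer_inner] at this
  rwa [h.1, (plus D').sameCircle_outer_inner] at this

theorem side_eq (h : IsMove s D D' i j) {s' : Side} {l : DecLink n} (hl : l.diag = D')
    (hb : IsBridgeEdge s' (plus D) l) : s' = s := by
  have e1 : l.inner s = (plus D').inner s := DecLink.inner_of_diag hl s
  have e2 := (h.2.moved_iff i).2 (Or.inl rfl)
  cases s <;> cases s' <;> try rfl
  · exact absurd (by rw [← e1]; exact congrArg (fun a : NCMatching n => a i) hb.1.symm) e2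
  · exact absurd (by rw [← e1]; exact congrArg (fun a : NCMatching n => a i) hb.1.symm) e2

theorem moveMat_plus (h : IsMove s D D' i j) (l : DecLink n) :
    moveMat D D' (plus D) l ≠ 0 ↔ l.diag = D' ∧
      (JoinStep (plus D) l i j ∨ JoinStep l.neg (plus D).neg i ((plus D).inner s i)) := by
  rw [moveMat, rm_ne_zero]
  have e : ∀ l : DecLink n, l.diag = D' → (IsBridgeEdge s (plus D) l ↔
      (JoinStep (plus D) l i j ∨ JoinStep l.neg (plus D).neg i ((plus D).inner s i))) := by
    intro l hl
    refine isBridgeEdge_iff (h.1.trans (DecLink.outer_of_diag (h := plus D') (k := l) hl.symm s)) ?_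
    have : l.inner s = (plus D').inner s := DecLink.inner_of_diag hl s
    rw [this]
    exact h.2
  simp only [plus_diag, true_and]
  refine and_congr_right fun hl => ?_
  rw [← e l hl]
  exact ⟨fun ⟨s', hs'⟩ => h.side_eq hl hs' ▸ hs', fun h' => ⟨s, h'⟩⟩

theorem moveMat_eq_one_of_ne_zero {l k : DecLink n} (h : moveMat D D' l k ≠ 0) :
    moveMat D D' l k = 1 := by
  rw [moveMat, rm_apply] at h ⊢
  split_ifs at h ⊢
  · rfl
  · exact absurd rfl h

theorem stepVal_join (h : IsMove s D D' i j)
    (hj : IsJoin (plus D).SameCirc (plus D').SameCirc i j)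
    (N : Matrix (DecLink n) (DecLink n) ℤ) (k : DecLink n) :
    (moveMat D D' * N) (plus D) k = N (plus D') k := by
  have e : ∀ l, moveMat D D' (plus D) l ≠ 0 ↔ l = plus D' := by
    intro l
    rw [h.moveMat_plus]
    constructor
    · rintro ⟨hl, h1 | h1⟩
      · refine DecLink.ext_diag hl fun p => ?_
        obtain ⟨-, h2, h3⟩ := h1
        rw [plus_sign]
        have hi : l.sign i = true := by simpa using h3
        by_cases hp : (plus D).SameCirc i p
        · rw [← hi]
          exact l.sign_eq (by rw [DecLink.sameCirc_of_diag (hl.trans (plus_diag D').symm)]; exact (hj.le hp).symm)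
        by_cases hp' : (plus D).SameCirc j p
        · rw [← hi]
          refine l.sign_eq ?_
          rw [DecLink.sameCirc_of_diag (hl.trans (plus_diag D').symm)]
          exact ((hj.joined (plus D).sameCirc_equiv).trans (hj.le hp')).symm
        · exact h2 p hp hp'
      · exact absurd (hj.le ((plus D).sameCirc_inner s i)) (by
          have := h1.1.1
          change ¬ l.SameCirc _ _ at this
          rwa [DecLink.sameCirc_of_diag (hl.trans (plus_diag D').symm)] at this)
    · rintro rfl
      exact ⟨rfl, Or.inl ⟨hj, fun _ _ _ => rfl, Or.inl ⟨rfl, rfl⟩⟩⟩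
  rw [Matrix.mul_apply, Finset.sum_eq_single (plus D')]
  · rw [moveMat_eq_one_of_ne_zero ((e _).2 rfl), one_mul]
  · intro l _ hl
    rw [not_not.1 (fun h' => hl ((e l).1 h')), zero_mul]
  · exact fun h' => absurd (Finset.mem_univ _) h'

theorem stepVal_split (h : IsMove s D D' i j)
    (hj : IsJoin (plus D').SameCirc (plus D).SameCirc i ((plus D).inner s i))
    (N : Matrix (DecLink n) (DecLink n) ℤ) (k : DecLink n) :
    (moveMat D D' * N) (plus D) k =
      ((decoMat i + decoMat ((plus D).inner s i)) * N) (plus D') k := by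
  set i' := (plus D).inner s i with hi'
  have hii : ¬ (plus D').SameCirc i i' := hj.1
  have e : ∀ l, moveMat D D' (plus D) l ≠ 0 ↔
      l = (plus D').set i false ∨ l = (plus D').set i' false := by
    intro l
    rw [h.moveMat_plus]
    constructor
    · rintro ⟨hl, h1 | h1⟩
      · refine absurd (h1.1.le ((plus D).sameCirc_inner s i)) ?_
        rwa [DecLink.sameCirc_of_diag (hl.trans (plus_diag D').symm)]
      · obtain ⟨-, h2, h3⟩ := h1
        have hc : l.SameCirc = (plus D').SameCirc :=
          DecLink.sameCirc_of_diag (hl.trans (plus_diag D').symm)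
        have hc' : l.neg.SameCirc = (plus D').SameCirc := hc
        rw [hc'] at h2
        simp only [DecLink.neg_sign, plus_sign] at h2 h3
        have h4 : (l.sign i = false ∧ l.sign i' = true) ∨ (l.sign i = true ∧ l.sign i' = false) := by
          rw [← hi'] at h3
          revert h3
          cases l.sign i <;> cases l.sign i' <;> simp
        have key : ∀ x y, l.sign x = false → l.sign y = true →
            (∀ q, ¬ (plus D').SameCirc x q → ¬ (plus D').SameCirc y q → l.sign q = true) →
            l = (plus D').set x false := by
          intro x y hx hy hoff
          refine DecLink.ext_diag hl fun q => ?_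
          by_cases hq : (plus D').SameCirc x q
          · rw [(plus D').set_sign_of_sameCirc hq, ← hx]
            exact (l.sign_eq (hc ▸ hq)).symm
          · rw [(plus D').set_sign_of_not hq, plus_sign]
            by_cases hq' : (plus D').SameCirc y q
            · rw [← hy]
              exact (l.sign_eq (hc ▸ hq')).symm
            · exact hoff q hq hq'
        have h5 : ∀ q, ¬ (plus D').SameCirc i q → ¬ (plus D').SameCirc i' q → l.sign q = true := by
          intro q hq hq'
          have := h2 q hq hq'
          simpa using this
        rcases h4 with ⟨h4, h4'⟩ | ⟨h4, h4'⟩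
        · exact Or.inl (key i i' h4 h4' h5)
        · exact Or.inr (key i' i h4' h4 fun q hq hq' => h5 q hq' hq)
    · have key : ∀ x, (x = i ∨ x = i') → ((plus D').set x false).diag = D' ∧
          JoinStep ((plus D').set x false).neg (plus D).neg i i' := by
        intro x hx
        refine ⟨rfl, hj, fun q hq hq' => ?_, ?_⟩
        · have : ¬ (plus D').SameCirc x q := by rcases hx with rfl | rfl; exacts [hq, hq']
          rw [DecLink.neg_sign, DecLink.neg_sign, (plus D').set_sign_of_not this]
          rfl
        · simp only [DecLink.neg_sign, plus_sign]
          rcases hx with rfl | rfl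
          · rw [(plus D').set_sign_self, (plus D').set_sign_of_not hii]
            simp
          · rw [(plus D').set_sign_self, (plus D').set_sign_of_not (fun e => hii e.symm)]
            simp
      rintro (rfl | rfl)
      · exact ⟨rfl, Or.inr (key i (Or.inl rfl)).2⟩
      · exact ⟨rfl, Or.inr (key i' (Or.inr rfl)).2⟩
  have hne : (plus D').set i false ≠ (plus D').set i' false := by
    intro e
    have := congrArg (fun h => DecLink.sign h i) e
    change ((plus D').set i false).sign i = ((plus D').set i' false).sign i at this
    rw [(plus D').set_sign_self, (plus D').set_sign_of_not (fun e => hii e.symm), plus_sign] at this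
    cases this
  have hz : ∀ l ∈ Finset.univ, l ∉ ({(plus D').set i false, (plus D').set i' false} : Finset _) →
      moveMat D D' (plus D) l * N l k = 0 := by
    intro l _ hl
    rw [not_not.1 (fun h' : moveMat D D' (plus D) l ≠ 0 => hl (by simpa using (e l).1 h')), zero_mul]
  rw [add_mul, Matrix.add_apply, decoMat_mul_apply, decoMat_mul_apply, plus_sign, plus_sign, if_pos rfl, if_pos rfl,
    Matrix.mul_apply, ← Finset.sum_subset (Finset.subset_univ
      {(plus D').set i false, (plus D').set i' false}) hz, Finset.sum_pair hne,
    moveMat_eq_one_of_ne_zero ((e _).2 (Or.inl rfl)),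
    moveMat_eq_one_of_ne_zero ((e _).2 (Or.inr rfl)), one_mul, one_mul]

/-- The number of circles changes by one. -/
theorem wsum_of_join (hj : IsJoin (plus D).SameCirc (plus D').SameCirc i j) :
    wsum (plus D').SameCirc (fun _ => 1) = wsum (plus D).SameCirc (fun _ => 1) - 1 := by
  rw [wsum_join (plus D).sameCirc_equiv (plus D').sameCirc_equiv hj (w := fun _ => 1)
    (w' := fun _ => 1) (fun _ _ _ => rfl) (fun _ _ _ => rfl) (fun _ _ _ => rfl)]
  ring

/-- The matrix by which the diagram with all labels plus is moved: `1` for a join, and the sum of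
two decorations for a split. -/
theorem exists_stepVal (h : IsMove s D D' i j) :
    (IsJoin (plus D).SameCirc (plus D').SameCirc i j ∧
      wsum (plus D').SameCirc (fun _ => 1) = wsum (plus D).SameCirc (fun _ => 1) - 1 ∧
      ∀ (N : Matrix (DecLink n) (DecLink n) ℤ) (k : DecLink n), (moveMat D D' * N) (plus D) k = ((1 : Matrix (DecLink n) (DecLink n) ℤ) * N) (plus D') k) ∨
    ((plus D).SameCirc i j ∧
      IsJoin (plus D').SameCirc (plus D).SameCirc i ((plus D).inner s i) ∧
      wsum (plus D').SameCirc (fun _ => 1) = wsum (plus D).SameCirc (fun _ => 1) + 1 ∧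
      ∀ (N : Matrix (DecLink n) (DecLink n) ℤ) (k : DecLink n), (moveMat D D' * N) (plus D) k =
        ((decoMat i + decoMat ((plus D).inner s i)) * N) (plus D') k) := by
  rcases h.isJoin_or with hj | ⟨h1, hj⟩
  · exact Or.inl ⟨hj, wsum_of_join hj, fun N k => by rw [h.stepVal_join hj, one_mul]⟩
  · refine Or.inr ⟨h1, hj, ?_, h.stepVal_split hj⟩
    have := wsum_of_join hj
    linarith

end IsMove

theorem two_steps {D₁ D₂ D₃ : NCMatching n × NCMatching n}
    {W W' : Matrix (DecLink n) (DecLink n) ℤ}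
    (h1 : ∀ (N : Matrix (DecLink n) (DecLink n) ℤ) (k : DecLink n), (moveMat D₁ D₂ * N) (plus D₁) k = (W * N) (plus D₂) k)
    (h2 : ∀ (N : Matrix (DecLink n) (DecLink n) ℤ) (k : DecLink n), (moveMat D₂ D₃ * N) (plus D₂) k = (W' * N) (plus D₃) k)
    (hW : W * moveMat D₂ D₃ = moveMat D₂ D₃ * W) (k : DecLink n) :
    (moveMat D₁ D₂ * moveMat D₂ D₃) (plus D₁) k = (W' * W) (plus D₃) k := by
  rw [h1, hW, h2]

theorem decoMat_add_comm (p q : Fin (2 * n)) (D D' : NCMatching n × NCMatching n) :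
    (decoMat p + decoMat q) * moveMat D D' = moveMat D D' * (decoMat p + decoMat q) := by
  rw [add_mul, mul_add, decoMat_mul_moveMat, decoMat_mul_moveMat]

theorem decoMat_row_congr {D : NCMatching n × NCMatching n} {p q p' q' : Fin (2 * n)}
    (h : ((plus D).SameCirc p p' ∧ (plus D).SameCirc q q') ∨
      ((plus D).SameCirc p q' ∧ (plus D).SameCirc q p')) (k : DecLink n) :
    ((decoMat p + decoMat q) : Matrix _ _ ℤ) (plus D) k =
      ((decoMat p' + decoMat q') : Matrix _ _ ℤ) (plus D) k := by
  have e : ∀ {p q}, (plus D).SameCirc p q → decoMat p (plus D) k = decoMat q (plus D) k := by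
    intro p q hpq
    have := decoMat_congr hpq 1 k
    rwa [mul_one, mul_one] at this
  rw [Matrix.add_apply, Matrix.add_apply]
  rcases h with ⟨h1, h2⟩ | ⟨h1, h2⟩
  · rw [e h1, e h2]
  · rw [e h1, e h2, add_comm]

theorem moveMat_mul_comm_decoMat {D₁ D₂ D₃ : NCMatching n × NCMatching n} (p : Fin (2 * n)) :
    decoMat p * (moveMat D₁ D₂ * moveMat D₂ D₃) = moveMat D₁ D₂ * moveMat D₂ D₃ * decoMat p := by
  rw [← mul_assoc, decoMat_mul_moveMat, mul_assoc, decoMat_mul_moveMat, mul_assoc]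

theorem moveMat_mul_eq_zero {D₁ D₂ D₃ : NCMatching n × NCMatching n} {h : DecLink n}
    (hD : h.diag ≠ D₁) (k : DecLink n) : (moveMat D₁ D₂ * moveMat D₂ D₃) h k = 0 := by
  by_contra hc
  obtain ⟨l, h1, -⟩ := rm_mul_rm_ne_zero.1 hc
  exact hD h1.1

/-- Two surgeries performed in either order give the same map. -/
theorem moveMat_square {D₁ D₂ D₂' D₃ : NCMatching n × NCMatching n} {s t : Side}
    {i j j' k l : Fin (2 * n)}
    (γ : IsMove s D₁ D₂ i j) (η' : IsMove t D₂ D₃ k l)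
    (η : IsMove t D₁ D₂' k l) (γ' : IsMove s D₂' D₃ i j')
    (hi : (plus D₂').inner s i = (plus D₁).inner s i)
    (hk : (plus D₂).inner t k = (plus D₁).inner t k) :
    moveMat D₁ D₂ * moveMat D₂ D₃ = moveMat D₁ D₂' * moveMat D₂' D₃ := by
  refine ext_of_comm moveMat_mul_comm_decoMat moveMat_mul_comm_decoMat D₁
    (fun h k hD => by rw [moveMat_mul_eq_zero hD, moveMat_mul_eq_zero hD]) fun x => ?_
  have A := IsMove.exists_stepVal γ
  have B := IsMove.exists_stepVal η'
  have A' := IsMove.exists_stepVal η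
  have B' := IsMove.exists_stepVal γ'
  rw [hk] at B
  rw [hi] at B'
  have c1 : ∀ D D' : NCMatching n × NCMatching n,
      (1 : Matrix (DecLink n) (DecLink n) ℤ) * moveMat D D' = moveMat D D' * 1 := fun D D' => by
    rw [one_mul, mul_one]
  have i2 : (plus D₂).SameCirc k ((plus D₁).inner t k) := hk ▸ (plus D₂).sameCirc_inner t k
  have i2' : (plus D₂').SameCirc i ((plus D₁).inner s i) := hi ▸ (plus D₂').sameCirc_inner s i
  have i1 : (plus D₁).SameCirc i ((plus D₁).inner s i) := (plus D₁).sameCirc_inner s i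
  generalize (plus D₁).inner s i = i' at *
  generalize (plus D₁).inner t k = k' at *
  rcases A with ⟨a1, a2, a3⟩ | ⟨a0, a1, a2, a3⟩ <;> rcases B with ⟨b1, b2, b3⟩ | ⟨b0, b1, b2, b3⟩ <;>
    rcases A' with ⟨a1', a2', a3'⟩ | ⟨a0', a1', a2', a3'⟩ <;>
    rcases B' with ⟨b1', b2', b3'⟩ | ⟨b0', b1', b2', b3'⟩ <;> try (exfalso; linarith)
  · rw [two_steps a3 b3 (c1 _ _), two_steps a3' b3' (c1 _ _)]
  · rw [two_steps a3 b3 (c1 _ _), two_steps a3' b3' (c1 _ _), mul_one, mul_one]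
    refine decoMat_row_congr ?_ x
    have e1 : (plus D₂).SameCirc k i := by
      rcases (a1.2 k l).1 b0 with h | ⟨h | h, -⟩
      · exact absurd h a1'.1
      · exact a1.le h
      · exact (a1.le h).trans (a1.joined (plus D₁).sameCirc_equiv).symm
    have e2 : (plus D₂).SameCirc k i' := e1.trans (a1.le i1)
    have f : ∀ y, (plus D₂).SameCirc k y → (plus D₃).SameCirc k y ∨ (plus D₃).SameCirc k' y := by
      intro y hy
      rcases (b1.2 k y).1 hy with h | ⟨-, h | h⟩
      exacts [Or.inl h, Or.inl h.symm, Or.inr h.symm]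
    rcases f i e1 with h | h <;> rcases f i' e2 with h' | h'
    · exact absurd (h.symm.trans h') b1'.1
    · exact Or.inl ⟨h, h'⟩
    · exact Or.inr ⟨h', h⟩
    · exact absurd (h.symm.trans h') b1'.1
  · rw [two_steps a3 b3 (c1 _ _), two_steps a3' b3' (decoMat_add_comm _ _ _ _), mul_one, one_mul]
  · rw [two_steps a3 b3 (decoMat_add_comm _ _ _ _), two_steps a3' b3' (c1 _ _), mul_one, one_mul]
  · rw [two_steps a3 b3 (decoMat_add_comm _ _ _ _),
      two_steps a3' b3' (decoMat_add_comm _ _ _ _), one_mul, one_mul]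
    refine decoMat_row_congr ?_ x
    have hkl := b1.joined (plus D₂).sameCirc_equiv
    have h3 : (plus D₃).SameCirc k k' := b1.le i2
    rcases (a1.2 k l).1 a0' with h | ⟨h, h'⟩
    · exact absurd h b1.1
    · rcases h with h | h <;> rcases h' with h' | h'
      · exact absurd (h.trans h'.symm) b1.1
      · exact Or.inl ⟨(b1.le h).symm, (b1.le h').symm.trans (hkl.symm.trans h3)⟩
      · exact Or.inr ⟨(b1.le h').symm.trans (hkl.symm.trans h3), (b1.le h).symm⟩
      · exact absurd (h.trans h'.symm) b1.1
  · rw [two_steps a3 b3 (decoMat_add_comm _ _ _ _),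
      two_steps a3' b3' (decoMat_add_comm _ _ _ _)]
    rw [add_mul, mul_add, mul_add, add_mul, mul_add, mul_add, decoMat_mul_comm k i,
      decoMat_mul_comm k i', decoMat_mul_comm k' i, decoMat_mul_comm k' i']
    exact congrArg (fun M : Matrix (DecLink n) (DecLink n) ℤ => M (plus D₃) x) (add_add_add_comm _ _ _ _)

end matrices

end BorderedKh

namespace BorderedKh

/-! ### Degrees -/

section degrees

variable {X : Type} [Fintype X]

theorem wsum_relabel {r : X → X → Prop} (hr : Equivalence r) {w w' : X → ℚ} (i : X)
    (hw : ∀ p q, r p q → w p = w q) (hw' : ∀ p q, r p q → w' p = w' q)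
    (hoff : ∀ k, ¬ r i k → w' k = w k) : wsum r w' = wsum r w - w i + w' i := by
  classical
  unfold wsum
  rw [← Finset.sum_filter_add_sum_filter_not Finset.univ (fun q => r i q), sum_class hr hw',
    ← Finset.sum_filter_add_sum_filter_not (s := Finset.univ) (p := fun q => r i q)
      (f := fun p => w p / _), sum_class hr hw,
    Finset.sum_congr (g := fun p => w p / ((Finset.univ.filter fun q => r p q).card : ℚ)) rfl]
  · ring
  · intro p hp
    rw [hoff p (Finset.mem_filter.1 hp).2]

theorem wsum_sub (r : X → X → Prop) (w w' : X → ℚ) :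
    wsum r (fun p => w p - w' p) = wsum r w - wsum r w' := by
  unfold wsum
  rw [← Finset.sum_sub_distrib]
  exact Finset.sum_congr rfl fun p _ => sub_div _ _ _

variable {n : ℕ}

open Classical in
theorem DecLink.count_eq_wsum (h : DecLink n) (s : Bool) :
    (h.count s : ℚ) = wsum h.SameCirc fun p => if h.sign p = s then 1 else 0 := by
  obtain ⟨mk, hmk, hcount⟩ : ∃ mk : Fin (2 * n) → Circles h.left h.right,
      (∀ p q, mk p = mk q ↔ h.SameCirc p q) ∧
      h.count s = Set.ncard {c | ∃ p, mk p = c ∧ h.sign p = s} :=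
    ⟨fun p => Quotient.mk _ p, fun p q => Quotient.eq, rfl⟩
  have : Finite (Circles h.left h.right) := Quotient.finite _
  have : Fintype (Circles h.left h.right) := Fintype.ofFinite _
  rw [hcount, Set.ncard_eq_toFinset_card', Finset.card_eq_sum_ones, Nat.cast_sum, Nat.cast_one]
  unfold wsum
  rw [← Finset.sum_fiberwise Finset.univ mk]
  refine Finset.sum_subset_zero_on_sdiff (Finset.subset_univ _) (fun c hc => ?_) fun c hc => ?_
  · refine Finset.sum_eq_zero fun p hp => ?_
    beta_reduce
    rw [if_neg, zero_div]
    intro h'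
    exact (Finset.mem_sdiff.1 hc).2 (Set.mem_toFinset.2 ⟨p, (Finset.mem_filter.1 hp).2, h'⟩)
  · rw [Set.mem_toFinset] at hc
    obtain ⟨p, rfl, hp⟩ := hc
    have e : (Finset.univ.filter fun q => mk q = mk p) =
        Finset.univ.filter fun q => h.SameCirc p q := by
      ext q
      rw [Finset.mem_filter, Finset.mem_filter, hmk]
      exact and_congr_right fun _ => ⟨.symm, .symm⟩
    rw [e, sum_class h.sameCirc_equiv fun p q hpq => by rw [h.sign_eq hpq], if_pos hp]

/-- The label of a point as a number. -/
def DecLink.wt (h : DecLink n) (p : Fin (2 * n)) : ℚ := if h.sign p then 1 else -1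

theorem DecLink.wt_eq (h : DecLink n) {p q : Fin (2 * n)} (hpq : h.SameCirc p q) :
    h.wt p = h.wt q := by
  unfold DecLink.wt
  rw [h.sign_eq hpq]

theorem DecLink.deg_eq_wsum (h : DecLink n) : (h.deg : ℚ) = n - wsum h.SameCirc h.wt := by
  classical
  unfold DecLink.deg
  push_cast
  rw [h.count_eq_wsum, h.count_eq_wsum]
  have : h.wt = fun p => (if h.sign p = true then (1 : ℚ) else 0) -
      if h.sign p = false then 1 else 0 := by
    ext p
    unfold DecLink.wt
    cases h.sign p <;> simp
  rw [this, wsum_sub]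
  ring

theorem DecoAt.deg_eq {p : Fin (2 * n)} {h k : DecLink n} (hd : DecoAt p h k) :
    k.deg = h.deg + 2 := by
  have hc := DecLink.sameCirc_of_diag hd.diag
  have h1 := wsum_relabel h.sameCirc_equiv p (w := h.wt) (w' := k.wt) (fun _ _ => h.wt_eq)
    (fun _ _ h' => k.wt_eq (hc ▸ h')) fun q hq => by
      unfold DecLink.wt
      rw [not_not.1 (mt hd.sign_ne_iff.1 hq)]
  have h2 : (k.deg : ℚ) = h.deg + 2 := by
    rw [k.deg_eq_wsum, h.deg_eq_wsum, ← hc, h1]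
    have e1 := hd.1
    have e2 : k.sign p = false := (decoAt_iff'.1 hd).1
    simp only [DecLink.wt, e1, e2]
    norm_num
    ring
  exact_mod_cast h2

theorem IsDecoEdge.deg_eq {h k : DecLink n} (hd : IsDecoEdge h k) : k.deg = h.deg + 2 := by
  obtain ⟨p, hp⟩ := isDecoEdge_iff.1 hd
  exact hp.deg_eq

theorem JoinStep.wsum_eq {h k : DecLink n} {i j : Fin (2 * n)} (hs : JoinStep h k i j) :
    wsum k.SameCirc k.wt = wsum h.SameCirc h.wt - 1 := by
  obtain ⟨h1, h2, h3⟩ := hs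
  rw [wsum_join h.sameCirc_equiv k.sameCirc_equiv h1 (w := h.wt) (w' := k.wt) (fun _ _ => h.wt_eq)
    (fun _ _ => k.wt_eq) fun q hq hq' => by unfold DecLink.wt; rw [h2 q hq hq']]
  unfold DecLink.wt
  revert h3
  cases h.sign i <;> cases h.sign j <;> cases k.sign i <;> simp <;> ring

theorem DecLink.wsum_neg (h : DecLink n) : wsum h.neg.SameCirc h.neg.wt = - wsum h.SameCirc h.wt := by
  unfold wsum
  rw [← Finset.sum_neg_distrib]
  refine Finset.sum_congr rfl fun p _ => ?_
  rw [← neg_div]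
  congr 1
  unfold DecLink.wt
  rw [DecLink.neg_sign]
  cases h.sign p <;> simp

theorem IsBridgeEdge.deg_eq {s : Side} {h k : DecLink n} (hb : IsBridgeEdge s h k) :
    k.deg = h.deg + 1 := by
  obtain ⟨i, j, hs⟩ := hb.exists_surg
  have h2 : (k.deg : ℚ) = h.deg + 1 := by
    rw [k.deg_eq_wsum, h.deg_eq_wsum]
    rcases (isBridgeEdge_iff hb.1 hs).1 hb with h1 | h1
    · rw [h1.wsum_eq]
      ring
    · have := h1.wsum_eq
      rw [DecLink.wsum_neg, DecLink.wsum_neg] at this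
      linarith
  exact_mod_cast h2

theorem IsBridgeEdge.not_deco {s : Side} {h k : DecLink n} (hb : IsBridgeEdge s h k) :
    ¬ IsDecoEdge h k := by
  intro hd
  have := hb.deg_eq
  have := hd.deg_eq
  omega

end degrees

/-! ### Counting pairs of bridges -/

section pairs

variable {n : ℕ}

theorem card_filter_congr {X : Type} [Fintype X] {p q : X → Prop} {_ : DecidablePred p}
    {_ : DecidablePred q} (h : ∀ x, p x ↔ q x) :
    (Finset.univ.filter p).card = (Finset.univ.filter q).card :=
  congrArg Finset.card (by ext x; simp [h])

open Classical in
/-- The labellings between two bridges in the half-plane `s`, with the matching `a` in between. -/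
noncomputable def mids (s : Side) (a : NCMatching n) (h₁ h₃ : DecLink n) : Finset (DecLink n) :=
  Finset.univ.filter fun h => h.inner s = a ∧ IsBridgeEdge s h₁ h ∧ IsBridgeEdge s h h₃

theorem mem_mids {s : Side} {a : NCMatching n} {h₁ h₃ h : DecLink n} :
    h ∈ mids s a h₁ h₃ ↔ h.inner s = a ∧ IsBridgeEdge s h₁ h ∧ IsBridgeEdge s h h₃ := by
  simp [mids]

/-- The diagram with given matchings in the half-plane `s` and in the other one. -/
def mkDiag (s : Side) (o a : NCMatching n) : NCMatching n × NCMatching n :=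
  match s with
  | .left => (a, o)
  | .right => (o, a)

theorem mkDiag_inner (s : Side) (o a : NCMatching n) : (plus (mkDiag s o a)).inner s = a := by
  cases s <;> rfl

theorem mkDiag_outer (s : Side) (o a : NCMatching n) : (plus (mkDiag s o a)).outer s = o := by
  cases s <;> rfl

theorem diag_eq_mkDiag (s : Side) (h : DecLink n) : h.diag = mkDiag s (h.outer s) (h.inner s) := by
  cases s <;> rfl

theorem diag_eq_mkDiag_iff {s : Side} {h : DecLink n} {o a : NCMatching n} :
    h.diag = mkDiag s o a ↔ h.outer s = o ∧ h.inner s = a := by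
  constructor
  · intro e
    rw [← plus_diag (mkDiag s o a)] at e
    exact ⟨(DecLink.outer_of_diag e s).trans (mkDiag_outer s o a),
      (DecLink.inner_of_diag e s).trans (mkDiag_inner s o a)⟩
  · rintro ⟨rfl, rfl⟩
    exact diag_eq_mkDiag s h

theorem isMove_mkDiag {s : Side} {o a a' : NCMatching n} {i j : Fin (2 * n)} :
    IsMove s (mkDiag s o a) (mkDiag s o a') i j ↔ Surg NCMatching.col a a' i j := by
  unfold IsMove
  rw [mkDiag_outer, mkDiag_outer, mkDiag_inner, mkDiag_inner]
  exact and_iff_right rfl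

theorem diag_mid {s : Side} {h k : DecLink n} (hb : IsBridgeEdge s h k) :
    k.diag = mkDiag s (h.outer s) (k.inner s) := diag_eq_mkDiag_iff.2 ⟨hb.1.symm, rfl⟩

/-- Equal numbers of labellings between two pairs of bridges in one half-plane that are obtained
from each other by changing the order. -/
theorem card_mid_eq {s : Side} {h₁ h₃ : DecLink n} {a a' : NCMatching n} (ho : h₁.outer s = h₃.outer s)
    {i j k l j' : Fin (2 * n)}
    (γ : Surg NCMatching.col (h₁.inner s) a i j) (η' : Surg NCMatching.col a (h₃.inner s) k l)
    (η : Surg NCMatching.col (h₁.inner s) a' k l)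
    (γ' : Surg NCMatching.col a' (h₃.inner s) i j')
    (hi : a' i = h₁.inner s i) (hk : a k = h₁.inner s k) :
    (mids s a h₁ h₃).card = (mids s a' h₁ h₃).card := by
  classical
  have key : ∀ b : NCMatching n,
      ((mids s b h₁ h₃).card : ℤ) =
      (moveMat (mkDiag s (h₁.outer s) (h₁.inner s)) (mkDiag s (h₁.outer s) b) *
        moveMat (mkDiag s (h₁.outer s) b) (mkDiag s (h₁.outer s) (h₃.inner s))) h₁ h₃ := by
    intro b
    unfold moveMat
    rw [rm_mul_rm_apply]
    refine congrArg _ (card_filter_congr fun h => ?_)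
    constructor
    · rintro ⟨rfl, h1, h2⟩
      have e := diag_mid h1
      exact ⟨⟨diag_eq_mkDiag s h₁, e, s, h1⟩, e, ho ▸ diag_eq_mkDiag s h₃, s, h2⟩
    · rintro ⟨⟨h1, h2, t, h3⟩, -, h4, t', h5⟩
      obtain ⟨e1, e2⟩ := diag_eq_mkDiag_iff.1 h2
      obtain ⟨e3, e4⟩ := diag_eq_mkDiag_iff.1 h4
      have f1 := h3.inner_ne
      have f2 := h3.1
      have f3 := h5.inner_ne
      have f4 := h5.1
      refine ⟨e2, ?_, ?_⟩
      · cases s <;> cases t <;> first | exact h3 | exact absurd e1.symm f1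
      · cases s <;> cases t' <;> first | exact h5 | exact absurd (e1.trans ho) f3
  have := moveMat_square ((isMove_mkDiag (s := s) (o := h₁.outer s)).2 γ) (isMove_mkDiag.2 η')
    (isMove_mkDiag.2 η) (isMove_mkDiag.2 γ')
    (by rw [mkDiag_inner, mkDiag_inner, hi]) (by rw [mkDiag_inner, mkDiag_inner, hk])
  exact_mod_cast (key a).trans ((congrFun (congrFun this h₁) h₃).trans (key a').symm)

theorem bridgeMat_mul_apply (s t : Side) (hst : s ≠ t) (h₁ h₃ : DecLink n) :
    (bridgeMat n s * bridgeMat n t) h₁ h₃ =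
      (moveMat h₁.diag (mkDiag s (h₁.outer s) (h₃.inner s)) *
        moveMat (mkDiag s (h₁.outer s) (h₃.inner s)) h₃.diag) h₁ h₃ := by
  classical
  unfold moveMat bridgeMat
  rw [rm_mul_rm_apply, rm_mul_rm_apply]
  refine congrArg _ (card_filter_congr fun h => ?_)
  have hts : ∀ k k' : DecLink n, k.outer t = k'.outer t ↔ k.inner s = k'.inner s := by
    intro k k'
    cases s <;> cases t <;> first | exact absurd rfl hst | exact Iff.rfl
  constructor
  · rintro ⟨h1, h2⟩
    have e : h.diag = mkDiag s (h₁.outer s) (h₃.inner s) :=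
      diag_eq_mkDiag_iff.2 ⟨h1.1.symm, (hts _ _).1 h2.1⟩
    exact ⟨⟨rfl, e, s, h1⟩, e, rfl, t, h2⟩
  · rintro ⟨⟨-, h2, s', h3⟩, -, -, t', h5⟩
    obtain ⟨e1, e2⟩ := diag_eq_mkDiag_iff.1 h2
    have f1 := h3.inner_ne
    have f2 := h5.inner_ne
    have e3 := (hts h h₃).2 e2
    constructor
    · cases s <;> cases s' <;> first | exact h3 | exact absurd e1.symm f1
    · cases t <;> cases t' <;> first | exact h5 | exact absurd e3 f2

/-- Bridges in different half-planes commute. -/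
theorem bridgeMat_comm : bridgeMat n .right * bridgeMat n .left =
    bridgeMat n .left * bridgeMat n .right := by
  ext h₁ h₃
  rw [bridgeMat_mul_apply _ _ (by simp), bridgeMat_mul_apply _ _ (by simp)]
  by_cases hc : (∃ i j, Surg NCMatching.col h₁.right h₃.right i j) ∧
      ∃ k l, Surg NCMatching.col h₁.left h₃.left k l
  · obtain ⟨⟨i, j, h1⟩, k, l, h2⟩ := hc
    have e := moveMat_square (n := n) (s := .right) (t := .left) (D₁ := h₁.diag) (D₃ := h₃.diag)
      (D₂ := mkDiag .right (h₁.outer .right) (h₃.inner .right))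
      (D₂' := mkDiag .left (h₁.outer .left) (h₃.inner .left)) (i := i) (j := j) (j' := j)
      (k := k) (l := l) ⟨rfl, h1⟩ ⟨rfl, h2⟩ ⟨rfl, h2⟩ ⟨rfl, h1⟩ rfl rfl
    exact congrFun (congrFun e h₁) h₃
  · have key : ∀ s t : Side, s ≠ t → (moveMat h₁.diag (mkDiag s (h₁.outer s) (h₃.inner s)) *
        moveMat (mkDiag s (h₁.outer s) (h₃.inner s)) h₃.diag) h₁ h₃ = 0 := by
      intro s t hst
      by_contra hz
      rw [← bridgeMat_mul_apply s t hst] at hz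
      obtain ⟨h, h1, h2⟩ := rm_mul_rm_ne_zero.1 hz
      obtain ⟨i, j, e1⟩ := h1.exists_surg
      obtain ⟨k, l, e2⟩ := h2.exists_surg
      have e3 := h1.1
      have e4 := h2.1
      cases s <;> cases t <;> first | exact absurd rfl hst | skip
      · refine hc ⟨⟨k, l, ?_⟩, i, j, ?_⟩
        · have : h₁.right = h.right := e3
          rw [this]; exact e2
        · have : h.left = h₃.left := e4
          rw [← this]; exact e1
      · refine hc ⟨⟨i, j, ?_⟩, k, l, ?_⟩
        · have : h.right = h₃.right := e4
          rw [← this]; exact e1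
        · have : h₁.left = h.left := e3
          rw [this]; exact e2
    rw [key _ _ (by simp : Side.right ≠ Side.left), key _ _ (by simp : Side.left ≠ Side.right)]

open Classical in
/-- The rows of a diagram. -/
noncomputable def restrictRow (D : NCMatching n × NCMatching n)
    (M : Matrix (DecLink n) (DecLink n) ℤ) : Matrix (DecLink n) (DecLink n) ℤ :=
  Matrix.of fun h k => if h.diag = D then M h k else 0

theorem restrictRow_comm {D : NCMatching n × NCMatching n} {M : Matrix (DecLink n) (DecLink n) ℤ}
    {p : Fin (2 * n)} (h : decoMat p * M = M * decoMat p) :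
    decoMat p * restrictRow D M = restrictRow D M * decoMat p := by
  classical
  ext x y
  have := congrFun (congrFun h x) y
  rw [decoMat_mul_apply, mul_decoMat_apply] at this ⊢
  simp only [restrictRow, Matrix.of_apply]
  have e : (x.set p false).diag = x.diag := rfl
  rw [e]
  by_cases hx : x.diag = D
  · simp only [if_pos hx]
    exact this
  · simp only [if_neg hx, ite_self]

theorem exists_moveMat_dual {s : Side} {D₁ D₂ : NCMatching n × NCMatching n} {i j : Fin (2 * n)}
    (γ : IsMove s D₁ D₂ i j) :
    ∃ p q, moveMat D₁ D₂ * moveMat D₂ D₁ = restrictRow D₁ (decoMat p + decoMat q) := by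
  have γ' : IsMove s D₂ D₁ i ((plus D₁).inner s i) := ⟨γ.1.symm, γ.2.reverse⟩
  have c1 : ∀ D D' : NCMatching n × NCMatching n,
      (1 : Matrix (DecLink n) (DecLink n) ℤ) * moveMat D D' = moveMat D D' * 1 := fun D D' => by
    rw [one_mul, mul_one]
  suffices h : ∃ p q, ∀ k, (moveMat D₁ D₂ * moveMat D₂ D₁) (plus D₁) k =
      ((decoMat p + decoMat q) : Matrix (DecLink n) (DecLink n) ℤ) (plus D₁) k by
    obtain ⟨p, q, h⟩ := h
    refine ⟨p, q, ext_of_comm moveMat_mul_comm_decoMat (fun x => restrictRow_comm ?_) D₁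
      (fun h k hD => ?_) fun k => ?_⟩
    · rw [mul_add, add_mul, decoMat_mul_comm x p, decoMat_mul_comm x q]
    · rw [moveMat_mul_eq_zero hD, restrictRow, Matrix.of_apply, if_neg hD]
    · rw [h k, restrictRow, Matrix.of_apply, if_pos (plus_diag D₁)]
  rcases IsMove.exists_stepVal γ with ⟨a1, a2, a3⟩ | ⟨a0, a1, a2, a3⟩ <;>
    rcases IsMove.exists_stepVal γ' with ⟨b1, b2, b3⟩ | ⟨b0, b1, b2, b3⟩ <;>
    try (exfalso; linarith)
  · exact ⟨_, _, fun k => by rw [two_steps a3 b3 (c1 _ _), mul_one]⟩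
  · exact ⟨_, _, fun k => by rw [two_steps a3 b3 (decoMat_add_comm _ _ _ _), one_mul]⟩

/-- A bridge followed by the dual bridge changes one label. -/
theorem isDecoEdge_of_dual {s : Side} {h₁ h₂ h₃ : DecLink n} (hb : IsBridgeEdge s h₁ h₂)
    (hb' : IsBridgeEdge s h₂ h₃) (he : h₁.inner s = h₃.inner s) : IsDecoEdge h₁ h₃ := by
  classical
  obtain ⟨i, j, hs⟩ := hb.exists_surg
  have hd : h₁.diag = h₃.diag := DecLink.diag_ext s he (hb.1.trans hb'.1)
  have hm : IsMove s h₁.diag h₂.diag i j := by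
    have e1 : (plus h₁.diag).inner s = h₁.inner s := DecLink.inner_of_diag (plus_diag _) s
    have e2 : (plus h₂.diag).inner s = h₂.inner s := DecLink.inner_of_diag (plus_diag _) s
    have e3 : (plus h₁.diag).outer s = h₁.outer s := DecLink.outer_of_diag (plus_diag _) s
    have e4 : (plus h₂.diag).outer s = h₂.outer s := DecLink.outer_of_diag (plus_diag _) s
    refine ⟨?_, ?_⟩
    · rw [e3, e4]; exact hb.1
    · rw [e1, e2]; exact hs
  obtain ⟨p, q, hpq⟩ := exists_moveMat_dual hm
  have hne : (moveMat h₁.diag h₂.diag * moveMat h₂.diag h₁.diag) h₁ h₃ ≠ 0 :=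
    rm_mul_rm_ne_zero.2 ⟨h₂, ⟨rfl, rfl, s, hb⟩, rfl, hd.symm, s, hb'⟩
  rw [hpq, restrictRow, Matrix.of_apply, if_pos rfl, Matrix.add_apply] at hne
  rw [isDecoEdge_iff]
  by_cases hp : decoMat p h₁ h₃ = 0
  · rw [hp, zero_add] at hne
    exact ⟨q, rm_ne_zero.1 hne⟩
  · exact ⟨p, rm_ne_zero.1 hp⟩

theorem JoinStep.ext {h k k' : DecLink n} {i j : Fin (2 * n)} (hs : JoinStep h k i j)
    (hs' : JoinStep h k' i j) (hd : k.diag = k'.diag) : k = k' := by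
  refine DecLink.ext_diag hd fun p => ?_
  have hi : k.sign i = k'.sign i := by
    have h1 := hs.2.2
    have h2 := hs'.2.2
    revert h1 h2
    cases h.sign i <;> cases h.sign j <;> cases k.sign i <;> cases k'.sign i <;> simp
  have hc := DecLink.sameCirc_of_diag hd
  have hj := hs.1.joined h.sameCirc_equiv
  by_cases hp : h.SameCirc i p
  · rw [← k.sign_eq (hs.1.le hp), ← k'.sign_eq (hs'.1.le hp), hi]
  by_cases hp' : h.SameCirc j p
  · rw [← k.sign_eq (hj.trans (hs.1.le hp')),
      ← k'.sign_eq ((hs'.1.joined h.sameCirc_equiv).trans (hs'.1.le hp')), hi]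
  · rw [hs.2.1 p hp hp', hs'.2.1 p hp hp']

/-- If there are two labellings between two bridges in one half-plane, the first one splits a circle
labelled plus and the second one joins the two new circles to a circle labelled minus. -/
theorem exists_of_two_mids {s : Side} {h₁ h₂ h₂' h₃ : DecLink n} (x : IsBridgeEdge s h₁ h₂)
    (y : IsBridgeEdge s h₂ h₃) (x' : IsBridgeEdge s h₁ h₂') (y' : IsBridgeEdge s h₂' h₃)
    (he : h₂.inner s = h₂'.inner s) (hne : h₂ ≠ h₂') :
    ∃ i j k l, SurgeryAt (h₁.inner s) (h₂.inner s) i j ∧ h₁.SameCirc i j ∧ h₁.sign i = true ∧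
      SurgeryAt (h₂.inner s) (h₃.inner s) k l ∧ h₂.SameCirc k i ∧ h₂.SameCirc l (h₁.inner s i) ∧
      ¬ h₂.SameCirc k l ∧ h₃.sign k = false := by
  have hd : h₂.diag = h₂'.diag := DecLink.diag_ext s he (x.1.symm.trans x'.1)
  have hc := DecLink.sameCirc_of_diag hd
  obtain ⟨i, j, hs⟩ := x.exists_surg
  obtain ⟨k, l, ht⟩ := y.exists_surg
  have hs' := hs
  have ht' := ht
  rw [he] at hs' ht'
  have ho := x.1
  rw [isBridgeEdge_iff x.1 hs] at x
  rw [isBridgeEdge_iff x'.1 hs'] at x'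
  rw [isBridgeEdge_iff y.1 ht] at y
  rw [isBridgeEdge_iff y'.1 ht', ← he] at y'
  rcases x with x | x
  · rcases x' with x' | x'
    · exact absurd (x.ext x' hd) hne
    · refine absurd (x.1.le (h₁.sameCirc_inner s i)) ?_
      rw [hc]
      exact x'.1.1
  have hns : ∀ q, h₂.SameCirc i q → ¬ h₂.SameCirc (h₁.inner s i) q :=
    fun q h1 h2 => x.1.1 (h1.trans h2.symm)
  replace x' : JoinStep h₂'.neg h₁.neg i (h₁.inner s i) := by
    rcases x' with x' | x'
    · refine absurd (x'.1.le (h₁.sameCirc_inner s i)) ?_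
      rw [← hc]
      exact x.1.1
    · exact x'
  have hnd : h₂.neg.diag = h₂'.neg.diag := hd
  have hy : ¬ ∃ y0 y0', JoinStep h₃.neg h₂.neg y0 y0' ∧ JoinStep h₃.neg h₂'.neg y0 y0' := by
    rintro ⟨y0, y0', h1, h2⟩
    have := h1.ext h2 hnd
    exact hne (by rw [← h₂.neg_neg, this, h₂'.neg_neg])
  have hys : ¬ JoinStep h₃.neg h₂.neg k (h₂.inner s k) := by
    intro h1
    rcases y' with y' | y'
    · refine h1.1.1 ?_
      exact y'.1.le ((hc ▸ h₂.sameCirc_inner s k))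
    · exact hy ⟨_, _, h1, y'⟩
  replace y := y.resolve_right hys
  replace y' : JoinStep h₂' h₃ k l := by
    rcases y' with y' | y'
    · exact y'
    · exact absurd (y.1.le (h₂.sameCirc_inner s k)) y'.1.1
  have hij : h₁.SameCirc i j := by
    rcases hs.isJoin_or (h₁.outer s).isArcs with h | h
    · rw [h₁.sameCircle_outer_inner, ho, h₂.sameCircle_outer_inner] at h
      exact absurd (h.le (h₁.sameCirc_inner s i)) x.1.1
    · rw [h₁.sameCircle_outer_inner] at h
      exact h.1
  obtain ⟨i', hii⟩ : ∃ i', h₁.inner s i = i' := ⟨_, rfl⟩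
  rw [hii] at x x' hns
  have hi' : h₂.sign i ≠ h₂'.sign i := by
    intro e
    have e' : h₂.sign i' = h₂'.sign i' := by
      have h1 := x.2.2
      have h2 := x'.2.2
      simp only [DecLink.neg_sign] at h1 h2
      revert h1 h2 e
      cases h₂.sign i <;> cases h₂.sign i' <;> cases h₂'.sign i <;> cases h₂'.sign i' <;>
        cases h₁.sign i <;> simp
    refine hne (DecLink.ext_diag hd fun p => ?_)
    by_cases hp : h₂.SameCirc i p
    · rw [← h₂.sign_eq hp, ← h₂'.sign_eq (hc ▸ hp), e]
    by_cases hp' : h₂.SameCirc i' p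
    · rw [← h₂.sign_eq hp', ← h₂'.sign_eq (hc ▸ hp'), e']
    · have h1 := x.2.1 p hp hp'
      have h2 := x'.2.1 p (hc ▸ hp) (hc ▸ hp')
      simp only [DecLink.neg_sign] at h1 h2
      rw [← Bool.not_inj h1, ← Bool.not_inj h2]
  have hs1 : h₁.sign i = true ∧ h₂.sign i ≠ h₂.sign i' ∧ h₂.sign i' ≠ h₂'.sign i' := by
    have h1 := x.2.2
    have h2 := x'.2.2
    simp only [DecLink.neg_sign] at h1 h2
    revert h1 h2 hi'
    cases h₂.sign i <;> cases h₂.sign i' <;> cases h₂'.sign i <;> cases h₂'.sign i' <;>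
      cases h₁.sign i <;> simp
  obtain ⟨hs1, hs2, hs3⟩ := hs1
  have hkl : ∀ p, h₂.sign p ≠ h₂'.sign p → h₂.SameCirc k p ∨ h₂.SameCirc l p := by
    intro p hp
    by_contra hcon
    rw [not_or] at hcon
    refine hp ?_
    rw [← y.2.1 p hcon.1 hcon.2]
    rw [hc] at hcon
    exact y'.2.1 p hcon.1 hcon.2
  have hi1 : ¬ h₂.SameCirc i i' := fun h => hs2 (h₂.sign_eq h)
  have hm : h₂.sign k ≠ h₂.sign l → h₃.sign k = false := by
    have h1 := y.2.2
    revert h1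
    cases h₂.sign k <;> cases h₂.sign l <;> cases h₃.sign k <;> simp
  rcases hkl i hi' with h | h <;> rcases hkl i' hs3 with h' | h'
  · exact absurd (h.symm.trans h') hi1
  · exact ⟨i, j, k, l, hs.surgeryAt, hij, hs1, ht.surgeryAt, h, by rwa [hii], y.1.1,
      hm (by rw [h₂.sign_eq h, h₂.sign_eq h']; exact hs2)⟩
  · refine ⟨i, j, l, k, hs.surgeryAt, hij, hs1, ht.symm.surgeryAt, h, by rwa [hii], fun e => y.1.1 e.symm, ?_⟩
    rw [← h₃.sign_eq (y.1.joined h₂.sameCirc_equiv)]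
    exact hm (by rw [h₂.sign_eq h, h₂.sign_eq h']; exact hs2.symm)
  · exact absurd (h.symm.trans h') hi1

end pairs

end BorderedKh

namespace BorderedKh

/-! ### A decoration and a bridge -/

section decoBridge

variable {n : ℕ}

theorem IsJoin.class_cases {X : Type} {r r' : X → X → Prop} (hr : Equivalence r)
    (hr' : Equivalence r') {i j : X} (h : IsJoin r r' i j) {P : X → Prop}
    (hP : ∀ p q, P p → P q → r' p q) (hP' : ∀ p q, P p → r' p q → P q) {p : X} (hp : P p) :
    ((∀ q, P q ↔ r p q) ∧ (∀ q, P q ↔ r' p q) ∧ ¬ r i p ∧ ¬ r j p) ∨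
      ((∀ q, P q ↔ r i q ∨ r j q) ∧ ∀ q, P q ↔ r' i q) := by
  have h1 : ∀ q, P q ↔ r' p q := fun q => ⟨hP p q hp, hP' p q hp⟩
  have hij := h.joined hr
  by_cases hpi : r' i p
  · refine Or.inr ⟨fun q => ?_, fun q => ⟨fun hq => hr'.trans hpi ((h1 q).1 hq),
      fun hq => (h1 q).2 (hr'.trans (hr'.symm hpi) hq)⟩⟩
    constructor
    · intro hq
      rcases (h.2 i q).1 (hr'.trans hpi ((h1 q).1 hq)) with e | ⟨-, e | e⟩
      exacts [Or.inl e, Or.inl (hr.symm e), Or.inr (hr.symm e)]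
    · rintro (hq | hq)
      · exact (h1 q).2 (hr'.trans (hr'.symm hpi) (h.le hq))
      · exact (h1 q).2 (hr'.trans (hr'.symm hpi) (hr'.trans hij (h.le hq)))
  · have h2 : ¬ r i p := fun e => hpi (h.le e)
    have h3 : ¬ r j p := fun e => hpi (hr'.trans hij (h.le e))
    refine Or.inl ⟨fun q => ?_, h1, h2, h3⟩
    rw [h1, h.2]
    refine ⟨fun e => e.resolve_right fun e' => ?_, Or.inl⟩
    exact e'.1.elim (fun e => h2 (hr.symm e)) fun e => h3 (hr.symm e)

theorem JoinStep.single {h k : DecLink n} {i j p q : Fin (2 * n)} (hp1 : h.sign p = true)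
    (hp : JoinStep (h.set p false) k i j) (hq1 : h.sign q = true)
    (hq : JoinStep (h.set q false) k i j) : k.SameCirc p q := by
  have key : ∀ p q, h.sign p = true → JoinStep (h.set p false) k i j → h.sign q = true →
      JoinStep (h.set q false) k i j → ¬ k.SameCirc i p → k.SameCirc p q := by
    intro p q hp1 hp hq1 hq hip
    have hj : IsJoin h.SameCirc k.SameCirc i j := hp.1
    by_contra hpq
    have e1 := hq.2.1 p (fun e => hip (hj.le e))
      (fun e => hip ((hj.joined h.sameCirc_equiv).trans (hj.le e)))
    rw [h.set_sign_of_not (fun e => hpq (hj.le e).symm), hp1,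
      ((JoinStep.set_iff p).1 ⟨hp1, hp⟩).1] at e1
    cases e1
  by_cases hip : k.SameCirc i p
  · by_cases hiq : k.SameCirc i q
    · exact hip.symm.trans hiq
    · exact (key q p hq1 hq hp1 hp hiq).symm
  · exact key p q hp1 hp hq1 hq hip

/-- The points whose circle can be changed before or after a bridge from the diagram of `h` to the
diagram of `k`. -/
def DecoBridge (t : Side) (h k : DecLink n) (p : Fin (2 * n)) : Prop :=
  h.sign p = true ∧ IsBridgeEdge t (h.set p false) k

theorem decoBridge_iff {t : Side} {h k : DecLink n} {p : Fin (2 * n)} :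
    DecoBridge t h k p ↔ k.sign p = false ∧ IsBridgeEdge t h (k.set p true) :=
  isBridgeEdge_set_iff p

theorem exists_decoBridge_left {t : Side} {h k w : DecLink n} :
    (IsDecoEdge h w ∧ IsBridgeEdge t w k) ↔ ∃ p, DecoBridge t h k p ∧ w = h.set p false := by
  rw [isDecoEdge_iff]
  constructor
  · rintro ⟨⟨p, h1, rfl⟩, h2⟩
    exact ⟨p, ⟨h1, h2⟩, rfl⟩
  · rintro ⟨p, ⟨h1, h2⟩, rfl⟩
    exact ⟨⟨p, h1, rfl⟩, h2⟩

theorem exists_decoBridge_right {t : Side} {h k u : DecLink n} :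
    (IsBridgeEdge t h u ∧ IsDecoEdge u k) ↔ ∃ p, DecoBridge t h k p ∧ u = k.set p true := by
  rw [isDecoEdge_iff]
  simp only [decoBridge_iff]
  constructor
  · rintro ⟨h2, ⟨p, h1⟩⟩
    rw [decoAt_iff'] at h1
    obtain ⟨h1, rfl⟩ := h1
    exact ⟨p, ⟨h1, h2⟩, rfl⟩
  · rintro ⟨p, ⟨h1, h2⟩, rfl⟩
    exact ⟨h2, ⟨p, decoAt_iff'.2 ⟨h1, rfl⟩⟩⟩

theorem DecoBridge.congr_left {t : Side} {h k : DecLink n} {p q : Fin (2 * n)}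
    (hp : DecoBridge t h k p) (hpq : h.SameCirc p q) : DecoBridge t h k q := by
  unfold DecoBridge at hp ⊢
  rwa [← h.sign_eq hpq, ← h.set_congr hpq]

theorem DecoBridge.congr_right {t : Side} {h k : DecLink n} {p q : Fin (2 * n)}
    (hp : DecoBridge t h k p) (hpq : k.SameCirc p q) : DecoBridge t h k q := by
  rw [decoBridge_iff] at hp ⊢
  rwa [← k.sign_eq hpq, ← k.set_congr hpq]

theorem set_inner (h : DecLink n) (p : Fin (2 * n)) (v : Bool) (t : Side) :
    (h.set p v).inner t = h.inner t := by cases t <;> rfl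

theorem set_outer (h : DecLink n) (p : Fin (2 * n)) (v : Bool) (t : Side) :
    (h.set p v).outer t = h.outer t := by cases t <;> rfl

theorem set_ne_set {h : DecLink n} {p q : Fin (2 * n)} {v w : Bool} (hp : h.sign p = v)
    (hvw : v ≠ w) (hpq : ¬ h.SameCirc p q) : h.set p w ≠ h.set q w := by
  intro e
  have := congrArg (fun h : DecLink n => h.sign p) e
  change (h.set p w).sign p = (h.set q w).sign p at this
  rw [h.set_sign_self, h.set_sign_of_not (fun e => hpq e.symm), hp] at this
  exact hvw this.symm

/-- The paths consisting of a decoration edge and a bridge edge between two given diagrams. -/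
theorem deco_bridge_cases (t : Side) (h k : DecLink n) :
    ((∀ u, ¬ (IsBridgeEdge t h u ∧ IsDecoEdge u k)) ∧
      ∀ w, ¬ (IsDecoEdge h w ∧ IsBridgeEdge t w k)) ∨
    (∃ u w, (∀ x, (IsBridgeEdge t h x ∧ IsDecoEdge x k) ↔ x = u) ∧
      (∀ x, (IsDecoEdge h x ∧ IsBridgeEdge t x k) ↔ x = w) ∧
      ¬ Touches t u k h u ∧ ¬ Touches t h w w k) ∨
    (∃ u w w', w ≠ w' ∧ (∀ x, (IsBridgeEdge t h x ∧ IsDecoEdge x k) ↔ x = u) ∧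
      (∀ x, (IsDecoEdge h x ∧ IsBridgeEdge t x k) ↔ x = w ∨ x = w') ∧
      Joins (h.outer t) (h.inner t) (u.inner t) ∧
      Touches t u k h u ∧ Touches t h w w k ∧ Touches t h w' w' k) ∨
    (∃ u u' w, u ≠ u' ∧ (∀ x, (IsBridgeEdge t h x ∧ IsDecoEdge x k) ↔ x = u ∨ x = u') ∧
      (∀ x, (IsDecoEdge h x ∧ IsBridgeEdge t x k) ↔ x = w) ∧
      Splits (w.outer t) (w.inner t) (k.inner t) ∧
      Touches t h w w k ∧ Touches t u k h u ∧ Touches t u' k h u') := by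
  by_cases hne : ∃ p, DecoBridge t h k p
  swap
  · refine Or.inl ⟨fun u hu => ?_, fun w hw => ?_⟩
    · obtain ⟨p, hp, -⟩ := exists_decoBridge_right.1 hu
      exact hne ⟨p, hp⟩
    · obtain ⟨p, hp, -⟩ := exists_decoBridge_left.1 hw
      exact hne ⟨p, hp⟩
  obtain ⟨p, hp⟩ := hne
  obtain ⟨i, j, hs⟩ := hp.2.exists_surg
  have ho : h.outer t = k.outer t := by rw [← set_outer h p false t]; exact hp.2.1
  rw [set_inner] at hs
  have hs' : ∀ q v, Surg NCMatching.col ((h.set q v).inner t) (k.inner t) i j := by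
    intro q v
    rwa [set_inner]
  have ho' : ∀ q v, (h.set q v).outer t = k.outer t := by
    intro q v
    rwa [set_outer]
  have hor := hs.isJoin_or (h.outer t).isArcs
  have hmoved : ∀ q, h.inner t q ≠ k.inner t q →
      q = i ∨ q = j ∨ q = h.inner t i ∨ q = h.inner t j := fun q hq => (hs.moved_iff q).1 hq.symm
  have hmi : h.inner t i ≠ k.inner t i := ((hs.moved_iff i).2 (Or.inl rfl)).symm
  have hmj : h.inner t j ≠ k.inner t j := ((hs.moved_iff j).2 (Or.inr (Or.inl rfl))).symm
  have hmi' : h.inner t (h.inner t i) ≠ k.inner t (h.inner t i) :=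
    ((hs.moved_iff _).2 (Or.inr (Or.inr (Or.inl rfl)))).symm
  have hsame : ∀ q, h.inner t q ≠ k.inner t q → (h.SameCirc i q ∨ h.SameCirc j q) := by
    intro q hq
    rcases hmoved q hq with rfl | rfl | rfl | rfl
    exacts [Or.inl (.refl _), Or.inr (.refl _), Or.inl (h.sameCirc_inner t _),
      Or.inr (h.sameCirc_inner t _)]
  have tW : ∀ q, Touches t h (h.set q false) (h.set q false) k ↔
      ∃ x, h.sign x ≠ (h.set q false).sign x ∧ h.inner t x ≠ k.inner t x := by
    intro q
    unfold Touches
    rw [set_inner]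
  have tU : ∀ q, Touches t (k.set q true) k h (k.set q true) ↔
      ∃ x, (k.set q true).sign x ≠ k.sign x ∧ h.inner t x ≠ k.inner t x := by
    intro q
    unfold Touches
    rw [set_inner]
  have sW : ∀ q x, DecoBridge t h k q → (h.sign x ≠ (h.set q false).sign x ↔ h.SameCirc q x) :=
    fun q x hq => DecoAt.sign_ne_iff ⟨hq.1, rfl⟩
  have sU : ∀ q x, DecoBridge t h k q → ((k.set q true).sign x ≠ k.sign x ↔ k.SameCirc q x) :=
    fun q x hq => DecoAt.sign_ne_iff (h := k.set q true)
      (decoAt_iff'.2 ⟨(decoBridge_iff.1 hq).1, rfl⟩)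
  -- the off case, from a description of the set of points
  have off : (∀ q, DecoBridge t h k q ↔ h.SameCirc p q) → (∀ q, DecoBridge t h k q ↔ k.SameCirc p q) →
      (∀ q, h.inner t q ≠ k.inner t q → ¬ h.SameCirc p q) → 
      ∃ u w, (∀ x, (IsBridgeEdge t h x ∧ IsDecoEdge x k) ↔ x = u) ∧
      (∀ x, (IsDecoEdge h x ∧ IsBridgeEdge t x k) ↔ x = w) ∧
      ¬ Touches t u k h u ∧ ¬ Touches t h w w k := by
    intro e1 e2 e3
    refine ⟨k.set p true, h.set p false, fun x => ?_, fun x => ?_, ?_, ?_⟩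
    · rw [exists_decoBridge_right]
      constructor
      · rintro ⟨q, hq, rfl⟩
        rw [k.set_congr ((e2 q).1 hq)]
      · rintro rfl
        exact ⟨p, hp, rfl⟩
    · rw [exists_decoBridge_left]
      constructor
      · rintro ⟨q, hq, rfl⟩
        rw [h.set_congr ((e1 q).1 hq)]
      · rintro rfl
        exact ⟨p, hp, rfl⟩
    · rw [tU]
      rintro ⟨x, h1, h2⟩
      rw [sU p x hp, ← e2, e1] at h1
      exact e3 x h2 h1
    · rw [tW]
      rintro ⟨x, h1, h2⟩
      rw [sW p x hp] at h1
      exact e3 x h2 h1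
  rw [h.sameCircle_outer_inner, ho, k.sameCircle_outer_inner] at hor
  rcases hor with hj | ⟨hij, hj⟩
  · have hjs : ∀ q, DecoBridge t h k q → JoinStep (h.set q false) k i j := by
      intro q hq
      rcases (isBridgeEdge_iff (ho' q false) (hs' q false)).1 hq.2 with e | e
      · exact e
      · refine absurd (hj.le (h.sameCirc_inner t i)) ?_
        rw [set_inner] at e
        exact e.1.1
    rcases hj.class_cases h.sameCirc_equiv k.sameCirc_equiv
      (fun p q hp hq => JoinStep.single hp.1 (hjs p hp) hq.1 (hjs q hq))
      (fun p q hp hpq => hp.congr_right hpq) hp with ⟨e1, e2, e3, e4⟩ | ⟨e1, e2⟩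
    · refine Or.inr (Or.inl (off e1 e2 fun q hq hpq => ?_))
      rcases hsame q hq with e | e
      · exact e3 (e.trans hpq.symm)
      · exact e4 (e.trans hpq.symm)
    · have hi := (e1 i).2 (Or.inl (.refl i))
      have hj' := (e1 j).2 (Or.inr (.refl j))
      refine Or.inr (Or.inr (Or.inl ⟨k.set i true, h.set i false, h.set j false,
        set_ne_set hi.1 (by simp) hj.1, fun x => ?_, fun x => ?_, ?_, ?_, ?_, ?_⟩))
      · rw [exists_decoBridge_right]
        constructor
        · rintro ⟨q, hq, rfl⟩
          rw [k.set_congr ((e2 q).1 hq)]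
        · rintro rfl
          exact ⟨i, hi, rfl⟩
      · rw [exists_decoBridge_left]
        constructor
        · rintro ⟨q, hq, rfl⟩
          rcases (e1 q).1 hq with e | e
          · exact Or.inl (by rw [h.set_congr e])
          · exact Or.inr (by rw [h.set_congr e])
        · rintro (rfl | rfl)
          exacts [⟨i, hi, rfl⟩, ⟨j, hj', rfl⟩]
      · rw [set_inner]
        refine ⟨i, j, hs.surgeryAt, ?_⟩
        rw [h.sameCircle_outer_inner]
        exact hj.1
      · exact (tU i).2 ⟨i, (sU i i hi).2 (.refl i), hmi⟩
      · exact (tW i).2 ⟨i, (sW i i hi).2 (.refl i), hmi⟩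
      · exact (tW j).2 ⟨j, (sW j j hj').2 (.refl j), hmj⟩
  · have hjs : ∀ q, DecoBridge t h k q →
        JoinStep (k.neg.set q false) h.neg i (h.inner t i) := by
      intro q hq
      rw [decoBridge_iff] at hq
      have hs2 : Surg NCMatching.col (h.inner t) ((k.set q true).inner t) i j := by rwa [set_inner]
      rcases (isBridgeEdge_iff hq.2.1 hs2).1 hq.2 with e | e
      · exact absurd hij e.1.1
      · rwa [k.set_neg] at e
    have hks : ∀ q, DecoBridge t h k q → k.neg.sign q = true := by
      intro q hq
      rw [decoBridge_iff] at hq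
      simp [hq.1]
    rcases hj.class_cases k.sameCirc_equiv h.sameCirc_equiv
      (fun p q hp hq => JoinStep.single (k := h.neg) (hks p hp) (hjs p hp) (hks q hq) (hjs q hq))
      (fun p q hp hpq => hp.congr_left hpq) hp with ⟨e1, e2, e3, e4⟩ | ⟨e1, e2⟩
    · refine Or.inr (Or.inl (off e2 e1 fun q hq hpq => ?_))
      have : DecoBridge t h k i := (e2 i).2 (by
        rcases hsame q hq with e | e
        · exact hpq.trans e.symm
        · exact hpq.trans (hij.trans e).symm)
      exact e3 ((e1 i).1 this).symm
    · have hi := (e1 i).2 (Or.inl (.refl i))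
      have hj' := (e1 (h.inner t i)).2 (Or.inr (.refl _))
      have hk1 := (decoBridge_iff.1 hi).1
      refine Or.inr (Or.inr (Or.inr ⟨k.set i true, k.set (h.inner t i) true, h.set i false,
        set_ne_set hk1 (by simp) hj.1, fun x => ?_, fun x => ?_, ?_, ?_, ?_, ?_⟩))
      · rw [exists_decoBridge_right]
        constructor
        · rintro ⟨q, hq, rfl⟩
          rcases (e1 q).1 hq with e | e
          · exact Or.inl (by rw [k.set_congr e])
          · exact Or.inr (by rw [k.set_congr e])
        · rintro (rfl | rfl)
          exacts [⟨i, hi, rfl⟩, ⟨_, hj', rfl⟩]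
      · rw [exists_decoBridge_left]
        constructor
        · rintro ⟨q, hq, rfl⟩
          rw [h.set_congr ((e2 q).1 hq)]
        · rintro rfl
          exact ⟨i, hi, rfl⟩
      · rw [set_inner, set_outer]
        refine ⟨i, j, hs.surgeryAt, ?_⟩
        rw [h.sameCircle_outer_inner]
        exact hij
      · exact (tW i).2 ⟨i, (sW i i hi).2 (.refl i), hmi⟩
      · exact (tU i).2 ⟨i, (sU i i hi).2 (.refl i), hmi⟩
      · exact (tU _).2 ⟨_, (sU _ _ hj').2 (.refl _), hmi'⟩

/-- The paths consisting of two decoration edges between two given diagrams. -/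
theorem deco_deco_cases (h k : DecLink n) :
    (∀ x, ¬ (IsDecoEdge h x ∧ IsDecoEdge x k)) ∨
      ∃ u w, u ≠ w ∧ ∀ x, (IsDecoEdge h x ∧ IsDecoEdge x k) ↔ x = u ∨ x = w := by
  by_cases hne : ∃ x, IsDecoEdge h x ∧ IsDecoEdge x k
  swap
  · exact Or.inl (not_exists.1 hne)
  obtain ⟨x, h1, h2⟩ := hne
  obtain ⟨p, hp, rfl⟩ := isDecoEdge_iff.1 h1
  obtain ⟨q, hq, rfl⟩ := isDecoEdge_iff.1 h2
  have hpq : ¬ h.SameCirc p q := by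
    intro e
    rw [h.set_sign_of_sameCirc e] at hq
    cases hq
  rw [h.set_sign_of_not hpq] at hq
  refine Or.inr ⟨h.set p false, h.set q false, set_ne_set hp (by simp) hpq, fun x => ⟨?_, ?_⟩⟩
  · rintro ⟨h3, h4⟩
    obtain ⟨p', hp', rfl⟩ := isDecoEdge_iff.1 h3
    have h5 : ((h.set p false).set q false).sign p' = false := by
      obtain ⟨q', hq', e⟩ := isDecoEdge_iff.1 h4
      rw [e]
      by_cases hc : h.SameCirc q' p'
      · exact (h.set p' false).set_sign_of_sameCirc hc
      · exact ((h.set p' false).set_sign_of_not hc).trans (h.set_sign_self _ _)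
    by_cases c1 : h.SameCirc p p'
    · exact Or.inl (by rw [h.set_congr c1])
    by_cases c2 : h.SameCirc q p'
    · exact Or.inr (by rw [h.set_congr c2])
    have : ((h.set p false).set q false).sign p' = h.sign p' :=
      ((h.set p false).set_sign_of_not c2).trans (h.set_sign_of_not c1)
    rw [this, hp'] at h5
    cases h5
  · rintro (rfl | rfl)
    · exact ⟨h1, h2⟩
    · refine ⟨isDecoEdge_iff.2 ⟨q, hq, rfl⟩, isDecoEdge_iff.2 ⟨p, ?_, h.set_comm hpq _ _⟩⟩
      rw [h.set_sign_of_not (fun e => hpq e.symm), hp]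

end decoBridge

end BorderedKh

namespace BorderedKh

/-! ### Crossing numbers modulo two -/

section crossing

variable {n : ℕ}

/-- `1` if `x < y`, modulo two. -/
def ltNum (x y : Fin (2 * n)) : ZMod 2 := if x < y then 1 else 0

theorem ltNum_add {x y : Fin (2 * n)} (h : x ≠ y) : ltNum x y + ltNum y x = 1 := by
  unfold ltNum
  rcases lt_or_gt_of_ne h with h | h
  · rw [if_pos h, if_neg h.asymm, add_zero]
  · rw [if_neg h.asymm, if_pos h, zero_add]

/-- The number of crossings of arcs from `x` to `y` and from `u` to `v`, modulo two. -/
def crossNum (x y u v : Fin (2 * n)) : ZMod 2 := ltNum x u + ltNum y u + (ltNum x v + ltNum y v)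

theorem crossNum_swap (x y u v : Fin (2 * n)) : crossNum x y u v = crossNum y x u v := by
  unfold crossNum; ring

theorem crossNum_swap' (x y u v : Fin (2 * n)) : crossNum x y u v = crossNum x y v u := by
  unfold crossNum; ring

theorem two_eq_zero_zmod : (2 : ZMod 2) = 0 := rfl

theorem crossNum_trans (x y z u v : Fin (2 * n)) :
    crossNum x z u v = crossNum x y u v + crossNum y z u v := by
  unfold crossNum
  linear_combination (-(ltNum y u) - ltNum y v) * two_eq_zero_zmod

theorem crossNum_trans' (x y u v w : Fin (2 * n)) :
    crossNum x y u w = crossNum x y u v + crossNum x y v w := by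
  unfold crossNum
  linear_combination (-(ltNum x v) - ltNum y v) * two_eq_zero_zmod

theorem crossNum_comm {x y u v : Fin (2 * n)} (h1 : x ≠ u) (h2 : x ≠ v) (h3 : y ≠ u) (h4 : y ≠ v) :
    crossNum x y u v = crossNum u v x y := by
  unfold crossNum
  have e : ∀ {a b : Fin (2 * n)}, a ≠ b → ltNum a b = 1 + ltNum b a := by
    intro a b h
    linear_combination ltNum_add h - ltNum b a * two_eq_zero_zmod
  rw [e h1, e h2, e h3, e h4]
  linear_combination 2 * two_eq_zero_zmod

theorem crossNum_pairings {w x y z : Fin (2 * n)} (h1 : x ≠ y) (h2 : x ≠ z) (h3 : y ≠ z) :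
    crossNum w x y z + crossNum w y x z + crossNum w z x y = 1 := by
  unfold crossNum
  linear_combination (ltNum w y + ltNum w z + ltNum w x + 1) * two_eq_zero_zmod + ltNum_add h1 +
    ltNum_add h2 + ltNum_add h3

theorem NCMatching.crossNum_eq_zero (a : NCMatching n) {p q : Fin (2 * n)} (h1 : q ≠ p)
    (h2 : q ≠ a p) : crossNum p (a p) q (a q) = 0 := by
  have key : ∀ p q : Fin (2 * n), q ≠ p → q ≠ a p → p < a p → q < a q →
      crossNum p (a p) q (a q) = 0 := by
    intro p q h1 h2 h3 h4
    have h5 : a q ≠ p := fun e => h2 (by rw [← e, a.invol])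
    have h6 : a q ≠ a p := fun e => h1 (by rw [← a.invol q, e, a.invol])
    have h7 := a.noCross p q
    have h8 := a.noCross q p
    unfold crossNum ltNum
    generalize a p = p' at *
    generalize a q = q' at *
    rw [ne_eq, Fin.ext_iff] at h1 h2 h5 h6
    simp only [Fin.lt_def] at *
    split_ifs <;> first | rfl | (exfalso; omega)
  have key2 : ∀ p q : Fin (2 * n), q ≠ p → q ≠ a p → p < a p →
      crossNum p (a p) q (a q) = 0 := by
    intro p q h1 h2 h3
    rcases lt_or_gt_of_ne (a.noFix q) with h | h
    · rw [crossNum_swap']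
      have := key p (a q) (fun e => h2 (by rw [← e, a.invol]))
        (fun e => h1 (by rw [← a.invol q, e, a.invol])) h3 (by rwa [a.invol])
      rwa [a.invol] at this
    · exact key p q h1 h2 h3 h
  rcases lt_or_gt_of_ne (a.noFix p) with h | h
  · rw [crossNum_swap]
    have := key2 (a p) q h2 (by rwa [a.invol]) (by rwa [a.invol])
    rwa [a.invol] at this
  · exact key2 p q h1 h2 h

theorem NCMatching.crossNum_arcs (a : NCMatching n) {p p' q q' : Fin (2 * n)} (hp : a p = p')
    (hq : a q = q') (h1 : q ≠ p) (h2 : q ≠ p') : crossNum p p' q q' = 0 := by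
  subst hp hq
  exact a.crossNum_eq_zero h1 h2

theorem NCMatching.eq_symm (a : NCMatching n) {p q : Fin (2 * n)} (h : a p = q) : a q = p := by
  rw [← h, a.invol]

theorem NCMatching.sum_ltNum (a : NCMatching n) (S : Finset (Fin (2 * n))) (hS : ∀ x ∈ S, a x ∈ S)
    {p : Fin (2 * n)} (hp : p ∉ S) : ∑ q ∈ S, (ltNum p q + ltNum (a p) q) = 0 := by
  refine Finset.sum_involution (fun q _ => a q) (fun q hq => ?_) (fun q _ _ => a.noFix q) hS
    (fun q _ => a.invol q)
  refine a.crossNum_eq_zero (fun e => hp (e ▸ hq)) fun e => hp ?_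
  have := hS q hq
  rwa [e, a.invol] at this

/-- A surgery gives a crossingless matching if the new arcs do not cross. -/
theorem NCMatching.exists_surgeryAt (a : NCMatching n) {i j : Fin (2 * n)} (hji : j ≠ i)
    (hji' : j ≠ a i) (h0 : crossNum i j (a i) (a j) = 0)
    (h1 : ∀ q, q ≠ i → q ≠ j → q ≠ a i → q ≠ a j → crossNum i j q (a q) = 0) :
    ∃ a' : NCMatching n, SurgeryAt a a' i j := by
  classical
  have hij' : a i ≠ a j := fun e => hji (by rw [← a.invol j, ← e, a.invol])
  have hij2 : i ≠ a j := fun e => hji' (by rw [e, a.invol])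
  have v1 : surger a i j i = j := by simp [surger]
  have v2 : surger a i j j = i := by simp [surger, hji]
  have v3 : surger a i j (a i) = a j := by simp [surger, a.noFix, hji'.symm]
  have v4 : surger a i j (a j) = a i := by simp [surger, a.noFix, hij2.symm, hij'.symm]
  have v5 : ∀ q, q ≠ i → q ≠ j → q ≠ a i → q ≠ a j → surger a i j q = a q := by
    intro q e1 e2 e3 e4
    simp [surger, e1, e2, e3, e4]
  have off : ∀ q, q ≠ i → q ≠ j → q ≠ a i → q ≠ a j →
      a q ≠ i ∧ a q ≠ j ∧ a q ≠ a i ∧ a q ≠ a j := by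
    intro q e1 e2 e3 e4
    exact ⟨fun e => e3 (a.eq_symm e).symm, fun e => e4 (a.eq_symm e).symm,
      fun e => e1 (a.isArcs.inj e), fun e => e2 (a.isArcs.inj e)⟩
  have cases : ∀ q, q = i ∨ q = j ∨ q = a i ∨ q = a j ∨
      (q ≠ i ∧ q ≠ j ∧ q ≠ a i ∧ q ≠ a j) := by
    intro q
    by_cases e1 : q = i <;> by_cases e2 : q = j <;> by_cases e3 : q = a i <;>
      by_cases e4 : q = a j <;> simp_all
  have h2 : ∀ q, q ≠ i → q ≠ j → q ≠ a i → q ≠ a j → crossNum (a i) (a j) q (a q) = 0 := by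
    intro q e1 e2 e3 e4
    rw [crossNum_trans _ i, crossNum_trans i j, h1 q e1 e2 e3 e4, crossNum_swap (a i),
      a.crossNum_eq_zero e1 e3, a.crossNum_eq_zero e2 e4]
    rfl
  have hcomm : ∀ q, q ≠ i → q ≠ j → q ≠ a i → q ≠ a j → crossNum q (a q) i j = 0 := by
    intro q e1 e2 e3 e4
    obtain ⟨f1, f2, f3, f4⟩ := off q e1 e2 e3 e4
    rw [crossNum_comm e1 e2 f1 f2, h1 q e1 e2 e3 e4]
  have hcomm' : ∀ q, q ≠ i → q ≠ j → q ≠ a i → q ≠ a j → crossNum q (a q) (a i) (a j) = 0 := by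
    intro q e1 e2 e3 e4
    obtain ⟨f1, f2, f3, f4⟩ := off q e1 e2 e3 e4
    rw [crossNum_comm e3 e4 f3 f4, h2 q e1 e2 e3 e4]
  have h0' : crossNum (a i) (a j) i j = 0 := by
    rw [crossNum_comm (a.noFix i) hji'.symm hij2.symm (a.noFix j), h0]
  have main : ∀ p q, q ≠ p → q ≠ surger a i j p →
      crossNum p (surger a i j p) q (surger a i j q) = 0 := by
    intro p q hqp hqp'
    rcases cases p with rfl | rfl | rfl | rfl | ⟨e1, e2, e3, e4⟩
    · rw [v1] at hqp' ⊢
      rcases cases q with rfl | rfl | rfl | rfl | ⟨e1, e2, e3, e4⟩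
      · exact absurd rfl hqp
      · exact absurd rfl hqp'
      · rw [v3, h0]
      · rw [v4, crossNum_swap', h0]
      · rw [v5 q e1 e2 e3 e4, h1 q e1 e2 e3 e4]
    · rw [v2] at hqp' ⊢
      rcases cases q with rfl | rfl | rfl | rfl | ⟨e1, e2, e3, e4⟩
      · exact absurd rfl hqp'
      · exact absurd rfl hqp
      · rw [v3, crossNum_swap, h0]
      · rw [v4, crossNum_swap, crossNum_swap', h0]
      · rw [v5 q e1 e2 e3 e4, crossNum_swap, h1 q e1 e2 e3 e4]
    · rw [v3] at hqp' ⊢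
      rcases cases q with rfl | rfl | rfl | rfl | ⟨e1, e2, e3, e4⟩
      · rw [v1, h0']
      · rw [v2, crossNum_swap', h0']
      · exact absurd rfl hqp
      · exact absurd rfl hqp'
      · rw [v5 q e1 e2 e3 e4, h2 q e1 e2 e3 e4]
    · rw [v4] at hqp' ⊢
      rcases cases q with rfl | rfl | rfl | rfl | ⟨e1, e2, e3, e4⟩
      · rw [v1, crossNum_swap, h0']
      · rw [v2, crossNum_swap, crossNum_swap', h0']
      · exact absurd rfl hqp'
      · exact absurd rfl hqp
      · rw [v5 q e1 e2 e3 e4, crossNum_swap, h2 q e1 e2 e3 e4]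
    · rw [v5 p e1 e2 e3 e4] at hqp' ⊢
      rcases cases q with rfl | rfl | rfl | rfl | ⟨e1', e2', e3', e4'⟩
      · rw [v1, hcomm p e1 e2 e3 e4]
      · rw [v2, crossNum_swap', hcomm p e1 e2 e3 e4]
      · rw [v3, hcomm' p e1 e2 e3 e4]
      · rw [v4, crossNum_swap', hcomm' p e1 e2 e3 e4]
      · rw [v5 q e1' e2' e3' e4', a.crossNum_eq_zero hqp hqp']
  refine ⟨⟨surger a i j, fun q => ?_, fun q => ?_, fun p q hpq => ?_⟩, hji, hji', rfl⟩
  · rcases cases q with rfl | rfl | rfl | rfl | ⟨e1, e2, e3, e4⟩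
    · rw [v1, v2]
    · rw [v2, v1]
    · rw [v3, v4]
    · rw [v4, v3]
    · obtain ⟨f1, f2, f3, f4⟩ := off q e1 e2 e3 e4
      rw [v5 q e1 e2 e3 e4, v5 _ f1 f2 f3 f4, a.invol]
  · rcases cases q with rfl | rfl | rfl | rfl | ⟨e1, e2, e3, e4⟩
    · rw [v1]; exact hji
    · rw [v2]; exact hji.symm
    · rw [v3]; exact hij'.symm
    · rw [v4]; exact hij'
    · rw [v5 q e1 e2 e3 e4]; exact a.noFix q
  · obtain ⟨l1, l2, l3⟩ := hpq
    have := main p q l1.ne' l2.ne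
    unfold crossNum ltNum at this
    rw [if_pos l1, if_neg l2.asymm, if_pos (l1.trans (l2.trans l3)), if_pos l3] at this
    revert this
    decide

end crossing

/-! ### Two surgeries on a crossingless matching -/

section planar

variable {n : ℕ}

theorem IsSurgery.exists_surg {a a' : NCMatching n} (h : IsSurgery a a') :
    ∃ i j, Surg NCMatching.col a a' i j := by
  obtain ⟨i, j, h⟩ := h
  exact ⟨i, j, .of_surgeryAt a.isArcs a'.isArcs h⟩

theorem Surg.isSurgery {a a' : NCMatching n} {i j : Fin (2 * n)} (h : Surg NCMatching.col a a' i j) :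
    IsSurgery a a' := ⟨i, j, h.surgeryAt⟩

theorem IsSurgery.symm {a a' : NCMatching n} (h : IsSurgery a a') : IsSurgery a' a := by
  obtain ⟨i, j, h⟩ := h.exists_surg
  exact h.reverse.isSurgery

theorem IsSurgery.surg {a a' : NCMatching n} (h : IsSurgery a a') {p : Fin (2 * n)}
    (hp : a' p ≠ a p) : Surg NCMatching.col a a' p (a' p) := by
  obtain ⟨i, j, h⟩ := h.exists_surg
  exact h.of_moved hp

theorem IsSurgery.unique {a a' a'' : NCMatching n} (h : IsSurgery a a') (h' : IsSurgery a a'')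
    {p q : Fin (2 * n)} (hp : a' p ≠ a p) (hp' : a'' p ≠ a p) (hq : a' q ≠ a q) (hq' : a'' q ≠ a q)
    (hqp : q ≠ p) (hqp' : q ≠ a p) : a' = a'' := by
  obtain ⟨i, j, h⟩ := h.exists_surg
  obtain ⟨k, l, h'⟩ := h'.exists_surg
  exact NCMatching.toFun_inj (h.unique h' hp hp' hq hq' hqp hqp')

/-- `a` lies between `a₁` and `a₃`: two surgeries lead from `a₁` to `a₃` by way of `a`. -/
structure Between (a₁ a a₃ : NCMatching n) : Prop where
  fst : IsSurgery a₁ a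
  snd : IsSurgery a a₃
  ne : a₁ ≠ a₃

namespace Between

variable {a₁ a a' a₃ : NCMatching n}

theorem ne_of_moved (h : Between a₁ a a₃) {k : Fin (2 * n)} (hk : a k ≠ a₁ k) : a₃ k ≠ a₁ k := by
  intro e
  have e1 : a₃ k ≠ a k := by rw [e]; exact hk.symm
  have s1 := h.fst.symm.surg (p := k) hk.symm
  have s2 := h.snd.surg e1
  refine h.ne (h.fst.symm.unique h.snd (p := k) (q := a₁ k) hk.symm e1
    ((s1.moved_iff _).2 (Or.inr (Or.inl rfl))) ?_ (a₁.noFix k) hk.symm)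
  rw [← e]
  exact (s2.moved_iff _).2 (Or.inr (Or.inl rfl))

/-- Two different matchings between `a₁` and `a₃` agree with them at a common point. -/
theorem exists_agree (h : Between a₁ a a₃) (h' : Between a₁ a' a₃) (hne : a ≠ a') :
    ∃ k, a k = a₁ k ∧ a' k = a₃ k ∧ a₃ k ≠ a₁ k := by
  by_cases hK : ∃ k, a k = a₁ k ∧ a₃ k ≠ a₁ k
  · obtain ⟨k, h1, h2⟩ := hK
    have e1 : a (a₁ k) = k := by rw [← h1, a.invol]
    have e2 : a₃ (a₁ k) ≠ k := fun e => h2 (by rw [← a₃.invol (a₁ k), e])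
    by_cases h3 : a' k = a₃ k
    · exact ⟨k, h1, h3, h2⟩
    by_cases h4 : a' (a₁ k) = a₃ (a₁ k)
    · exact ⟨a₁ k, by rw [a₁.invol, e1], h4, by rwa [a₁.invol]⟩
    · refine absurd (h.snd.symm.unique h'.snd.symm (p := k) (q := a₁ k) ?_ h3 ?_ h4 (a₁.noFix k)
        h2.symm) hne
      · rw [h1]; exact h2.symm
      · rw [e1]; exact e2.symm
  · push Not at hK
    obtain ⟨i, j, hs⟩ := h.snd.exists_surg
    have key : ∀ k, a₃ k ≠ a k → a₁ k ≠ a k := by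
      intro k hk e
      exact hk ((hK k e.symm).trans e)
    have hi := (hs.moved_iff i).2 (Or.inl rfl)
    have hj := (hs.moved_iff j).2 (Or.inr (Or.inl rfl))
    exact absurd (h.fst.symm.unique h.snd (key i hi) hi (key j hj) hj hs.ne_i hs.ne) h.ne

/-- If the two surgeries have disjoint arcs, another matching between `a₁` and `a₃` comes from
performing them in the other order. -/
theorem eq_of_disjoint (h : Between a₁ a a₃) (h' : Between a₁ a' a₃) (hne : a ≠ a')
    (hd : ∀ p, a₁ p = a p ∨ a₃ p = a p) (p : Fin (2 * n)) :
    (a₁ p ≠ a p → a' p = a₁ p) ∧ (a₁ p = a p → a' p = a₃ p) := by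
  obtain ⟨k, h1, h2, h3⟩ := h.exists_agree h' hne
  have s1 : Surg NCMatching.col a a₃ k (a₃ k) := h.snd.surg (by rw [h1]; exact h3)
  have s2 : Surg NCMatching.col a₁ a' k (a' k) := h'.fst.surg (by rw [h2]; exact h3)
  rw [h2] at s2
  have e1 : a₁ (a₃ k) = a (a₃ k) := by
    rcases hd (a₃ k) with e | e
    · exact e
    · rw [a₃.invol] at e
      exact absurd ((a.eq_symm e.symm).symm.trans h1) h3
  have hm : a' p ≠ a₁ p ↔ a₃ p ≠ a p := by
    rw [s1.moved_iff, s2.moved_iff, h1, e1]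
  constructor
  · intro hp
    by_contra hc
    exact hm.1 hc ((hd p).resolve_left hp)
  · intro hp
    by_cases hc : a₃ p = a p
    · rw [hc, ← hp]
      exact not_not.1 fun e => hm.1 e hc
    · rcases (s1.moved_iff p).1 hc with rfl | rfl | rfl | rfl
      · exact h2
      · rw [← h2, a'.invol, h2, a₃.invol]
      · rw [h1, s2.at_mi, e1, ← s1.at_mi, h1]
      · rw [← e1, s2.at_mj, e1, s1.at_mj, h1]

theorem of_disjoint (h : Between a₁ a a₃) (hd : ∀ p, a₁ p = a p ∨ a₃ p = a p)
    (h' : ∀ p, (a₁ p ≠ a p → a' p = a₁ p) ∧ (a₁ p = a p → a' p = a₃ p)) :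
    Between a₁ a' a₃ ∧ a' ≠ a := by
  obtain ⟨i, j, s1⟩ := h.fst.exists_surg
  obtain ⟨k, l, s2⟩ := h.snd.exists_surg
  have f1 : ∀ p, a p ≠ a₁ p → a₃ p = a p ∧ a' p = a₁ p := fun p hp =>
    ⟨(hd p).resolve_left hp.symm, (h' p).1 hp.symm⟩
  have f2 : ∀ p, a₃ p ≠ a p → a₁ p = a p ∧ a' p = a₃ p := fun p hp =>
    ⟨(hd p).resolve_right hp, (h' p).2 ((hd p).resolve_right hp)⟩
  have hi := f1 i ((s1.moved_iff i).2 (Or.inl rfl))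
  have hj := f1 j ((s1.moved_iff j).2 (Or.inr (Or.inl rfl)))
  have hi' := f1 _ ((s1.moved_iff _).2 (Or.inr (Or.inr (Or.inl rfl))))
  have hk := f2 k ((s2.moved_iff k).2 (Or.inl rfl))
  have hl := f2 l ((s2.moved_iff l).2 (Or.inr (Or.inl rfl)))
  have hk' := f2 _ ((s2.moved_iff _).2 (Or.inr (Or.inr (Or.inl rfl))))
  refine ⟨⟨?_, ?_, h.ne⟩, fun e => (s1.moved_iff i).2 (Or.inl rfl) ?_⟩
  · refine Surg.isSurgery (i := k) (j := l)
      ⟨a₁.isArcs, a'.isArcs, ?_, ?_, s2.col_eq, ?_, fun p e1 e2 e3 e4 => ?_⟩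
    · rw [hk.2, s2.at_i]
    · rw [hk.1, hk'.2, s2.at_mi, hl.1]
    · rw [hk.1]; exact s2.ne
    · rw [hk.1] at e3
      rw [hl.1] at e4
      have := s2.other p e1 e2 e3 e4
      by_cases hp : a₁ p = a p
      · rw [(h' p).2 hp, this, hp]
      · exact (h' p).1 hp
  · refine Surg.isSurgery (i := i) (j := j)
      ⟨a'.isArcs, a₃.isArcs, ?_, ?_, s1.col_eq, ?_, fun p e1 e2 e3 e4 => ?_⟩
    · rw [hi.1, s1.at_i]
    · rw [hi.2, hi'.1, s1.at_mi, hj.2]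
    · rw [hi.2]; exact s1.ne
    · rw [hi.2] at e3
      rw [hj.2] at e4
      exact ((h' p).2 (s1.other p e1 e2 e3 e4).symm).symm
  · rw [← e]; exact hi.2

end Between

/-- Two surgeries that share a point: `a₁`, `a` and `a₃` consist of the arcs `12, 34, 56`, the arcs
`12, 45, 36` and the arcs `23, 45, 61` and of common arcs. -/
structure Hex (a₁ a a₃ : NCMatching n) (x₁ x₂ x₃ x₄ x₅ x₆ : Fin (2 * n)) : Prop where
  e12 : a₁ x₁ = x₂
  e34 : a₁ x₃ = x₄
  e56 : a₁ x₅ = x₆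
  f12 : a x₁ = x₂
  f45 : a x₄ = x₅
  f36 : a x₃ = x₆
  g23 : a₃ x₂ = x₃
  g45 : a₃ x₄ = x₅
  g61 : a₃ x₆ = x₁
  n24 : x₂ ≠ x₄
  n26 : x₂ ≠ x₆
  n46 : x₄ ≠ x₆
  other : ∀ p, p ≠ x₁ → p ≠ x₂ → p ≠ x₃ → p ≠ x₄ → p ≠ x₅ → p ≠ x₆ → a p = a₁ p ∧ a₃ p = a₁ p

theorem Between.exists_hex {a₁ a a₃ : NCMatching n} (h : Between a₁ a a₃) {p : Fin (2 * n)}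
    (h1 : a₁ p ≠ a p) (h3 : a₃ p ≠ a p) : ∃ x₁ x₂ x₃ x₄ x₅ x₆, Hex a₁ a a₃ x₁ x₂ x₃ x₄ x₅ x₆ := by
  have s1 := h.fst.surg h1.symm
  have s2 := h.snd.surg h3
  have h13 : a₃ p ≠ a₁ p := h.ne_of_moved h1.symm
  have c4 : a (a₁ p) = a₁ (a p) := s1.at_mi
  have c1 : a₃ (a p) = a (a₃ p) := s2.at_mi
  have col : ∀ (b b' : NCMatching n) q, b q ≠ q ∧ b q ≠ b' (b q) → True := fun _ _ _ _ => trivial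
  have hc : ∀ b b' b'' : NCMatching n, b p ≠ b' (b'' p) := by
    intro b b' b'' e
    have := congrArg NCMatching.col e
    rw [b.col_eq, b'.col_eq, b''.col_eq] at this
    cases hp : NCMatching.col p <;> simp [hp] at this
  refine ⟨a (a₃ p), a₃ p, p, a₁ p, a (a₁ p), a p, ?_, rfl, ?_, a.invol _, rfl, rfl, a₃.invol p, ?_,
    c1, h13, h3, h1, fun q e1 e2 e3 e4 e5 e6 => ⟨?_, ?_⟩⟩
  · have : a (a₃ p) = a₁ (a₃ p) :=
      s1.other _ (a₃.noFix p) h3 h13 fun e => hc a₃ a₁ a e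
    rw [this, a₁.invol]
  · rw [c4, a₁.invol]
  · exact s2.other _ (a₁.noFix p) h13.symm h1 fun e => hc a₁ a a₃ e
  · exact s1.other q e3 e6 e4 (by rwa [← c4])
  · rw [s2.other q e3 e2 e6 e1]
    exact s1.other q e3 e6 e4 (by rwa [← c4])

namespace Hex

variable {a₁ a a' a'' a₃ : NCMatching n} {x₁ x₂ x₃ x₄ x₅ x₆ : Fin (2 * n)}

section one

variable (h : Hex a₁ a a₃ x₁ x₂ x₃ x₄ x₅ x₆)
include h

theorem col_eqs : NCMatching.col x₂ = !NCMatching.col x₁ ∧ NCMatching.col x₃ = NCMatching.col x₁ ∧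
    NCMatching.col x₄ = !NCMatching.col x₁ ∧ NCMatching.col x₅ = NCMatching.col x₁ ∧
    NCMatching.col x₆ = !NCMatching.col x₁ := by
  have e1 := a₁.col_eq x₁
  have e2 := a₃.col_eq x₂
  have e3 := a₁.col_eq x₃
  have e4 := a.col_eq x₄
  have e5 := a₁.col_eq x₅
  rw [h.e12] at e1
  rw [h.g23] at e2
  rw [h.e34] at e3
  rw [h.f45] at e4
  rw [h.e56] at e5
  rw [e1] at e2
  rw [e2] at e3
  rw [e3] at e4
  rw [e4] at e5
  simp_all

theorem ne_of_col {x y : Fin (2 * n)} (hxy : NCMatching.col x = !NCMatching.col y) : x ≠ y := by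
  rintro rfl
  cases hx : NCMatching.col x <;> simp [hx] at hxy

theorem nodup : (x₁ ≠ x₂ ∧ x₁ ≠ x₃ ∧ x₁ ≠ x₄ ∧ x₁ ≠ x₅ ∧ x₁ ≠ x₆) ∧
    (x₂ ≠ x₃ ∧ x₂ ≠ x₄ ∧ x₂ ≠ x₅ ∧ x₂ ≠ x₆) ∧ (x₃ ≠ x₄ ∧ x₃ ≠ x₅ ∧ x₃ ≠ x₆) ∧
    (x₄ ≠ x₅ ∧ x₄ ≠ x₆) ∧ x₅ ≠ x₆ := by
  obtain ⟨c2, c3, c4, c5, c6⟩ := h.col_eqs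
  have m13 : x₁ ≠ x₃ := fun e => h.n24 (by rw [← h.e12, ← h.e34, e])
  have m15 : x₁ ≠ x₅ := fun e => h.n26 (by rw [← h.e12, ← h.e56, e])
  have m35 : x₃ ≠ x₅ := fun e => h.n46 (by rw [← h.e34, ← h.e56, e])
  have k : ∀ {x y : Fin (2 * n)}, NCMatching.col x = !NCMatching.col y → x ≠ y :=
    fun e => h.ne_of_col e
  have n24 := h.n24
  have n26 := h.n26
  have n46 := h.n46
  have m12 : x₁ ≠ x₂ := k (by simp [*])
  have m14 : x₁ ≠ x₄ := k (by simp [*])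
  have m16 : x₁ ≠ x₆ := k (by simp [*])
  have m23 : x₂ ≠ x₃ := k (by simp [*])
  have m25 : x₂ ≠ x₅ := k (by simp [*])
  have m34 : x₃ ≠ x₄ := k (by simp [*])
  have m36 : x₃ ≠ x₆ := k (by simp [*])
  have m45 : x₄ ≠ x₅ := k (by simp [*])
  have m56 : x₅ ≠ x₆ := k (by simp [*])
  exact ⟨⟨m12, m13, m14, m15, m16⟩, ⟨m23, n24, m25, n26⟩, ⟨m34, m35, m36⟩, ⟨m45, n46⟩, m56⟩

theorem surg₁ : Surg NCMatching.col a₁ a x₃ x₆ := by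
  obtain ⟨c2, c3, c4, c5, c6⟩ := h.col_eqs
  refine ⟨a₁.isArcs, a.isArcs, h.f36, ?_, by rw [c6, c3], by rw [h.e34]; exact h.n46.symm,
    fun p e1 e2 e3 e4 => ?_⟩
  · rw [h.e34, h.f45, a₁.eq_symm h.e56]
  · rw [h.e34] at e3
    rw [a₁.eq_symm h.e56] at e4
    by_cases f1 : p = x₁
    · rw [f1, h.f12, h.e12]
    by_cases f2 : p = x₂
    · rw [f2, a.eq_symm h.f12, a₁.eq_symm h.e12]
    · exact (h.other p f1 f2 e1 e3 e4 e2).1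

theorem surg₂ : Surg NCMatching.col a a₃ x₃ x₂ := by
  obtain ⟨c2, c3, c4, c5, c6⟩ := h.col_eqs
  refine ⟨a.isArcs, a₃.isArcs, a₃.eq_symm h.g23, ?_, by rw [c2, c3], by rw [h.f36]; exact h.n26,
    fun p e1 e2 e3 e4 => ?_⟩
  · rw [h.f36, h.g61, a.eq_symm h.f12]
  · rw [h.f36] at e3
    rw [a.eq_symm h.f12] at e4
    by_cases f1 : p = x₄
    · rw [f1, h.f45, h.g45]
    by_cases f2 : p = x₅
    · rw [f2, a.eq_symm h.f45, a₃.eq_symm h.g45]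
    · rw [(h.other p e4 e2 e1 f1 f2 e3).1, (h.other p e4 e2 e1 f1 f2 e3).2]

theorem between : Between a₁ a a₃ :=
  ⟨h.surg₁.isSurgery, h.surg₂.isSurgery, fun e => h.n24 (by
    have := a₃.eq_symm h.g23
    rw [← e, h.e34] at this
    exact this.symm)⟩

theorem moved_iff (p : Fin (2 * n)) : a p ≠ a₁ p ↔ p = x₃ ∨ p = x₆ ∨ p = x₄ ∨ p = x₅ := by
  rw [h.surg₁.moved_iff, h.e34, a₁.eq_symm h.e56]

/-- Any other matching between `a₁` and `a₃` is obtained by rotating the hexagon. -/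
theorem rotate_of_between (h' : Between a₁ a' a₃) (hne : a ≠ a') :
    Hex a₁ a' a₃ x₃ x₄ x₅ x₆ x₁ x₂ ∨ Hex a₁ a' a₃ x₅ x₆ x₁ x₂ x₃ x₄ := by
  obtain ⟨⟨m12, m13, m14, m15, m16⟩, ⟨m23, m24, m25, m26⟩, ⟨m34, m35, m36⟩, ⟨m45, m46⟩, m56⟩ := h.nodup
  obtain ⟨k, h1, h2, h3⟩ := h'.exists_agree h.between hne.symm
  have hk : k = x₄ ∨ k = x₅ := by
    have hm : a k ≠ a₁ k := by rw [h2]; exact h3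
    rcases (h.moved_iff k).1 hm with rfl | rfl | rfl | rfl
    · rw [h.f36, a₃.eq_symm h.g23] at h2
      exact absurd h2.symm h.n26
    · rw [a.eq_symm h.f36, h.g61] at h2
      exact absurd h2.symm m13
    · exact Or.inl rfl
    · exact Or.inr rfl
  have hs := h'.snd.symm.surg (p := k) (by rw [h1]; exact h3.symm)
  rw [h1] at hs
  have s12 := a₁.eq_symm h.e12
  have s34 := a₁.eq_symm h.e34
  have s56 := a₁.eq_symm h.e56
  have t23 := a₃.eq_symm h.g23
  have t45 := a₃.eq_symm h.g45
  have t61 := a₃.eq_symm h.g61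
  rcases hk with hk | hk <;> rw [hk] at hs
  · left
    rw [s34] at hs
    have v4 : a' x₄ = x₃ := hs.at_i
    have v5 : a' x₅ = x₂ := by rw [← h.g45, hs.at_mi, t23]
    have v6 : a' x₆ = x₁ := by
      rw [hs.other x₆ m46.symm m36.symm (by rw [h.g45]; exact m56.symm)
        (by rw [t23]; exact m26.symm), h.g61]
    refine ⟨h.e34, h.e56, h.e12, a'.eq_symm v4, v6, v5, h.g45, h.g61, h.g23, m46, m24.symm, m26.symm,
      fun p e1 e2 e3 e4 e5 e6 => ?_⟩
    have := h.other p e5 e6 e1 e2 e3 e4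
    exact ⟨(hs.other p e2 e1 (by rwa [h.g45]) (by rwa [t23])).trans this.2, this.2⟩
  · right
    rw [h.e56] at hs
    have v5 : a' x₅ = x₆ := hs.at_i
    have v4 : a' x₄ = x₁ := by rw [← t45, hs.at_mi, h.g61]
    have v2 : a' x₂ = x₃ := by
      rw [hs.other x₂ m25 m26 (by rw [t45]; exact m24)
        (by rw [h.g61]; exact m12.symm), h.g23]
    refine ⟨h.e56, h.e12, h.e34, v5, v2, a'.eq_symm v4, h.g61, h.g23, h.g45, m26.symm, m46.symm, m24,
      fun p e1 e2 e3 e4 e5 e6 => ?_⟩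
    have := h.other p e3 e4 e5 e6 e1 e2
    exact ⟨(hs.other p e1 e2 (by rwa [t45]) (by rwa [h.g61])).trans this.2, this.2⟩

theorem unique (h' : Hex a₁ a' a₃ x₁ x₂ x₃ x₄ x₅ x₆) : a = a' := by
  refine NCMatching.ext fun p => ?_
  by_cases e1 : p = x₁
  · rw [e1, h.f12, h'.f12]
  by_cases e2 : p = x₂
  · rw [e2, a.eq_symm h.f12, a'.eq_symm h'.f12]
  by_cases e3 : p = x₃
  · rw [e3, h.f36, h'.f36]
  by_cases e4 : p = x₄
  · rw [e4, h.f45, h'.f45]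
  by_cases e5 : p = x₅
  · rw [e5, a.eq_symm h.f45, a'.eq_symm h'.f45]
  by_cases e6 : p = x₆
  · rw [e6, a.eq_symm h.f36, a'.eq_symm h'.f36]
  · rw [(h.other p e1 e2 e3 e4 e5 e6).1, (h'.other p e1 e2 e3 e4 e5 e6).1]

/-- In a hexagon there are at least two matchings between `a₁` and `a₃`. -/
theorem exists_rotate : ∃ a', Hex a₁ a' a₃ x₃ x₄ x₅ x₆ x₁ x₂ ∨ Hex a₁ a' a₃ x₅ x₆ x₁ x₂ x₃ x₄ := by
  obtain ⟨⟨m12, m13, m14, m15, m16⟩, ⟨m23, m24, m25, m26⟩, ⟨m34, m35, m36⟩, ⟨m45, m46⟩, m56⟩ := h.nodup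
  have s12 := a₁.eq_symm h.e12
  have s34 := a₁.eq_symm h.e34
  have s56 := a₁.eq_symm h.e56
  have t23 := a₃.eq_symm h.g23
  have t45 := a₃.eq_symm h.g45
  have t61 := a₃.eq_symm h.g61
  have k1245 : crossNum x₁ x₂ x₄ x₅ = 0 := a.crossNum_arcs h.f12 h.f45 m14.symm m24.symm
  have k1256 : crossNum x₁ x₂ x₅ x₆ = 0 := a₁.crossNum_arcs h.e12 h.e56 m15.symm m25.symm
  have k2345 : crossNum x₂ x₃ x₄ x₅ = 0 := a₃.crossNum_arcs h.g23 h.g45 m24.symm m34.symm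
  have hsum : crossNum x₁ x₃ x₄ x₆ = crossNum x₂ x₃ x₅ x₆ := by
    rw [crossNum_trans x₁ x₂, crossNum_trans' x₁ x₂ x₄ x₅, crossNum_trans' x₂ x₃ x₄ x₅, k1245, k1256,
      k2345]
    ring
  have hp := crossNum_pairings (w := x₁) (x := x₃) (y := x₄) (z := x₆) m34 m36 m46
  rw [hsum] at hp
  have hsymm : crossNum x₁ x₄ x₃ x₆ + crossNum x₁ x₆ x₃ x₄ = 1 + crossNum x₂ x₃ x₅ x₆ := by
    linear_combination hp - crossNum x₂ x₃ x₅ x₆ * two_eq_zero_zmod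
  by_cases hc : crossNum x₁ x₆ x₃ x₄ = 0
  · have hA : crossNum x₁ x₆ (a₁ x₁) (a₁ x₆) = 0 := by
      rw [h.e12, s56, crossNum_trans' _ _ x₂ x₃, crossNum_trans' _ _ x₃ x₄,
        a₃.crossNum_arcs t61 h.g23 m12.symm m26, hc, a₃.crossNum_arcs t61 h.g45 m14.symm m46, add_zero, add_zero]
    have hB : ∀ q, q ≠ x₁ → q ≠ x₆ → q ≠ a₁ x₁ → q ≠ a₁ x₆ →
        crossNum x₁ x₆ q (a₁ q) = 0 := by
      intro q e1 e2 e3 e4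
      rw [h.e12] at e3
      rw [s56] at e4
      by_cases f3 : q = x₃
      · rw [f3, h.e34, hc]
      by_cases f4 : q = x₄
      · rw [f4, s34, crossNum_swap', hc]
      · rw [← (h.other q e1 e3 f3 f4 e4 e2).2]
        exact a₃.crossNum_arcs t61 rfl e1 e2
    obtain ⟨a', ha'⟩ := a₁.exists_surgeryAt (i := x₁) (j := x₆) m16.symm
      (by rw [h.e12]; exact m26.symm) hA hB
    have hs := Surg.of_surgeryAt a₁.isArcs a'.isArcs ha'
    refine ⟨a', Or.inl ⟨h.e34, h.e56, h.e12, ?_, a'.eq_symm hs.at_i, ?_, h.g45, h.g61, h.g23, m46,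
      m24.symm, m26.symm, fun p e1 e2 e3 e4 e5 e6 => ?_⟩⟩
    · rw [hs.other x₃ m13.symm m36 (by rw [h.e12]; exact m23.symm) (by rw [s56]; exact m35), h.e34]
    · have := hs.at_mi
      rw [h.e12, s56] at this
      exact a'.eq_symm this
    · have := h.other p e5 e6 e1 e2 e3 e4
      exact ⟨hs.other p e5 e4 (by rwa [h.e12]) (by rwa [s56]), this.2⟩
  · have hc' : crossNum x₂ x₃ x₅ x₆ = 0 := by
      have e1 : crossNum x₁ x₆ x₃ x₄ = 1 := by
        revert hc
        generalize crossNum x₁ x₆ x₃ x₄ = z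
        revert z
        decide
      have e2 := crossNum_pairings (w := x₁) (x := x₃) (y := x₄) (z := x₆) m34 m36 m46
      have e3 : crossNum x₁ x₄ x₃ x₆ = crossNum x₂ x₃ x₅ x₆ := by
        rw [e1] at hsymm
        linear_combination hsymm
      have k : crossNum x₁ x₃ x₄ x₆ = 0 := by
        -- a pair of arcs crosses in at most one of the three pairings
        have e4 : crossNum x₁ x₆ x₃ x₄ = 1 := e1
        unfold crossNum ltNum at e4 ⊢
        simp only [Fin.lt_def] at e4 ⊢
        have g13 : (x₁ : ℕ) ≠ x₃ := fun e => m13 (Fin.ext e)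
        have g14 : (x₁ : ℕ) ≠ x₄ := fun e => m14 (Fin.ext e)
        have g16 : (x₁ : ℕ) ≠ x₆ := fun e => m16 (Fin.ext e)
        have g34 : (x₃ : ℕ) ≠ x₄ := fun e => m34 (Fin.ext e)
        have g36 : (x₃ : ℕ) ≠ x₆ := fun e => m36 (Fin.ext e)
        have g46 : (x₄ : ℕ) ≠ x₆ := fun e => m46 (Fin.ext e)
        split_ifs at e4 ⊢ <;> first | rfl | (exfalso; omega) | (exfalso; revert e4; decide)
      rw [← hsum, k]
    have hA : crossNum x₁ x₄ (a₁ x₁) (a₁ x₄) = 0 := by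
      rw [h.e12, s34, crossNum_comm m12 m13 m24.symm m34.symm, crossNum_trans' _ _ x₁ x₆,
        crossNum_trans' _ _ x₆ x₅, a₃.crossNum_arcs h.g23 t61 m12 m13, crossNum_swap' _ _ x₆, hc',
        a₃.crossNum_arcs h.g23 t45 m25.symm m35.symm, add_zero, add_zero]
    have hB : ∀ q, q ≠ x₁ → q ≠ x₄ → q ≠ a₁ x₁ → q ≠ a₁ x₄ →
        crossNum x₁ x₄ q (a₁ q) = 0 := by
      intro q e1 e2 e3 e4
      rw [h.e12] at e3
      rw [s34] at e4
      have key : ∀ q q', q ≠ x₁ → q ≠ x₂ → q ≠ x₃ → q ≠ x₄ → a₁ q = q' →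
          crossNum x₂ x₃ q q' = 0 → crossNum x₁ x₄ q q' = 0 := by
        intro q q' e1 e2 e3 e4 e5 e6
        rw [crossNum_trans _ x₂, crossNum_trans x₂ x₃, e6, a₁.crossNum_arcs h.e12 e5 e1 e2,
          a₁.crossNum_arcs h.e34 e5 e3 e4]
        rfl
      by_cases f5 : q = x₅
      · rw [f5, h.e56]
        exact key _ _ m15.symm m25.symm m35.symm m45.symm h.e56 hc'
      by_cases f6 : q = x₆
      · rw [f6, s56]
        exact key _ _ m16.symm m26.symm m36.symm m46.symm s56 (by rw [crossNum_swap', hc'])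
      · refine key _ _ e1 e3 e4 e2 rfl ?_
        rw [← (h.other q e1 e3 e4 e2 f5 f6).2]
        exact a₃.crossNum_arcs h.g23 rfl e3 e4
    obtain ⟨a', ha'⟩ := a₁.exists_surgeryAt (i := x₁) (j := x₄) m14.symm
      (by rw [h.e12]; exact m24.symm) hA hB
    have hs := Surg.of_surgeryAt a₁.isArcs a'.isArcs ha'
    refine ⟨a', Or.inr ⟨h.e56, h.e12, h.e34, ?_, ?_, hs.at_i, h.g61, h.g23, h.g45, m26.symm,
      m46.symm, m24, fun p e1 e2 e3 e4 e5 e6 => ?_⟩⟩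
    · rw [hs.other x₅ m15.symm m45.symm (by rw [h.e12]; exact m25.symm)
        (by rw [s34]; exact m35.symm), h.e56]
    · have := hs.at_mi
      rwa [h.e12, s34] at this
    · have := h.other p e3 e4 e5 e6 e1 e2
      exact ⟨hs.other p e3 e6 (by rwa [h.e12]) (by rwa [s34]), this.2⟩

end one

end Hex

end planar

end BorderedKh

namespace BorderedKh

section planar

variable {n : ℕ} {a₁ a a' a'' a₃ : NCMatching n}

namespace Hex

variable {x₁ x₂ x₃ x₄ x₅ x₆ : Fin (2 * n)}

/-- The three matchings in a hexagon form a triad. -/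
theorem isTriad (h : Hex a₁ a a₃ x₁ x₂ x₃ x₄ x₅ x₆) (h' : Hex a₁ a' a₃ x₃ x₄ x₅ x₆ x₁ x₂)
    (h'' : Hex a₁ a'' a₃ x₅ x₆ x₁ x₂ x₃ x₄) : IsTriad a₁ a a' a'' := by
  obtain ⟨⟨m12, m13, m14, m15, m16⟩, ⟨m23, m24, m25, m26⟩, ⟨m34, m35, m36⟩, ⟨m45, m46⟩, m56⟩ := h.nodup
  refine ⟨h.surg₁.isSurgery, h'.surg₁.isSurgery, h''.surg₁.isSurgery, fun p => ?_⟩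
  rw [h.moved_iff, h'.moved_iff, h''.moved_iff]
  unfold Xor
  by_cases e1 : p = x₁
  · subst e1; simp [*]
  by_cases e2 : p = x₂
  · subst e2; simp [*]
  by_cases e3 : p = x₃
  · subst e3; simp [m35, m36, m34, m13.symm, m23.symm]
  by_cases e4 : p = x₄
  · subst e4; simp [m45, m46, m34.symm, m14.symm, m24.symm]
  by_cases e5 : p = x₅
  · subst e5; simp [m56, m45.symm, m35.symm, m15.symm, m25.symm]
  by_cases e6 : p = x₆
  · subst e6; simp [m46.symm, m36.symm, m16.symm, m26.symm, m56.symm]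
  · simp [*]

theorem _root_.BorderedKh.IsTriad.swap (h : IsTriad a₁ a a' a'') : IsTriad a₁ a' a a'' :=
  ⟨h.2.1, h.1, h.2.2.1, fun p => (h.2.2.2 p).trans (by unfold Xor; tauto)⟩

theorem _root_.BorderedKh.IsTriad.ne (h : IsTriad a₁ a a' a'') : a'' ≠ a ∧ a'' ≠ a' := by
  constructor
  · rintro rfl
    obtain ⟨i, j, hs⟩ := h.2.1.exists_surg
    have := h.2.2.2 i
    have := (hs.moved_iff i).2 (Or.inl rfl)
    unfold Xor at *
    tauto
  · rintro rfl
    obtain ⟨i, j, hs⟩ := h.1.exists_surg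
    have := h.2.2.2 i
    have := (hs.moved_iff i).2 (Or.inl rfl)
    unfold Xor at *
    tauto

/-- The third matching of a triad. -/
theorem exists_third (h : Hex a₁ a a₃ x₁ x₂ x₃ x₄ x₅ x₆) (h' : Hex a₁ a' a₃ x₃ x₄ x₅ x₆ x₁ x₂)
    (ht : IsTriad a₁ a a' a'') : Hex a₁ a'' a₃ x₅ x₆ x₁ x₂ x₃ x₄ := by
  obtain ⟨⟨m12, m13, m14, m15, m16⟩, ⟨m23, m24, m25, m26⟩, ⟨m34, m35, m36⟩, ⟨m45, m46⟩, m56⟩ := h.nodup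
  have hm : ∀ p, a'' p ≠ a₁ p ↔ Xor (p = x₃ ∨ p = x₆ ∨ p = x₄ ∨ p = x₅)
      (p = x₅ ∨ p = x₂ ∨ p = x₆ ∨ p = x₁) := by
    intro p
    rw [ht.2.2.2, h.moved_iff, h'.moved_iff]
  have h1 : a'' x₁ ≠ a₁ x₁ := by rw [hm]; simp [Xor, *]
  have h4 : a'' x₄ ≠ a₁ x₄ := by
    rw [hm]; simp [Xor, m45, m46, m34.symm, m14.symm, m24.symm]
  have hs := ht.2.2.1.surg h1
  have hc := h.col_eqs
  have v1 : a'' x₁ = x₄ := by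
    rcases (hs.moved_iff x₄).1 h4 with e | e | e | e
    · exact absurd e.symm m14
    · exact e.symm
    · rw [h.e12] at e; exact absurd e.symm m24
    · have := hs.col_eq
      rw [← a₁.eq_symm e.symm, a₁.col_eq, hc.2.2.1] at this
      cases hx : NCMatching.col x₁ <;> simp [hx] at this
  rw [v1] at hs
  have s34 := a₁.eq_symm h.e34
  have v2 := hs.at_mi
  rw [h.e12, s34] at v2
  have v5 : a'' x₅ = x₆ := by
    rw [hs.other x₅ m15.symm m45.symm (by rw [h.e12]; exact m25.symm)
      (by rw [s34]; exact m35.symm), h.e56]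
  refine ⟨h.e56, h.e12, h.e34, v5, v2, v1, h.g61, h.g23, h.g45, m26.symm, m46.symm, m24,
    fun p e1 e2 e3 e4 e5 e6 => ?_⟩
  exact ⟨hs.other p e3 e6 (by rwa [h.e12]) (by rwa [s34]), (h.other p e3 e4 e5 e6 e1 e2).2⟩

/-- Two of the matchings in a hexagon, and the third one of their triad. -/
theorem third_of_between (h : Hex a₁ a a₃ x₁ x₂ x₃ x₄ x₅ x₆) (hb : Between a₁ a' a₃)
    (hne : a ≠ a') (ht : IsTriad a₁ a a' a'') : Between a₁ a'' a₃ := by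
  rcases h.rotate_of_between hb hne with h' | h'
  · exact (h.exists_third h' ht).between
  · exact (h'.exists_third h ht.swap).between

theorem isTriad_of_between (h : Hex a₁ a a₃ x₁ x₂ x₃ x₄ x₅ x₆) (hb : Between a₁ a' a₃)
    (hb' : Between a₁ a'' a₃) (hne : a ≠ a') (hne' : a ≠ a'') (hne'' : a' ≠ a'') :
    IsTriad a₁ a a' a'' := by
  rcases h.rotate_of_between hb hne with h1 | h1 <;> rcases h.rotate_of_between hb' hne' with h2 | h2
  · exact absurd (h1.unique h2) hne''
  · exact h.isTriad h1 h2
  · exact (h1.isTriad h h2).swap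
  · exact absurd (h1.unique h2) hne''

end Hex

namespace Between

theorem disjoint_or (h : Between a₁ a a₃) : (∀ p, a₁ p = a p ∨ a₃ p = a p) ∨
    ∃ x₁ x₂ x₃ x₄ x₅ x₆, Hex a₁ a a₃ x₁ x₂ x₃ x₄ x₅ x₆ := by
  by_cases hd : ∀ p, a₁ p = a p ∨ a₃ p = a p
  · exact Or.inl hd
  · push Not at hd
    obtain ⟨p, h1, h2⟩ := hd
    exact Or.inr (h.exists_hex h1 h2)

theorem eq_of_crossing (h : Between a₁ a a₃) (hc : Crossing a a₁ a₃) (h' : Between a₁ a' a₃) :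
    a' = a := by
  by_contra hne
  exact hc.2 ⟨a', h.eq_of_disjoint h' (Ne.symm hne) hc.1⟩

theorem exists_ne (h : Between a₁ a a₃) (hc : ¬ Crossing a a₁ a₃) :
    ∃ a', Between a₁ a' a₃ ∧ a' ≠ a := by
  rcases h.disjoint_or with hd | ⟨x₁, x₂, x₃, x₄, x₅, x₆, hx⟩
  · have : ∃ a' : NCMatching n, ∀ p, (a₁ p ≠ a p → a' p = a₁ p) ∧ (a₁ p = a p → a' p = a₃ p) := by
      by_contra h'
      exact hc ⟨hd, h'⟩
    obtain ⟨a', ha'⟩ := this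
    exact ⟨a', h.of_disjoint hd ha'⟩
  · obtain ⟨⟨m12, m13, m14, m15, m16⟩, ⟨m23, m24, m25, m26⟩, -⟩ := hx.nodup
    obtain ⟨a', h1 | h1⟩ := hx.exists_rotate
    · refine ⟨a', h1.between, fun e => ?_⟩
      have := a'.eq_symm h1.f45
      rw [e, hx.f12] at this
      exact m26 this
    · refine ⟨a', h1.between, fun e => ?_⟩
      have := h1.f36
      rw [e, hx.f12] at this
      exact m24 this

/-- Two matchings between `a₁` and `a₃` that belong to a triad. -/
theorem third (h : Between a₁ a a₃) (h' : Between a₁ a' a₃) (hne : a ≠ a')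
    (ht : IsTriad a₁ a a' a'') : Between a₁ a'' a₃ := by
  rcases h.disjoint_or with hd | ⟨x₁, x₂, x₃, x₄, x₅, x₆, hx⟩
  · exfalso
    have he := h.eq_of_disjoint h' hne hd
    obtain ⟨i, j, hs⟩ := h.fst.exists_surg
    have hi := (hs.moved_iff i).2 (Or.inl rfl)
    have hj := (hs.moved_iff j).2 (Or.inr (Or.inl rfl))
    have m1 : ∀ p, a p ≠ a₁ p → a'' p ≠ a₁ p := by
      intro p hp
      rw [ht.2.2.2]
      exact Or.inl ⟨hp, not_not.2 ((he p).1 hp.symm)⟩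
    have e : a = a'' := ht.1.unique ht.2.2.1 hi (m1 i hi) hj (m1 j hj) hs.ne_i hs.ne
    exact ht.ne.1 e.symm
  · exact hx.third_of_between h' hne ht

theorem isTriad (h : Between a₁ a a₃) (h' : Between a₁ a' a₃) (h'' : Between a₁ a'' a₃)
    (hne : a ≠ a') (hne' : a ≠ a'') (hne'' : a' ≠ a'') : IsTriad a₁ a a' a'' := by
  rcases h.disjoint_or with hd | ⟨x₁, x₂, x₃, x₄, x₅, x₆, hx⟩
  · refine absurd (NCMatching.ext fun p => ?_) hne''
    have e1 := h.eq_of_disjoint h' hne hd p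
    have e2 := h.eq_of_disjoint h'' hne' hd p
    by_cases hp : a₁ p = a p
    · rw [e1.2 hp, e2.2 hp]
    · rw [e1.1 hp, e2.1 hp]
  · exact hx.isTriad_of_between h' h'' hne hne' hne''

theorem exists_hex_of_isTriad (h : Between a₁ a a₃) (h' : Between a₁ a' a₃)
    (h'' : Between a₁ a'' a₃) (hne : a ≠ a') (hne' : a ≠ a'') (hne'' : a' ≠ a'') :
    ∃ b b' x₁ x₂ x₃ x₄ x₅ x₆, Hex a₁ a a₃ x₁ x₂ x₃ x₄ x₅ x₆ ∧ Hex a₁ b a₃ x₃ x₄ x₅ x₆ x₁ x₂ ∧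
      Hex a₁ b' a₃ x₅ x₆ x₁ x₂ x₃ x₄ := by
  rcases h.disjoint_or with hd | ⟨x₁, x₂, x₃, x₄, x₅, x₆, hx⟩
  · refine absurd (NCMatching.ext fun p => ?_) hne''
    have e1 := h.eq_of_disjoint h' hne hd p
    have e2 := h.eq_of_disjoint h'' hne' hd p
    by_cases hp : a₁ p = a p
    · rw [e1.2 hp, e2.2 hp]
    · rw [e1.1 hp, e2.1 hp]
  · rcases hx.rotate_of_between h' hne with h1 | h1 <;>
      rcases hx.rotate_of_between h'' hne' with h2 | h2
    · exact absurd (h1.unique h2) hne''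
    · exact ⟨_, _, _, _, _, _, _, _, hx, h1, h2⟩
    · exact ⟨_, _, _, _, _, _, _, _, hx, h2, h1⟩
    · exact absurd (h1.unique h2) hne''

/-- There are at most three matchings between `a₁` and `a₃`. -/
theorem eq_third {a₄ : NCMatching n} (h : Between a₁ a a₃) (h' : Between a₁ a' a₃)
    (h'' : Between a₁ a'' a₃) (h₄ : Between a₁ a₄ a₃) (hne : a ≠ a') (hne' : a ≠ a'')
    (hne'' : a' ≠ a'') (h1 : a₄ ≠ a) (h2 : a₄ ≠ a') : a₄ = a'' := by
  have t1 := h.isTriad h' h'' hne hne' hne''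
  have t2 := h.isTriad h' h₄ hne h1.symm h2.symm
  have hm : ∀ p, a₄ p ≠ a₁ p ↔ a'' p ≠ a₁ p := fun p => (t2.2.2.2 p).trans (t1.2.2.2 p).symm
  obtain ⟨i, j, hs⟩ := h₄.fst.exists_surg
  have hi := (hs.moved_iff i).2 (Or.inl rfl)
  have hj := (hs.moved_iff j).2 (Or.inr (Or.inl rfl))
  exact h₄.fst.unique h''.fst hi ((hm i).1 hi) hj ((hm j).1 hj) hs.ne_i hs.ne

/-- In a triad, it does not happen that the first surgery splits a circle and the second one joins
the two new circles. -/
theorem not_rejoin (b : NCMatching n) (h : Between a₁ a a₃) (h' : Between a₁ a' a₃)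
    (h'' : Between a₁ a'' a₃) (hne : a ≠ a') (hne' : a ≠ a'') (hne'' : a' ≠ a'')
    {i j k l : Fin (2 * n)} (hs : Surg NCMatching.col a₁ a i j) (ht : Surg NCMatching.col a a₃ k l)
    (hk : SameCircle b a k i) (hl : SameCircle b a l (a₁ i)) (hkl : ¬ SameCircle b a k l) : False := by
  classical
  obtain ⟨b₁, b₂, x₁, x₂, x₃, x₄, x₅, x₆, hx, hx', hx''⟩ :=
    h.exists_hex_of_isTriad h' h'' hne hne' hne''
  obtain ⟨⟨m12, m13, m14, m15, m16⟩, ⟨m23, m24, m25, m26⟩, ⟨m34, m35, m36⟩, ⟨m45, m46⟩, m56⟩ :=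
    hx.nodup
  have c12 : SameCircle b a x₁ x₂ := hx.f12 ▸ SameCircle.right x₁
  have c45 : SameCircle b a x₄ x₅ := hx.f45 ▸ SameCircle.right x₄
  have c36 : SameCircle b a x₃ x₆ := hx.f36 ▸ SameCircle.right x₃
  have hii : ¬ SameCircle b a i (a₁ i) := fun e => hkl (hk.trans (e.trans hl.symm))
  -- the circles of the first surgery
  have hi : (SameCircle b a i x₃ ∧ SameCircle b a (a₁ i) x₄) ∨
      (SameCircle b a i x₄ ∧ SameCircle b a (a₁ i) x₃) := by
    rcases (hx.moved_iff i).1 ((hs.moved_iff i).2 (Or.inl rfl)) with rfl | rfl | rfl | rfl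
    · exact Or.inl ⟨.refl _, by rw [hx.e34]; exact .refl _⟩
    · exact Or.inl ⟨c36.symm, by rw [a₁.eq_symm hx.e56]; exact c45.symm⟩
    · exact Or.inr ⟨.refl _, by rw [a₁.eq_symm hx.e34]; exact .refl _⟩
    · exact Or.inr ⟨c45.symm, by rw [hx.e56]; exact c36.symm⟩
  have hk' : ∀ y, a₃ y ≠ a y → SameCircle b a y x₃ ∨ SameCircle b a y x₁ := by
    intro y hy
    rcases (hx.surg₂.moved_iff y).1 hy with rfl | rfl | rfl | rfl
    · exact Or.inl (.refl _)
    · exact Or.inr c12.symm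
    · rw [hx.f36]; exact Or.inl c36.symm
    · rw [a.eq_symm hx.f12]; exact Or.inr (.refl _)
  have hkm := hk' k ((ht.moved_iff k).2 (Or.inl rfl))
  have hlm := hk' l ((ht.moved_iff l).2 (Or.inr (Or.inl rfl)))
  have c34 : ¬ SameCircle b a x₃ x₄ := by
    rcases hi with ⟨h1, h2⟩ | ⟨h1, h2⟩
    · exact fun e => hii (h1.trans (e.trans h2.symm))
    · exact fun e => hii (h1.trans (e.symm.trans h2.symm))
  have c14 : SameCircle b a x₁ x₄ := by
    rcases hkm with h1 | h1 <;> rcases hlm with h2 | h2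
    · exact absurd (h1.trans h2.symm) hkl
    · rcases hi with ⟨h3, h4⟩ | ⟨h3, h4⟩
      · exact h2.symm.trans (hl.trans h4)
      · exact absurd (h1.symm.trans (hk.trans h3)) c34
    · rcases hi with ⟨h3, h4⟩ | ⟨h3, h4⟩
      · exact absurd (h2.symm.trans (hl.trans h4)) c34
      · exact h1.symm.trans (hk.trans h3)
    · exact absurd (h1.trans h2.symm) hkl
  have c31 : ¬ SameCircle b a x₃ x₁ := fun e => c34 (e.trans c14)
  -- the parity of the number of points of the circle of `x₃` to the right of a point
  set S : Finset (Fin (2 * n)) := Finset.univ.filter fun q => SameCircle b a x₃ q with hS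
  have mem_S : ∀ q, q ∈ S ↔ SameCircle b a x₃ q := fun q => by simp [hS]
  have par : ∑ q ∈ S, ltNum x₁ q = ∑ q ∈ S, ltNum x₄ q := by
    have hE : Equivalence fun x y => (SameCircle b a x₃ x ↔ SameCircle b a x₃ y) ∧
        (¬ SameCircle b a x₃ x → ∑ q ∈ S, ltNum x q = ∑ q ∈ S, ltNum y q) :=
      ⟨fun _ => ⟨Iff.rfl, fun _ => rfl⟩,
        fun h => ⟨h.1.symm, fun e => (h.2 (mt h.1.1 e)).symm⟩,
        fun h h' => ⟨h.1.trans h'.1, fun e => (h.2 e).trans (h'.2 (mt h.1.2 e))⟩⟩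
    have step : ∀ c : NCMatching n, (∀ p, SameCircle b a p (c p)) → ∀ p,
        (SameCircle b a x₃ p ↔ SameCircle b a x₃ (c p)) ∧
        (¬ SameCircle b a x₃ p → ∑ q ∈ S, ltNum p q = ∑ q ∈ S, ltNum (c p) q) := by
      intro c hc p
      refine ⟨⟨fun e => e.trans (hc p), fun e => e.trans (hc p).symm⟩, fun e => ?_⟩
      have := c.sum_ltNum S (fun x hx => (mem_S _).2 (((mem_S x).1 hx).trans (hc x)))
        (mt (mem_S p).1 e)
      rw [Finset.sum_add_distrib] at this
      linear_combination this - (∑ q ∈ S, ltNum (c p) q) * two_eq_zero_zmod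
    exact (SameCircle.of_le hE (step b .left) (step a .right) c14).2 c31
  have hS3 : x₃ ∈ S := (mem_S _).2 (.refl _)
  have hS6 : x₆ ∈ S := (mem_S _).2 c36
  have off : ∀ q ∈ (S.erase x₃).erase x₆, q ≠ x₃ ∧ q ≠ x₆ ∧ SameCircle b a x₃ q ∧ b₂ q = a q ∧
      a q ≠ x₃ ∧ a q ≠ x₆ := by
    intro q hq
    rw [Finset.mem_erase, Finset.mem_erase, mem_S] at hq
    obtain ⟨h6, h3, hq⟩ := hq
    have n1 : q ≠ x₁ := by rintro rfl; exact c31 hq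
    have n2 : q ≠ x₂ := by rintro rfl; exact c31 (hq.trans c12.symm)
    have n4 : q ≠ x₄ := by rintro rfl; exact c34 hq
    have n5 : q ≠ x₅ := by rintro rfl; exact c34 (hq.trans c45.symm)
    refine ⟨h3, h6, hq, ?_, fun e => h6 ?_, fun e => h3 ?_⟩
    · rw [(hx''.other q n5 h6 n1 n2 h3 n4).1, (hx.other q n1 n2 h3 n4 n5 h6).1]
    · rw [← hx.f36, ← e, a.invol]
    · rw [← a.eq_symm hx.f36, ← e, a.invol]
  have par' := b₂.sum_ltNum ((S.erase x₃).erase x₆) (fun q hq => ?_) (p := x₁) (fun e => by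
    exact c31 (off _ e).2.2.1)
  · rw [hx''.f36, Finset.sum_add_distrib] at par'
    have hS6' : x₆ ∈ S.erase x₃ := Finset.mem_erase.2 ⟨m36.symm, hS6⟩
    rw [← Finset.add_sum_erase S _ hS3, ← Finset.add_sum_erase _ _ hS6',
      ← Finset.add_sum_erase S _ hS3, ← Finset.add_sum_erase _ _ hS6'] at par
    have k1436 : crossNum x₁ x₄ x₃ x₆ = 0 := by
      unfold crossNum
      linear_combination par + par' + (ltNum x₄ x₃ + ltNum x₄ x₆ -
        ∑ q ∈ (S.erase x₃).erase x₆, ltNum x₁ q) * two_eq_zero_zmod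
    have k1634 : crossNum x₁ x₆ x₃ x₄ = 0 := by
      rw [crossNum_swap]
      exact b₁.crossNum_arcs hx'.f45 hx'.f12 m36 m13.symm
    have k1346 : crossNum x₁ x₃ x₄ x₆ = 0 := by
      rw [crossNum_trans x₁ x₂, crossNum_trans' x₁ x₂ x₄ x₅, crossNum_trans' x₂ x₃ x₄ x₅,
        a.crossNum_arcs hx.f12 hx.f45 m14.symm m24.symm,
        a₁.crossNum_arcs hx.e12 hx.e56 m15.symm m25.symm,
        a₃.crossNum_arcs hx.g23 hx.g45 m24.symm m34.symm,
        b₂.crossNum_arcs hx''.f45 hx''.f12 m25.symm m35.symm]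
      rfl
    have := crossNum_pairings (w := x₁) (x := x₃) (y := x₄) (z := x₆) m34 m36 m46
    rw [k1436, k1634, k1346] at this
    revert this
    decide
  · obtain ⟨h3, h6, hq', hb, h3', h6'⟩ := off q hq
    rw [hb, Finset.mem_erase, Finset.mem_erase, mem_S]
    exact ⟨h6', h3', hq'.trans (.right q)⟩

end Between

end planar

end BorderedKh

namespace BorderedKh

/-! ### The generators of `B` in terms of surgeries -/

section reach

variable {X : Type} [Fintype X]

open Classical in
/-- `ℓ'` occurs in the image of `ℓ` under the composition of the saddle maps. -/
def SaddleReach (f : X → X) : List (X × X) → (X → X) → (X → Bool) → (X → Bool) → Prop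
  | [], _, ℓ, ℓ' => ℓ = ℓ'
  | (i, j) :: rest, m, ℓ, ℓ' =>
      ∃ ℓ₁ : X → Bool,
        ((∀ k, ℓ₁ (f k) = ℓ₁ k) ∧ (∀ k, ℓ₁ (surger m i j k) = ℓ₁ k) ∧ SaddleRule f m i j ℓ ℓ₁) ∧
        SaddleReach f rest (surger m i j) ℓ₁ ℓ'

theorem saddleCoeff_nonneg (f : X → X) (L : List (X × X)) (m : X → X) (ℓ ℓ' : X → Bool) :
    0 ≤ saddleCoeff f L m ℓ ℓ' := by
  induction L generalizing m ℓ with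
  | nil =>
    rw [saddleCoeff]
    split_ifs <;> decide
  | cons x rest ih =>
    obtain ⟨i, j⟩ := x
    rw [saddleCoeff]
    refine Finset.sum_nonneg fun ℓ₁ _ => ?_
    split_ifs
    · exact ih _ _
    · exact le_rfl

theorem saddleCoeff_ne_zero (f : X → X) (L : List (X × X)) (m : X → X) (ℓ ℓ' : X → Bool) :
    saddleCoeff f L m ℓ ℓ' ≠ 0 ↔ SaddleReach f L m ℓ ℓ' := by
  induction L generalizing m ℓ with
  | nil =>
    rw [saddleCoeff, SaddleReach]
    split_ifs with h <;> simp [h]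
  | cons x rest ih =>
    obtain ⟨i, j⟩ := x
    rw [saddleCoeff, SaddleReach, ne_eq, Finset.sum_eq_zero_iff_of_nonneg]
    · push Not
      refine exists_congr fun ℓ₁ => ?_
      rw [← ih]
      split_ifs with h
      · simp only [Finset.mem_univ, true_and]
        exact ⟨fun e => ⟨h, e⟩, fun e => e.2⟩
      · simp only [ne_eq, not_true_eq_false, and_false, false_iff]
        exact fun e => h e.1
    · intro ℓ₁ _
      split_ifs
      · exact saddleCoeff_nonneg _ _ _ _ _
      · exact le_rfl

/-- A diagram on `X` whose circles are those of a diagram on `P`, by a map `φ`, and some others. -/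
structure Model {P : Type} (f m : X → X) (D : P → P → Prop) (Main : X → Prop) (φ : X → P)
    (ι : P → X) : Prop where
  equiv : Equivalence D
  main_f : ∀ z, Main z ↔ Main (f z)
  main_m : ∀ z, Main z ↔ Main (m z)
  φ_f : ∀ z, Main z → D (φ z) (φ (f z))
  φ_m : ∀ z, Main z → D (φ z) (φ (m z))
  main_ι : ∀ x, Main (ι x)
  φ_ι : ∀ x, φ (ι x) = x
  rep : ∀ z, Main z → SameCircle f m z (ι (φ z))
  le : ∀ x y, D x y → SameCircle f m (ι x) (ι y)

open Classical in
/-- The labelling of the larger diagram. -/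
noncomputable def lab {P : Type} (Main : X → Prop) (φ : X → P) (σ : P → Bool) (τ : X → Bool) :
    X → Bool := fun z => if Main z then σ (φ z) else τ z

namespace Model

variable {P : Type} {f m m' : X → X} {D D' : P → P → Prop} {Main Main' : X → Prop} {φ φ' : X → P}
  {ι : P → X} {σ σ' : P → Bool} {τ : X → Bool}

theorem main_iff (M : Model f m D Main φ ι) {z w : X} (h : SameCircle f m z w) : Main z ↔ Main w :=
  SameCircle.mem_iff M.main_f M.main_m h

theorem rel (M : Model f m D Main φ ι) {z w : X} (h : SameCircle f m z w) (hz : Main z) :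
    D (φ z) (φ w) := by
  have hE : Equivalence fun z w => (Main z ↔ Main w) ∧ (Main z → D (φ z) (φ w)) :=
    ⟨fun z => ⟨Iff.rfl, fun _ => M.equiv.refl _⟩,
      fun h => ⟨h.1.symm, fun hz => M.equiv.symm (h.2 (h.1.2 hz))⟩,
      fun h h' => ⟨h.1.trans h'.1, fun hz => M.equiv.trans (h.2 hz) (h'.2 (h.1.1 hz))⟩⟩
  exact (SameCircle.of_le hE (fun p => ⟨M.main_f p, M.φ_f p⟩) (fun p => ⟨M.main_m p, M.φ_m p⟩) h).2 hz

theorem same_iff (M : Model f m D Main φ ι) {z w : X} (hz : Main z) (hw : Main w) :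
    SameCircle f m z w ↔ D (φ z) (φ w) :=
  ⟨fun h => M.rel h hz, fun h => (M.rep z hz).trans ((M.le _ _ h).trans (M.rep w hw).symm)⟩

theorem lab_main (hz : Main z) : lab Main φ σ τ z = σ (φ z) := if_pos hz

theorem lab_not_main (hz : ¬ Main z) : lab Main φ σ τ z = τ z := if_neg hz

theorem lab_f (M : Model f m D Main φ ι) (hσ : ∀ x y, D x y → σ x = σ y)
    (hτ : ∀ z, ¬ Main z → τ (f z) = τ z) (z : X) : lab Main φ σ τ (f z) = lab Main φ σ τ z := by
  by_cases hz : Main z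
  · rw [lab_main hz, lab_main ((M.main_f z).1 hz), hσ _ _ (M.φ_f z hz)]
  · rw [lab_not_main hz, lab_not_main (mt (M.main_f z).2 hz), hτ z hz]

theorem lab_m (M : Model f m D Main φ ι) (hσ : ∀ x y, D x y → σ x = σ y)
    (hτ : ∀ z, ¬ Main z → τ (m z) = τ z) (z : X) : lab Main φ σ τ (m z) = lab Main φ σ τ z := by
  by_cases hz : Main z
  · rw [lab_main hz, lab_main ((M.main_m z).1 hz), hσ _ _ (M.φ_m z hz)]
  · rw [lab_not_main hz, lab_not_main (mt (M.main_m z).2 hz), hτ z hz]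

theorem const_of (M : Model f m D Main φ ι) {ℓ : X → Bool} (h1 : ∀ k, ℓ (f k) = ℓ k)
    (h2 : ∀ k, ℓ (m k) = ℓ k) {z w : X} (h : SameCircle f m z w) : ℓ z = ℓ w :=
  SameCircle.of_le (r := fun z w => ℓ z = ℓ w) ⟨fun _ => rfl, Eq.symm, Eq.trans⟩
    (fun p => (h1 p).symm) (fun p => (h2 p).symm) h

/-- A saddle that joins another circle to the main diagram. -/
theorem merge_iff (M : Model f m D Main φ ι) (M' : Model f m' D Main' φ' ι) {i j : X} (hi : Main i)
    (hj : ¬ Main j) (hM : ∀ z, Main' z ↔ Main z ∨ SameCircle f m j z)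
    (hφ : ∀ z, Main z → φ' z = φ z) (hσ : ∀ x y, D x y → σ x = σ y)
    (hτ : ∀ z, ¬ Main z → τ (f z) = τ z) (hτ' : ∀ z, ¬ Main' z → τ (m' z) = τ z) (ℓ : X → Bool) :
    ((∀ k, ℓ (f k) = ℓ k) ∧ (∀ k, ℓ (m' k) = ℓ k) ∧ SaddleRule f m i j (lab Main φ σ τ) ℓ) ↔
      (τ j = true ∧ ℓ = lab Main' φ' σ τ) ∨
      (τ j = false ∧ σ (φ i) = true ∧ ℓ = lab Main' φ' (relabel D (φ i) false σ) τ) := by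
  classical
  have hij : ¬ SameCircle f m i j := fun h => hj ((M.main_iff h).1 hi)
  have hi' : Main' i := (hM i).2 (Or.inl hi)
  have hr : ∀ x y, D x y → relabel D (φ i) false σ x = relabel D (φ i) false σ y := by
    intro x y h
    unfold relabel
    have : D (φ i) x ↔ D (φ i) y :=
      ⟨fun e => M.equiv.trans e h, fun e => M.equiv.trans e (M.equiv.symm h)⟩
    simp only [this, hσ x y h]
  unfold SaddleRule
  rw [if_neg hij, lab_main hi, lab_not_main hj]
  constructor
  · rintro ⟨h1, h2, h3, h4⟩
    have key : ∀ s : P → Bool, (∀ x, D (φ i) x → s x = ℓ i) → (∀ x, ¬ D (φ i) x → s x = σ x) →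
        ℓ = lab Main' φ' s τ := by
      intro s hs1 hs2
      ext z
      by_cases hz : Main' z
      · rw [lab_main hz, M'.const_of h1 h2 (M'.rep z hz)]
        by_cases hd : D (φ i) (φ' z)
        · rw [hs1 _ hd]
          refine (M'.const_of h1 h2 ?_).symm
          rw [M'.same_iff hi' (M'.main_ι _), M'.φ_ι, hφ i hi]
          exact hd
        · rw [hs2 _ hd, h3, lab_main (M.main_ι _), M.φ_ι]
          · rw [M.same_iff hi (M.main_ι _), M.φ_ι]
            exact hd
          · exact fun e => hj ((M.main_iff e).2 (M.main_ι _))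
      · have hz' := mt (hM z).2 hz
        rw [not_or] at hz'
        rw [lab_not_main hz, h3, lab_not_main hz'.1]
        · exact fun e => hz'.1 ((M.main_iff e).1 hi)
        · exact hz'.2
    cases ht : τ j
    · rw [ht] at h4
      refine Or.inr ⟨rfl, ?_, key _ (fun x hx => ?_) fun x hx => if_neg hx⟩
      · rcases h4 with h4 | h4
        · exact h4.1
        · exact absurd h4.2.1 (by simp)
      · unfold relabel
        rw [if_pos hx]
        rcases h4 with h4 | h4
        · exact h4.2.symm
        · exact h4.2.2.symm
    · rw [ht] at h4
      refine Or.inl ⟨rfl, key _ (fun x hx => ?_) fun x hx => rfl⟩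
      rw [← hσ _ _ hx]
      rcases h4 with h4 | h4
      · rw [h4.1, h4.2]
      · rw [h4.1, h4.2.2]
  · have key : ∀ s : P → Bool, (∀ x y, D x y → s x = s y) → (∀ x, ¬ D (φ i) x → s x = σ x) →
        ((∀ k, lab Main' φ' s τ (f k) = lab Main' φ' s τ k) ∧
          (∀ k, lab Main' φ' s τ (m' k) = lab Main' φ' s τ k) ∧
          ∀ k, ¬ SameCircle f m i k → ¬ SameCircle f m j k →
            lab Main' φ' s τ k = lab Main φ σ τ k) := by
      intro s hs hs'
      refine ⟨M'.lab_f hs fun z hz => hτ z fun e => hz ((hM z).2 (Or.inl e)), M'.lab_m hs hτ',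
        fun k hk hk' => ?_⟩
      by_cases hz : Main k
      · rw [lab_main hz, lab_main ((hM k).2 (Or.inl hz)), hφ k hz, hs']
        rwa [← M.same_iff hi hz]
      · rw [lab_not_main hz, lab_not_main]
        rw [hM, not_or]
        exact ⟨hz, hk'⟩
    rintro (⟨ht, rfl⟩ | ⟨ht, hs, rfl⟩)
    · obtain ⟨k1, k2, k3⟩ := key σ hσ fun _ _ => rfl
      refine ⟨k1, k2, k3, ?_⟩
      rw [lab_main hi', ht, hφ i hi]
      cases σ (φ i) <;> simp
    · obtain ⟨k1, k2, k3⟩ := key _ hr fun x hx => if_neg hx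
      refine ⟨k1, k2, k3, ?_⟩
      rw [lab_main hi', ht, hφ i hi, hs]
      unfold relabel
      rw [if_pos (M.equiv.refl _)]
      simp

/-- A saddle inside the main diagram. -/
theorem bridge_iff {a b : P → P} (M : Model f m (SameCircle a b) Main φ ι)
    (M' : Model f m' D' Main φ' ι) {i j : X} (hi : Main i) (hj : Main j)
    (hmi : φ (m i) = b (φ i)) (hι : i = ι (φ i)) (hι' : m i = ι (b (φ i)))
    (hφ : ∀ z, Main z → D' (φ' z) (φ z))
    (hτ : ∀ z, ¬ Main z → τ (f z) = τ z) (hτ' : ∀ z, ¬ Main z → τ (m' z) = τ z) (ℓ : X → Bool) :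
    ((∀ k, ℓ (f k) = ℓ k) ∧ (∀ k, ℓ (m' k) = ℓ k) ∧ SaddleRule f m i j (lab Main φ σ τ) ℓ) ↔
      ∃ s : P → Bool, (∀ x y, D' x y → s x = s y) ∧ SaddleRule a b (φ i) (φ j) σ s ∧
        ℓ = lab Main φ' s τ := by
  classical
  have hv : ∀ s : P → Bool, (∀ x y, D' x y → s x = s y) → ∀ z, Main z →
      lab Main φ' s τ z = s (φ z) := fun s hs z hz => by rw [lab_main hz, hs _ _ (hφ z hz)]
  constructor
  · rintro ⟨h1, h2, h3, h4⟩
    refine ⟨fun x => ℓ (ι x), fun x y hxy => M'.const_of h1 h2 (M'.le x y hxy), ⟨?_, ?_⟩, ?_⟩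
    · intro x hx hx'
      change ℓ (ι x) = σ x
      rw [h3, lab_main (M.main_ι _), M.φ_ι]
      · rwa [M.same_iff hi (M.main_ι _), M.φ_ι]
      · rwa [M.same_iff hj (M.main_ι _), M.φ_ι]
    · simp only [M.same_iff hi hj, lab_main hi, lab_main hj] at h4
      simp only [← hι, ← hι']
      exact h4
    · ext z
      by_cases hz : Main z
      · rw [lab_main hz]
        exact M'.const_of h1 h2 (M'.rep z hz)
      · rw [lab_not_main hz, h3, lab_not_main hz]
        · exact fun e => hz ((M.main_iff e).1 hi)
        · exact fun e => hz ((M.main_iff e).1 hj)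
  · rintro ⟨s, hs, ⟨h3, h4⟩, rfl⟩
    refine ⟨M'.lab_f hs hτ, M'.lab_m hs hτ', fun k hk hk' => ?_, ?_⟩
    · by_cases hz : Main k
      · rw [hv s hs k hz, lab_main hz, h3]
        · rwa [← M.same_iff hi hz]
        · rwa [← M.same_iff hj hz]
      · rw [lab_not_main hz, lab_not_main hz]
    · rw [hv s hs i hi, hv s hs (m i) ((M.main_m i).1 hi), hmi]
      simp only [M.same_iff hi hj, lab_main (φ := φ) (σ := σ) hi, lab_main (φ := φ) (σ := σ) hj]
      exact h4

end Model

end reach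

section product

variable {n : ℕ}

open Classical in
/-- The arcs in the middle after the saddles at the points of `S`. -/
noncomputable def midArcs (b : NCMatching n) (S : Set (Fin (2 * n))) :
    Fin (2 * n) ⊕ Fin (2 * n) → Fin (2 * n) ⊕ Fin (2 * n)
  | .inl x => if x ∈ S then .inr x else .inl (b x)
  | .inr x => if x ∈ S then .inl x else .inr (b x)

theorem midArcs_empty (b : NCMatching n) : midArcs b ∅ = Sum.map b b := by
  ext (x | x) <;> simp [midArcs]

theorem surger_midArcs (b : NCMatching n) (S : Set (Fin (2 * n))) {i : Fin (2 * n)} (hi : i ∉ S)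
    (hbi : b i ∉ S) :
    surger (midArcs b S) (.inl i) (.inr i) = midArcs b (S ∪ {i, b i}) := by
  classical
  ext (x | x)
  · by_cases h1 : x = i
    · subst h1; simp [surger, midArcs]
    by_cases h2 : x = b i
    · subst h2; simp [surger, midArcs, hi, b.noFix]
    · simp [surger, midArcs, hi, h1, h2]
  · by_cases h1 : x = i
    · subst h1; simp [surger, midArcs]
    by_cases h2 : x = b i
    · subst h2; simp [surger, midArcs, hi, b.noFix]
    · simp [surger, midArcs, hi, h1, h2]

/-- The points of the main diagram. -/
def midMain (b' : NCMatching n) (S : Set (Fin (2 * n))) : Fin (2 * n) ⊕ Fin (2 * n) → Prop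
  | .inl _ => True
  | .inr x => x ∈ S ∨ b' x ∈ S

open Classical in
/-- The point of the main diagram that represents a point. -/
noncomputable def midRep (b' : NCMatching n) (S : Set (Fin (2 * n))) :
    Fin (2 * n) ⊕ Fin (2 * n) → Fin (2 * n)
  | .inl x => x
  | .inr x => if x ∈ S then x else b' x

variable (a b b' : NCMatching n) {S : Set (Fin (2 * n))}

theorem model_before (hc : ∀ x, b (b' x) = b' (b x)) (hS : ∀ x, x ∈ S → b x ∈ S)
    (hH : ∀ x, x ∈ S → b' x ∈ S → b' x = b x) :
    Model (Sum.map a b') (midArcs b S) (SameCircle a b) (midMain b' S) (midRep b' S) Sum.inl := by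
  classical
  have hS' : ∀ x, b x ∈ S ↔ x ∈ S := fun x => ⟨fun h => by simpa [b.invol] using hS _ h, hS x⟩
  refine ⟨⟨.refl, .symm, .trans⟩, ?_, ?_, ?_, ?_, fun _ => trivial, fun _ => rfl, ?_, ?_⟩
  · rintro (x | x)
    · exact Iff.rfl
    · simp only [midMain, Sum.map_inr, b'.invol]
      exact or_comm
  · rintro (x | x)
    · by_cases hx : x ∈ S <;> simp [midArcs, midMain, hx]
    · by_cases hx : x ∈ S
      · simp [midArcs, midMain, hx]
      · simp [midArcs, midMain, hx, hS', ← hc]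
  · rintro (x | x) hx
    · exact .left x
    · simp only [midMain] at hx
      simp only [midRep, Sum.map_inr, b'.invol]
      by_cases h1 : x ∈ S <;> by_cases h2 : b' x ∈ S
      · rw [if_pos h1, if_pos h2, hH x h1 h2]
        exact .right x
      · rw [if_pos h1, if_neg h2]
        exact .refl _
      · rw [if_neg h1, if_pos h2]
        exact .refl _
      · exact absurd hx (by simp [h1, h2])
  · rintro (x | x) hx
    · by_cases h1 : x ∈ S
      · simp only [midArcs, midRep, if_pos h1]
        exact .refl _
      · simp only [midArcs, midRep, if_neg h1]
        exact .right x
    · by_cases h1 : x ∈ S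
      · simp only [midArcs, midRep, if_pos h1]
        exact .refl _
      · simp only [midArcs, midRep, if_neg h1, hS', ← hc]
        exact .right _
  · rintro (x | x) hx
    · exact .refl _
    · by_cases h1 : x ∈ S
      · have := SameCircle.right (f := Sum.map a b') (m := midArcs b S) (Sum.inr x)
        simpa only [midArcs, midRep, if_pos h1] using this
      · have h2 : b' x ∈ S := hx.resolve_left h1
        have e1 := SameCircle.left (f := Sum.map a b') (m := midArcs b S) (Sum.inr x)
        have e2 := SameCircle.right (f := Sum.map a b') (m := midArcs b S) (Sum.inr (b' x))
        simp only [midArcs, if_pos h2] at e2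
        simp only [midRep, if_neg h1]
        exact e1.trans e2
  · intro x y h
    refine SameCircle.of_le (r := fun x y => SameCircle (Sum.map a b') (midArcs b S) (.inl x) (.inl y))
      ⟨fun _ => .refl _, .symm, .trans⟩ (fun p => .left (f := Sum.map a b') (Sum.inl p)) (fun p => ?_) h
    have g1 : ∀ p, SameCircle (Sum.map a b') (midArcs b S) (.inr p) (.inr (b' p)) :=
      fun p => .left (f := Sum.map a b') (Sum.inr p)
    have g2 : ∀ p ∈ S, SameCircle (Sum.map a b') (midArcs b S) (.inl p) (.inr p) := by
      intro p hp
      have := SameCircle.right (f := Sum.map a b') (m := midArcs b S) (Sum.inl p)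
      simpa only [midArcs, if_pos hp] using this
    by_cases h1 : p ∈ S
    · have h3 := g2 _ ((hS' p).2 h1)
      by_cases h2 : b' p ∈ S
      · have := g1 p
        rw [hH p h1 h2] at this
        exact (g2 p h1).trans (this.trans h3.symm)
      · have e1 := SameCircle.right (f := Sum.map a b') (m := midArcs b S) (Sum.inr (b' p))
        simp only [midArcs, if_neg h2, hc] at e1
        have e2 := g1 (b' (b p))
        rw [b'.invol] at e2
        exact (g2 p h1).trans ((g1 p).trans (e1.trans (e2.trans h3.symm)))
    · have := SameCircle.right (f := Sum.map a b') (m := midArcs b S) (Sum.inl p)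
      simpa only [midArcs, if_neg h1] using this

theorem model_after (hS : ∀ x, x ∈ S → b x ∈ S) (hH : ∀ x, b' x ≠ b x → x ∈ S) :
    Model (Sum.map a b') (midArcs b S) (SameCircle a b') (midMain b' S) (midRep b' S) Sum.inl := by
  classical
  have hS' : ∀ x, b x ∈ S ↔ x ∈ S := fun x => ⟨fun h => by simpa [b.invol] using hS _ h, hS x⟩
  have hS2 : ∀ x, b' x ∈ S ↔ x ∈ S := by
    intro x
    by_cases hx : b' x = b x
    · rw [hx, hS']
    · have h2 : b' (b' x) ≠ b (b' x) := fun e => hx (by rw [← b.invol (b' x), ← e, b'.invol])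
      exact ⟨fun _ => hH x hx, fun _ => hH _ h2⟩
  refine ⟨⟨.refl, .symm, .trans⟩, ?_, ?_, ?_, ?_, fun _ => trivial, fun _ => rfl, ?_, ?_⟩
  · rintro (x | x)
    · exact Iff.rfl
    · simp only [midMain, Sum.map_inr, b'.invol]
      exact or_comm
  · rintro (x | x)
    · by_cases hx : x ∈ S <;> simp [midArcs, midMain, hx]
    · by_cases hx : x ∈ S
      · simp [midArcs, midMain, hx]
      · simp [midArcs, midMain, hx, hS', hS2]
  · rintro (x | x) hx
    · exact .left x
    · simp only [midMain, hS2, or_self] at hx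
      simp only [midRep, Sum.map_inr, hS2, if_pos hx]
      exact .right x
  · rintro (x | x) hx
    · by_cases h1 : x ∈ S
      · simp only [midArcs, midRep, if_pos h1]
        exact .refl _
      · simp only [midArcs, midRep, if_neg h1]
        rw [← not_not.1 fun e => h1 (hH x e)]
        exact .right x
    · simp only [midMain, hS2, or_self] at hx
      simp only [midArcs, midRep, if_pos hx]
      exact .refl _
  · rintro (x | x) hx
    · exact .refl _
    · simp only [midMain, hS2, or_self] at hx
      have := SameCircle.right (f := Sum.map a b') (m := midArcs b S) (Sum.inr x)
      simpa only [midArcs, midRep, if_pos hx] using this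
  · intro x y h
    refine SameCircle.of_le (r := fun x y => SameCircle (Sum.map a b') (midArcs b S) (.inl x) (.inl y))
      ⟨fun _ => .refl _, .symm, .trans⟩ (fun p => .left (f := Sum.map a b') (Sum.inl p)) (fun p => ?_) h
    have g1 : ∀ p, SameCircle (Sum.map a b') (midArcs b S) (.inr p) (.inr (b' p)) :=
      fun p => .left (f := Sum.map a b') (Sum.inr p)
    have g2 : ∀ p ∈ S, SameCircle (Sum.map a b') (midArcs b S) (.inl p) (.inr p) := by
      intro p hp
      have := SameCircle.right (f := Sum.map a b') (m := midArcs b S) (Sum.inl p)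
      simpa only [midArcs, if_pos hp] using this
    by_cases h1 : p ∈ S
    · exact (g2 p h1).trans ((g1 p).trans (g2 _ ((hS2 p).2 h1)).symm)
    · have := SameCircle.right (f := Sum.map a b') (m := midArcs b S) (Sum.inl p)
      simp only [midArcs, if_neg h1] at this
      rwa [← not_not.1 fun e => h1 (hH p e)] at this

end product

end BorderedKh

namespace BorderedKh

section product

variable {n : ℕ} (a b b' : NCMatching n) {S : Set (Fin (2 * n))}

/-- The labelling of the diagram on two copies of the points, by a labelling of the main diagram and
a labelling of the second copy. -/
noncomputable abbrev midLab (S : Set (Fin (2 * n))) (σ t : Fin (2 * n) → Bool) :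
    Fin (2 * n) ⊕ Fin (2 * n) → Bool :=
  lab (midMain b' S) (midRep b' S) σ (Sum.elim (fun _ => true) t)

theorem reach_merge {D : Fin (2 * n) → Fin (2 * n) → Prop} {t σ : Fin (2 * n) → Bool}
    (ht : ∀ x, t (b x) = t x) (ht' : ∀ x, t (b' x) = t x) (hc : ∀ x, b (b' x) = b' (b x))
    (hS : ∀ x, x ∈ S → b x ∈ S) {i : Fin (2 * n)} (hi : i ∉ S) (hi' : b' i ∉ S)
    (M : Model (Sum.map a b') (midArcs b S) D (midMain b' S) (midRep b' S) Sum.inl)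
    (M' : Model (Sum.map a b') (midArcs b (S ∪ {i, b i})) D (midMain b' (S ∪ {i, b i}))
      (midRep b' (S ∪ {i, b i})) Sum.inl)
    (hσ : ∀ x y, D x y → σ x = σ y) (L : List _) (ℓ' : Fin (2 * n) ⊕ Fin (2 * n) → Bool) :
    SaddleReach (Sum.map a b') ((Sum.inl i, Sum.inr i) :: L) (midArcs b S) (midLab b' S σ t) ℓ' ↔
      (t i = true ∧
        SaddleReach (Sum.map a b') L (midArcs b (S ∪ {i, b i})) (midLab b' (S ∪ {i, b i}) σ t) ℓ') ∨
      (t i = false ∧ σ i = true ∧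
        SaddleReach (Sum.map a b') L (midArcs b (S ∪ {i, b i}))
          (midLab b' (S ∪ {i, b i}) (relabel D i false σ) t) ℓ') := by
  have hS' : ∀ x, b x ∈ S ↔ x ∈ S := fun x => ⟨fun h => by simpa [b.invol] using hS _ h, hS x⟩
  have hb : ∀ x y, b x = y ↔ x = b y := fun x y =>
    ⟨fun h => by rw [← h, b.invol], fun h => by rw [h, b.invol]⟩
  have hb' : ∀ x y, b' x = y ↔ x = b' y := fun x y =>
    ⟨fun h => by rw [← h, b'.invol], fun h => by rw [h, b'.invol]⟩
  have hbi : b i ∉ S := by rwa [hS']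
  have hbi' : b' (b i) ∉ S := by rwa [← hc, hS']
  have hK : ∀ z, SameCircle (Sum.map a b') (midArcs b S) (Sum.inr i) z ↔
      ∃ x, z = Sum.inr x ∧ (x = i ∨ x = b i ∨ x = b' i ∨ x = b' (b i)) := by
    have e1 : ∀ x, x ∉ S → SameCircle (Sum.map a b') (midArcs b S) (Sum.inr x) (Sum.inr (b x)) := by
      intro x hx
      have := SameCircle.right (f := Sum.map a b') (m := midArcs b S) (Sum.inr x)
      simpa only [midArcs, if_neg hx] using this
    have e2 : ∀ x, SameCircle (Sum.map a b') (midArcs b S) (Sum.inr x) (Sum.inr (b' x)) :=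
      fun x => .left (f := Sum.map a b') (Sum.inr x)
    intro z
    constructor
    · intro h
      refine (SameCircle.mem_iff (K := fun z => ∃ x, z = Sum.inr x ∧
        (x = i ∨ x = b i ∨ x = b' i ∨ x = b' (b i))) ?_ ?_ h).1 ⟨i, rfl, Or.inl rfl⟩
      · rintro (x | x)
        · simp
        · simp only [Sum.map_inr, Sum.inr.injEq, exists_eq_left']
          rw [hb' x i, hb' x (b i), hb' x (b' i), hb' x (b' (b i)), b'.invol, b'.invol]
          tauto
      · rintro (x | x)
        · by_cases hx : x ∈ S
          · simp only [midArcs, if_pos hx, reduceCtorEq, false_and, exists_false, Sum.inr.injEq,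
              exists_eq_left', false_iff]
            rintro (rfl | rfl | rfl | rfl) <;> contradiction
          · simp [midArcs, hx]
        · by_cases hx : x ∈ S
          · simp only [midArcs, if_pos hx, reduceCtorEq, false_and, exists_false, Sum.inr.injEq,
              exists_eq_left', iff_false]
            rintro (rfl | rfl | rfl | rfl) <;> contradiction
          · simp only [midArcs, if_neg hx, Sum.inr.injEq, exists_eq_left']
            rw [hb x i, hb x (b i), hb x (b' i), hb x (b' (b i)), b.invol, hc, hc, b.invol]
            tauto
    · rintro ⟨x, rfl, rfl | rfl | rfl | rfl⟩
      exacts [.refl _, e1 _ hi, e2 _, (e1 _ hi).trans (e2 _)]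
  have key := M.merge_iff M' (i := Sum.inl i) (j := Sum.inr i) (σ := σ)
    (τ := Sum.elim (fun _ => true) t) trivial (by simp [midMain, hi, hi']) (by
      rintro (x | x)
      · simp [midMain]
      · rw [hK]
        simp only [midMain, Sum.inr.injEq, exists_eq_left', Set.mem_union, Set.mem_insert_iff,
          Set.mem_singleton_iff, hb']
        tauto) (by
      rintro (x | x) hx
      · rfl
      · by_cases h1 : x ∈ S
        · simp [midRep, h1]
        · have h2 : x ∉ S ∪ {i, b i} := by
            rintro (h2 | rfl | rfl)
            exacts [h1 h2, hx.elim h1 hi', hx.elim h1 hbi']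
          simp only [midRep, if_neg h1, if_neg h2]) hσ (by
      rintro (x | x) hx
      · exact absurd trivial hx
      · exact ht' x) (by
      rintro (x | x) hx
      · exact absurd trivial hx
      · have h2 : x ∉ S ∪ {i, b i} := fun h => hx (Or.inl h)
        simp only [midArcs, if_neg h2]
        exact ht x)
  rw [SaddleReach, surger_midArcs b S hi hbi]
  simp only [key]
  constructor
  · rintro ⟨ℓ₁, ⟨h, rfl⟩ | ⟨h, h', rfl⟩, h''⟩
    exacts [Or.inl ⟨h, h''⟩, Or.inr ⟨h, h', h''⟩]
  · rintro (⟨h, h''⟩ | ⟨h, h', h''⟩)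
    exacts [⟨_, Or.inl ⟨h, rfl⟩, h''⟩, ⟨_, Or.inr ⟨h, h', rfl⟩, h''⟩]

/-- `L` contains one end of each arc of `b` outside of `S`. -/
structure Remaining (b : NCMatching n) (S : Set (Fin (2 * n))) (L : List (Fin (2 * n))) : Prop where
  not_mem_iff : ∀ x, x ∉ S ↔ x ∈ L ∨ b x ∈ L
  not_both : ∀ x ∈ L, b x ∉ L
  nodup : L.Nodup

namespace Remaining

variable {b} {L : List (Fin (2 * n))} {i : Fin (2 * n)}

theorem closed (h : Remaining b S L) (x : Fin (2 * n)) (hx : x ∈ S) : b x ∈ S := by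
  by_contra hc
  rw [h.not_mem_iff, b.invol] at hc
  exact (h.not_mem_iff x).2 hc.symm hx

theorem tail (h : Remaining b S (i :: L)) : Remaining b (S ∪ {i, b i}) L := by
  have hb : ∀ x, b x = i ↔ x = b i := fun x =>
    ⟨fun h => by rw [← h, b.invol], fun h => by rw [h, b.invol]⟩
  have h3 := List.nodup_cons.1 h.nodup
  have h4 := h.not_both i (List.mem_cons_self ..)
  rw [List.mem_cons, not_or] at h4
  refine ⟨fun x => ?_, fun x hx hx' => h.not_both x (List.mem_cons_of_mem _ hx)
    (List.mem_cons_of_mem _ hx'), h3.2⟩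
  have h1 := h.not_mem_iff x
  simp only [List.mem_cons, hb] at h1
  simp only [Set.mem_union, Set.mem_insert_iff, Set.mem_singleton_iff, not_or, h1]
  constructor
  · tauto
  · intro hx
    have e1 : x ≠ i := by
      rintro rfl
      exact hx.elim h3.1 h4.2
    have e2 : x ≠ b i := by
      rintro rfl
      rw [b.invol] at hx
      exact hx.elim h4.2 h3.1
    tauto

theorem head (h : Remaining b S (i :: L)) : i ∉ S := by
  rw [h.not_mem_iff]
  exact Or.inl (List.mem_cons_self ..)

theorem eq_univ (h : Remaining b S []) : S = Set.univ := by
  ext x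
  by_contra hx
  simp only [Set.mem_univ, iff_true] at hx
  simpa using (h.not_mem_iff x).1 hx

theorem init (b : NCMatching n) :
    Remaining b ∅ ((List.finRange (2 * n)).filter fun i => i < b i) := by
  refine ⟨fun x => ?_, fun x hx => ?_, (List.nodup_finRange _).filter _⟩
  · simp only [Set.mem_empty_iff_false, not_false_eq_true, List.mem_filter, List.mem_finRange,
      true_and, decide_eq_true_eq, b.invol, true_iff]
    exact (lt_or_gt_of_ne (b.noFix x)).symm
  · simp only [List.mem_filter, List.mem_finRange, true_and, decide_eq_true_eq, b.invol] at hx ⊢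
    exact hx.asymm

end Remaining

theorem midLab_univ (σ t : Fin (2 * n) → Bool) : midLab b' Set.univ σ t = Sum.elim σ σ := by
  ext (x | x) <;> simp [midLab, lab, midMain, midRep]

theorem midLab_empty (σ t : Fin (2 * n) → Bool) : midLab b' ∅ σ t = Sum.elim σ t := by
  ext (x | x) <;> simp [midLab, lab, midMain, midRep]

/-- The list of saddles for a list of arcs. -/
def saddles (L : List (Fin (2 * n))) :
    List ((Fin (2 * n) ⊕ Fin (2 * n)) × (Fin (2 * n) ⊕ Fin (2 * n))) :=
  L.map fun i => (Sum.inl i, Sum.inr i)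

theorem reach_after {L : List (Fin (2 * n))} (h : Remaining b S L) {t σ : Fin (2 * n) → Bool}
    (ht : ∀ x, t (b x) = t x) (ht' : ∀ x, t (b' x) = t x) (hc : ∀ x, b (b' x) = b' (b x))
    (hH : ∀ x, b' x ≠ b x → x ∈ S) (hσ : ∀ x y, SameCircle a b' x y → σ x = σ y)
    (htS : ∀ x, x ∉ S → t x = true) (ℓ' : Fin (2 * n) ⊕ Fin (2 * n) → Bool) :
    SaddleReach (Sum.map a b') (saddles L) (midArcs b S) (midLab b' S σ t) ℓ' ↔
      ℓ' = Sum.elim σ σ := by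
  induction L generalizing S with
  | nil =>
    rw [h.eq_univ, midLab_univ]
    exact eq_comm
  | cons i L ih =>
    have e : b' i = b i := not_not.1 fun e => h.head (hH i e)
    have h1 := h.head
    have h2 : b' i ∉ S := by
      rw [e]
      intro h2
      have := h.closed _ h2
      rw [b.invol] at this
      exact h1 this
    rw [saddles, List.map_cons, reach_merge a b b' ht ht' hc h.closed h1 h2
      (model_after a b b' h.closed hH)
      (model_after a b b' h.tail.closed fun x hx => Or.inl (hH x hx)) hσ]
    have h3 := htS i h1
    simp only [h3, true_and, Bool.true_eq_false, false_and, or_false]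
    exact ih h.tail (fun x hx => Or.inl (hH x hx)) fun x hx => htS x fun hx' => hx (Or.inl hx')

theorem reach_circle {L : List (Fin (2 * n))} (h : Remaining b S L) {t σ : Fin (2 * n) → Bool}
    {p : Fin (2 * n)} (hp : p ∉ S) (ht : ∀ x, t x = false ↔ x = p ∨ x = b p)
    (hσ : ∀ x y, SameCircle a b x y → σ x = σ y) (ℓ' : Fin (2 * n) ⊕ Fin (2 * n) → Bool) :
    SaddleReach (Sum.map a b) (saddles L) (midArcs b S) (midLab b S σ t) ℓ' ↔
      σ p = true ∧ ℓ' = Sum.elim (relabel (SameCircle a b) p false σ)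
        (relabel (SameCircle a b) p false σ) := by
  have hb : ∀ x y, b x = y ↔ x = b y := fun x y =>
    ⟨fun h => by rw [← h, b.invol], fun h => by rw [h, b.invol]⟩
  have htb : ∀ x, t (b x) = t x := by
    intro x
    have : t (b x) = false ↔ t x = false := by
      rw [ht, ht, hb, hb, b.invol, or_comm]
    revert this
    cases t (b x) <;> cases t x <;> simp
  induction L generalizing S with
  | nil =>
    rw [h.eq_univ] at hp
    exact absurd trivial hp
  | cons i L ih =>
    have h1 := h.head
    have h2 : b i ∉ S := by
      intro h2
      have := h.closed _ h2
      rw [b.invol] at this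
      exact h1 this
    rw [saddles, List.map_cons, reach_merge a b b htb htb (fun _ => rfl) h.closed h1 h2
      (model_after a b b h.closed fun x hx => absurd rfl hx)
      (model_after a b b h.tail.closed fun x hx => absurd rfl hx) hσ]
    by_cases hi : t i = false
    · have hip : SameCircle a b i p := by
        obtain rfl | rfl := (ht i).1 hi
        exacts [.refl _, (SameCircle.right p).symm]
      have e : relabel (SameCircle a b) i false σ = relabel (SameCircle a b) p false σ := by
        ext x
        have : SameCircle a b i x ↔ SameCircle a b p x := ⟨hip.symm.trans, hip.trans⟩
        unfold relabel
        by_cases hx : SameCircle a b p x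
        · rw [if_pos hx, if_pos (this.2 hx)]
        · rw [if_neg hx, if_neg (mt this.1 hx)]
      have hr : ∀ x y, SameCircle a b x y →
          relabel (SameCircle a b) p false σ x = relabel (SameCircle a b) p false σ y := by
        intro x y hxy
        have : SameCircle a b p x ↔ SameCircle a b p y :=
          ⟨fun h => h.trans hxy, fun h => h.trans hxy.symm⟩
        unfold relabel
        by_cases hx : SameCircle a b p x
        · rw [if_pos hx, if_pos (this.1 hx)]
        · rw [if_neg hx, if_neg (mt this.2 hx), hσ x y hxy]
      rw [e, hσ i p hip]
      simp only [hi, Bool.false_eq_true, false_and, false_or, true_and]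
      refine and_congr_right fun _ => ?_
      refine reach_after a b b h.tail htb htb (fun _ => rfl) (fun x hx => absurd rfl hx) hr
        (fun x hx => ?_) ℓ'
      by_contra hx'
      rw [Bool.not_eq_true, ht] at hx'
      refine hx (Or.inr ?_)
      obtain rfl | rfl := (ht i).1 hi <;> obtain rfl | rfl := hx' <;> simp [b.invol]
    · have hi' := (Bool.eq_false_or_eq_true (t i)).resolve_right hi
      simp only [hi', true_and, Bool.true_eq_false, false_and, or_false]
      refine ih h.tail ?_
      rintro (h' | rfl | h')
      · exact hp h'
      · exact hi ((ht _).2 (Or.inl rfl))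
      · exact hi ((ht _).2 (Or.inr ((hb _ _).1 (Eq.symm h'))))

theorem reach_bridge {k k' : DecLink n} (ho : k.left = k'.left) {u v : Fin (2 * n)}
    (hs : Surg NCMatching.col k.right k'.right u v) {L : List (Fin (2 * n))}
    (h : Remaining k.right S L) (hH : ∀ x, x ∈ S → k'.right x ∈ S → k'.right x = k.right x) :
    SaddleReach (Sum.map k.left k'.right) (saddles L) (midArcs k.right S)
        (midLab k'.right S k.sign fun _ => true) (Sum.elim k'.sign k'.sign) ↔
      IsBridgeEdge .right k k' := by
  have hbb : ∀ x y, k.right x = y ↔ x = k.right y := fun x y =>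
    ⟨fun h => by rw [← h, k.right.invol], fun h => by rw [h, k.right.invol]⟩
  have hbb' : ∀ x y, k'.right x = y ↔ x = k'.right y := fun x y =>
    ⟨fun h => by rw [← h, k'.right.invol], fun h => by rw [h, k'.right.invol]⟩
  have hc : ∀ x, k.right (k'.right x) = k'.right (k.right x) := by
    intro x
    by_cases hx : k'.right x = k.right x
    · rw [hx, k.right.invol, ← hx, k'.right.invol]
    · exact (hs.of_moved hx).at_mi.symm
  induction L generalizing S with
  | nil =>
    have := h.eq_univ
    exact absurd (hH u (by rw [this]; trivial) (by rw [this]; trivial))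
      ((hs.moved_iff u).2 (Or.inl rfl))
  | cons i L ih =>
    have h1 := h.head
    have h2 : k.right i ∉ S := by
      intro h2
      have := h.closed _ h2
      rw [k.right.invol] at this
      exact h1 this
    have hcl : ∀ x, k.right x ∈ S ↔ x ∈ S :=
      fun x => ⟨fun hx => by simpa [k.right.invol] using h.closed _ hx, h.closed x⟩
    by_cases h3 : k'.right i ∈ S
    · have hne : k'.right i ≠ k.right i := fun e => h2 (by rwa [← e])
      have hs' := hs.of_moved hne
      have hH' : ∀ x, k'.right x ≠ k.right x → x ∈ S ∪ {i, k.right i} := by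
        intro x hx
        obtain rfl | rfl | rfl | rfl := (hs'.moved_iff x).1 hx
        · exact Or.inr (Or.inl rfl)
        · exact Or.inl h3
        · exact Or.inr (Or.inr rfl)
        · exact Or.inl (h.closed _ h3)
      have hr : midMain k'.right (S ∪ {i, k.right i}) = midMain k'.right S := by
        ext (x | x)
        · exact Iff.rfl
        · simp only [midMain, Set.mem_union, Set.mem_insert_iff, Set.mem_singleton_iff]
          constructor
          · rintro ((hx | rfl | rfl) | (hx | hx | hx))
            · exact Or.inl hx
            · exact Or.inr h3
            · exact Or.inr (by rw [← hc]; exact h.closed _ h3)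
            · exact Or.inr hx
            · exact Or.inl (by rw [(hbb' _ _).1 hx]; exact h3)
            · exact Or.inl (by rw [(hbb' _ _).1 hx, ← hc]; exact h.closed _ h3)
          · tauto
      have M' := model_after k.left k.right k'.right h.tail.closed hH'
      rw [hr] at M'
      have key := (model_before k.left k.right k'.right hc h.closed hH).bridge_iff
        M' (i := Sum.inl i) (j := Sum.inr i)
        (τ := Sum.elim (fun _ => true) fun _ => true) (σ := k.sign) trivial (Or.inr h3)
        (by simp [midArcs, midRep, h1]) rfl (by simp [midArcs, midRep, h1]) (by
          rintro (x | x) hx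
          · exact .refl _
          · by_cases hx1 : x ∈ S
            · have hx2 : x ∈ S ∪ {i, k.right i} := Or.inl hx1
              simp only [midRep, if_pos hx1, if_pos hx2]
              exact .refl _
            · by_cases hx2 : x ∈ S ∪ {i, k.right i}
              · simp only [midRep, if_neg hx1, if_pos hx2]
                exact .right x
              · simp only [midRep, if_neg hx1, if_neg hx2]
                exact .refl _)
        (by rintro (x | x) _ <;> rfl) (by
          rintro (x | x) hx
          · exact absurd trivial hx
          · have hx' := hx
            rw [← hr] at hx'
            have h2 : x ∉ S ∪ {i, k.right i} := fun h => hx' (Or.inl h)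
            simp only [midArcs, if_neg h2]
            rfl)
      have hi' : midRep k'.right S (Sum.inr i) = k'.right i := by simp [midRep, h1]
      rw [hi'] at key
      rw [saddles, List.map_cons, SaddleReach, surger_midArcs _ S h1 h2]
      simp only [midLab, key]
      have hso := isBridgeEdge_iff (s := .right) ho hs'
      rw [hso, ← saddleRule_iff (s := .right) ho hs']
      have after := fun s hσ => reach_after k.left k.right k'.right h.tail (σ := s)
        (t := fun _ => true) (fun _ => rfl) (fun _ => rfl) hc hH' hσ (fun _ _ => rfl)
        (Sum.elim k'.sign k'.sign)
      simp only [midLab, hr] at after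
      constructor
      · rintro ⟨ℓ₁, ⟨s, hσ, hs, rfl⟩, hL⟩
        have e := (after s hσ).1 hL
        have : k'.sign = s := funext fun x => congrFun e (Sum.inl x)
        rw [this]
        exact hs
      · intro hs
        have hσ : ∀ x y, SameCircle k.left k'.right x y → k'.sign x = k'.sign y := by
          intro x y hxy
          rw [ho] at hxy
          exact k'.sign_eq hxy
        exact ⟨_, ⟨k'.sign, hσ, hs, rfl⟩, (after _ hσ).2 rfl⟩
    · have hH' : ∀ x, x ∈ S ∪ {i, k.right i} → k'.right x ∈ S ∪ {i, k.right i} →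
          k'.right x = k.right x := by
        have h4 : k'.right (k.right i) ∉ S := by
          rw [← hc, hcl]
          exact h3
        rintro x (hx | rfl | rfl) (hx' | hx' | hx')
        · exact hH x hx hx'
        · exact absurd ((hbb' _ _).1 hx' ▸ hx) h3
        · exact absurd ((hbb' _ _).1 hx' ▸ hx) h4
        · exact absurd hx' h3
        · exact absurd hx' (k'.right.noFix _)
        · exact hx'
        · exact absurd hx' h4
        · rw [k.right.invol, hx']
        · exact absurd hx' (k'.right.noFix _)
      rw [saddles, List.map_cons, reach_merge k.left k.right k'.right (fun _ => rfl) (fun _ => rfl) hc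
        h.closed h1 h3 (model_before _ _ _ hc h.closed hH) (model_before _ _ _ hc h.tail.closed hH')
        fun x y hxy => k.sign_eq hxy]
      simp only [true_and, Bool.true_eq_false, false_and, or_false]
      exact ih h.tail hH'

theorem arcMulCoeff_ne_zero {h₁ h h₂ : DecLink n} : arcMulCoeff h₁ h h₂ ≠ 0 ↔
    (h₁.right = h.left ∧ h₂.left = h₁.left ∧ h₂.right = h.right) ∧
      SaddleReach (Sum.map h₁.left h₂.right)
        (saddles ((List.finRange (2 * n)).filter fun i => i < h₁.right i)) (midArcs h₁.right ∅)
        (midLab h₂.right ∅ h₁.sign h.sign) (Sum.elim h₂.sign h₂.sign) := by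
  unfold arcMulCoeff
  split_ifs with hc
  · simp only [hc, true_and, and_self]
    rw [saddleCoeff_ne_zero, midLab_empty, midArcs_empty]
    rfl
  · simp [hc]

theorem isBridgeGen_iff {h₁ h₂ : DecLink n} : IsBridgeGen h₁ h₂ ↔ IsBridgeEdge .right h₁ h₂ := by
  have hH : ∀ x, x ∈ (∅ : Set (Fin (2 * n))) → h₂.right x ∈ (∅ : Set (Fin (2 * n))) →
    h₂.right x = h₁.right x := fun x hx => hx.elim
  constructor
  · rintro ⟨h, ⟨hs, hp⟩, hne⟩
    obtain ⟨⟨e1, e2, e3⟩, hr⟩ := arcMulCoeff_ne_zero.1 hne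
    have ht : h.sign = fun _ => true := funext hp
    rw [ht] at hr
    rw [← e1, ← e3] at hs
    obtain ⟨i, j, hs⟩ := hs.exists_surg
    exact (reach_bridge e2.symm hs (.init _) hH).1 hr
  · intro hb
    obtain ⟨i, j, hs⟩ := hb.exists_surg
    refine ⟨⟨h₁.right, h₂.right, fun _ => true, fun _ => rfl, fun _ => rfl⟩,
      ⟨Surg.isSurgery hs, fun _ => rfl⟩, arcMulCoeff_ne_zero.2 ⟨⟨rfl, hb.1.symm, rfl⟩, ?_⟩⟩
    exact (reach_bridge hb.1 hs (.init _) hH).2 hb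

theorem isCircleGen_iff {h₁ h₂ : DecLink n} : IsCircleGen h₁ h₂ ↔ IsDecoEdge h₁ h₂ := by
  have hσ : ∀ x y, SameCircle h₁.left h₁.right x y → h₁.sign x = h₁.sign y :=
    fun x y hxy => h₁.sign_eq hxy
  rw [isDecoEdge_iff]
  constructor
  · rintro ⟨h, ⟨hlr, p, hp⟩, hne⟩
    obtain ⟨⟨e1, e2, e3⟩, hr⟩ := arcMulCoeff_ne_zero.1 hne
    rw [e3, ← hlr, ← e1] at hr
    rw [← e1] at hp
    obtain ⟨h3, h4⟩ := (reach_circle h₁.left h₁.right (.init _) (Set.notMem_empty p) hp hσ _).1 hr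
    refine ⟨p, h3, DecLink.ext e2 (by rw [e3, ← hlr, ← e1]; rfl) ?_⟩
    exact funext fun x => congrFun h4 (Sum.inl x)
  · rintro ⟨p, hp, rfl⟩
    classical
    have ht : ∀ q, (decide (¬ (q = p ∨ q = h₁.right p))) = false ↔ q = p ∨ q = h₁.right p :=
      fun q => by rw [decide_eq_false_iff_not, not_not]
    have ht' : ∀ q, (decide (¬ (h₁.right q = p ∨ h₁.right q = h₁.right p))) =
        decide (¬ (q = p ∨ q = h₁.right p)) := by
      intro q
      rw [decide_eq_decide, h₁.right.isArcs.eq_iff, h₁.right.isArcs.eq_iff, h₁.right.invol, or_comm]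
    exact ⟨⟨h₁.right, h₁.right, fun q => decide (¬ (q = p ∨ q = h₁.right p)), ht', ht'⟩,
      ⟨rfl, p, ht⟩, arcMulCoeff_ne_zero.2 ⟨⟨rfl, rfl, rfl⟩,
        (reach_circle h₁.left h₁.right (.init _) (Set.notMem_empty p) ht hσ _).2 ⟨hp, rfl⟩⟩⟩

theorem isBridgeGen_mirror_iff {h₁ h₂ : DecLink n} :
    IsBridgeGen h₁.mirror h₂.mirror ↔ IsBridgeEdge .left h₁ h₂ := isBridgeGen_iff

theorem isCircleGen_mirror_iff {h₁ h₂ : DecLink n} :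
    IsCircleGen h₁.mirror h₂.mirror ↔ IsDecoEdge h₁ h₂ := by
  rw [isCircleGen_iff]
  have : h₁.mirror.SameCirc = h₁.SameCirc := by
    ext p q
    exact SameCircle.swap_iff
  unfold IsDecoEdge
  rw [this]
  exact ⟨fun h => ⟨h.2.1, h.1, h.2.2⟩, fun h => ⟨h.2.1, h.1, h.2.2⟩⟩

end product

end BorderedKh

namespace BorderedKh

/-! ### Pairs of bridges in the same half-plane -/

section pairs

variable {n : ℕ} {s : Side} {h₁ h h' h'' h₃ : DecLink n}

theorem IsBridgeEdge.isSurgery (x : IsBridgeEdge s h h') : IsSurgery (h.inner s) (h'.inner s) := by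
  obtain ⟨i, j, hs⟩ := x.exists_surg
  exact Surg.isSurgery hs

/-- There are bridge edges from `h₁` to `h` and from `h` to `h₃`. -/
def BridgePath (s : Side) (h₁ h h₃ : DecLink n) : Prop := IsBridgeEdge s h₁ h ∧ IsBridgeEdge s h h₃

namespace BridgePath

theorem between (x : BridgePath s h₁ h h₃) (hne : h₁.inner s ≠ h₃.inner s) :
    Between (h₁.inner s) (h.inner s) (h₃.inner s) := ⟨x.1.isSurgery, x.2.isSurgery, hne⟩

theorem mem_mids (x : BridgePath s h₁ h h₃) : h ∈ mids s (h.inner s) h₁ h₃ :=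
  BorderedKh.mem_mids.2 ⟨rfl, x⟩

theorem card_mids_eq (x : BridgePath s h₁ h h₃) {a a' : NCMatching n}
    (ha : Between (h₁.inner s) a (h₃.inner s)) (ha' : Between (h₁.inner s) a' (h₃.inner s)) :
    (mids s a h₁ h₃).card = (mids s a' h₁ h₃).card := by
  by_cases hne : a = a'
  · rw [hne]
  obtain ⟨k, k1, k2, k3⟩ := ha.exists_agree ha' hne
  obtain ⟨i, i1, i2, i3⟩ := ha'.exists_agree ha (Ne.symm hne)
  refine card_mid_eq (x.1.1.trans x.2.1) (i := i) (k := k) (ha.fst.surg ?_) (ha.snd.surg ?_) ?_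
    (j' := h₃.inner s i) (ha'.snd.surg ?_) i1 k1
  · rwa [i2]
  · rwa [k1]
  · rw [← k2]
    refine ha'.fst.surg ?_
    rwa [k2]
  · rwa [i1]

theorem exists_ne (x : BridgePath s h₁ h h₃) (hne : h₁.inner s ≠ h₃.inner s)
    (hc : ¬ Crossing (h.inner s) (h₁.inner s) (h₃.inner s)) :
    ∃ h', BridgePath s h₁ h' h₃ ∧ h'.inner s ≠ h.inner s := by
  obtain ⟨a', ha', ha⟩ := (x.between hne).exists_ne hc
  have h1 : 0 < (mids s a' h₁ h₃).card := by
    rw [x.card_mids_eq ha' (x.between hne)]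
    exact Finset.card_pos.2 ⟨_, x.mem_mids⟩
  obtain ⟨h', hh⟩ := Finset.card_pos.1 h1
  rw [BorderedKh.mem_mids] at hh
  exact ⟨h', hh.2, by rw [hh.1]; exact ha⟩

theorem inner_ne_of_crossing (x : BridgePath s h₁ h h₃)
    (hc : Crossing (h.inner s) (h₁.inner s) (h₃.inner s)) : h₁.inner s ≠ h₃.inner s := by
  intro e
  refine x.1.inner_ne (NCMatching.ext fun p => ?_)
  rcases hc.1 p with h1 | h1
  · exact h1
  · rw [e, h1]

theorem not_rejoin (x : BridgePath s h₁ h h₃) (x' : BridgePath s h₁ h' h₃)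
    (hne : h₁.inner s ≠ h₃.inner s) (hd : h.inner s ≠ h'.inner s)
    (hside : SameSide (h₁.inner s) (h.inner s) (h'.inner s)) {i j k l : Fin (2 * n)}
    (hij : SurgeryAt (h₁.inner s) (h.inner s) i j) (hkl : SurgeryAt (h.inner s) (h₃.inner s) k l)
    (hk : h.SameCirc k i) (hl : h.SameCirc l (h₁.inner s i)) (hn : ¬ h.SameCirc k l) : False := by
  obtain ⟨a, ha⟩ := hside
  have hb := x.between hne
  have hb' := x'.between hne
  have e := h.sameCircle_outer_inner s
  rw [← e] at hk hl hn
  have hne' := ha.ne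
  exact hb.not_rejoin _ hb' (hb.third hb' hd ha) hd hne'.1.symm hne'.2.symm
    (Surg.of_surgeryAt (h₁.inner s).isArcs (h.inner s).isArcs hij)
    (Surg.of_surgeryAt (h.inner s).isArcs (h₃.inner s).isArcs hkl) hk hl hn

theorem eq_of_sameSide (x : BridgePath s h₁ h h₃) (x' : BridgePath s h₁ h' h₃)
    (hne : h₁.inner s ≠ h₃.inner s) (hd : h.inner s ≠ h'.inner s)
    (hside : SameSide (h₁.inner s) (h.inner s) (h'.inner s)) (x'' : BridgePath s h₁ h'' h₃)
    (he : h''.inner s = h.inner s) : h'' = h := by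
  by_contra hc
  obtain ⟨i, j, k, l, h1, -, -, h2, h3, h4, h5, -⟩ :=
    exists_of_two_mids x.1 x.2 x''.1 x''.2 he.symm (Ne.symm hc)
  exact x.not_rejoin x' hne hd hside h1 h2 h3 h4 h5

end BridgePath

theorem IsTriad.ne' {a a₁ a₂ a₃ : NCMatching n} (h : IsTriad a a₁ a₂ a₃) : a₁ ≠ a₂ := by
  rintro rfl
  obtain ⟨i, j, hs⟩ := h.2.2.1.exists_surg
  have := (h.2.2.2 i).1 ((hs.moved_iff i).2 (Or.inl rfl))
  simp at this

theorem IsTriad.rotate {a a₁ a₂ a₃ : NCMatching n} (h : IsTriad a a₁ a₂ a₃) : IsTriad a a₂ a₃ a₁ := by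
  refine ⟨h.2.1, h.2.2.1, h.1, fun p => ?_⟩
  have := h.2.2.2 p
  unfold Xor at this ⊢
  tauto

namespace BridgePath

/-- The paths of bridges on three arcs, on the same side of a common arc. -/
theorem exists_triad (x : BridgePath s h₁ h h₃) (x' : BridgePath s h₁ h' h₃)
    (hne : h₁.inner s ≠ h₃.inner s) (hd : h.inner s ≠ h'.inner s)
    (hside : SameSide (h₁.inner s) (h.inner s) (h'.inner s)) :
    ∃ h'', BridgePath s h₁ h'' h₃ ∧ IsTriad (h₁.inner s) (h.inner s) (h'.inner s) (h''.inner s) := by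
  obtain ⟨a, ha⟩ := hside
  have h1 : 0 < (mids s a h₁ h₃).card := by
    rw [x.card_mids_eq ((x.between hne).third (x'.between hne) hd ha) (x.between hne)]
    exact Finset.card_pos.2 ⟨_, x.mem_mids⟩
  obtain ⟨h'', hh⟩ := Finset.card_pos.1 h1
  obtain ⟨rfl, hh'⟩ := BorderedKh.mem_mids.1 hh
  exact ⟨h'', hh', ha⟩

theorem iff_of_triad (x : BridgePath s h₁ h h₃) (x' : BridgePath s h₁ h' h₃)
    (x'' : BridgePath s h₁ h'' h₃) (hne : h₁.inner s ≠ h₃.inner s)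
    (ht : IsTriad (h₁.inner s) (h.inner s) (h'.inner s) (h''.inner s)) (k : DecLink n) :
    BridgePath s h₁ k h₃ ↔ k = h ∨ k = h' ∨ k = h'' := by
  constructor
  · intro y
    by_cases h1 : k.inner s = h.inner s
    · exact Or.inl (x.eq_of_sameSide x' hne ht.ne' ⟨_, ht⟩ y h1)
    by_cases h2 : k.inner s = h'.inner s
    · exact Or.inr (Or.inl (x'.eq_of_sameSide x'' hne ht.rotate.ne' ⟨_, ht.rotate⟩ y h2))
    have h3 : k.inner s = h''.inner s :=
      (x.between hne).eq_third (x'.between hne) (x''.between hne) (y.between hne) ht.ne'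
        ht.ne.1.symm ht.ne.2.symm h1 h2
    exact Or.inr (Or.inr (x''.eq_of_sameSide x hne ht.rotate.rotate.ne' ⟨_, ht.rotate.rotate⟩ y h3))
  · rintro (rfl | rfl | rfl) <;> assumption

theorem inner_eq_or (x : BridgePath s h₁ h h₃) (x' : BridgePath s h₁ h' h₃)
    (hne : h₁.inner s ≠ h₃.inner s) (hd : h.inner s ≠ h'.inner s)
    (hside : ¬ SameSide (h₁.inner s) (h.inner s) (h'.inner s)) (x'' : BridgePath s h₁ h'' h₃) :
    h''.inner s = h.inner s ∨ h''.inner s = h'.inner s := by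
  by_contra hc
  rw [not_or] at hc
  exact hside ⟨_, (x.between hne).isTriad (x'.between hne) (x''.between hne) hd (Ne.symm hc.1)
    (Ne.symm hc.2)⟩

end BridgePath

end pairs

end BorderedKh

namespace BorderedKh

/-! ### Representations of the edges -/

section rep

variable {n : ℕ}

/-- There is an edge from `h` to `k` on the side `s`. -/
def IsEdge (s : Side) (h k : DecLink n) : Prop := IsDecoEdge h k ∨ IsBridgeEdge s h k

section degrees

variable {s : Side} {h x k : DecLink n}

theorem edges_iff_of_deg_four (hd : k.deg = h.deg + 4) :
    (IsEdge s h x ∧ IsEdge s x k) ↔ (IsDecoEdge h x ∧ IsDecoEdge x k) := by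
  constructor
  · rintro ⟨h1 | h1, h2 | h2⟩
    · exact ⟨h1, h2⟩
    all_goals have e1 := h1.deg_eq; have e2 := h2.deg_eq; omega
  · exact fun h => ⟨Or.inl h.1, Or.inl h.2⟩

theorem edges_iff_of_deg_three (hd : k.deg = h.deg + 3) :
    (IsEdge s h x ∧ IsEdge s x k) ↔
      (IsBridgeEdge s h x ∧ IsDecoEdge x k) ∨ (IsDecoEdge h x ∧ IsBridgeEdge s x k) := by
  constructor
  · rintro ⟨h1 | h1, h2 | h2⟩
    · have e1 := h1.deg_eq; have e2 := h2.deg_eq; omega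
    · exact Or.inr ⟨h1, h2⟩
    · exact Or.inl ⟨h1, h2⟩
    · have e1 := h1.deg_eq; have e2 := h2.deg_eq; omega
  · rintro (h | h)
    exacts [⟨Or.inr h.1, Or.inl h.2⟩, ⟨Or.inl h.1, Or.inr h.2⟩]

theorem edges_iff_of_deg_two (hd : k.deg = h.deg + 2) :
    (IsEdge s h x ∧ IsEdge s x k) ↔ BridgePath s h x k := by
  constructor
  · rintro ⟨h1 | h1, h2 | h2⟩
    on_goal 4 => exact ⟨h1, h2⟩
    all_goals have e1 := h1.deg_eq; have e2 := h2.deg_eq; omega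
  · exact fun h => ⟨Or.inr h.1, Or.inr h.2⟩

theorem not_isEdge_of_deg (hd : h.deg + 2 < k.deg) : ¬ IsEdge s h k := by
  rintro (h1 | h1) <;> have e1 := h1.deg_eq <;> omega

theorem BridgePath.deg_eq (p : BridgePath s h x k) : k.deg = h.deg + 2 := by
  have e1 := p.1.deg_eq; have e2 := p.2.deg_eq; omega

theorem BridgePath.isEdge_iff (p : BridgePath s h x k) : IsEdge s h k ↔ h.inner s = k.inner s := by
  constructor
  · rintro (h1 | h1)
    · obtain ⟨q, hq⟩ := isDecoEdge_iff.1 h1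
      exact DecLink.inner_of_diag hq.diag s
    · have e1 := h1.deg_eq; have e2 := p.deg_eq; omega
  · exact fun e => Or.inl (isDecoEdge_of_dual p.1 p.2 e)

end degrees

/-- Orthogonal idempotents of a ring and elements for the edges that are compatible with them. -/
structure EdgeRep (n : ℕ) (A : Type) [Ring A] where
  e : DecLink n → A
  E : Side → DecLink n → DecLink n → A
  e_self : ∀ u, e u * e u = e u
  e_ne : ∀ u v, u ≠ v → e u * e v = 0
  e_sum : ∑ u, e u = 1
  e_E : ∀ s h k, e h * E s h k = E s h k
  E_e : ∀ s h k, E s h k * e k = E s h k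
  E_zero : ∀ s h k, ¬ IsEdge s h k → E s h k = 0

namespace EdgeRep

variable {A : Type} [Ring A] (ρ : EdgeRep n A)

/-- The data for a ring homomorphism out of the tensor algebra of the product algebra. -/
noncomputable def full : TAlg.LiftData (gensFull n) A where
  e := ρ.e
  g := Sum.elim (fun x => ρ.E .right x.1.1 x.1.2) fun x => ρ.E .left x.1.1 x.1.2
  e_self := ρ.e_self
  e_ne := ρ.e_ne
  e_sum := ρ.e_sum
  e_g := by rintro (x | x) <;> exact ρ.e_E _ _ _
  g_e := by rintro (x | x) <;> exact ρ.E_e _ _ _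

/-- The data for a ring homomorphism out of the path algebra. -/
noncomputable def gamma : TAlg.LiftData (gensGamma n) A where
  e := ρ.e
  g x := ρ.E x.1.1 x.1.2.1 x.1.2.2
  e_self := ρ.e_self
  e_ne := ρ.e_ne
  e_sum := ρ.e_sum
  e_g _ := ρ.e_E _ _ _
  g_e _ := ρ.E_e _ _ _

theorem gamma_eC (s : Side) {h k : DecLink n} (x : IsDecoEdge h k) :
    ρ.gamma.lift (eC s x) = ρ.E s h k := ρ.gamma.lift_gen _

theorem gamma_eB {s : Side} {h k : DecLink n} (x : IsBridgeEdge s h k) :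
    ρ.gamma.lift (eB x) = ρ.E s h k := ρ.gamma.lift_gen _

/-- The relations of Roberts' algebra. -/
def GammaRels : Prop := ∀ x, GammaRel x → ρ.gamma.lift x = 0

/-- The product of two edges. -/
noncomputable def two (s t : Side) (h₁ h₂ h₃ : DecLink n) : A := ρ.E s h₁ h₂ * ρ.E t h₂ h₃

theorem two_eq_zero {s t : Side} {h₁ h₂ h₃ : DecLink n} (h : ¬ (IsEdge s h₁ h₂ ∧ IsEdge t h₂ h₃)) :
    ρ.two s t h₁ h₂ h₃ = 0 := by
  unfold two
  by_cases h1 : IsEdge s h₁ h₂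
  · rw [ρ.E_zero t h₂ h₃ fun h2 => h ⟨h1, h2⟩, mul_zero]
  · rw [ρ.E_zero s h₁ h₂ h1, zero_mul]

theorem sum_two {s : Side} {h₁ h₃ : DecLink n} (T : Finset (DecLink n))
    (hT : ∀ x, (IsEdge s h₁ x ∧ IsEdge s x h₃) ↔ x ∈ T) :
    ∑ x, ρ.two s s h₁ x h₃ = ∑ x ∈ T, ρ.two s s h₁ x h₃ := by
  refine (Finset.sum_subset (Finset.subset_univ T) fun x _ hx => ?_).symm
  exact ρ.two_eq_zero (mt (hT x).1 hx)

/-- The relations of the product algebra. -/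
structure ProdRels : Prop where
  right_eq : ∀ {h₁ h₂ h₂' h₃}, IsEdge .right h₁ h₂ → IsEdge .right h₂ h₃ → IsEdge .right h₁ h₂' →
    IsEdge .right h₂' h₃ → ρ.two .right .right h₁ h₂ h₃ = ρ.two .right .right h₁ h₂' h₃
  right_edge : ∀ {h₁ h₂ h₃}, IsEdge .right h₁ h₂ → IsEdge .right h₂ h₃ → IsEdge .right h₁ h₃ →
    ρ.two .right .right h₁ h₂ h₃ = ρ.E .right h₁ h₃
  left_sum : ∀ {h₁ h₃}, ¬ IsEdge .left h₁ h₃ → ∑ h₂, ρ.two .left .left h₁ h₂ h₃ = 0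
  bridge_bridge : ∀ {h₁ h₂ h₂' h₃}, IsBridgeEdge .right h₁ h₂ → IsBridgeEdge .left h₂ h₃ →
    IsBridgeEdge .left h₁ h₂' → IsBridgeEdge .right h₂' h₃ →
    ρ.two .right .left h₁ h₂ h₃ = ρ.two .left .right h₁ h₂' h₃
  circle_bridge : ∀ {h₁ h₂ h₂' h₃}, IsDecoEdge h₁ h₂ → IsBridgeEdge .left h₂ h₃ →
    IsBridgeEdge .left h₁ h₂' → IsDecoEdge h₂' h₃ →
    ρ.two .right .left h₁ h₂ h₃ = ρ.two .left .right h₁ h₂' h₃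
  bridge_circle_disjoint : ∀ {h₁ h₂ h₂' h₃}, IsBridgeEdge .right h₁ h₂ → IsDecoEdge h₂ h₃ →
    IsDecoEdge h₁ h₂' → IsBridgeEdge .right h₂' h₃ → ¬ Touches .right h₂ h₃ h₁ h₂ →
    ρ.two .right .left h₁ h₂ h₃ = ρ.two .left .right h₁ h₂' h₃
  circle_circle : ∀ {h₁ h₂ h₂' h₃}, IsDecoEdge h₁ h₂ → IsDecoEdge h₂ h₃ →
    IsDecoEdge h₁ h₂' → IsDecoEdge h₂' h₃ → h₂ ≠ h₂' →
    ρ.two .right .left h₁ h₂ h₃ = ρ.two .left .right h₁ h₂' h₃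
  join : ∀ {h₁ h₂ h₂' h₂'' h₃}, IsBridgeEdge .right h₁ h₂ → IsDecoEdge h₂ h₃ →
    IsDecoEdge h₁ h₂' → IsBridgeEdge .right h₂' h₃ →
    IsDecoEdge h₁ h₂'' → IsBridgeEdge .right h₂'' h₃ →
    Joins h₁.left h₁.right h₂.right → Touches .right h₂ h₃ h₁ h₂ → h₂' ≠ h₂'' →
    ρ.two .right .left h₁ h₂ h₃ = ρ.two .left .right h₁ h₂' h₃ + ρ.two .left .right h₁ h₂'' h₃
  split : ∀ {h₁ h₂ h₂' h₂'' h₃}, IsBridgeEdge .right h₁ h₂' → IsDecoEdge h₂' h₃ →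
    IsBridgeEdge .right h₁ h₂'' → IsDecoEdge h₂'' h₃ →
    IsDecoEdge h₁ h₂ → IsBridgeEdge .right h₂ h₃ →
    Splits h₂.left h₂.right h₃.right → Touches .right h₁ h₂ h₂ h₃ → h₂' ≠ h₂'' →
    ρ.two .right .left h₁ h₂' h₃ + ρ.two .right .left h₁ h₂'' h₃ = ρ.two .left .right h₁ h₂ h₃

/-- The tetrahedron relations. -/
def TetraRels : Prop := ∀ {h₁ h₂ h₂' h₃ : DecLink n}, BridgePath .left h₁ h₂ h₃ →
  BridgePath .left h₁ h₂' h₃ → h₂.left ≠ h₂'.left → h₁.left ≠ h₃.left → ∀ i j k l,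
  SurgeryAt h₁.left h₂.left i j → h₁.SameCirc i j → h₁.sign i = true →
  SurgeryAt h₂.left h₃.left k l → h₂.SameCirc k i → h₂.SameCirc l (h₁.left i) →
  ¬ h₂.SameCirc k l → h₃.sign k = false →
  ρ.two .left .left h₁ h₂ h₃ + ρ.two .left .left h₁ h₂' h₃ = 0

namespace GammaRels

variable {ρ} (hρ : ρ.GammaRels)
include hρ

theorem deco_deco (s t : Side) {h₁ h₂ h₂' h₃ : DecLink n} (x : IsDecoEdge h₁ h₂)
    (y' : IsDecoEdge h₂ h₃) (y : IsDecoEdge h₁ h₂') (x' : IsDecoEdge h₂' h₃) (hne : h₂ ≠ h₂') :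
    ρ.two s t h₁ h₂ h₃ = sgn s t • ρ.two t s h₁ h₂' h₃ := by
  have := hρ _ (.deco_deco s t x y' y x' hne)
  simpa only [map_sub, map_mul, map_zsmul, gamma_eC, sub_eq_zero, two] using this

theorem bridge_bridge {s t : Side} (hst : s ≠ t) {h₁ h₂ h₂' h₃ : DecLink n}
    (x : IsBridgeEdge s h₁ h₂) (y' : IsBridgeEdge t h₂ h₃)
    (y : IsBridgeEdge t h₁ h₂') (x' : IsBridgeEdge s h₂' h₃) :
    ρ.two s t h₁ h₂ h₃ = sgn s t • ρ.two t s h₁ h₂' h₃ := by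
  have := hρ _ (.bridge_bridge hst x y' y x')
  simpa only [map_sub, map_mul, map_zsmul, gamma_eB, sub_eq_zero, two] using this

theorem bridge_bridge_same {s : Side} {h₁ h₂ h₂' h₃ : DecLink n} (x : BridgePath s h₁ h₂ h₃)
    (y : BridgePath s h₁ h₂' h₃) (hne : h₂.inner s ≠ h₂'.inner s) (hne' : h₁.inner s ≠ h₃.inner s)
    (hside : ¬ SameSide (h₁.inner s) (h₂.inner s) (h₂'.inner s)) :
    ρ.two s s h₁ h₂ h₃ = sgn s s • ρ.two s s h₁ h₂' h₃ := by
  have := hρ _ (.bridge_bridge_same x.1 x.2 y.1 y.2 hne hne' hside)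
  simpa only [map_sub, map_mul, map_zsmul, gamma_eB, sub_eq_zero, two] using this

theorem triad_right {h₁ h₂ h₂' h₃ : DecLink n} (x : BridgePath .right h₁ h₂ h₃)
    (y : BridgePath .right h₁ h₂' h₃) (hne' : h₁.right ≠ h₃.right)
    (hside : SameSide h₁.right h₂.right h₂'.right) :
    ρ.two .right .right h₁ h₂ h₃ = ρ.two .right .right h₁ h₂' h₃ := by
  have := hρ _ (.triad_right x.1 x.2 y.1 y.2 hne' hside)
  simpa only [map_sub, map_mul, gamma_eB, sub_eq_zero, two] using this

theorem triad_left {h₁ h₂ h₂' h₂'' h₃ : DecLink n} (x : BridgePath .left h₁ h₂ h₃)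
    (y : BridgePath .left h₁ h₂' h₃) (z : BridgePath .left h₁ h₂'' h₃) (hne' : h₁.left ≠ h₃.left)
    (htriad : IsTriad h₁.left h₂.left h₂'.left h₂''.left) :
    ρ.two .left .left h₁ h₂ h₃ + ρ.two .left .left h₁ h₂' h₃ + ρ.two .left .left h₁ h₂'' h₃ = 0 := by
  have := hρ _ (.triad_left x.1 x.2 y.1 y.2 z.1 z.2 hne' htriad)
  simpa only [map_add, map_mul, gamma_eB, two] using this

theorem crossing_right {h₁ h₂ h₂' h₃ : DecLink n} (x : BridgePath .right h₁ h₂ h₃)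
    (y : BridgePath .right h₁ h₂' h₃) (hright : h₂.right = h₂'.right)
    (hcross : Crossing h₂.right h₁.right h₃.right) :
    ρ.two .right .right h₁ h₂ h₃ = ρ.two .right .right h₁ h₂' h₃ := by
  have := hρ _ (.crossing_right x.1 x.2 y.1 y.2 hright hcross)
  simpa only [map_sub, map_mul, gamma_eB, sub_eq_zero, two] using this

theorem crossing_left (h₁ h₃ : DecLink n) (a : NCMatching n) (hcross : Crossing a h₁.left h₃.left) :
    ∑ x ∈ mids .left a h₁ h₃, ρ.two .left .left h₁ x h₃ = 0 := by
  classical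
  have := hρ _ (.crossing_left h₁ h₃ a hcross)
  rw [map_sum] at this
  rw [← this, mids, Finset.sum_filter]
  refine Finset.sum_congr rfl fun x _ => ?_
  by_cases hx : x.left = a ∧ IsBridgeEdge .left h₁ x ∧ IsBridgeEdge .left x h₃
  · rw [dif_pos hx, map_mul, gamma_eB, gamma_eB]
    exact if_pos hx
  · rw [dif_neg hx, map_zero]
    exact if_neg hx

theorem deco_bridge (s : Side) {t : Side} {h₁ h₂ h₂' h₃ : DecLink n} (x : IsDecoEdge h₁ h₂)
    (y' : IsBridgeEdge t h₂ h₃) (y : IsBridgeEdge t h₁ h₂') (x' : IsDecoEdge h₂' h₃)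
    (hdisj : ¬ Touches t h₁ h₂ h₂ h₃) :
    ρ.two s t h₁ h₂ h₃ = sgn s t • ρ.two t s h₁ h₂' h₃ := by
  have := hρ _ (.deco_bridge s x y' y x' hdisj)
  simpa only [map_sub, map_mul, map_zsmul, gamma_eB, gamma_eC, sub_eq_zero, two] using this

theorem deco_bridge_right {t : Side} {h₁ h₂ h₂' h₃ : DecLink n} (x : IsDecoEdge h₁ h₂)
    (y' : IsBridgeEdge t h₂ h₃) (y : IsBridgeEdge t h₁ h₂') (x' : IsDecoEdge h₂' h₃) :
    ρ.two .right t h₁ h₂ h₃ = ρ.two t .right h₁ h₂' h₃ := by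
  by_cases ht : Touches t h₁ h₂ h₂ h₃
  · have := hρ _ (.deco_bridge_right x y' y x' ht)
    simpa only [map_sub, map_mul, map_zsmul, gamma_eB, gamma_eC, sub_eq_zero, two] using this
  · rw [hρ.deco_bridge .right x y' y x' ht]
    cases t <;> exact one_smul _ _

theorem deco_join_left {t : Side} {h₁ h₂ h₂' h₂'' h₃ : DecLink n}
    (x₁ : IsDecoEdge h₁ h₂') (y₁ : IsBridgeEdge t h₂' h₃)
    (x₂ : IsDecoEdge h₁ h₂'') (y₂ : IsBridgeEdge t h₂'' h₃)
    (y : IsBridgeEdge t h₁ h₂) (x : IsDecoEdge h₂ h₃)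
    (hjoin : Joins (h₁.outer t) (h₁.inner t) (h₂.inner t))
    (htouch : Touches t h₂ h₃ h₁ h₂) (hne : h₂' ≠ h₂'') :
    ρ.two .left t h₁ h₂' h₃ + ρ.two .left t h₁ h₂'' h₃ = sgn .left t • ρ.two t .left h₁ h₂ h₃ := by
  have := hρ _ (.deco_join_left x₁ y₁ x₂ y₂ y x hjoin htouch hne)
  simpa only [map_sub, map_add, map_mul, map_zsmul, gamma_eB, gamma_eC, sub_eq_zero, two] using this

theorem deco_split_left {t : Side} {h₁ h₂ h₂' h₂'' h₃ : DecLink n}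
    (x : IsDecoEdge h₁ h₂) (y : IsBridgeEdge t h₂ h₃)
    (y₁ : IsBridgeEdge t h₁ h₂') (x₁ : IsDecoEdge h₂' h₃)
    (y₂ : IsBridgeEdge t h₁ h₂'') (x₂ : IsDecoEdge h₂'' h₃)
    (hsplit : Splits (h₂.outer t) (h₂.inner t) (h₃.inner t))
    (htouch : Touches t h₁ h₂ h₂ h₃) (hne : h₂' ≠ h₂'') :
    ρ.two .left t h₁ h₂ h₃ =
      sgn .left t • (ρ.two t .left h₁ h₂' h₃ + ρ.two t .left h₁ h₂'' h₃) := by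
  have := hρ _ (.deco_split_left x y y₁ x₁ y₂ x₂ hsplit htouch hne)
  simpa only [map_sub, map_add, map_mul, map_zsmul, gamma_eB, gamma_eC, sub_eq_zero, two] using this

theorem bridge_dual {h₁ h₂ h₃ : DecLink n} (x : BridgePath .right h₁ h₂ h₃) (z : IsDecoEdge h₁ h₃) :
    ρ.two .right .right h₁ h₂ h₃ = ρ.E .right h₁ h₃ := by
  have := hρ _ (.bridge_dual x.1 x.2 z)
  simpa only [map_sub, map_mul, gamma_eB, gamma_eC, sub_eq_zero, two] using this

end GammaRels

end EdgeRep

end rep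

end BorderedKh

namespace BorderedKh

section equivalence

variable {n : ℕ} {A : Type} [Ring A] {ρ : EdgeRep n A}

namespace EdgeRep.GammaRels

variable (hρ : ρ.GammaRels)
include hρ

theorem right_bridges {h₁ h₂ h₂' h₃ : DecLink n} (x : BridgePath .right h₁ h₂ h₃)
    (y : BridgePath .right h₁ h₂' h₃) :
    ρ.two .right .right h₁ h₂ h₃ = ρ.two .right .right h₁ h₂' h₃ := by
  by_cases hne : h₁.right = h₃.right
  · have z := isDecoEdge_of_dual x.1 x.2 hne
    rw [hρ.bridge_dual x z, hρ.bridge_dual y z]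
  have key : ∀ {h h' : DecLink n}, BridgePath .right h₁ h h₃ → BridgePath .right h₁ h' h₃ →
      h.right ≠ h'.right → ρ.two .right .right h₁ h h₃ = ρ.two .right .right h₁ h' h₃ := by
    intro h h' x y hd
    by_cases hs : SameSide h₁.right h.right h'.right
    · exact hρ.triad_right x y hne hs
    · exact (hρ.bridge_bridge_same x y hd hne hs).trans (one_smul _ _)
  by_cases he : h₂.right = h₂'.right
  · by_cases hc : Crossing h₂.right h₁.right h₃.right
    · exact hρ.crossing_right x y he hc
    · obtain ⟨h, z, hz⟩ := x.exists_ne hne hc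
      rw [key x z (Ne.symm hz), key y z]
      rw [← he]
      exact Ne.symm hz
  · exact key x y he

theorem right_eq {h₁ h₂ h₂' h₃ : DecLink n} (x : IsEdge .right h₁ h₂) (y : IsEdge .right h₂ h₃)
    (x' : IsEdge .right h₁ h₂') (y' : IsEdge .right h₂' h₃) :
    ρ.two .right .right h₁ h₂ h₃ = ρ.two .right .right h₁ h₂' h₃ := by
  by_cases he : h₂ = h₂'
  · rw [he]
  have key : ∀ {h h' : DecLink n}, IsDecoEdge h₁ h → IsBridgeEdge .right h h₃ →
      IsBridgeEdge .right h₁ h' → IsDecoEdge h' h₃ →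
      ρ.two .right .right h₁ h h₃ = ρ.two .right .right h₁ h' h₃ := fun a b c d =>
    hρ.deco_bridge_right a b c d
  have h3 : h₃.deg = h₁.deg + 3 → ρ.two .right .right h₁ h₂ h₃ = ρ.two .right .right h₁ h₂' h₃ := by
    intro hd
    have z := (edges_iff_of_deg_three hd).1 ⟨x, y⟩
    have z' := (edges_iff_of_deg_three hd).1 ⟨x', y'⟩
    have hex : (∃ u, IsBridgeEdge .right h₁ u ∧ IsDecoEdge u h₃) ∧
        ∃ w, IsDecoEdge h₁ w ∧ IsBridgeEdge .right w h₃ := by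
      rcases deco_bridge_cases .right h₁ h₃ with ⟨c1, c2⟩ | ⟨u, w, c1, c2, -⟩ |
        ⟨u, w, w', -, c1, c2, -⟩ | ⟨u, u', w, -, c1, c2, -⟩
      · exact absurd z (not_or.2 ⟨c1 _, c2 _⟩)
      · exact ⟨⟨u, (c1 u).2 rfl⟩, ⟨w, (c2 w).2 rfl⟩⟩
      · exact ⟨⟨u, (c1 u).2 rfl⟩, ⟨w, (c2 w).2 (Or.inl rfl)⟩⟩
      · exact ⟨⟨u, (c1 u).2 (Or.inl rfl)⟩, ⟨w, (c2 w).2 rfl⟩⟩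
    obtain ⟨⟨u, u1, u2⟩, ⟨w, w1, w2⟩⟩ := hex
    have all : ∀ {h}, (IsBridgeEdge .right h₁ h ∧ IsDecoEdge h h₃) ∨
        (IsDecoEdge h₁ h ∧ IsBridgeEdge .right h h₃) →
        ρ.two .right .right h₁ h h₃ = ρ.two .right .right h₁ u h₃ := by
      rintro h (⟨a, b⟩ | ⟨a, b⟩)
      · rw [← key w1 w2 a b, key w1 w2 u1 u2]
      · exact key a b u1 u2
    rw [all z, all z']
  rcases x with a | a <;> rcases y with b | b
  · have hd : h₃.deg = h₁.deg + 4 := by have := a.deg_eq; have := b.deg_eq; omega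
    obtain ⟨a', b'⟩ := (edges_iff_of_deg_four hd).1 ⟨x', y'⟩
    exact (hρ.deco_deco .right .right a b a' b' he).trans (one_smul _ _)
  · exact h3 (by have := a.deg_eq; have := b.deg_eq; omega)
  · exact h3 (by have := a.deg_eq; have := b.deg_eq; omega)
  · have p : BridgePath .right h₁ h₂ h₃ := ⟨a, b⟩
    exact hρ.right_bridges p ((edges_iff_of_deg_two p.deg_eq).1 ⟨x', y'⟩)

theorem right_edge {h₁ h₂ h₃ : DecLink n} (x : IsEdge .right h₁ h₂) (y : IsEdge .right h₂ h₃)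
    (z : IsEdge .right h₁ h₃) : ρ.two .right .right h₁ h₂ h₃ = ρ.E .right h₁ h₃ := by
  rcases x with a | a <;> rcases y with b | b
  on_goal 4 =>
    rcases z with c | c
    · exact hρ.bridge_dual ⟨a, b⟩ c
  all_goals
    exfalso
    have e1 := a.deg_eq
    have e2 := b.deg_eq
    first
      | have e3 := c.deg_eq; omega
      | exact not_isEdge_of_deg (by omega) z

theorem left_bridges_sum {h₁ h₂ h₃ : DecLink n} (x : BridgePath .left h₁ h₂ h₃)
    (hne : h₁.left ≠ h₃.left) : ∑ h, ρ.two .left .left h₁ h h₃ = 0 := by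
  classical
  have hiff : ∀ h, (IsEdge .left h₁ h ∧ IsEdge .left h h₃) ↔ BridgePath .left h₁ h h₃ :=
    fun h => edges_iff_of_deg_two x.deg_eq
  by_cases hc : Crossing h₂.left h₁.left h₃.left
  · rw [ρ.sum_two (mids .left h₂.left h₁ h₃), hρ.crossing_left _ _ _ hc]
    intro h
    rw [hiff, mem_mids]
    exact ⟨fun y => ⟨(x.between hne).eq_of_crossing hc (y.between hne), y⟩, fun y => y.2⟩
  obtain ⟨h₂', y, hd⟩ := x.exists_ne hne hc
  by_cases hs : SameSide h₁.left h₂.left h₂'.left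
  · obtain ⟨h₂'', z, ht⟩ := x.exists_triad y hne (Ne.symm hd) hs
    rw [ρ.sum_two {h₂, h₂', h₂''}]
    · rw [Finset.sum_insert, Finset.sum_insert, Finset.sum_singleton, ← add_assoc]
      · exact hρ.triad_left x y z hne ht
      · rw [Finset.mem_singleton]
        rintro rfl
        exact ht.ne.2 rfl
      · rw [Finset.mem_insert, Finset.mem_singleton]
        rintro (rfl | rfl)
        exacts [hd rfl, ht.ne.1 rfl]
    · intro h
      rw [hiff, x.iff_of_triad y z hne ht]
      simp
  · have hneg : ∀ {h h'}, h ∈ mids .left h₂.left h₁ h₃ → h' ∈ mids .left h₂'.left h₁ h₃ →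
        ρ.two .left .left h₁ h h₃ = - ρ.two .left .left h₁ h' h₃ := by
      intro h h' hh hh'
      rw [mem_mids] at hh hh'
      have h1 : h.left = h₂.left := hh.1
      have h2 : h'.left = h₂'.left := hh'.1
      rw [hρ.bridge_bridge_same (s := .left) hh.2 hh'.2]
      · exact neg_one_smul ℤ _
      · change h.left ≠ h'.left
        rw [h1, h2]
        exact Ne.symm hd
      · exact hne
      · change ¬ SameSide h₁.left h.left h'.left
        rwa [h1, h2]
    have hT : ∀ h, (IsEdge .left h₁ h ∧ IsEdge .left h h₃) ↔
        h ∈ mids .left h₂.left h₁ h₃ ∪ mids .left h₂'.left h₁ h₃ := by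
      intro h
      rw [hiff, Finset.mem_union, mem_mids, mem_mids]
      constructor
      · intro w
        exact (x.inner_eq_or y hne (Ne.symm hd) hs w).imp (fun e => ⟨e, w⟩) fun e => ⟨e, w⟩
      · rintro (w | w)
        exacts [w.2, w.2]
    have hcard : (mids .left h₂'.left h₁ h₃).card = (mids .left h₂.left h₁ h₃).card :=
      x.card_mids_eq (y.between hne) (x.between hne)
    rw [ρ.sum_two _ hT, Finset.sum_union]
    · rw [Finset.sum_congr rfl fun h hh => hneg hh y.mem_mids,
        Finset.sum_congr rfl fun h hh => neg_eq_iff_eq_neg.1 (hneg x.mem_mids hh).symm,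
        Finset.sum_const, Finset.sum_const, hcard,
        hneg x.mem_mids y.mem_mids]
      rw [neg_neg, smul_neg, neg_add_cancel]
    · rw [Finset.disjoint_left]
      intro h h1 h2
      rw [mem_mids] at h1 h2
      exact hd (h2.1.symm.trans h1.1)

theorem left_sum_of_deg_three {h₁ h₃ : DecLink n} (hd : h₃.deg = h₁.deg + 3) :
    ∑ h, ρ.two .left .left h₁ h h₃ = 0 := by
  classical
  have hiff : ∀ h, (IsEdge .left h₁ h ∧ IsEdge .left h h₃) ↔
      (IsBridgeEdge .left h₁ h ∧ IsDecoEdge h h₃) ∨ (IsDecoEdge h₁ h ∧ IsBridgeEdge .left h h₃) :=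
    fun h => edges_iff_of_deg_three hd
  have hdis : ∀ {u w}, (IsBridgeEdge .left h₁ u ∧ IsDecoEdge u h₃) →
      (IsDecoEdge h₁ w ∧ IsBridgeEdge .left w h₃) → u ≠ w := by
    rintro u w hu hw rfl
    exact hu.1.not_deco hw.1
  rcases deco_bridge_cases .left h₁ h₃ with ⟨c1, c2⟩ | ⟨u, w, c1, c2, -, ht⟩ |
    ⟨u, w, w', hw, c1, c2, hj, ht, -⟩ | ⟨u, u', w, hu, c1, c2, hj, ht, -⟩
  · rw [ρ.sum_two ∅, Finset.sum_empty]
    intro x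
    simp only [hiff, c1, c2, or_self, Finset.notMem_empty]
  · have u1 := (c1 u).2 rfl
    have w1 := (c2 w).2 rfl
    rw [ρ.sum_two {u, w}, Finset.sum_pair (hdis u1 w1),
      hρ.deco_bridge .left w1.1 w1.2 u1.1 u1.2 ht]
    · exact (congrArg _ (neg_one_smul ℤ _)).trans (add_neg_cancel _)
    · intro x
      simp only [hiff, c1, c2, Finset.mem_insert, Finset.mem_singleton]
  · have u1 := (c1 u).2 rfl
    have w1 := (c2 w).2 (Or.inl rfl)
    have w1' := (c2 w').2 (Or.inr rfl)
    rw [ρ.sum_two {u, w, w'}, Finset.sum_insert, Finset.sum_pair hw,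
      hρ.deco_join_left w1.1 w1.2 w1'.1 w1'.2 u1.1 u1.2 hj ht hw]
    · exact (congrArg _ (neg_one_smul ℤ _)).trans (add_neg_cancel _)
    · rw [Finset.mem_insert, Finset.mem_singleton]
      exact not_or.2 ⟨hdis u1 w1, hdis u1 w1'⟩
    · intro x
      simp only [hiff, c1, c2, Finset.mem_insert, Finset.mem_singleton]
  · have u1 := (c1 u).2 (Or.inl rfl)
    have u1' := (c1 u').2 (Or.inr rfl)
    have w1 := (c2 w).2 rfl
    rw [ρ.sum_two {w, u, u'}, Finset.sum_insert, Finset.sum_pair hu,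
      hρ.deco_split_left w1.1 w1.2 u1.1 u1.2 u1'.1 u1'.2 hj ht hu]
    · exact (congrArg (· + _) (neg_one_smul ℤ _)).trans (neg_add_cancel _)
    · rw [Finset.mem_insert, Finset.mem_singleton]
      exact not_or.2 ⟨(hdis u1 w1).symm, (hdis u1' w1).symm⟩
    · intro x
      simp only [hiff, c1, c2, Finset.mem_insert, Finset.mem_singleton]
      exact or_comm

theorem left_sum {h₁ h₃ : DecLink n} (hn : ¬ IsEdge .left h₁ h₃) :
    ∑ h, ρ.two .left .left h₁ h h₃ = 0 := by
  classical
  by_cases hex : ∃ h, IsEdge .left h₁ h ∧ IsEdge .left h h₃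
  swap
  · rw [ρ.sum_two ∅, Finset.sum_empty]
    intro x
    simpa using not_exists.1 hex x
  obtain ⟨h, a | a, b | b⟩ := hex
  · have hd : h₃.deg = h₁.deg + 4 := by have := a.deg_eq; have := b.deg_eq; omega
    rcases deco_deco_cases h₁ h₃ with c | ⟨u, w, hne, c⟩
    · exact absurd ⟨a, b⟩ (c h)
    · have u1 := (c u).2 (Or.inl rfl)
      have w1 := (c w).2 (Or.inr rfl)
      rw [ρ.sum_two {u, w}, Finset.sum_pair hne,
        hρ.deco_deco .left .left u1.1 u1.2 w1.1 w1.2 hne]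
      · exact (congrArg (· + _) (neg_one_smul ℤ _)).trans (neg_add_cancel _)
      · intro x
        rw [edges_iff_of_deg_four hd, c]
        simp
  · exact hρ.left_sum_of_deg_three (by have := a.deg_eq; have := b.deg_eq; omega)
  · exact hρ.left_sum_of_deg_three (by have := a.deg_eq; have := b.deg_eq; omega)
  · have p : BridgePath .left h₁ h h₃ := ⟨a, b⟩
    exact hρ.left_bridges_sum p (mt p.isEdge_iff.2 hn)

theorem prodRels : ρ.ProdRels where
  right_eq := hρ.right_eq
  right_edge := hρ.right_edge
  left_sum := hρ.left_sum
  bridge_bridge x y' y x' := (hρ.bridge_bridge (by simp) x y' y x').trans (one_smul _ _)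
  circle_bridge x y' y x' := hρ.deco_bridge_right x y' y x'
  bridge_circle_disjoint {h₁ h₂ h₂' h₃} x y' y x' hd := by
    refine ((hρ.deco_bridge .left y x' x y' ?_).trans (one_smul _ _)).symm
    rcases deco_bridge_cases .right h₁ h₃ with ⟨c1, c2⟩ | ⟨u, w, c1, c2, -, ht⟩ |
      ⟨u, w, w', hw, c1, c2, hj, ht, -⟩ | ⟨u, u', w, hu, c1, c2, hj, ht, ht', ht''⟩
    · exact absurd ⟨y, x'⟩ (c2 _)
    · obtain rfl := (c2 _).1 ⟨y, x'⟩
      exact ht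
    · obtain rfl := (c1 _).1 ⟨x, y'⟩
      exact absurd ht hd
    · obtain rfl | rfl := (c1 _).1 ⟨x, y'⟩
      exacts [absurd ht' hd, absurd ht'' hd]
  circle_circle x y' y x' hne := (hρ.deco_deco .right .left x y' y x' hne).trans (one_smul _ _)
  join x y' y₁ x₁ y₂ x₂ hj ht hne :=
    ((hρ.deco_join_left (t := .right) y₁ x₁ y₂ x₂ x y' hj ht hne).trans (one_smul _ _)).symm
  split x₁ y₁ x₂ y₂ y x' hs ht hne :=
    ((hρ.deco_split_left (t := .right) y x' x₁ y₁ x₂ y₂ hs ht hne).trans (one_smul _ _)).symm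

theorem tetraRels : ρ.TetraRels := by
  intro h₁ h₂ h₂' h₃ x y hd hne i j k l h1 h2 h3 h4 h5 h6 h7 h8
  rw [hρ.bridge_bridge_same (s := .left) x y hd hne]
  · exact (congrArg (· + _) (neg_one_smul ℤ _)).trans (neg_add_cancel _)
  · exact fun hs => x.not_rejoin y hne hd hs h1 h4 h5 h6 h7

end EdgeRep.GammaRels

namespace EdgeRep.ProdRels

variable (hρ : ρ.ProdRels)
include hρ

theorem deco_deco (s t : Side) {h₁ h₂ h₂' h₃ : DecLink n} (x : IsDecoEdge h₁ h₂)
    (y' : IsDecoEdge h₂ h₃) (y : IsDecoEdge h₁ h₂') (x' : IsDecoEdge h₂' h₃) (hne : h₂ ≠ h₂') :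
    ρ.two s t h₁ h₂ h₃ = sgn s t • ρ.two t s h₁ h₂' h₃ := by
  classical
  cases s <;> cases t
  · have hd : h₃.deg = h₁.deg + 4 := by have := x.deg_eq; have := y'.deg_eq; omega
    have hs := hρ.left_sum (not_isEdge_of_deg (s := .left) (h := h₁) (k := h₃) (by omega))
    rcases deco_deco_cases h₁ h₃ with c | ⟨u, w, huw, c⟩
    · exact absurd ⟨x, y'⟩ (c _)
    · have hT : ∀ z, (IsEdge .left h₁ z ∧ IsEdge .left z h₃) ↔ z ∈ ({h₂, h₂'} : Finset (DecLink n)) := by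
        intro z
        rw [edges_iff_of_deg_four hd, c, Finset.mem_insert, Finset.mem_singleton]
        have e1 := (c _).1 ⟨x, y'⟩
        have e2 := (c _).1 ⟨y, x'⟩
        rcases e1 with rfl | rfl <;> rcases e2 with rfl | rfl
        exacts [absurd rfl hne, Iff.rfl, or_comm, absurd rfl hne]
      rw [ρ.sum_two _ hT, Finset.sum_pair hne] at hs
      exact (eq_neg_of_add_eq_zero_left hs).trans (neg_one_smul ℤ _).symm
  · exact (hρ.circle_circle y x' x y' (Ne.symm hne)).symm.trans (one_smul ℤ _).symm
  · exact (hρ.circle_circle x y' y x' hne).trans (one_smul ℤ _).symm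
  · exact (hρ.right_eq (.inl x) (.inl y') (.inl y) (.inl x')).trans (one_smul ℤ _).symm

theorem bridge_bridge_opp {s t : Side} (hst : s ≠ t) {h₁ h₂ h₂' h₃ : DecLink n}
    (x : IsBridgeEdge s h₁ h₂) (y' : IsBridgeEdge t h₂ h₃)
    (y : IsBridgeEdge t h₁ h₂') (x' : IsBridgeEdge s h₂' h₃) :
    ρ.two s t h₁ h₂ h₃ = sgn s t • ρ.two t s h₁ h₂' h₃ := by
  cases s <;> cases t
  · exact absurd rfl hst
  · exact (hρ.bridge_bridge y x' x y').symm.trans (one_smul ℤ _).symm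
  · exact (hρ.bridge_bridge x y' y x').trans (one_smul ℤ _).symm
  · exact absurd rfl hst

theorem left_bridges_sum {h₁ h₂ h₃ : DecLink n} (x : BridgePath .left h₁ h₂ h₃)
    (hne : h₁.left ≠ h₃.left) : ∑ h, ρ.two .left .left h₁ h h₃ = 0 :=
  hρ.left_sum (mt x.isEdge_iff.1 hne)

theorem bridge_bridge_same (ht : ρ.TetraRels) {s : Side} {h₁ h₂ h₂' h₃ : DecLink n}
    (x : BridgePath s h₁ h₂ h₃) (y : BridgePath s h₁ h₂' h₃) (hd : h₂.inner s ≠ h₂'.inner s)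
    (hne : h₁.inner s ≠ h₃.inner s)
    (hside : ¬ SameSide (h₁.inner s) (h₂.inner s) (h₂'.inner s)) :
    ρ.two s s h₁ h₂ h₃ = sgn s s • ρ.two s s h₁ h₂' h₃ := by
  classical
  cases s
  swap
  · exact (hρ.right_eq (.inr x.1) (.inr x.2) (.inr y.1) (.inr y.2)).trans (one_smul ℤ _).symm
  refine Eq.trans ?_ (neg_one_smul ℤ _).symm
  rw [← add_eq_zero_iff_eq_neg]
  by_cases h : ∃ z, BridgePath .left h₁ z h₃ ∧ z.left = h₂.left ∧ z ≠ h₂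
  · obtain ⟨z, hz, he, hn⟩ := h
    obtain ⟨i, j, k, l, c1, c2, c3, c4, c5, c6, c7, c8⟩ :=
      exists_of_two_mids x.1 x.2 hz.1 hz.2 he.symm (Ne.symm hn)
    exact ht x y hd hne i j k l c1 c2 c3 c4 c5 c6 c7 c8
  · push Not at h
    have h1 : mids .left h₂.left h₁ h₃ = {h₂} := by
      ext z
      rw [mem_mids, Finset.mem_singleton]
      constructor
      · exact fun hz => h z hz.2 hz.1
      · rintro rfl
        exact ⟨rfl, x⟩
    have h2 : (mids .left h₂'.left h₁ h₃).card = 1 := by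
      have : (mids .left h₂'.left h₁ h₃).card = (mids .left h₂.left h₁ h₃).card :=
        x.card_mids_eq (y.between hne) (x.between hne)
      rw [this, h1, Finset.card_singleton]
    obtain ⟨w, hw⟩ := Finset.card_eq_one.1 h2
    have hw' : ∀ z, z ∈ mids .left h₂'.left h₁ h₃ → z = h₂' := by
      intro z hz
      have h3 : h₂' ∈ mids .left h₂'.left h₁ h₃ := y.mem_mids
      rw [hw, Finset.mem_singleton] at hz h3
      rw [hz, h3]
    have hs := hρ.left_bridges_sum x hne
    rw [ρ.sum_two {h₂, h₂'}, Finset.sum_pair] at hs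
    · exact hs
    · rintro rfl
      exact hd rfl
    · intro z
      rw [edges_iff_of_deg_two x.deg_eq, Finset.mem_insert, Finset.mem_singleton]
      constructor
      · intro hz
        rcases x.inner_eq_or y hne hd hside hz with e | e
        · exact Or.inl (h z hz e)
        · exact Or.inr (hw' z (mem_mids.2 ⟨e, hz⟩))
      · rintro (rfl | rfl) <;> assumption

theorem triad_left {h₁ h₂ h₂' h₂'' h₃ : DecLink n} (x : BridgePath .left h₁ h₂ h₃)
    (y : BridgePath .left h₁ h₂' h₃) (z : BridgePath .left h₁ h₂'' h₃) (hne : h₁.left ≠ h₃.left)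
    (ht : IsTriad h₁.left h₂.left h₂'.left h₂''.left) :
    ρ.two .left .left h₁ h₂ h₃ + ρ.two .left .left h₁ h₂' h₃ + ρ.two .left .left h₁ h₂'' h₃ = 0 := by
  classical
  have hs := hρ.left_bridges_sum x hne
  rw [ρ.sum_two {h₂, h₂', h₂''}] at hs
  · rw [Finset.sum_insert, Finset.sum_insert, Finset.sum_singleton, ← add_assoc] at hs
    · exact hs
    · rw [Finset.mem_singleton]
      rintro rfl
      exact ht.ne.2 rfl
    · rw [Finset.mem_insert, Finset.mem_singleton]
      rintro (rfl | rfl)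
      exacts [ht.ne' rfl, ht.ne.1 rfl]
  · intro h
    rw [edges_iff_of_deg_two x.deg_eq, x.iff_of_triad y z hne ht]
    simp

theorem crossing_left (h₁ h₃ : DecLink n) (a : NCMatching n) (hc : Crossing a h₁.left h₃.left) :
    ∑ x ∈ mids .left a h₁ h₃, ρ.two .left .left h₁ x h₃ = 0 := by
  rcases (mids .left a h₁ h₃).eq_empty_or_nonempty with he | ⟨h, hh⟩
  · rw [he, Finset.sum_empty]
  obtain ⟨rfl, x⟩ := mem_mids.1 hh
  have x : BridgePath .left h₁ h h₃ := x
  have hne := x.inner_ne_of_crossing hc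
  have hs := hρ.left_bridges_sum x hne
  rwa [ρ.sum_two (mids .left h.left h₁ h₃)] at hs
  intro z
  rw [edges_iff_of_deg_two x.deg_eq, mem_mids]
  exact ⟨fun y => ⟨(x.between hne).eq_of_crossing hc (y.between hne), y⟩, fun y => y.2⟩

theorem left_sum_of_deg_three {h₁ h₃ : DecLink n} (hd : h₃.deg = h₁.deg + 3) (T : Finset (DecLink n))
    (hT : ∀ x, x ∈ T ↔ (IsBridgeEdge .left h₁ x ∧ IsDecoEdge x h₃) ∨
      (IsDecoEdge h₁ x ∧ IsBridgeEdge .left x h₃)) : ∑ x ∈ T, ρ.two .left .left h₁ x h₃ = 0 := by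
  rw [← ρ.sum_two T]
  · exact hρ.left_sum (not_isEdge_of_deg (by omega))
  · intro x
    rw [hT, edges_iff_of_deg_three hd]

theorem deco_bridge (s : Side) {t : Side} {h₁ h₂ h₂' h₃ : DecLink n} (x : IsDecoEdge h₁ h₂)
    (y' : IsBridgeEdge t h₂ h₃) (y : IsBridgeEdge t h₁ h₂') (x' : IsDecoEdge h₂' h₃)
    (hdisj : ¬ Touches t h₁ h₂ h₂ h₃) :
    ρ.two s t h₁ h₂ h₃ = sgn s t • ρ.two t s h₁ h₂' h₃ := by
  classical
  have hd : h₃.deg = h₁.deg + 3 := by have := x.deg_eq; have := y'.deg_eq; omega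
  have hcase : (∀ z, (IsBridgeEdge t h₁ z ∧ IsDecoEdge z h₃) ↔ z = h₂') ∧
      (∀ z, (IsDecoEdge h₁ z ∧ IsBridgeEdge t z h₃) ↔ z = h₂) ∧ ¬ Touches t h₂' h₃ h₁ h₂' := by
    rcases deco_bridge_cases t h₁ h₃ with ⟨c1, c2⟩ | ⟨u, w, c1, c2, ht, -⟩ |
      ⟨u, w, w', hw, c1, c2, hj, -, ht, ht'⟩ | ⟨u, u', w, hu, c1, c2, hj, ht, -⟩
    · exact absurd ⟨x, y'⟩ (c2 _)
    · obtain rfl := (c2 _).1 ⟨x, y'⟩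
      obtain rfl := (c1 _).1 ⟨y, x'⟩
      exact ⟨c1, c2, ht⟩
    · obtain rfl | rfl := (c2 _).1 ⟨x, y'⟩
      exacts [absurd ht hdisj, absurd ht' hdisj]
    · obtain rfl := (c2 _).1 ⟨x, y'⟩
      exact absurd ht hdisj
  obtain ⟨c1, c2, c3⟩ := hcase
  cases s <;> cases t
  · have hne : h₂' ≠ h₂ := by
      rintro rfl
      exact y.not_deco x
    have hs := hρ.left_sum_of_deg_three hd {h₂', h₂} fun z => by
      rw [c1, c2, Finset.mem_insert, Finset.mem_singleton]
    rw [Finset.sum_pair hne, add_comm] at hs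
    exact (eq_neg_of_add_eq_zero_left hs).trans (neg_one_smul ℤ _).symm
  · exact (hρ.bridge_circle_disjoint y x' x y' c3).symm.trans (one_smul ℤ _).symm
  · exact (hρ.circle_bridge x y' y x').trans (one_smul ℤ _).symm
  · exact (hρ.right_eq (.inl x) (.inr y') (.inr y) (.inl x')).trans (one_smul ℤ _).symm

theorem deco_join_left {t : Side} {h₁ h₂ h₂' h₂'' h₃ : DecLink n}
    (x₁ : IsDecoEdge h₁ h₂') (y₁ : IsBridgeEdge t h₂' h₃)
    (x₂ : IsDecoEdge h₁ h₂'') (y₂ : IsBridgeEdge t h₂'' h₃)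
    (y : IsBridgeEdge t h₁ h₂) (x : IsDecoEdge h₂ h₃)
    (hjoin : Joins (h₁.outer t) (h₁.inner t) (h₂.inner t))
    (htouch : Touches t h₂ h₃ h₁ h₂) (hne : h₂' ≠ h₂'') :
    ρ.two .left t h₁ h₂' h₃ + ρ.two .left t h₁ h₂'' h₃ = sgn .left t • ρ.two t .left h₁ h₂ h₃ := by
  classical
  cases t
  swap
  · exact (hρ.join y x x₁ y₁ x₂ y₂ hjoin htouch hne).symm.trans (one_smul ℤ _).symm
  have hd : h₃.deg = h₁.deg + 3 := by have := x₁.deg_eq; have := y₁.deg_eq; omega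
  have n1 : h₂ ≠ h₂' := by
    rintro rfl
    exact y.not_deco x₁
  have n2 : h₂ ≠ h₂'' := by
    rintro rfl
    exact y.not_deco x₂
  have hs := hρ.left_sum_of_deg_three hd {h₂, h₂', h₂''} fun z => by
    rw [Finset.mem_insert, Finset.mem_insert, Finset.mem_singleton]
    rcases deco_bridge_cases .left h₁ h₃ with ⟨c1, c2⟩ | ⟨u, w, c1, c2, -⟩ |
      ⟨u, w, w', hw, c1, c2, -⟩ | ⟨u, u', w, hu, c1, c2, -⟩
    · exact absurd ⟨x₁, y₁⟩ (c2 _)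
    · exact absurd (((c2 _).1 ⟨x₁, y₁⟩).trans ((c2 _).1 ⟨x₂, y₂⟩).symm) hne
    · obtain rfl := (c1 _).1 ⟨y, x⟩
      rw [c1, c2]
      rcases (c2 _).1 ⟨x₁, y₁⟩ with rfl | rfl <;> rcases (c2 _).1 ⟨x₂, y₂⟩ with rfl | rfl
      exacts [absurd rfl hne, Iff.rfl, or_congr_right or_comm, absurd rfl hne]
    · exact absurd (((c2 _).1 ⟨x₁, y₁⟩).trans ((c2 _).1 ⟨x₂, y₂⟩).symm) hne
  rw [Finset.sum_insert, Finset.sum_pair hne, add_comm] at hs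
  · exact (eq_neg_of_add_eq_zero_left hs).trans (neg_one_smul ℤ _).symm
  · rw [Finset.mem_insert, Finset.mem_singleton]
    exact not_or.2 ⟨n1, n2⟩

theorem deco_split_left {t : Side} {h₁ h₂ h₂' h₂'' h₃ : DecLink n}
    (x : IsDecoEdge h₁ h₂) (y : IsBridgeEdge t h₂ h₃)
    (y₁ : IsBridgeEdge t h₁ h₂') (x₁ : IsDecoEdge h₂' h₃)
    (y₂ : IsBridgeEdge t h₁ h₂'') (x₂ : IsDecoEdge h₂'' h₃)
    (hsplit : Splits (h₂.outer t) (h₂.inner t) (h₃.inner t))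
    (htouch : Touches t h₁ h₂ h₂ h₃) (hne : h₂' ≠ h₂'') :
    ρ.two .left t h₁ h₂ h₃ =
      sgn .left t • (ρ.two t .left h₁ h₂' h₃ + ρ.two t .left h₁ h₂'' h₃) := by
  classical
  cases t
  swap
  · exact (hρ.split y₁ x₁ y₂ x₂ x y hsplit htouch hne).symm.trans (one_smul ℤ _).symm
  have hd : h₃.deg = h₁.deg + 3 := by have := x.deg_eq; have := y.deg_eq; omega
  have n1 : h₂ ≠ h₂' := by
    rintro rfl
    exact y₁.not_deco x
  have n2 : h₂ ≠ h₂'' := by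
    rintro rfl
    exact y₂.not_deco x
  have hs := hρ.left_sum_of_deg_three hd {h₂, h₂', h₂''} fun z => by
    rw [Finset.mem_insert, Finset.mem_insert, Finset.mem_singleton]
    rcases deco_bridge_cases .left h₁ h₃ with ⟨c1, c2⟩ | ⟨u, w, c1, c2, -⟩ |
      ⟨u, w, w', hw, c1, c2, -⟩ | ⟨u, u', w, hu, c1, c2, -⟩
    · exact absurd ⟨x, y⟩ (c2 _)
    · exact absurd (((c1 _).1 ⟨y₁, x₁⟩).trans ((c1 _).1 ⟨y₂, x₂⟩).symm) hne
    · exact absurd (((c1 _).1 ⟨y₁, x₁⟩).trans ((c1 _).1 ⟨y₂, x₂⟩).symm) hne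
    · obtain rfl := (c2 _).1 ⟨x, y⟩
      rw [c1, c2, or_comm]
      rcases (c1 _).1 ⟨y₁, x₁⟩ with rfl | rfl <;> rcases (c1 _).1 ⟨y₂, x₂⟩ with rfl | rfl
      exacts [absurd rfl hne, Iff.rfl, or_congr_left or_comm, absurd rfl hne]
  rw [Finset.sum_insert, Finset.sum_pair hne] at hs
  · exact (eq_neg_of_add_eq_zero_left hs).trans (neg_one_smul ℤ _).symm
  · rw [Finset.mem_insert, Finset.mem_singleton]
    exact not_or.2 ⟨n1, n2⟩

theorem gammaRels (ht : ρ.TetraRels) : ρ.GammaRels := by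
  classical
  intro x hx
  cases hx with
  | deco_deco s t x y' y x' hne =>
    simpa only [map_sub, map_mul, map_zsmul, gamma_eC, sub_eq_zero, two] using
      hρ.deco_deco s t x y' y x' hne
  | bridge_bridge hst x y' y x' =>
    simpa only [map_sub, map_mul, map_zsmul, gamma_eB, sub_eq_zero, two] using
      hρ.bridge_bridge_opp hst x y' y x'
  | bridge_bridge_same x y' y x' hne hne' hside =>
    simpa only [map_sub, map_mul, map_zsmul, gamma_eB, sub_eq_zero, two] using
      hρ.bridge_bridge_same ht ⟨x, y'⟩ ⟨y, x'⟩ hne hne' hside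
  | triad_right x y' y x' hne' hside =>
    simpa only [map_sub, map_mul, gamma_eB, sub_eq_zero, two] using
      hρ.right_eq (.inr x) (.inr y') (.inr y) (.inr x')
  | triad_left x x' y y' z z' hne' htriad =>
    simpa only [map_add, map_mul, gamma_eB, two] using
      hρ.triad_left ⟨x, x'⟩ ⟨y, y'⟩ ⟨z, z'⟩ hne' htriad
  | crossing_right x y x' y' hright hcross =>
    simpa only [map_sub, map_mul, gamma_eB, sub_eq_zero, two] using
      hρ.right_eq (.inr x) (.inr y) (.inr x') (.inr y')
  | crossing_left h₁ h₃ a hcross =>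
    rw [map_sum, ← hρ.crossing_left h₁ h₃ a hcross, mids, Finset.sum_filter]
    refine Finset.sum_congr rfl fun x _ => ?_
    by_cases hx : x.left = a ∧ IsBridgeEdge .left h₁ x ∧ IsBridgeEdge .left x h₃
    · rw [dif_pos hx, map_mul, gamma_eB, gamma_eB]
      exact (if_pos hx).symm
    · rw [dif_neg hx, map_zero]
      exact (if_neg hx).symm
  | deco_bridge s x y' y x' hdisj =>
    simpa only [map_sub, map_mul, map_zsmul, gamma_eB, gamma_eC, sub_eq_zero, two] using
      hρ.deco_bridge s x y' y x' hdisj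
  | deco_bridge_right x y' y x' htouch =>
    rename_i t _ _ _ _
    simp only [map_sub, map_mul, gamma_eB, gamma_eC, sub_eq_zero]
    cases t
    · exact hρ.circle_bridge x y' y x'
    · exact hρ.right_eq (.inl x) (.inr y') (.inr y) (.inl x')
  | deco_join_left x₁ y₁ x₂ y₂ y x hjoin htouch hne =>
    simpa only [map_sub, map_add, map_mul, map_zsmul, gamma_eB, gamma_eC, sub_eq_zero, two] using
      hρ.deco_join_left x₁ y₁ x₂ y₂ y x hjoin htouch hne
  | deco_split_left x y y₁ x₁ y₂ x₂ hsplit htouch hne =>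
    simpa only [map_sub, map_add, map_mul, map_zsmul, gamma_eB, gamma_eC, sub_eq_zero, two] using
      hρ.deco_split_left x y y₁ x₁ y₂ x₂ hsplit htouch hne
  | bridge_dual x x' z =>
    simpa only [map_sub, map_mul, gamma_eB, gamma_eC, sub_eq_zero, two] using
      hρ.right_edge (.inr x) (.inr x') (.inl z)

end EdgeRep.ProdRels

end equivalence

end BorderedKh

namespace BorderedKh

/-! ### Words with one or two letters -/

section words

variable {I : Type} {Q : Gens I}

/-- The word with two letters. -/
def Gens.Word.pair (x y : Q.E) (h : Q.tgt x = Q.src y) : Q.Word :=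
  (Gens.Word.letter x).comp (Gens.Word.letter y) h

theorem Gens.Word.eq_letter_or_pair (p : Q.Word)
    (hp : p.letters.length = 1 ∨ p.letters.length = 2) :
    (∃ x, p = Gens.Word.letter x) ∨ ∃ x y h, p = Gens.Word.pair x y h := by
  obtain ⟨u, v, w, hw⟩ := p
  match w, hw with
  | [], _ => simp at hp
  | [x], hw =>
    obtain ⟨rfl, h⟩ := hw
    obtain rfl : Q.tgt x = v := h
    exact Or.inl ⟨x, rfl⟩
  | [x, y], hw =>
    obtain ⟨rfl, h, h'⟩ := hw
    obtain rfl : Q.tgt y = v := h'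
    exact Or.inr ⟨x, y, h.symm, rfl⟩
  | _ :: _ :: _ :: _, _ => simp at hp

theorem Gens.Word.eq_pair (p : Q.Word) (hp : p.letters.length = 2) :
    ∃ x y h, p = Gens.Word.pair x y h := by
  rcases p.eq_letter_or_pair (Or.inr hp) with ⟨x, rfl⟩ | h
  · cases hp
  · exact h

theorem TAlg.lift_eq_sum [Fintype I] {A : Type} [Ring A] (d : TAlg.LiftData Q A) (x : TAlg Q) :
    d.lift x = x.coeffs.sum fun p c => c • d.wordVal p := Finsupp.lift_apply ..

theorem TAlg.LiftData.wordVal_pair [Fintype I] {A : Type} [Ring A] (d : TAlg.LiftData Q A)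
    (x y : Q.E) (h : Q.tgt x = Q.src y) : d.wordVal (Gens.Word.pair x y h) = d.g x * d.g y := by
  refine (d.wordVal_comp (Gens.Word.letter x) (Gens.Word.letter y) h).trans ?_
  rw [d.wordVal_letter, d.wordVal_letter]

theorem TAlg.coeffs_ofWord [DecidableEq Q.Word] (p q : Q.Word) :
    TAlg.coeffs (TAlg.ofWord p) q = if p = q then 1 else 0 :=
  Finsupp.single_apply

theorem TAlg.pairing_sub (f x y : TAlg Q) : f.pairing (x - y) = f.pairing x - f.pairing y :=
  Finsupp.sum_sub_index fun _ _ _ => mul_sub _ _ _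

theorem TAlg.pairing_ofWord (f : TAlg Q) (p : Q.Word) : f.pairing (TAlg.ofWord p) = f.coeffs p :=
  (Finsupp.sum_single_index (mul_zero _)).trans (mul_one _)

theorem TAlg.InT.sub {k : ℕ} {x y : TAlg Q} (hx : x.InT k) (hy : y.InT k) : (x - y).InT k := by
  intro p hp
  by_cases h : x.coeffs p = 0
  · refine hy p fun h' => hp ?_
    have : (x - y).coeffs p = x.coeffs p - y.coeffs p := rfl
    rw [this, h, h', sub_zero]
  · exact hx p h

theorem TAlg.inT_ofWord (p : Q.Word) : (TAlg.ofWord p).InT p.letters.length := by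
  classical
  intro q hq
  rw [TAlg.coeffs_ofWord] at hq
  split_ifs at hq with h
  · rw [h]
  · exact absurd rfl hq

theorem TAlg.inT_neg {k : ℕ} {x : TAlg Q} (hx : x.InT k) : (-x).InT k := by
  intro p hp
  refine hx p fun h => hp ?_
  have : (-x).coeffs p = - x.coeffs p := rfl
  rw [this, h, neg_zero]

end words

section relations

variable {n : ℕ}

theorem isGen_iff {h k : DecLink n} : IsGen h k ↔ IsEdge .right h k := by
  rw [IsGen, isBridgeGen_iff, isCircleGen_iff, or_comm]
  rfl

theorem isGen_mirror_iff {h k : DecLink n} : IsGen h.mirror k.mirror ↔ IsEdge .left h k := by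
  rw [IsGen, isBridgeGen_mirror_iff, isCircleGen_mirror_iff, or_comm]
  rfl

variable (n)

/-- The data of the map from the tensor algebra to matrices. -/
noncomputable def matData : TAlg.LiftData (gensB n) (Matrix (DecLink n) (DecLink n) ℤ) where
  e u := Matrix.single u u 1
  g x := Matrix.single x.1.1 x.1.2 1
  e_self u := by simp
  e_ne u v h := by simp [h]
  e_sum := by
    ext u v
    rw [Matrix.sum_apply]
    by_cases h : u = v
    · subst h
      rw [Finset.sum_eq_single u] <;> simp +contextual
    · rw [Finset.sum_eq_zero, Matrix.one_apply_ne h]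
      intro w _
      rw [Matrix.single_apply, if_neg]
      rintro ⟨rfl, rfl⟩
      exact h rfl
  e_g x := by simp [gensB]
  g_e x := by simp [gensB]

variable {n}

theorem matData_wordVal (p : (gensB n).Word) :
    (matData n).wordVal p = Matrix.single p.start p.finish 1 := by
  induction p using Gens.Word.induction with
  | nil u => exact (matData n).wordVal_nil u
  | cons x p h ih =>
    rw [TAlg.LiftData.wordVal_cons, ih]
    have h' : x.1.2 = p.start := h
    change Matrix.single x.1.1 x.1.2 1 * Matrix.single p.start p.finish 1 =
      Matrix.single x.1.1 p.finish 1
    rw [h', Matrix.single_mul_single_same, mul_one]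

theorem coe_evalB (x : TAlg (gensB n)) :
    (evalB n x : Matrix (DecLink n) (DecLink n) ℤ) = (matData n).lift x := by
  rw [TAlg.lift_eq_sum, evalB, Finsupp.sum, Finsupp.sum, AddSubmonoidClass.coe_finsetSum]
  refine Finset.sum_congr rfl fun p _ => ?_
  have : ((p.letters.map (genB n)).prod : BR n) =
      ((p.letters.map (matData n).g).prod : Matrix (DecLink n) (DecLink n) ℤ) := by
    rw [← Subalgebra.coe_val, map_list_prod, List.map_map]
    rfl
  rw [TAlg.LiftData.wordVal, ← this]
  rfl

theorem mem_relJ {x : TAlg (gensB n)} : x ∈ relJ n ↔ (matData n).lift x = 0 := by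
  rw [← coe_evalB]
  exact Subtype.ext_iff

theorem lift_matData_apply (x : TAlg (gensB n)) (u v : DecLink n) :
    (matData n).lift x u v = x.coeffs.sum fun p c => if p.start = u ∧ p.finish = v then c else 0 := by
  rw [TAlg.lift_eq_sum, Finsupp.sum, Finsupp.sum, Matrix.sum_apply]
  refine Finset.sum_congr rfl fun p _ => ?_
  rw [matData_wordVal, Matrix.smul_apply, Matrix.single_apply]
  split_ifs <;> simp

theorem sub_mem_relJ {p q : (gensB n).Word} (hs : p.start = q.start) (hf : p.finish = q.finish) :
    TAlg.ofWord p - TAlg.ofWord q ∈ relJ n := by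
  rw [mem_relJ, map_sub, TAlg.LiftData.lift_ofWord, TAlg.LiftData.lift_ofWord, matData_wordVal,
    matData_wordVal, hs, hf, sub_self]

namespace EdgeRep

variable {A : Type} [Ring A] (ρ : EdgeRep n A)

theorem full_wordVal_inclB_pair (x y : (gensB n).E) (h : (gensB n).tgt x = (gensB n).src y) :
    ρ.full.wordVal ((Gens.Word.pair x y h).map (inclB n)) =
      ρ.two .right .right x.1.1 x.1.2 y.1.2 := by
  have h' : x.1.2 = y.1.1 := h
  refine (ρ.full.wordVal_pair (Sum.inl x) (Sum.inl y) h).trans ?_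
  have e : ρ.E .right x.1.2 y.1.2 = ρ.E .right y.1.1 y.1.2 := by rw [h']
  rw [two, e]
  rfl

theorem full_wordVal_inclB_letter (x : (gensB n).E) :
    ρ.full.wordVal ((Gens.Word.letter x).map (inclB n)) = ρ.E .right x.1.1 x.1.2 :=
  ρ.full.wordVal_letter (Sum.inl x)

theorem lift_map_inclB (x : TAlg (gensB n)) : ρ.full.lift (TAlg.map (inclB n) x) =
    x.coeffs.sum fun p c => c • ρ.full.wordVal (p.map (inclB n)) := by
  have h := congrArg (fun y => ρ.full.lift (TAlg.mapAdd (inclB n) y)) x.sum_coeffs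
  refine h.trans ?_
  rw [map_sum, map_sum]
  refine Finset.sum_congr rfl fun p _ => ?_
  rw [map_zsmul, map_zsmul]
  change _ • ρ.full.lift (TAlg.map (inclB n) (TAlg.ofWord p)) = _
  rw [TAlg.map_ofWord, TAlg.LiftData.lift_ofWord]

variable {ρ}

theorem ProdRels.full_wordVal_inclB_eq (hρ : ρ.ProdRels) {p q : (gensB n).Word}
    (hp : p.letters.length = 1 ∨ p.letters.length = 2)
    (hq : q.letters.length = 1 ∨ q.letters.length = 2) (hs : p.start = q.start)
    (hf : p.finish = q.finish) :
    ρ.full.wordVal (p.map (inclB n)) = ρ.full.wordVal (q.map (inclB n)) := by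
  rcases p.eq_letter_or_pair hp with ⟨⟨⟨a, b⟩, x⟩, rfl⟩ | ⟨⟨⟨a, b⟩, x⟩, ⟨⟨b', c⟩, y⟩, h, rfl⟩ <;>
    rcases q.eq_letter_or_pair hq with ⟨⟨⟨a', d⟩, x'⟩, rfl⟩ | ⟨⟨⟨a', d⟩, x'⟩, ⟨⟨d', e⟩, y'⟩, h', rfl⟩
  · obtain rfl : a = a' := hs
    obtain rfl : b = d := hf
    rfl
  · obtain rfl : a = a' := hs
    obtain rfl : b = e := hf
    obtain rfl : d = d' := h'
    refine (ρ.full_wordVal_inclB_letter ⟨(a, b), x⟩).trans (Eq.trans ?_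
      (ρ.full_wordVal_inclB_pair ⟨(a, d), x'⟩ ⟨(d, b), y'⟩ rfl).symm)
    exact (hρ.right_edge (isGen_iff.1 x') (isGen_iff.1 y') (isGen_iff.1 x)).symm
  · obtain rfl : a = a' := hs
    obtain rfl : c = d := hf
    obtain rfl : b = b' := h
    refine (ρ.full_wordVal_inclB_pair ⟨(a, b), x⟩ ⟨(b, c), y⟩ rfl).trans (Eq.trans ?_
      (ρ.full_wordVal_inclB_letter ⟨(a, c), x'⟩).symm)
    exact hρ.right_edge (isGen_iff.1 x) (isGen_iff.1 y) (isGen_iff.1 x')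
  · obtain rfl : a = a' := hs
    obtain rfl : c = e := hf
    obtain rfl : b = b' := h
    obtain rfl : d = d' := h'
    refine (ρ.full_wordVal_inclB_pair ⟨(a, b), x⟩ ⟨(b, c), y⟩ rfl).trans (Eq.trans ?_
      (ρ.full_wordVal_inclB_pair ⟨(a, d), x'⟩ ⟨(d, c), y'⟩ rfl).symm)
    exact hρ.right_eq (isGen_iff.1 x) (isGen_iff.1 y) (isGen_iff.1 x') (isGen_iff.1 y')

theorem ProdRels.lift_relJ (hρ : ρ.ProdRels) {x : TAlg (gensB n)} (hx : x ∈ relJ n)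
    (hx' : x.InT12) : ρ.full.lift (TAlg.map (inclB n) x) = 0 := by
  classical
  have hW : ∃ W : DecLink n → DecLink n → A, ∀ p : (gensB n).Word,
      (p.letters.length = 1 ∨ p.letters.length = 2) →
      ρ.full.wordVal (p.map (inclB n)) = W p.start p.finish := by
    refine ⟨fun u v => if h : ∃ p : (gensB n).Word, (p.letters.length = 1 ∨ p.letters.length = 2) ∧
      p.start = u ∧ p.finish = v then ρ.full.wordVal (h.choose.map (inclB n)) else 0, fun p hp => ?_⟩
    have h : ∃ q : (gensB n).Word, (q.letters.length = 1 ∨ q.letters.length = 2) ∧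
      q.start = p.start ∧ q.finish = p.finish := ⟨p, hp, rfl, rfl⟩
    beta_reduce
    rw [dif_pos h]
    exact hρ.full_wordVal_inclB_eq hp h.choose_spec.1 h.choose_spec.2.1.symm
      h.choose_spec.2.2.symm
  obtain ⟨W, hW⟩ := hW
  rw [mem_relJ] at hx
  have h0 : ∑ u, ∑ v, (matData n).lift x u v • W u v = 0 := by simp [hx]
  rw [lift_map_inclB, ← h0]
  simp only [lift_matData_apply, Finsupp.sum, Finset.sum_smul, ite_smul, zero_smul]
  symm
  calc ∑ u, ∑ v, ∑ p ∈ x.coeffs.support,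
        (if p.start = u ∧ p.finish = v then x.coeffs p • W u v else 0)
      = ∑ p ∈ x.coeffs.support, ∑ u, ∑ v,
        (if p.start = u ∧ p.finish = v then x.coeffs p • W u v else 0) := by
        rw [Finset.sum_congr rfl fun u _ => Finset.sum_comm, Finset.sum_comm]
    _ = _ := by
        refine Finset.sum_congr rfl fun p hp => ?_
        rw [hW p (hx' p (Finsupp.mem_support_iff.1 hp))]
        simp only [ite_and, Finset.sum_ite_irrel, Finset.sum_const_zero]
        simp

end EdgeRep

/-- The point in the middle of a word with two letters. -/
def wordMid (p : (gensB n).Word) : DecLink n :=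
  match p.letters with
  | [] => p.start
  | x :: _ => x.1.2

theorem injOn_pair : Set.InjOn (fun p : (gensB n).Word => (p.start, wordMid p, p.finish))
    {p | p.letters.length = 2} := by
  rintro p hp q hq h
  obtain ⟨⟨⟨a, b⟩, x⟩, ⟨⟨b', c⟩, y⟩, h1, rfl⟩ := p.eq_pair hp
  obtain ⟨⟨⟨d, e⟩, x'⟩, ⟨⟨e', f⟩, y'⟩, h2, rfl⟩ := q.eq_pair hq
  obtain ⟨rfl, h3⟩ := Prod.mk.inj h
  obtain ⟨h4, h5⟩ := Prod.mk.inj h3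
  obtain rfl : b = e := h4
  obtain rfl : c = f := h5
  obtain rfl : b = b' := h1
  obtain rfl : b = e' := h2
  rfl

theorem finite_pairs : {p : (gensB n).Word | p.letters.length = 2}.Finite :=
  Set.Finite.of_finite_image (Set.toFinite _) injOn_pair

open Classical in
/-- The sum of all words with two letters from `u` to `v`. -/
noncomputable def pathsB (u v : DecLink n) : TAlg (gensB n) :=
  Finsupp.onFinset (finite_pairs (n := n)).toFinset
    (fun p => if p.letters.length = 2 ∧ p.start = u ∧ p.finish = v then 1 else 0)
    fun p hp => by
      rw [Set.Finite.mem_toFinset]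
      by_contra hc
      exact hp (if_neg fun h => hc h.1)

open Classical in
theorem coeffs_pathsB (u v : DecLink n) (p : (gensB n).Word) : (pathsB u v).coeffs p =
    if p.letters.length = 2 ∧ p.start = u ∧ p.finish = v then 1 else 0 := rfl

theorem inT_pathsB (u v : DecLink n) : (pathsB u v).InT 2 := by
  classical
  intro p hp
  rw [coeffs_pathsB] at hp
  by_contra hc
  exact hp (if_neg fun h => hc h.1)

theorem pairing_pathsB {u v : DecLink n} {r : TAlg (gensB n)} (hr : r.InT 2) :
    (pathsB u v).pairing r = (matData n).lift r u v := by
  classical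
  rw [lift_matData_apply, TAlg.pairing]
  refine Finset.sum_congr rfl fun p hp => ?_
  beta_reduce
  rw [coeffs_pathsB]
  have := hr p (Finsupp.mem_support_iff.1 hp)
  simp [this]

theorem lift_matData_of_inT_one {w : TAlg (gensB n)} (hw : w.InT 1) (u v : DecLink n)
    (c : ℤ) (hc : ∀ h : IsGen u v, w.coeffs (Gens.Word.letter (Q := gensB n) ⟨(u, v), h⟩) = c)
    (hc' : ¬ IsGen u v → c = 0) : (matData n).lift w u v = c := by
  classical
  rw [lift_matData_apply, Finsupp.sum]
  have hl : ∀ p ∈ w.coeffs.support, p.start = u ∧ p.finish = v →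
      ∃ h : IsGen u v, p = Gens.Word.letter (Q := gensB n) ⟨(u, v), h⟩ := by
    rintro p hp ⟨rfl, rfl⟩
    rcases p.eq_letter_or_pair (Or.inl (hw p (Finsupp.mem_support_iff.1 hp))) with ⟨x, rfl⟩ |
      ⟨x, y, h, rfl⟩
    · exact ⟨x.2, rfl⟩
    · exact absurd (hw _ (Finsupp.mem_support_iff.1 hp)) (by simp [Gens.Word.pair, Gens.Word.comp,
        Gens.Word.letter])
  by_cases hg : IsGen u v
  · rw [← hc hg, Finset.sum_eq_single (Gens.Word.letter (Q := gensB n) ⟨(u, v), hg⟩)]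
    · exact if_pos ⟨rfl, rfl⟩
    · intro p hp hne
      rw [if_neg]
      intro h
      obtain ⟨_, rfl⟩ := hl p hp h
      exact hne rfl
    · intro h
      rw [Finsupp.notMem_support_iff] at h
      rw [h, ite_self]
  · rw [hc' hg]
    refine Finset.sum_eq_zero fun p hp => if_neg fun h => hg (hl p hp h).1

theorem isPhiStar_neg_pathsB (b : (gensB n).E) : IsPhiStar n b (-pathsB b.1.1 b.1.2) := by
  refine ⟨TAlg.inT_neg (inT_pathsB _ _), fun v r hv hr h => ?_⟩
  rw [mem_relJ, map_add] at h
  have h1 := congrFun (congrFun h b.1.1) b.1.2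
  rw [Matrix.add_apply, Matrix.zero_apply, ← pairing_pathsB hr, lift_matData_of_inT_one hv _ _
    (v.coeffs (Gens.Word.letter b)) (fun _ => rfl) fun h => absurd b.2 h] at h1
  have h2 : (-pathsB b.1.1 b.1.2).pairing r = -((pathsB b.1.1 b.1.2).pairing r) := by
    rw [TAlg.pairing, TAlg.pairing, Finsupp.sum, Finsupp.sum, ← Finset.sum_neg_distrib]
    exact Finset.sum_congr rfl fun p _ => neg_mul _ _
  rw [h2]
  exact (eq_neg_of_add_eq_zero_left h1).symm

theorem pathsB_mem_relIPerp {u v : DecLink n} (h : ¬ IsGen u v) : pathsB u v ∈ relIPerp n := by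
  refine ⟨inT_pathsB u v, ?_⟩
  rintro r ⟨hr, w, hw, hJ⟩
  rw [mem_relJ, map_add] at hJ
  have h1 := congrFun (congrFun hJ u) v
  rw [Matrix.add_apply, Matrix.zero_apply, ← pairing_pathsB hr, lift_matData_of_inT_one hw _ _ 0
    (fun e => absurd e h) fun _ => rfl, zero_add] at h1
  exact h1

theorem coeffs_eq_of_mem_relIPerp {f : TAlg (gensB n)} (hf : f ∈ relIPerp n) {p q : (gensB n).Word}
    (hp : p.letters.length = 2) (hq : q.letters.length = 2) (hs : p.start = q.start)
    (he : p.finish = q.finish) : f.coeffs p = f.coeffs q := by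
  have h := hf.2 (TAlg.ofWord p - TAlg.ofWord q) ⟨?_, 0, ?_, ?_⟩
  · rwa [TAlg.pairing_sub, TAlg.pairing_ofWord, TAlg.pairing_ofWord, sub_eq_zero] at h
  · exact TAlg.InT.sub (hp ▸ TAlg.inT_ofWord p) (hq ▸ TAlg.inT_ofWord q)
  · exact fun _ h => absurd rfl h
  · rw [zero_add]
    exact sub_mem_relJ hs he

theorem coeffs_eq_zero_of_mem_relIPerp {f : TAlg (gensB n)} (hf : f ∈ relIPerp n)
    {p : (gensB n).Word} (hp : p.letters.length = 2) (hg : IsGen p.start p.finish) :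
    f.coeffs p = 0 := by
  have h := hf.2 (TAlg.ofWord p) ⟨hp ▸ TAlg.inT_ofWord p,
    -TAlg.ofWord (Gens.Word.letter (Q := gensB n) ⟨(p.start, p.finish), hg⟩), ?_, ?_⟩
  · rwa [TAlg.pairing_ofWord] at h
  · exact TAlg.inT_neg (TAlg.inT_ofWord _)
  · rw [neg_add_eq_sub]
    exact sub_mem_relJ rfl rfl

end relations

end BorderedKh

namespace BorderedKh

section relations

variable {n : ℕ}

/-- The mirror image as a permutation. -/
def mirrorEquiv : DecLink n ≃ DecLink n where
  toFun := DecLink.mirror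
  invFun := DecLink.mirror
  left_inv _ := rfl
  right_inv _ := rfl

namespace EdgeRep

variable {A : Type} [Ring A] (ρ : EdgeRep n A)

/-- The data of a ring homomorphism out of the tensor algebra of the mirrored dual. -/
noncomputable def left : TAlg.LiftData (gensL n) A where
  e := ρ.e
  g x := ρ.E .left x.1.1 x.1.2
  e_self := ρ.e_self
  e_ne := ρ.e_ne
  e_sum := ρ.e_sum
  e_g _ := ρ.e_E _ _ _
  g_e _ := ρ.E_e _ _ _

theorem full_wordVal_inclL (p : (gensL n).Word) :
    ρ.full.wordVal (p.map (inclL n)) = ρ.left.wordVal p := by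
  change ρ.e _ * ((p.letters.map (inclL n).onE).map ρ.full.g).prod = ρ.e _ * (p.letters.map ρ.left.g).prod
  rw [List.map_map]
  rfl

theorem lift_map_inclL (x : TAlg (gensL n)) :
    ρ.full.lift (TAlg.map (inclL n) x) = ρ.left.lift x := by
  induction x using TAlg.induction with
  | h0 => rw [TAlg.map_zero', map_zero, map_zero]
  | hadd x y hx hy => rw [TAlg.map_add', map_add, map_add, hx, hy]
  | hneg x hx =>
    have : TAlg.map (inclL n) (-x) = -TAlg.map (inclL n) x := map_neg (TAlg.mapAdd (inclL n)) x
    rw [this, map_neg, map_neg, hx]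
  | hw p => rw [TAlg.map_ofWord, TAlg.LiftData.lift_ofWord, TAlg.LiftData.lift_ofWord,
      full_wordVal_inclL]

theorem left_wordVal_mirror (x y : (gensB n).E) (h : (gensB n).tgt x = (gensB n).src y) :
    ρ.left.wordVal ((Gens.Word.pair x y h).map (mirrorHom n)) =
      ρ.two .left .left x.1.1.mirror x.1.2.mirror y.1.2.mirror := by
  have h' : x.1.2 = y.1.1 := h
  refine (ρ.left.wordVal_pair ((mirrorHom n).onE x) ((mirrorHom n).onE y)
    (congrArg DecLink.mirror h)).trans ?_
  have e : ρ.E .left x.1.2.mirror y.1.2.mirror = ρ.E .left y.1.1.mirror y.1.2.mirror := by rw [h']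
  rw [two, e]
  rfl

open Classical in
/-- The coefficient of the word with two letters through the given vertices. -/
noncomputable def pairCoeff (f : TAlg (gensB n)) (u m v : DecLink n) : ℤ :=
  if h : IsGen u m ∧ IsGen m v then
    f.coeffs (Gens.Word.pair (Q := gensB n) ⟨(u, m), h.1⟩ ⟨(m, v), h.2⟩ rfl) else 0

theorem left_lift_mirror {f : TAlg (gensB n)} (hf : f.InT 2) :
    ρ.left.lift (TAlg.map (mirrorHom n) f) =
      ∑ u, ∑ v, ∑ m, pairCoeff f u m v • ρ.two .left .left u.mirror m.mirror v.mirror := by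
  classical
  have h := congrArg (fun y => ρ.left.lift (TAlg.mapAdd (mirrorHom n) y)) f.sum_coeffs
  have h2 : ∀ p ∈ f.coeffs.support, p.letters.length = 2 :=
    fun p hp => hf p (Finsupp.mem_support_iff.1 hp)
  refine h.trans ?_
  rw [map_sum, map_sum]
  have e : ∑ u, ∑ v, ∑ m, pairCoeff f u m v • ρ.two .left .left u.mirror m.mirror v.mirror =
      ∑ t : DecLink n × DecLink n × DecLink n, pairCoeff f t.1 t.2.1 t.2.2 •
        ρ.two .left .left t.1.mirror t.2.1.mirror t.2.2.mirror := by
    simp only [Fintype.sum_prod_type]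
    exact Finset.sum_congr rfl fun u _ => Finset.sum_comm
  rw [e]
  refine Finset.sum_of_injOn (fun p : (gensB n).Word => (p.start, wordMid p, p.finish)) ?_ ?_ ?_ ?_
  · exact fun p hp q hq => injOn_pair (h2 p hp) (h2 q hq)
  · exact fun _ _ => Finset.mem_coe.2 (Finset.mem_univ _)
  · rintro ⟨u, m, v⟩ - ht
    rw [pairCoeff]
    split_ifs with hg
    · by_contra hc
      refine ht ⟨Gens.Word.pair (Q := gensB n) ⟨(u, m), hg.1⟩ ⟨(m, v), hg.2⟩ rfl,
        Finsupp.mem_support_iff.2 fun h0 => hc ?_, rfl⟩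
      rw [h0, zero_smul]
    · exact zero_smul _ _
  · intro p hp
    obtain ⟨⟨⟨a, b⟩, x⟩, ⟨⟨b', c⟩, y⟩, h1, rfl⟩ := p.eq_pair (h2 p hp)
    obtain rfl : b = b' := h1
    rw [map_zsmul, map_zsmul]
    change _ • ρ.left.lift (TAlg.map (mirrorHom n) (TAlg.ofWord _)) = _
    rw [TAlg.map_ofWord, TAlg.LiftData.lift_ofWord]
    have e1 := ρ.left_wordVal_mirror ⟨(a, b), x⟩ ⟨(b, c), y⟩ rfl
    refine (congrArg _ e1).trans ?_
    have e2 : pairCoeff f a b c = f.coeffs (Gens.Word.pair (Q := gensB n) ⟨(a, b), x⟩ ⟨(b, c), y⟩ rfl) :=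
      dif_pos ⟨x, y⟩
    rw [← e2]
    rfl

theorem isEdge_mirror {u m v : DecLink n} : (IsGen u m ∧ IsGen m v) ↔
    (IsEdge .left u.mirror m.mirror ∧ IsEdge .left m.mirror v.mirror) :=
  and_congr (isGen_mirror_iff (h := u.mirror) (k := m.mirror))
    (isGen_mirror_iff (h := m.mirror) (k := v.mirror))

theorem left_lift_pathsB (u v : DecLink n) : ρ.left.lift (TAlg.map (mirrorHom n) (pathsB u v)) =
    ∑ m, ρ.two .left .left u.mirror m v.mirror := by
  classical
  have key : ∀ u' v' m, pairCoeff (pathsB u v) u' m v' • ρ.two .left .left u'.mirror m.mirror v'.mirror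
      = if u' = u then if v' = v then ρ.two .left .left u.mirror m.mirror v.mirror else 0 else 0 := by
    intro u' v' m
    by_cases hg : IsGen u' m ∧ IsGen m v'
    · rw [pairCoeff, dif_pos hg, coeffs_pathsB]
      have h2 : (Gens.Word.pair (Q := gensB n) ⟨(u', m), hg.1⟩ ⟨(m, v'), hg.2⟩ rfl).letters.length = 2 :=
        rfl
      by_cases h1 : u' = u
      · by_cases h3 : v' = v
        · rw [if_pos ⟨h2, h1, h3⟩, if_pos h1, if_pos h3, one_smul, h1, h3]
        · rw [if_neg fun h => h3 h.2.2, if_pos h1, if_neg h3, zero_smul]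
      · rw [if_neg fun h => h1 h.2.1, if_neg h1, zero_smul]
    · rw [ρ.two_eq_zero (mt isEdge_mirror.2 hg), smul_zero]
      split_ifs with h1 h3
      · subst h1 h3
        exact (ρ.two_eq_zero (mt isEdge_mirror.2 hg)).symm
      · rfl
      · rfl
  rw [ρ.left_lift_mirror (inT_pathsB u v)]
  simp only [key]
  rw [Finset.sum_eq_single u, Finset.sum_eq_single v]
  · simp only [if_true]
    exact Equiv.sum_comp mirrorEquiv fun m => ρ.two .left .left u.mirror m v.mirror
  · intro v' _ hv
    exact Finset.sum_eq_zero fun m _ => by rw [if_pos rfl, if_neg hv]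
  · exact fun h => absurd (Finset.mem_univ _) h
  · intro u' _ hu
    exact Finset.sum_eq_zero fun v' _ => Finset.sum_eq_zero fun m _ => if_neg hu
  · exact fun h => absurd (Finset.mem_univ _) h

variable {ρ}

theorem ProdRels.left_lift_relIPerp (hρ : ρ.ProdRels) {f : TAlg (gensB n)} (hf : f ∈ relIPerp n) :
    ρ.left.lift (TAlg.map (mirrorHom n) f) = 0 := by
  classical
  rw [ρ.left_lift_mirror hf.1]
  refine Finset.sum_eq_zero fun u _ => Finset.sum_eq_zero fun v _ => ?_
  by_cases hex : ∃ m, IsGen u m ∧ IsGen m v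
  swap
  · refine Finset.sum_eq_zero fun m _ => ?_
    rw [pairCoeff, dif_neg fun h => hex ⟨m, h⟩, zero_smul]
  obtain ⟨m₀, h₀⟩ := hex
  have hc : ∀ m, pairCoeff f u m v • ρ.two .left .left u.mirror m.mirror v.mirror =
      pairCoeff f u m₀ v • ρ.two .left .left u.mirror m.mirror v.mirror := by
    intro m
    by_cases hg : IsGen u m ∧ IsGen m v
    · rw [pairCoeff, pairCoeff, dif_pos hg, dif_pos h₀]
      congr 1
      exact coeffs_eq_of_mem_relIPerp hf rfl rfl rfl rfl
    · rw [ρ.two_eq_zero (mt isEdge_mirror.2 hg), smul_zero, smul_zero]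
  simp only [hc]
  rw [← Finset.smul_sum]
  by_cases he : IsGen u v
  · have : pairCoeff f u m₀ v = 0 := by
      rw [pairCoeff, dif_pos h₀]
      exact coeffs_eq_zero_of_mem_relIPerp hf rfl he
    rw [this, zero_smul]
  · have hs := hρ.left_sum (mt isGen_mirror_iff.2 he : ¬ IsEdge .left u.mirror v.mirror)
    have e := Equiv.sum_comp mirrorEquiv fun m => ρ.two .left .left u.mirror m v.mirror
    rw [hs] at e
    exact (congrArg _ e).trans (smul_zero _)

theorem full_rB {h k : DecLink n} (x : IsBridgeGen h k) : ρ.full.lift (rB x) = ρ.E .right h k :=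
  ρ.full.lift_gen _

theorem full_rC {h k : DecLink n} (x : IsCircleGen h k) : ρ.full.lift (rC x) = ρ.E .right h k :=
  ρ.full.lift_gen _

theorem full_lB {h k : DecLink n} (x : IsBridgeGen h.mirror k.mirror) :
    ρ.full.lift (lB x) = ρ.E .left h k := ρ.full.lift_gen _

theorem full_lC {h k : DecLink n} (x : IsCircleGen h.mirror k.mirror) :
    ρ.full.lift (lC x) = ρ.E .left h k := ρ.full.lift_gen _

theorem ProdRels.lift_jExtra (hρ : ρ.ProdRels) {x : TAlg (gensFull n)} (hx : JExtra x) :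
    ρ.full.lift x = 0 := by
  cases hx with
  | bridge_bridge x y' y x' =>
    simpa only [map_sub, map_mul, full_rB, full_lB, sub_eq_zero, two] using
      hρ.bridge_bridge (isBridgeGen_iff.1 x) (isBridgeGen_mirror_iff.1 y')
        (isBridgeGen_mirror_iff.1 y) (isBridgeGen_iff.1 x')
  | circle_bridge x y' y x' =>
    simpa only [map_sub, map_mul, full_rC, full_lB, sub_eq_zero, two] using
      hρ.circle_bridge (isCircleGen_iff.1 x) (isBridgeGen_mirror_iff.1 y')
        (isBridgeGen_mirror_iff.1 y) (isCircleGen_iff.1 x')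
  | bridge_circle_disjoint x y' y x' hd =>
    simpa only [map_sub, map_mul, full_rB, full_lC, sub_eq_zero, two] using
      hρ.bridge_circle_disjoint (isBridgeGen_iff.1 x) (isCircleGen_mirror_iff.1 y')
        (isCircleGen_mirror_iff.1 y) (isBridgeGen_iff.1 x') fun ⟨p, h1, h2⟩ => h2 (hd p h1)
  | circle_circle x y' y x' hne =>
    simpa only [map_sub, map_mul, full_rC, full_lC, sub_eq_zero, two] using
      hρ.circle_circle (isCircleGen_iff.1 x) (isCircleGen_mirror_iff.1 y')
        (isCircleGen_mirror_iff.1 y) (isCircleGen_iff.1 x') hne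
  | join x y' y₁ x₁ y₂ x₂ hjoin hC hne =>
    simpa only [map_sub, map_add, map_mul, full_rB, full_lC, sub_sub, sub_eq_zero, two] using
      hρ.join (isBridgeGen_iff.1 x) (isCircleGen_mirror_iff.1 y') (isCircleGen_mirror_iff.1 y₁)
        (isBridgeGen_iff.1 x₁) (isCircleGen_mirror_iff.1 y₂) (isBridgeGen_iff.1 x₂) hjoin hC hne
  | split x₁ y₁ x₂ y₂ y x' hsplit hC hne =>
    simpa only [map_sub, map_add, map_mul, full_rB, full_lC, sub_eq_zero, two] using
      hρ.split (isBridgeGen_iff.1 x₁) (isCircleGen_mirror_iff.1 y₁) (isBridgeGen_iff.1 x₂)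
        (isCircleGen_mirror_iff.1 y₂) (isCircleGen_mirror_iff.1 y) (isBridgeGen_iff.1 x') hsplit hC hne

/-- A representation with the relations of the product algebra. -/
theorem ProdRels.lift_relFull (hρ : ρ.ProdRels) {x : TAlg (gensFull n)} (hx : x ∈ relFull n) :
    ρ.full.lift x = 0 := by
  refine map_eq_zero_of_mem_span ρ.full.lift ?_ hx
  rintro _ ((⟨y, hy, rfl⟩ | ⟨y, hy, rfl⟩) | hy)
  · exact hρ.lift_relJ hy.1 hy.2
  · rw [lift_map_inclL]
    refine map_eq_zero_of_mem_span ρ.left.lift ?_ hy.1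
    rintro _ ⟨f, hf, rfl⟩
    exact hρ.left_lift_relIPerp hf
  · exact hρ.lift_jExtra hy

theorem lift_tetrahedronRel (ht : ρ.TetraRels) {x : TAlg (gensFull n)} (hx : TetrahedronRel x) :
    ρ.full.lift x = 0 := by
  cases hx with
  | mk γ η' η γ' hne hne' i j k l hγ hsplit hplus hη hk hl hjoin hminus =>
    simpa only [map_add, map_mul, full_lB, two] using
      ht ⟨isBridgeGen_mirror_iff.1 γ, isBridgeGen_mirror_iff.1 η'⟩
        ⟨isBridgeGen_mirror_iff.1 η, isBridgeGen_mirror_iff.1 γ'⟩ hne hne' i j k l hγ hsplit hplus hη hk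
        hl hjoin hminus

end EdgeRep

end relations

end BorderedKh

namespace BorderedKh

section universal

variable {n : ℕ} {A : Type} [Ring A]

namespace EdgeRep

open Classical in
/-- The representation given by a homomorphism out of the tensor algebra of the product algebra. -/
noncomputable def ofFull (φ : TAlg (gensFull n) →+* A) : EdgeRep n A where
  e u := φ (TAlg.idem u)
  E s h k := match s with
    | .right => if x : IsGen h k then φ (TAlg.gen (Q := gensFull n) (Sum.inl ⟨(h, k), x⟩)) else 0
    | .left => if x : IsGen h.mirror k.mirror then
        φ (TAlg.gen (Q := gensFull n) (Sum.inr ⟨(h, k), x⟩)) else 0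
  e_self := (TAlg.LiftData.ofHom φ).e_self
  e_ne := (TAlg.LiftData.ofHom φ).e_ne
  e_sum := (TAlg.LiftData.ofHom φ).e_sum
  e_E s h k := by
    cases s <;> dsimp only <;> split_ifs with x
    · exact (TAlg.LiftData.ofHom φ).e_g (Sum.inr ⟨(h, k), x⟩)
    · exact mul_zero _
    · exact (TAlg.LiftData.ofHom φ).e_g (Sum.inl ⟨(h, k), x⟩)
    · exact mul_zero _
  E_e s h k := by
    cases s <;> dsimp only <;> split_ifs with x
    · exact (TAlg.LiftData.ofHom φ).g_e (Sum.inr ⟨(h, k), x⟩)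
    · exact zero_mul _
    · exact (TAlg.LiftData.ofHom φ).g_e (Sum.inl ⟨(h, k), x⟩)
    · exact zero_mul _
  E_zero s h k hn := by
    cases s
    · exact dif_neg (mt isGen_mirror_iff.1 hn)
    · exact dif_neg (mt isGen_iff.1 hn)

theorem ofFull_lift (φ : TAlg (gensFull n) →+* A) : (ofFull φ).full.lift = φ := by
  classical
  refine TAlg.ringHom_ext (fun u => TAlg.LiftData.lift_idem _ u) ?_
  refine fun x => (TAlg.LiftData.lift_gen _ x).trans ?_
  rcases x with x | x <;> exact dif_pos x.2

open Classical in
/-- The representation given by a homomorphism out of the path algebra. -/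
noncomputable def ofGamma (φ : TAlg (gensGamma n) →+* A) : EdgeRep n A where
  e u := φ (TAlg.idem u)
  E s h k := if x : IsDecoEdge h k ∨ IsBridgeEdge s h k then
    φ (TAlg.gen (Q := gensGamma n) ⟨(s, h, k), x⟩) else 0
  e_self := (TAlg.LiftData.ofHom φ).e_self
  e_ne := (TAlg.LiftData.ofHom φ).e_ne
  e_sum := (TAlg.LiftData.ofHom φ).e_sum
  e_E s h k := by
    split_ifs with x
    · exact (TAlg.LiftData.ofHom φ).e_g (⟨(s, h, k), x⟩ : (gensGamma n).E)
    · exact mul_zero _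
  E_e s h k := by
    split_ifs with x
    · exact (TAlg.LiftData.ofHom φ).g_e (⟨(s, h, k), x⟩ : (gensGamma n).E)
    · exact zero_mul _
  E_zero s h k hn := dif_neg hn

theorem ofGamma_lift (φ : TAlg (gensGamma n) →+* A) : (ofGamma φ).gamma.lift = φ := by
  classical
  refine TAlg.ringHom_ext (fun u => TAlg.LiftData.lift_idem _ u) fun x => ?_
  rw [TAlg.LiftData.lift_gen]
  exact dif_pos x.2

theorem ofGamma_gammaRels {φ : TAlg (gensGamma n) →+* A} (hφ : ∀ x, GammaRel x → φ x = 0) :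
    (ofGamma φ).GammaRels := fun x hx => by rw [ofGamma_lift]; exact hφ x hx

theorem lift_sub_eq_zero {ρ : EdgeRep n A} (hρ : ∀ x ∈ relFull n, ρ.full.lift x = 0)
    {p q : (gensB n).Word} (hp : p.letters.length = 1 ∨ p.letters.length = 2)
    (hq : q.letters.length = 1 ∨ q.letters.length = 2) (hs : p.start = q.start)
    (hf : p.finish = q.finish) :
    ρ.full.wordVal (p.map (inclB n)) = ρ.full.wordVal (q.map (inclB n)) := by
  classical
  have h := hρ _ (TwoSidedIdeal.subset_span (Or.inl (Or.inl ⟨_, ⟨sub_mem_relJ hs hf, ?_⟩, rfl⟩)))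
  · have e : TAlg.map (inclB n) (TAlg.ofWord p - TAlg.ofWord q) =
        TAlg.map (inclB n) (TAlg.ofWord p) - TAlg.map (inclB n) (TAlg.ofWord q) :=
      map_sub (TAlg.mapAdd (inclB n)) _ _
    rwa [e, map_sub, TAlg.map_ofWord, TAlg.map_ofWord, TAlg.LiftData.lift_ofWord,
      TAlg.LiftData.lift_ofWord, sub_eq_zero] at h
  · intro r hr
    have e : (TAlg.ofWord p - TAlg.ofWord q).coeffs r =
      (TAlg.ofWord p).coeffs r - (TAlg.ofWord q).coeffs r := rfl
    rw [e, TAlg.coeffs_ofWord, TAlg.coeffs_ofWord] at hr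
    by_cases h1 : p = r
    · rwa [← h1]
    by_cases h2 : q = r
    · rwa [← h2]
    · rw [if_neg h1, if_neg h2, sub_zero] at hr
      exact absurd rfl hr

theorem lift_jExtra_eq_zero {ρ : EdgeRep n A} (hρ : ∀ x ∈ relFull n, ρ.full.lift x = 0)
    {x : TAlg (gensFull n)} (hx : JExtra x) : ρ.full.lift x = 0 :=
  hρ x (TwoSidedIdeal.subset_span (Or.inr hx))

theorem prodRels_of_lift {ρ : EdgeRep n A} (hρ : ∀ x ∈ relFull n, ρ.full.lift x = 0) :
    ρ.ProdRels where
  right_eq {h₁ h₂ h₂' h₃} x y x' y' := by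
    have := lift_sub_eq_zero hρ
      (p := Gens.Word.pair (Q := gensB n) ⟨(h₁, h₂), isGen_iff.2 x⟩ ⟨(h₂, h₃), isGen_iff.2 y⟩ rfl)
      (q := Gens.Word.pair (Q := gensB n) ⟨(h₁, h₂'), isGen_iff.2 x'⟩ ⟨(h₂', h₃), isGen_iff.2 y'⟩ rfl)
      (Or.inr rfl) (Or.inr rfl) rfl rfl
    exact (ρ.full_wordVal_inclB_pair _ _ _).symm.trans (this.trans (ρ.full_wordVal_inclB_pair _ _ _))
  right_edge {h₁ h₂ h₃} x y z := by
    have := lift_sub_eq_zero hρ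
      (p := Gens.Word.pair (Q := gensB n) ⟨(h₁, h₂), isGen_iff.2 x⟩ ⟨(h₂, h₃), isGen_iff.2 y⟩ rfl)
      (q := Gens.Word.letter (Q := gensB n) ⟨(h₁, h₃), isGen_iff.2 z⟩)
      (Or.inr rfl) (Or.inl rfl) rfl rfl
    exact (ρ.full_wordVal_inclB_pair _ _ _).symm.trans (this.trans (ρ.full_wordVal_inclB_letter _))
  left_sum {h₁ h₃} hn := by
    have hn' : ¬ IsGen h₁.mirror h₃.mirror := mt isGen_mirror_iff.1 hn
    have h := hρ _ (TwoSidedIdeal.subset_span (Or.inl (Or.inr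
      ⟨TAlg.map (mirrorHom n) (pathsB h₁.mirror h₃.mirror),
        ⟨TwoSidedIdeal.subset_span ⟨_, pathsB_mem_relIPerp hn', rfl⟩, ?_⟩, rfl⟩)))
    · rwa [lift_map_inclL, left_lift_pathsB] at h
    · intro p hp
      right
      have h1 : p ∈ (Finsupp.mapDomain (Gens.Word.map (mirrorHom n))
        (pathsB h₁.mirror h₃.mirror).coeffs).support := Finsupp.mem_support_iff.2 hp
      classical
      obtain ⟨q, hq, rfl⟩ := Finset.mem_image.1 (Finsupp.mapDomain_support h1)
      have := inT_pathsB _ _ q (Finsupp.mem_support_iff.1 hq)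
      exact (List.length_map _).trans this
  bridge_bridge x y' y x' := by
    have := lift_jExtra_eq_zero hρ (.bridge_bridge (isBridgeGen_iff.2 x) (isBridgeGen_mirror_iff.2 y')
      (isBridgeGen_mirror_iff.2 y) (isBridgeGen_iff.2 x'))
    simpa only [map_sub, map_mul, full_rB, full_lB, sub_eq_zero, two] using this
  circle_bridge x y' y x' := by
    have := lift_jExtra_eq_zero hρ (.circle_bridge (isCircleGen_iff.2 x) (isBridgeGen_mirror_iff.2 y')
      (isBridgeGen_mirror_iff.2 y) (isCircleGen_iff.2 x'))
    simpa only [map_sub, map_mul, full_rC, full_lB, sub_eq_zero, two] using this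
  bridge_circle_disjoint x y' y x' hd := by
    have := lift_jExtra_eq_zero hρ (.bridge_circle_disjoint (isBridgeGen_iff.2 x)
      (isCircleGen_mirror_iff.2 y') (isCircleGen_mirror_iff.2 y) (isBridgeGen_iff.2 x')
      fun p h1 => not_not.1 fun h2 => hd ⟨p, h1, h2⟩)
    simpa only [map_sub, map_mul, full_rB, full_lC, sub_eq_zero, two] using this
  circle_circle x y' y x' hne := by
    have := lift_jExtra_eq_zero hρ (.circle_circle (isCircleGen_iff.2 x)
      (isCircleGen_mirror_iff.2 y') (isCircleGen_mirror_iff.2 y) (isCircleGen_iff.2 x') hne)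
    simpa only [map_sub, map_mul, full_rC, full_lC, sub_eq_zero, two] using this
  join x y' y₁ x₁ y₂ x₂ hj ht hne := by
    have := lift_jExtra_eq_zero hρ (.join (isBridgeGen_iff.2 x) (isCircleGen_mirror_iff.2 y')
      (isCircleGen_mirror_iff.2 y₁) (isBridgeGen_iff.2 x₁) (isCircleGen_mirror_iff.2 y₂)
      (isBridgeGen_iff.2 x₂) hj ht hne)
    rw [sub_sub] at this
    simpa only [map_sub, map_add, map_mul, full_rB, full_lC, sub_eq_zero, two] using this
  split x₁ y₁ x₂ y₂ y x' hs ht hne := by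
    have := lift_jExtra_eq_zero hρ (.split (isBridgeGen_iff.2 x₁) (isCircleGen_mirror_iff.2 y₁)
      (isBridgeGen_iff.2 x₂) (isCircleGen_mirror_iff.2 y₂) (isCircleGen_mirror_iff.2 y)
      (isBridgeGen_iff.2 x') hs ht hne)
    simpa only [map_sub, map_add, map_mul, full_rB, full_lC, sub_eq_zero, two] using this

theorem tetraRels_of_lift {ρ : EdgeRep n A} (hρ : ∀ x, TetrahedronRel x → ρ.full.lift x = 0) :
    ρ.TetraRels := by
  intro h₁ h₂ h₂' h₃ x y hd hne i j k l h1 h2 h3 h4 h5 h6 h7 h8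
  have := hρ _ (.mk (isBridgeGen_mirror_iff.2 x.1) (isBridgeGen_mirror_iff.2 x.2)
    (isBridgeGen_mirror_iff.2 y.1) (isBridgeGen_mirror_iff.2 y.2) hd hne i j k l h1 h2 h3 h4 h5 h6 h7 h8)
  simpa only [map_add, map_mul, full_lB, two] using this

end EdgeRep

end universal

end BorderedKh

namespace BorderedKh

section differential

variable {n : ℕ}

theorem DecLink.mirror_deg (h : DecLink n) : h.mirror.deg = h.deg := by
  have key : ∀ (R R' : Fin (2 * n) → Fin (2 * n) → Prop) (P : Fin (2 * n) → Prop), R = R' →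
      Set.ncard {c : Quotient (Relation.EqvGen.setoid R) | ∃ p, Quotient.mk _ p = c ∧ P p} =
        Set.ncard {c : Quotient (Relation.EqvGen.setoid R') | ∃ p, Quotient.mk _ p = c ∧ P p} := by
    rintro R _ P rfl
    rfl
  have hc : ∀ s, h.mirror.count s = h.count s := fun s =>
    key _ _ _ (funext fun _ => funext fun _ => propext or_comm)
  rw [DecLink.deg, DecLink.deg, hc, hc]

theorem DecoAt.of_sign {p : Fin (2 * n)} {h k : DecLink n} (hd : IsDecoEdge h k)
    (h1 : h.sign p = true) (h2 : k.sign p = false) : DecoAt p h k := by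
  obtain ⟨q, hq⟩ := isDecoEdge_iff.1 hd
  have hpq : h.SameCirc q p := hq.sign_ne_iff.1 (by rw [h1, h2]; simp)
  obtain ⟨h3, rfl⟩ := hq
  refine ⟨h1, DecLink.ext_diag rfl fun r => ?_⟩
  by_cases hr : h.SameCirc q r
  · rw [h.set_sign_of_sameCirc hr, h.set_sign_of_sameCirc]
    exact h.sameCirc_equiv.trans (h.sameCirc_equiv.symm hpq) hr
  · rw [h.set_sign_of_not hr, h.set_sign_of_not]
    exact fun hc => hr (h.sameCirc_equiv.trans hpq hc)

theorem IsDecoEdge.sign_eq_false {h k : DecLink n} (hd : IsDecoEdge h k) {p : Fin (2 * n)}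
    (hp : h.sign p = false) : k.sign p = false := by
  obtain ⟨q, h1, rfl⟩ := isDecoEdge_iff.1 hd
  by_cases hq : h.SameCirc q p
  · exact h.set_sign_of_sameCirc hq
  · rw [h.set_sign_of_not hq, hp]

/-- The bidegree of an edge. -/
noncomputable def edgeDeg (s : Side) (h k : DecLink n) : ℚ × ℤ :=
  match s with
  | .right => (((h.deg : ℚ) - k.deg) / 2, 0)
  | .left => (((k.deg : ℚ) - h.deg) / 2, 1)

namespace EdgeRep

variable {A : Type} [Ring A] {ρ : EdgeRep n A}

section square

variable (ρ)

open Classical in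
/-- The matrix of the edges on one side that satisfy a relation. -/
noncomputable def relMat (s : Side) (R : DecLink n → DecLink n → Prop) :
    Matrix (DecLink n) (DecLink n) A :=
  Matrix.of fun h k => if R h k then ρ.E s h k else 0

open Classical in
theorem relMat_mul_apply (s t : Side) (R R' : DecLink n → DecLink n → Prop) (h k : DecLink n) :
    (ρ.relMat s R * ρ.relMat t R') h k =
      ∑ m ∈ Finset.univ.filter (fun m => R h m ∧ R' m k), ρ.two s t h m k := by
  rw [Matrix.mul_apply, Finset.sum_filter]
  refine Finset.sum_congr rfl fun m _ => ?_
  change (if R h m then ρ.E s h m else 0) * (if R' m k then ρ.E t m k else 0) = _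
  by_cases h1 : R h m <;> by_cases h2 : R' m k <;> simp [h1, h2, two]

theorem relMat_comm (s t : Side) {R R' : DecLink n → DecLink n → Prop} (hc : rm R * rm R' = rm R' * rm R)
    (he : ∀ {h₁ h₂ h₂' h₃}, R h₁ h₂ → R' h₂ h₃ → R' h₁ h₂' → R h₂' h₃ →
      ρ.two s t h₁ h₂ h₃ = ρ.two t s h₁ h₂' h₃) :
    ρ.relMat s R * ρ.relMat t R' = ρ.relMat t R' * ρ.relMat s R := by
  classical
  ext h k
  have hcard := congrFun (congrFun hc h) k
  rw [rm_mul_rm_apply, rm_mul_rm_apply, Nat.cast_inj] at hcard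
  rw [relMat_mul_apply, relMat_mul_apply]
  by_cases hex : ∃ m, R h m ∧ R' m k
  · obtain ⟨m, hm⟩ := hex
    have hpos := Finset.card_pos.2 ⟨m, (Finset.mem_filter (p := fun m => R h m ∧ R' m k)).2
      ⟨Finset.mem_univ m, hm⟩⟩
    rw [hcard] at hpos
    obtain ⟨m', hm'⟩ := Finset.card_pos.1 hpos
    have hm' := (Finset.mem_filter.1 hm').2
    rw [Finset.sum_eq_card_nsmul (b := ρ.two s t h m k), hcard, Finset.sum_eq_card_nsmul]
    · intro x hx
      have hx := (Finset.mem_filter.1 hx).2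
      exact (he hm.1 hm.2 hx.1 hx.2).symm
    · intro x hx
      have hx := (Finset.mem_filter.1 hx).2
      exact (he hx.1 hx.2 hm'.1 hm'.2).trans (he hm.1 hm.2 hm'.1 hm'.2).symm
  · have h0 : (Finset.univ.filter fun m => R h m ∧ R' m k) = ∅ :=
      Finset.filter_eq_empty_iff.2 fun m _ hm => hex ⟨m, hm⟩
    rw [h0, Finset.card_empty] at hcard
    rw [h0, Finset.card_eq_zero.1 hcard.symm, Finset.sum_empty, Finset.sum_empty]

/-- The square of the matrix of all left edges. -/
noncomputable def square : Matrix (DecLink n) (DecLink n) A :=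
  Matrix.of (ρ.E .left) * Matrix.of (ρ.E .left)

theorem square_apply (h k : DecLink n) : ρ.square h k = ∑ m, ρ.two .left .left h m k :=
  Matrix.mul_apply

theorem e_square (h k : DecLink n) : ρ.e h * ρ.square h k = ρ.square h k := by
  rw [square_apply, Finset.mul_sum]
  refine Finset.sum_congr rfl fun m _ => ?_
  rw [two, ← mul_assoc, ρ.e_E]

theorem square_e (h k : DecLink n) : ρ.square h k * ρ.e k = ρ.square h k := by
  rw [square_apply, Finset.sum_mul]
  refine Finset.sum_congr rfl fun m _ => ?_
  rw [two, mul_assoc, ρ.E_e]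

end square

namespace ProdRels

variable (hρ : ρ.ProdRels)
include hρ

theorem square_eq_zero {h k : DecLink n} (hn : ¬ IsDecoEdge h k) : ρ.square h k = 0 := by
  rw [square_apply]
  by_cases he : IsEdge .left h k
  · have hb := (he.resolve_left hn).deg_eq
    refine Finset.sum_eq_zero fun m _ => ρ.two_eq_zero ?_
    rintro ⟨h1 | h1, h2 | h2⟩ <;> have e1 := h1.deg_eq <;> have e2 := h2.deg_eq <;> omega
  · exact hρ.left_sum he

theorem square_eq : ρ.square = ρ.relMat .left (IsBridgeEdge .left) * ρ.relMat .left (IsBridgeEdge .left) := by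
  classical
  ext h k
  rw [relMat_mul_apply]
  by_cases hd : k.deg = h.deg + 2
  · rw [square_apply, ρ.sum_two]
    intro x
    rw [edges_iff_of_deg_two hd, Finset.mem_filter]
    exact (and_iff_right (Finset.mem_univ x)).symm
  · rw [hρ.square_eq_zero fun hc => hd hc.deg_eq, Finset.sum_eq_zero]
    intro x hx
    have hx := (Finset.mem_filter.1 hx).2
    have e1 := hx.1.deg_eq
    have e2 := hx.2.deg_eq
    omega

theorem relMat_mul_square {R : DecLink n → DecLink n → Prop}
    (hc : rm R * bridgeMat n .left = bridgeMat n .left * rm R)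
    (he : ∀ {h₁ h₂ h₂' h₃}, R h₁ h₂ → IsBridgeEdge .left h₂ h₃ → IsBridgeEdge .left h₁ h₂' →
      R h₂' h₃ → ρ.two .right .left h₁ h₂ h₃ = ρ.two .left .right h₁ h₂' h₃) :
    ρ.relMat .right R * ρ.square = ρ.square * ρ.relMat .right R := by
  have h := ρ.relMat_comm .right .left hc he
  rw [hρ.square_eq, ← mul_assoc, h, mul_assoc, h, mul_assoc]

theorem sum_bridge_square (h₁ h₃ : DecLink n) {T T' : Finset (DecLink n)}
    (hT : ∀ x, (IsBridgeEdge .right h₁ x ∧ IsDecoEdge x h₃) ↔ x ∈ T)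
    (hT' : ∀ x, (IsDecoEdge h₁ x ∧ IsBridgeEdge .right x h₃) ↔ x ∈ T') :
    ∑ x ∈ T, ρ.E .right h₁ x * ρ.square x h₃ = ∑ x ∈ T', ρ.square h₁ x * ρ.E .right x h₃ := by
  classical
  have h := congrFun (congrFun (hρ.relMat_mul_square bridgeMat_comm hρ.bridge_bridge) h₁) h₃
  rw [Matrix.mul_apply, Matrix.mul_apply] at h
  rw [← Finset.sum_subset (Finset.subset_univ T), ← Finset.sum_subset (Finset.subset_univ T')] at h
  · refine Eq.trans (Finset.sum_congr rfl fun x hx => ?_) (h.trans (Finset.sum_congr rfl fun x hx => ?_))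
    · exact congrArg (· * _) (if_pos ((hT x).2 hx).1).symm
    · exact congrArg (_ * ·) (if_pos ((hT' x).2 hx).2)
  · intro x _ hx
    by_cases h1 : IsDecoEdge h₁ x
    · exact (congrArg (_ * ·) (if_neg fun h2 => hx ((hT' x).1 ⟨h1, h2⟩))).trans (mul_zero _)
    · rw [hρ.square_eq_zero h1, zero_mul]
  · intro x _ hx
    by_cases h1 : IsDecoEdge x h₃
    · exact (congrArg (· * _) (if_neg fun h2 => hx ((hT x).1 ⟨h2, h1⟩))).trans (zero_mul _)
    · rw [hρ.square_eq_zero h1, mul_zero]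

theorem circle_square {h₁ h₂ h₂' h₃ : DecLink n} (x : IsDecoEdge h₁ h₂) (y' : IsDecoEdge h₂ h₃)
    (y : IsDecoEdge h₁ h₂') (x' : IsDecoEdge h₂' h₃) (hne : h₂ ≠ h₂') :
    ρ.E .right h₁ h₂ * ρ.square h₂ h₃ = ρ.square h₁ h₂' * ρ.E .right h₂' h₃ := by
  classical
  obtain ⟨p, hp⟩ := isDecoEdge_iff.1 x
  have h := congrFun (congrFun (hρ.relMat_mul_square (decoMat_mul_bridgeMat p .left)
    fun h1 h2 h3 h4 => hρ.circle_bridge (isDecoEdge_iff.2 ⟨p, h1⟩) h2 h3 (isDecoEdge_iff.2 ⟨p, h4⟩))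
    h₁) h₃
  have h2p : h₂.sign p = false := (decoAt_iff'.1 hp).1
  have h3p : h₃.sign p = false := y'.sign_eq_false h2p
  have h2p' : h₂'.sign p = true := by
    by_contra hc
    exact hne (hp.2.trans (DecoAt.of_sign y hp.1 (Bool.eq_false_iff.2 hc)).2.symm)
  have hp' := DecoAt.of_sign x' h2p' h3p
  rw [Matrix.mul_apply, Matrix.mul_apply, Finset.sum_eq_single h₂, Finset.sum_eq_single h₂'] at h
  · exact (congrArg (· * _) (if_pos hp).symm).trans (h.trans (congrArg (_ * ·) (if_pos hp')))
  · intro x _ hx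
    exact (congrArg (_ * ·) (if_neg fun hc => hx
      ((decoAt_iff'.1 hc).2.trans (decoAt_iff'.1 hp').2.symm))).trans (mul_zero _)
  · exact fun hc => absurd (Finset.mem_univ _) hc
  · intro x _ hx
    exact (congrArg (· * _) (if_neg fun hc => hx (hc.2.trans hp.2.symm))).trans (zero_mul _)
  · exact fun hc => absurd (Finset.mem_univ _) hc

/-- The matrices with entries the edges, and off the diagonal the values of the differential. -/
noncomputable def derRep : EdgeRep n (Matrix (Fin 2) (Fin 2) A) where
  e u := !![ρ.e u, 0; 0, ρ.e u]
  E s h k := match s with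
    | .right => !![ρ.E .right h k, 0; 0, ρ.E .right h k]
    | .left => !![ρ.E .left h k, -ρ.square h k; 0, -ρ.E .left h k]
  e_self u := by simp [ρ.e_self]
  e_ne u v h := by
    ext i j
    fin_cases i <;> fin_cases j <;> simp [ρ.e_ne u v h]
  e_sum := by
    ext i j
    rw [Matrix.sum_apply]
    fin_cases i <;> fin_cases j <;> simp [ρ.e_sum]
  e_E s h k := by cases s <;> simp [ρ.e_E, e_square]
  E_e s h k := by cases s <;> simp [ρ.E_e, square_e]
  E_zero s h k hn := by
    ext i j
    cases s <;> fin_cases i <;> fin_cases j <;>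
      simp [ρ.E_zero _ h k hn, hρ.square_eq_zero fun hc => hn (Or.inl hc)]

theorem derRep_rr (h₁ h₂ h₃ : DecLink n) : hρ.derRep.two .right .right h₁ h₂ h₃ =
    !![ρ.two .right .right h₁ h₂ h₃, 0; 0, ρ.two .right .right h₁ h₂ h₃] := by
  simp [two, derRep]

theorem derRep_rl (h₁ h₂ h₃ : DecLink n) : hρ.derRep.two .right .left h₁ h₂ h₃ =
    !![ρ.two .right .left h₁ h₂ h₃, -(ρ.E .right h₁ h₂ * ρ.square h₂ h₃);
      0, -ρ.two .right .left h₁ h₂ h₃] := by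
  simp [two, derRep]

theorem derRep_lr (h₁ h₂ h₃ : DecLink n) : hρ.derRep.two .left .right h₁ h₂ h₃ =
    !![ρ.two .left .right h₁ h₂ h₃, -(ρ.square h₁ h₂ * ρ.E .right h₂ h₃);
      0, -ρ.two .left .right h₁ h₂ h₃] := by
  simp [two, derRep]

theorem derRep_ll (h₁ h₂ h₃ : DecLink n) : hρ.derRep.two .left .left h₁ h₂ h₃ =
    !![ρ.two .left .left h₁ h₂ h₃, ρ.square h₁ h₂ * ρ.E .left h₂ h₃ - ρ.E .left h₁ h₂ * ρ.square h₂ h₃;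
      0, ρ.two .left .left h₁ h₂ h₃] := by
  simp [two, derRep]
  abel

theorem sum_derRep_ll (h₁ h₃ : DecLink n) : ∑ m, hρ.derRep.two .left .left h₁ m h₃ =
    !![ρ.square h₁ h₃, 0; 0, ρ.square h₁ h₃] := by
  have h : ∑ m, (ρ.square h₁ m * ρ.E .left m h₃ - ρ.E .left h₁ m * ρ.square m h₃) = 0 := by
    have := congrFun (congrFun (mul_assoc (Matrix.of (ρ.E .left)) (Matrix.of (ρ.E .left))
      (Matrix.of (ρ.E .left))) h₁) h₃
    rw [Finset.sum_sub_distrib, sub_eq_zero]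
    exact this
  ext i j
  rw [Matrix.sum_apply, square_apply]
  fin_cases i <;> fin_cases j <;> simp [derRep_ll, h]

theorem derRep_prodRels : hρ.derRep.ProdRels where
  right_eq x y x' y' := by rw [derRep_rr, derRep_rr, hρ.right_eq x y x' y']
  right_edge x y z := by rw [derRep_rr, hρ.right_edge x y z]; rfl
  left_sum hn := by
    rw [sum_derRep_ll, hρ.square_eq_zero fun hc => hn (Or.inl hc)]
    exact Matrix.ext fun i j => by fin_cases i <;> fin_cases j <;> rfl
  bridge_bridge x y' y x' := by
    rw [derRep_rl, derRep_lr, hρ.bridge_bridge x y' y x', hρ.square_eq_zero y'.not_deco,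
      hρ.square_eq_zero y.not_deco, mul_zero, zero_mul]
  circle_bridge x y' y x' := by
    rw [derRep_rl, derRep_lr, hρ.circle_bridge x y' y x', hρ.square_eq_zero y'.not_deco,
      hρ.square_eq_zero y.not_deco, mul_zero, zero_mul]
  bridge_circle_disjoint {h₁ h₂ h₂' h₃} x y' y x' hd := by
    have h : ρ.E .right h₁ h₂ * ρ.square h₂ h₃ = ρ.square h₁ h₂' * ρ.E .right h₂' h₃ := by
      rcases deco_bridge_cases .right h₁ h₃ with ⟨c1, c2⟩ | ⟨u, w, c1, c2, -, ht⟩ |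
        ⟨u, w, w', hw, c1, c2, hj, ht, -⟩ | ⟨u, u', w, hu, c1, c2, hj, ht, ht', ht''⟩
      · exact absurd ⟨y, x'⟩ (c2 _)
      · obtain rfl := (c2 _).1 ⟨y, x'⟩
        obtain rfl := (c1 _).1 ⟨x, y'⟩
        have := hρ.sum_bridge_square h₁ h₃ (T := {h₂}) (T' := {h₂'}) (by simpa using c1) (by simpa using c2)
        rwa [Finset.sum_singleton, Finset.sum_singleton] at this
      · obtain rfl := (c1 _).1 ⟨x, y'⟩
        exact absurd ht hd
      · obtain rfl | rfl := (c1 _).1 ⟨x, y'⟩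
        exacts [absurd ht' hd, absurd ht'' hd]
    rw [derRep_rl, derRep_lr, hρ.bridge_circle_disjoint x y' y x' hd, h]
  circle_circle x y' y x' hne := by
    rw [derRep_rl, derRep_lr, hρ.circle_circle x y' y x' hne, hρ.circle_square x y' y x' hne]
  join {h₁ h₂ h₂' h₂'' h₃} x y' y₁ x₁ y₂ x₂ hj ht hne := by
    classical
    have h : ρ.E .right h₁ h₂ * ρ.square h₂ h₃ =
        ρ.square h₁ h₂' * ρ.E .right h₂' h₃ + ρ.square h₁ h₂'' * ρ.E .right h₂'' h₃ := by
      rcases deco_bridge_cases .right h₁ h₃ with ⟨c1, c2⟩ | ⟨u, w, c1, c2, -⟩ |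
        ⟨u, w, w', hw, c1, c2, -⟩ | ⟨u, u', w, hu, c1, c2, -⟩
      · exact absurd ⟨x, y'⟩ (c1 _)
      · exact absurd (((c2 _).1 ⟨y₁, x₁⟩).trans ((c2 _).1 ⟨y₂, x₂⟩).symm) hne
      · obtain rfl := (c1 _).1 ⟨x, y'⟩
        have := hρ.sum_bridge_square h₁ h₃ (T := {h₂}) (T' := {w, w'}) (by simpa using c1)
          (by simpa using c2)
        rw [Finset.sum_singleton, Finset.sum_pair hw] at this
        rw [this]
        obtain rfl | rfl := (c2 _).1 ⟨y₁, x₁⟩ <;> obtain rfl | rfl := (c2 _).1 ⟨y₂, x₂⟩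
        exacts [absurd rfl hne, rfl, add_comm _ _, absurd rfl hne]
      · exact absurd (((c2 _).1 ⟨y₁, x₁⟩).trans ((c2 _).1 ⟨y₂, x₂⟩).symm) hne
    rw [derRep_rl, derRep_lr, derRep_lr, hρ.join x y' y₁ x₁ y₂ x₂ hj ht hne, h]
    ext a b
    fin_cases a <;> fin_cases b <;> simp [add_comm]
  split {h₁ h₂ h₂' h₂'' h₃} x₁ y₁ x₂ y₂ y x' hs ht hne := by
    classical
    have h : ρ.E .right h₁ h₂' * ρ.square h₂' h₃ + ρ.E .right h₁ h₂'' * ρ.square h₂'' h₃ =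
        ρ.square h₁ h₂ * ρ.E .right h₂ h₃ := by
      rcases deco_bridge_cases .right h₁ h₃ with ⟨c1, c2⟩ | ⟨u, w, c1, c2, -⟩ |
        ⟨u, w, w', hw, c1, c2, -⟩ | ⟨u, u', w, hu, c1, c2, -⟩
      · exact absurd ⟨y, x'⟩ (c2 _)
      · exact absurd (((c1 _).1 ⟨x₁, y₁⟩).trans ((c1 _).1 ⟨x₂, y₂⟩).symm) hne
      · exact absurd (((c1 _).1 ⟨x₁, y₁⟩).trans ((c1 _).1 ⟨x₂, y₂⟩).symm) hne
      · obtain rfl := (c2 _).1 ⟨y, x'⟩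
        have := hρ.sum_bridge_square h₁ h₃ (T := {u, u'}) (T' := {h₂}) (by simpa using c1)
          (by simpa using c2)
        rw [Finset.sum_singleton, Finset.sum_pair hu] at this
        rw [← this]
        obtain rfl | rfl := (c1 _).1 ⟨x₁, y₁⟩ <;> obtain rfl | rfl := (c1 _).1 ⟨x₂, y₂⟩
        exacts [absurd rfl hne, rfl, add_comm _ _, absurd rfl hne]
    rw [derRep_rl, derRep_rl, derRep_lr, ← hρ.split x₁ y₁ x₂ y₂ y x' hs ht hne, ← h]
    ext a b
    fin_cases a <;> fin_cases b <;> simp [add_comm]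

theorem derRep_tetraRels (ht : ρ.TetraRels) : hρ.derRep.TetraRels := by
  intro h₁ h₂ h₂' h₃ x y hd hne i j k l h1 h2 h3 h4 h5 h6 h7 h8
  have h := ht x y hd hne i j k l h1 h2 h3 h4 h5 h6 h7 h8
  rw [derRep_ll, derRep_ll, hρ.square_eq_zero x.1.not_deco, hρ.square_eq_zero x.2.not_deco,
    hρ.square_eq_zero y.1.not_deco, hρ.square_eq_zero y.2.not_deco]
  ext a b
  fin_cases a <;> fin_cases b <;> simp [h]

end ProdRels

section coaction

variable (ρ)

/-- The edges marked with their bidegrees. -/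
noncomputable def coact : EdgeRep n (AddMonoidAlgebra A (ℚ × ℤ)) where
  e u := AddMonoidAlgebra.single 0 (ρ.e u)
  E s h k := AddMonoidAlgebra.single (edgeDeg s h k) (ρ.E s h k)
  e_self u := by rw [AddMonoidAlgebra.single_mul_single, ρ.e_self, add_zero]
  e_ne u v h := by
    rw [AddMonoidAlgebra.single_mul_single, ρ.e_ne u v h, AddMonoidAlgebra.single_zero]
  e_sum := by
    rw [AddMonoidAlgebra.one_def, ← ρ.e_sum]
    exact (map_sum (AddMonoidAlgebra.singleAddHom (0 : ℚ × ℤ)) _ _).symm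
  e_E s h k := by rw [AddMonoidAlgebra.single_mul_single, ρ.e_E, zero_add]
  E_e s h k := by rw [AddMonoidAlgebra.single_mul_single, ρ.E_e, add_zero]
  E_zero s h k hn := by rw [ρ.E_zero s h k hn, AddMonoidAlgebra.single_zero]

theorem coact_two {s t : Side} {h₁ h₂ h₃ : DecLink n} {d : ℚ × ℤ}
    (hd : edgeDeg s h₁ h₂ + edgeDeg t h₂ h₃ = d) :
    ρ.coact.two s t h₁ h₂ h₃ = AddMonoidAlgebra.single d (ρ.two s t h₁ h₂ h₃) := by
  rw [← hd]
  exact AddMonoidAlgebra.single_mul_single ..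

theorem edgeDeg_add_self (s : Side) (h₁ h₂ h₃ : DecLink n) : edgeDeg s h₁ h₂ + edgeDeg s h₂ h₃ =
    match s with
    | .right => (((h₁.deg : ℚ) - h₃.deg) / 2, 0)
    | .left => (((h₃.deg : ℚ) - h₁.deg) / 2, 2) := by
  cases s <;> refine Prod.ext ?_ ?_ <;> simp only [edgeDeg, Prod.mk_add_mk] <;> ring

theorem edgeDeg_right_left {a b : ℤ} {h₁ h₂ h₃ : DecLink n} (h1 : h₂.deg = h₁.deg + a)
    (h2 : h₃.deg = h₂.deg + b) : edgeDeg .right h₁ h₂ + edgeDeg .left h₂ h₃ = (((b : ℚ) - a) / 2, 1) := by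
  refine Prod.ext ?_ ?_ <;> simp only [edgeDeg, Prod.mk_add_mk, h1, h2, Int.cast_add]
  · ring
  · rfl

theorem edgeDeg_left_right {a b : ℤ} {h₁ h₂ h₃ : DecLink n} (h1 : h₂.deg = h₁.deg + a)
    (h2 : h₃.deg = h₂.deg + b) : edgeDeg .left h₁ h₂ + edgeDeg .right h₂ h₃ = (((a : ℚ) - b) / 2, 1) := by
  refine Prod.ext ?_ ?_ <;> simp only [edgeDeg, Prod.mk_add_mk, h1, h2, Int.cast_add]
  · ring
  · rfl

variable {ρ}

theorem ProdRels.coact_prodRels (hρ : ρ.ProdRels) : ρ.coact.ProdRels where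
  right_eq x y x' y' := by
    rw [ρ.coact_two (edgeDeg_add_self ..), ρ.coact_two (edgeDeg_add_self ..), hρ.right_eq x y x' y']
  right_edge x y z := by
    rw [ρ.coact_two (edgeDeg_add_self ..), hρ.right_edge x y z]
    rfl
  left_sum {h₁ h₃} hn := by
    have h := hρ.left_sum hn
    rw [Finset.sum_congr rfl fun m _ => ρ.coact_two (edgeDeg_add_self .left h₁ m h₃)]
    refine (map_sum (AddMonoidAlgebra.singleAddHom _) _ _).symm.trans ?_
    rw [h, map_zero]
  bridge_bridge x y' y x' := by
    rw [ρ.coact_two (edgeDeg_right_left x.deg_eq y'.deg_eq),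
      ρ.coact_two (edgeDeg_left_right y.deg_eq x'.deg_eq), hρ.bridge_bridge x y' y x']
  circle_bridge x y' y x' := by
    rw [ρ.coact_two (edgeDeg_right_left x.deg_eq y'.deg_eq),
      ρ.coact_two (edgeDeg_left_right y.deg_eq x'.deg_eq), hρ.circle_bridge x y' y x']
  bridge_circle_disjoint x y' y x' hd := by
    rw [ρ.coact_two (edgeDeg_right_left x.deg_eq y'.deg_eq),
      ρ.coact_two (edgeDeg_left_right y.deg_eq x'.deg_eq), hρ.bridge_circle_disjoint x y' y x' hd]
  circle_circle x y' y x' hne := by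
    rw [ρ.coact_two (edgeDeg_right_left x.deg_eq y'.deg_eq),
      ρ.coact_two (edgeDeg_left_right y.deg_eq x'.deg_eq), hρ.circle_circle x y' y x' hne]
  join x y' y₁ x₁ y₂ x₂ hj ht hne := by
    rw [ρ.coact_two (edgeDeg_right_left x.deg_eq y'.deg_eq),
      ρ.coact_two (edgeDeg_left_right y₁.deg_eq x₁.deg_eq),
      ρ.coact_two (edgeDeg_left_right y₂.deg_eq x₂.deg_eq), hρ.join x y' y₁ x₁ y₂ x₂ hj ht hne,
      AddMonoidAlgebra.single_add]
  split x₁ y₁ x₂ y₂ y x' hs ht hne := by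
    rw [ρ.coact_two (edgeDeg_right_left x₁.deg_eq y₁.deg_eq),
      ρ.coact_two (edgeDeg_right_left x₂.deg_eq y₂.deg_eq),
      ρ.coact_two (edgeDeg_left_right y.deg_eq x'.deg_eq), ← hρ.split x₁ y₁ x₂ y₂ y x' hs ht hne,
      AddMonoidAlgebra.single_add]

theorem coact_tetraRels (ht : ρ.TetraRels) : ρ.coact.TetraRels := by
  intro h₁ h₂ h₂' h₃ x y hd hne i j k l h1 h2 h3 h4 h5 h6 h7 h8
  rw [ρ.coact_two (edgeDeg_add_self ..), ρ.coact_two (edgeDeg_add_self ..),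
    ← AddMonoidAlgebra.single_add, ht x y hd hne i j k l h1 h2 h3 h4 h5 h6 h7 h8,
    AddMonoidAlgebra.single_zero]

end coaction

/-- The representation on the ring of idempotents. -/
noncomputable def aug (n : ℕ) : EdgeRep n (DecLink n → ℤ) where
  e := (augData (gensFull n)).e
  E _ _ _ := 0
  e_self := (augData (gensFull n)).e_self
  e_ne := (augData (gensFull n)).e_ne
  e_sum := (augData (gensFull n)).e_sum
  e_E _ _ _ := mul_zero _
  E_e _ _ _ := zero_mul _
  E_zero _ _ _ _ := rfl

theorem aug_two (s t : Side) (h₁ h₂ h₃ : DecLink n) : (aug n).two s t h₁ h₂ h₃ = 0 := mul_zero _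

theorem aug_prodRels : (aug n).ProdRels := by
  constructor <;> intros <;> simp only [aug_two, Finset.sum_const_zero, add_zero]
  rfl

theorem aug_tetraRels : (aug n).TetraRels := by
  intro h₁ h₂ h₂' h₃ x y hd hne i j k l h1 h2 h3 h4 h5 h6 h7 h8
  rw [aug_two, aug_two, add_zero]

end EdgeRep

end differential

end BorderedKh

namespace BorderedKh

section main

theorem letters_eq_nil_of_wdeg {I : Type} {Q : Gens I} {deg : Q.E → ℚ × ℤ}
    (h : ∀ x, (deg x).2 = 1 ∨ ((deg x).2 = 0 ∧ (deg x).1 < 0)) (p : Q.Word) (hp : wdeg deg p = 0) :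
    p.letters = [] := by
  have key : ∀ w : List Q.E, 0 ≤ ((w.map deg).sum).2 ∧
      (((w.map deg).sum).2 = 0 → w = [] ∨ ((w.map deg).sum).1 < 0) := by
    intro w
    induction w with
    | nil => exact ⟨le_rfl, fun _ => Or.inl rfl⟩
    | cons x w ih =>
      rw [List.map_cons, List.sum_cons, Prod.fst_add, Prod.snd_add]
      rcases h x with h1 | ⟨h1, h2⟩
      · refine ⟨by omega, fun h3 => ?_⟩
        omega
      · refine ⟨by omega, fun h3 => Or.inr ?_⟩
        rcases ih.2 (by omega) with rfl | h4
        · simpa using h2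
        · linarith
  have hp' : (p.letters.map deg).sum = 0 := hp
  have := (key p.letters).2 (by rw [hp']; rfl)
  rw [hp'] at this
  exact this.resolve_right (lt_irrefl _)

variable {n : ℕ}

theorem edgeDeg_spec {s : Side} {h k : DecLink n} (he : IsEdge s h k) :
    (edgeDeg s h k).2 = 1 ∨ ((edgeDeg s h k).2 = 0 ∧ (edgeDeg s h k).1 < 0) := by
  cases s
  · exact Or.inl rfl
  · refine Or.inr ⟨rfl, ?_⟩
    have hlt : (h.deg : ℚ) < k.deg := by
      rw [Int.cast_lt]
      rcases he with h1 | h1 <;> rw [h1.deg_eq] <;> omega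
    change ((h.deg : ℚ) - k.deg) / 2 < 0
    linarith

theorem isEdge_full (x : (gensFull n).E) :
    IsEdge (sideFull n x) ((gensFull n).src x) ((gensFull n).tgt x) := by
  rcases x with x | x
  · exact isGen_iff.1 x.2
  · exact isGen_mirror_iff.1 x.2

theorem degFull_eq (x : (gensFull n).E) :
    degFull n x = edgeDeg (sideFull n x) ((gensFull n).src x) ((gensFull n).tgt x) := by
  rcases x with x | x
  · rfl
  · change (-(((x.1.1.mirror.deg : ℚ) - x.1.2.mirror.deg) / 2), (1 : ℤ)) =
      (((x.1.2.deg : ℚ) - x.1.1.deg) / 2, 1)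
    rw [DecLink.mirror_deg, DecLink.mirror_deg]
    refine Prod.ext ?_ rfl
    ring

theorem degGamma_eq (x : (gensGamma n).E) : degGamma n x = edgeDeg x.1.1 x.1.2.1 x.1.2.2 := by
  classical
  obtain ⟨⟨s, h, k⟩, hx⟩ := x
  change IsDecoEdge h k ∨ IsBridgeEdge s h k at hx
  have key : (k.deg : ℚ) = h.deg + if IsDecoEdge h k then 2 else 1 := by
    rcases hx with h1 | h1
    · rw [h1.deg_eq, if_pos h1]
      push_cast
      rfl
    · rw [h1.deg_eq, if_neg h1.not_deco]
      push_cast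
      rfl
  cases s <;> unfold degGamma edgeDeg <;> simp only [key] <;> split_ifs <;>
    refine Prod.ext ?_ rfl <;> simp only <;> ring

variable (n)

/-- The edges in the product algebra. -/
noncomputable def repProduct : EdgeRep n (ProductAlg n) := .ofFull (quo (relFull n))

/-- The edges in Roberts' algebra. -/
noncomputable def repGamma : EdgeRep n (BGamma n) := .ofGamma (quo (relGamma n))

variable {n}

theorem repProduct_prodRels : (repProduct n).ProdRels := EdgeRep.prodRels_of_lift fun x hx => by
  rw [repProduct, EdgeRep.ofFull_lift]
  exact (quo_eq_zero _).2 hx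

theorem repGamma_gammaRels : (repGamma n).GammaRels :=
  EdgeRep.ofGamma_gammaRels fun _ hx => (quo_eq_zero _).2 (TwoSidedIdeal.subset_span hx)

theorem repProduct_gen (x : (gensFull n).E) : (repProduct n).E (sideFull n x) ((gensFull n).src x)
    ((gensFull n).tgt x) = quo (relFull n) (TAlg.gen x) := by
  classical
  rcases x with x | x <;> exact dif_pos x.2

theorem repGamma_gen (x : (gensGamma n).E) :
    (repGamma n).E x.1.1 x.1.2.1 x.1.2.2 = quo (relGamma n) (TAlg.gen x) := by
  classical
  exact dif_pos x.2

/-- A representation with the relations of Roberts' algebra. -/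
theorem EdgeRep.GammaRels.lift_relGamma {A : Type} [Ring A] {ρ : EdgeRep n A} (hρ : ρ.GammaRels)
    {x : TAlg (gensGamma n)} (hx : x ∈ relGamma n) : ρ.gamma.lift x = 0 :=
  map_eq_zero_of_mem_span ρ.gamma.lift hρ hx

namespace EdgeRep

variable {A : Type} [Ring A] {ρ : EdgeRep n A}

theorem ProdRels.lift_eq_zero (hρ : ρ.ProdRels) {F : TAlg.LiftData (gensFull n) A}
    (he : ∀ u, F.e u = ρ.e u)
    (hg : ∀ x, F.g x = ρ.E (sideFull n x) ((gensFull n).src x) ((gensFull n).tgt x))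
    {x : TAlg (gensFull n)} (hx : x ∈ relFull n) : F.lift x = 0 := by
  have h : F.lift = ρ.full.lift := by
    refine TAlg.ringHom_ext (fun u => ?_) fun y => ?_
    · rw [TAlg.LiftData.lift_idem, TAlg.LiftData.lift_idem, he]
      rfl
    · rw [TAlg.LiftData.lift_gen, TAlg.LiftData.lift_gen, hg]
      rcases y with y | y <;> rfl
  rw [h]
  exact hρ.lift_relFull hx

theorem GammaRels.lift_eq_zero (hρ : ρ.GammaRels) {F : TAlg.LiftData (gensGamma n) A}
    (he : ∀ u, F.e u = ρ.e u) (hg : ∀ x, F.g x = ρ.E x.1.1 x.1.2.1 x.1.2.2)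
    {x : TAlg (gensGamma n)} (hx : x ∈ relGamma n) : F.lift x = 0 := by
  have h : F.lift = ρ.gamma.lift := by
    refine TAlg.ringHom_ext (fun u => ?_) fun y => ?_
    · rw [TAlg.LiftData.lift_idem, TAlg.LiftData.lift_idem, he]
      rfl
    · rw [TAlg.LiftData.lift_gen, TAlg.LiftData.lift_gen, hg]
      rfl
  rw [h]
  exact hρ.lift_relGamma hx

end EdgeRep

theorem repGamma_prodRels : (repGamma n).ProdRels := repGamma_gammaRels.prodRels

theorem repGamma_tetraRels : (repGamma n).TetraRels := repGamma_gammaRels.tetraRels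

theorem isGradedIdeal_relFull : IsGradedIdeal (relFull n) (degFull n) where
  coact x hx := (repProduct_prodRels (n := n)).coact_prodRels.lift_eq_zero (fun u => rfl) (fun y => by
    change AddMonoidAlgebra.single (degFull n y) (quo (relFull n) (TAlg.gen y)) = _
    rw [degFull_eq, ← repProduct_gen]
    rfl) hx
  aug x hx := (EdgeRep.aug_prodRels (n := n)).lift_eq_zero (fun u => rfl) (fun y => rfl) hx
  pos := letters_eq_nil_of_wdeg fun x => by
    rw [degFull_eq]
    exact edgeDeg_spec (isEdge_full x)

theorem isGradedIdeal_relGamma : IsGradedIdeal (relGamma n) (degGamma n) where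
  coact x hx := ((repGamma_prodRels (n := n)).coact_prodRels.gammaRels
    (EdgeRep.coact_tetraRels repGamma_tetraRels)).lift_eq_zero (fun u => rfl) (fun y => by
      change AddMonoidAlgebra.single (degGamma n y) (quo (relGamma n) (TAlg.gen y)) = _
      rw [degGamma_eq, ← repGamma_gen]
      rfl) hx
  aug x hx := ((EdgeRep.aug_prodRels (n := n)).gammaRels EdgeRep.aug_tetraRels).lift_eq_zero
    (fun u => rfl) (fun y => rfl) hx
  pos := letters_eq_nil_of_wdeg fun x => by
    rw [degGamma_eq]
    exact edgeDeg_spec x.2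

namespace EdgeRep

variable {A : Type} [Ring A] (ρ : EdgeRep n A)

/-- The value of the differential on an edge. -/
noncomputable def dE (s : Side) (h k : DecLink n) : A :=
  match s with
  | .right => 0
  | .left => -ρ.square h k

theorem e_dE (s : Side) (h k : DecLink n) : ρ.e h * ρ.dE s h k = ρ.dE s h k := by
  cases s
  · exact (mul_neg _ _).trans (congrArg _ (ρ.e_square h k))
  · exact mul_zero _

theorem dE_e (s : Side) (h k : DecLink n) : ρ.dE s h k * ρ.e k = ρ.dE s h k := by
  cases s
  · exact (neg_mul _ _).trans (congrArg _ (ρ.square_e h k))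
  · exact zero_mul _

variable {ρ}

theorem ProdRels.derRep_E (hρ : ρ.ProdRels) (s : Side) (h k : DecLink n) : hρ.derRep.E s h k =
    !![ρ.E s h k, ρ.dE s h k; 0, isgn (edgeDeg s h k).2 • ρ.E s h k] := by
  cases s
  · rw [show (edgeDeg .left h k).2 = 1 from rfl, isgn_one, neg_one_smul]
    rfl
  · rw [show (edgeDeg .right h k).2 = 0 from rfl, isgn_zero, one_smul]
    rfl

theorem dE_mem {gr : ℚ × ℤ → AddSubgroup A} (hm : ∀ i j x y, x ∈ gr i → y ∈ gr j → x * y ∈ gr (i + j))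
    (hE : ∀ s h k, ρ.E s h k ∈ gr (edgeDeg s h k)) (s : Side) (h k : DecLink n) :
    ρ.dE s h k ∈ gr (edgeDeg s h k + (0, 1)) := by
  cases s
  · refine neg_mem ?_
    rw [square_apply]
    refine sum_mem fun m _ => ?_
    have := hm _ _ _ _ (hE .left h m) (hE .left m k)
    rw [edgeDeg_add_self] at this
    have e : edgeDeg .left h k + (0, 1) = (((k.deg : ℚ) - h.deg) / 2, 2) := by
      simp only [edgeDeg, Prod.mk_add_mk, add_zero]
      rfl
    rw [e]
    exact this
  · exact zero_mem _

theorem ProdRels.map_dE (hρ : ρ.ProdRels) (f : A →+* Matrix (Fin 2) (Fin 2) A)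
    (hf : ∀ s h k, f (ρ.E s h k) = hρ.derRep.E s h k) (s : Side) (h k : DecLink n) :
    f (ρ.dE s h k) 0 1 = 0 := by
  cases s
  · change f (-ρ.square h k) 0 1 = 0
    have : f (ρ.square h k) = !![ρ.square h k, 0; 0, ρ.square h k] := by
      rw [← hρ.sum_derRep_ll, square_apply, map_sum]
      refine Finset.sum_congr rfl fun m _ => ?_
      rw [two, two, map_mul, hf, hf]
    rw [map_neg, this]
    exact neg_zero
  · change f 0 0 1 = 0
    rw [map_zero]
    rfl

end EdgeRep

theorem repProduct_E_mem (s : Side) (h k : DecLink n) :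
    (repProduct n).E s h k ∈ quoGrading (relFull n) (degFull n) (edgeDeg s h k) := by
  have key : ∀ x : (gensFull n).E, (repProduct n).E (sideFull n x) ((gensFull n).src x)
      ((gensFull n).tgt x) ∈ quoGrading (relFull n) (degFull n)
        (edgeDeg (sideFull n x) ((gensFull n).src x) ((gensFull n).tgt x)) := by
    intro x
    rw [repProduct_gen, ← degFull_eq]
    exact quo_mem_quoGrading (gen_mem_grading x)
  by_cases he : IsEdge s h k
  · cases s
    · exact key (Sum.inr ⟨(h, k), isGen_mirror_iff.2 he⟩)
    · exact key (Sum.inl ⟨(h, k), isGen_iff.2 he⟩)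
  · rw [EdgeRep.E_zero _ _ _ _ he]
    exact zero_mem _

theorem repGamma_E_mem (s : Side) (h k : DecLink n) :
    (repGamma n).E s h k ∈ quoGrading (relGamma n) (degGamma n) (edgeDeg s h k) := by
  have key : ∀ x : (gensGamma n).E, (repGamma n).E x.1.1 x.1.2.1 x.1.2.2 ∈
      quoGrading (relGamma n) (degGamma n) (edgeDeg x.1.1 x.1.2.1 x.1.2.2) := by
    intro x
    rw [repGamma_gen, ← degGamma_eq]
    exact quo_mem_quoGrading (gen_mem_grading x)
  by_cases he : IsEdge s h k
  · exact key ⟨(s, h, k), he⟩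
  · rw [EdgeRep.E_zero _ _ _ _ he]
    exact zero_mem _

theorem repProduct_dE_mem (s : Side) (h k : DecLink n) :
    (repProduct n).dE s h k ∈ quoGrading (relFull n) (degFull n) (edgeDeg s h k + (0, 1)) :=
  EdgeRep.dE_mem (gr := quoGrading (relFull n) (degFull n))
    (fun _ _ _ _ hx hy => quoGrading_mul_mem hx hy) repProduct_E_mem s h k

theorem repGamma_dE_mem (s : Side) (h k : DecLink n) :
    (repGamma n).dE s h k ∈ quoGrading (relGamma n) (degGamma n) (edgeDeg s h k + (0, 1)) :=
  EdgeRep.dE_mem (gr := quoGrading (relGamma n) (degGamma n))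
    (fun _ _ _ _ hx hy => quoGrading_mul_mem hx hy) repGamma_E_mem s h k

variable (n)

/-- The differential of the product algebra. -/
noncomputable def derProduct : DerSpec (relFull n) (degFull n) where
  δ x := (repProduct n).dE (sideFull n x) ((gensFull n).src x) ((gensFull n).tgt x)
  hl _ := (repProduct n).e_dE _ _ _
  hr _ := (repProduct n).dE_e _ _ _
  kill x hx := (repProduct_prodRels (n := n)).derRep_prodRels.lift_eq_zero (fun u => rfl) (fun y => by
    rw [EdgeRep.ProdRels.derRep_E, ← degFull_eq, repProduct_gen]
    rfl) hx
  hδ x := by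
    rw [degFull_eq]
    exact repProduct_dE_mem _ _ _

/-- The differential of Roberts' algebra. -/
noncomputable def derGamma : DerSpec (relGamma n) (degGamma n) where
  δ x := (repGamma n).dE x.1.1 x.1.2.1 x.1.2.2
  hl _ := (repGamma n).e_dE _ _ _
  hr _ := (repGamma n).dE_e _ _ _
  kill x hx := ((repGamma_prodRels (n := n)).derRep_prodRels.gammaRels
    (repGamma_prodRels.derRep_tetraRels repGamma_tetraRels)).lift_eq_zero (fun u => rfl) (fun y => by
      rw [EdgeRep.ProdRels.derRep_E, ← degGamma_eq, repGamma_gen]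
      rfl) hx
  hδ x := by
    rw [degGamma_eq]
    exact repGamma_dE_mem _ _ _

variable {n}

theorem derProduct_mat_E (s : Side) (h k : DecLink n) :
    (derProduct n).mat ((repProduct n).E s h k) = repProduct_prodRels.derRep.E s h k := by
  have key : ∀ x : (gensFull n).E, (derProduct n).mat ((repProduct n).E (sideFull n x)
      ((gensFull n).src x) ((gensFull n).tgt x)) = repProduct_prodRels.derRep.E (sideFull n x)
      ((gensFull n).src x) ((gensFull n).tgt x) := by
    intro x
    rw [repProduct_gen, EdgeRep.ProdRels.derRep_E, ← degFull_eq, repProduct_gen]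
    exact (derProduct n).mat_gen x
  by_cases he : IsEdge s h k
  · cases s
    · exact key (Sum.inr ⟨(h, k), isGen_mirror_iff.2 he⟩)
    · exact key (Sum.inl ⟨(h, k), isGen_iff.2 he⟩)
  · rw [EdgeRep.E_zero _ _ _ _ he, EdgeRep.E_zero _ _ _ _ he, map_zero]

theorem derGamma_mat_E (s : Side) (h k : DecLink n) :
    (derGamma n).mat ((repGamma n).E s h k) = repGamma_prodRels.derRep.E s h k := by
  by_cases he : IsEdge s h k
  · have h1 := repGamma_gen (n := n) ⟨(s, h, k), he⟩
    have h2 := degGamma_eq (n := n) ⟨(s, h, k), he⟩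
    rw [EdgeRep.ProdRels.derRep_E]
    refine (congrArg _ h1).trans (((derGamma n).mat_gen _).trans ?_)
    rw [h2, ← h1]
    rfl
  · rw [EdgeRep.E_zero _ _ _ _ he, EdgeRep.E_zero _ _ _ _ he, map_zero]

theorem isDGAlgebra_product : IsDGAlgebra (idemProduct n) (gradingProduct n) (derProduct n).D :=
  (derProduct n).isDGAlgebra isGradedIdeal_relFull fun _ =>
    repProduct_prodRels.map_dE (derProduct n).mat derProduct_mat_E _ _ _

theorem isDGAlgebra_gamma : IsDGAlgebra (idemGamma n) (gradingGamma n) (derGamma n).D :=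
  (derGamma n).isDGAlgebra isGradedIdeal_relGamma fun _ =>
    repGamma_prodRels.map_dE (derGamma n).mat derGamma_mat_E _ _ _

theorem isProductDifferential : IsProductDifferential n (derProduct n).D := by
  refine ⟨fun b => (derProduct n).D_gen _, fun b => ⟨_, isPhiStar_neg_pathsB b, ?_⟩⟩
  refine ((derProduct n).D_gen _).trans ?_
  have h : ∀ f, toProduct n (TAlg.map (inclL n) f) = (repProduct n).left.lift f := by
    intro f
    rw [← EdgeRep.lift_map_inclL, repProduct, EdgeRep.ofFull_lift]
    rfl
  have hneg : TAlg.map (mirrorHom n) (-pathsB b.1.1 b.1.2) = -TAlg.map (mirrorHom n) (pathsB b.1.1 b.1.2) :=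
    map_neg (TAlg.mapAdd (mirrorHom n)) _
  rw [h, hneg, map_neg, EdgeRep.left_lift_pathsB, ← EdgeRep.square_apply]
  rfl

theorem derGamma_edge {s : Side} {h k : DecLink n} (x : IsDecoEdge h k ∨ IsBridgeEdge s h k) :
    (derGamma n).D (toBGamma n (TAlg.gen (Q := gensGamma n) ⟨(s, h, k), x⟩)) = (repGamma n).dE s h k :=
  (derGamma n).D_gen _

theorem isGammaDifferential : IsGammaDifferential n (derGamma n).D := by
  classical
  refine ⟨fun h₁ h₂ x => derGamma_edge (Or.inl x), fun s h₁ h₂ x => (derGamma_edge (Or.inr x)).trans ?_,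
    fun h₁ h₃ x => (derGamma_edge (Or.inl x)).trans (congrArg Neg.neg ?_)⟩
  · cases s
    · exact neg_eq_zero.2 (repGamma_prodRels.square_eq_zero x.not_deco)
    · rfl
  · rw [EdgeRep.square_apply]
    refine Finset.sum_congr rfl fun m _ => ?_
    have hd := edges_iff_of_deg_two (s := .left) (x := m) x.deg_eq
    by_cases hm : IsBridgeEdge .left h₁ m ∧ IsBridgeEdge .left m h₃
    · rw [dif_pos hm, map_mul]
      exact congrArg₂ (· * ·) (repGamma_gen ⟨(.left, h₁, m), Or.inr hm.1⟩)
        (repGamma_gen ⟨(.left, m, h₃), Or.inr hm.2⟩)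
    · rw [dif_neg hm]
      exact EdgeRep.two_eq_zero _ fun hc => hm (hd.1 hc)

end main

end BorderedKh

namespace BorderedKh

section isomorphism

open TAlg

theorem quo_hom_ext {I : Type} [Fintype I] {Q : Gens I} {J : TwoSidedIdeal (TAlg Q)} {R : Type} [Ring R]
    {f g : J.ringCon.Quotient →+* R} (hi : ∀ u, f (quo J (idem u)) = g (quo J (idem u)))
    (hg : ∀ x, f (quo J (gen x)) = g (quo J (gen x))) : f = g :=
  RingHom.ext fun x => by
    obtain ⟨x, rfl⟩ := quo_surjective J x
    exact congrArg (fun φ : TAlg Q →+* R => φ x)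
      (TAlg.ringHom_ext (φ := f.comp (quo J)) (ψ := g.comp (quo J)) hi hg)

theorem map_mem_of_mem_quoGrading {I : Type} [Fintype I] {Q : Gens I} {J : TwoSidedIdeal (TAlg Q)}
    {deg : Q.E → ℚ × ℤ} {R : Type} [Ring R] {gr : ℚ × ℤ → AddSubgroup R}
    (hm : ∀ i j x y, x ∈ gr i → y ∈ gr j → x * y ∈ gr (i + j)) (f : J.ringCon.Quotient →+* R)
    (hi : ∀ u, f (quo J (idem u)) ∈ gr 0) (hg : ∀ x, f (quo J (gen x)) ∈ gr (deg x))
    {d : ℚ × ℤ} {x : J.ringCon.Quotient} (hx : x ∈ quoGrading J deg d) : f x ∈ gr d := by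
  refine quoGrading_induction (P := fun x => f x ∈ gr d) ?_ ?_ ?_ ?_ hx
  · rw [map_zero]
    exact zero_mem _
  · intro x y hx hy
    rw [map_add]
    exact add_mem hx hy
  · intro x hx
    rw [map_neg]
    exact neg_mem hx
  · rintro p rfl
    clear hx
    induction p using Gens.Word.induction with
    | nil u =>
      rw [wdeg_nil]
      exact hi u
    | cons x p h ih =>
      rw [ofWord_cons, map_mul, map_mul, wdeg_cons]
      exact hm _ _ _ _ (hg x) ih

variable (n : ℕ)

/-- The edges in the quotient of the product algebra by the extra relations. -/
noncomputable def repQuotient : EdgeRep n (QuotientAlg n) :=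
  .ofFull ((quo (tetrahedronIdeal n)).comp (quo (relFull n)))

/-- The projection from the product algebra to Roberts' algebra. -/
noncomputable def productToGamma : ProductAlg n →+* BGamma n :=
  quoLift (relFull n) (repGamma n).full.lift fun _ hx => repGamma_prodRels.lift_relFull hx

variable {n}

theorem productToGamma_eq_zero {x : ProductAlg n} (hx : x ∈ tetrahedronIdeal n) :
    productToGamma n x = 0 := by
  refine map_eq_zero_of_mem_span (productToGamma n) ?_ hx
  rintro _ ⟨y, hy, rfl⟩
  exact EdgeRep.lift_tetrahedronRel repGamma_tetraRels hy

theorem repQuotient_gammaRels : (repQuotient n).GammaRels := by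
  have h : ∀ x, (repQuotient n).full.lift x = quo (tetrahedronIdeal n) (quo (relFull n) x) := by
    intro x
    rw [repQuotient, EdgeRep.ofFull_lift]
    rfl
  have hp : (repQuotient n).ProdRels := EdgeRep.prodRels_of_lift fun x hx => by
    rw [h, (quo_eq_zero _).2 hx, map_zero]
  refine hp.gammaRels (EdgeRep.tetraRels_of_lift fun x hx => ?_)
  rw [h]
  exact (quo_eq_zero _).2 (TwoSidedIdeal.subset_span ⟨x, hx, rfl⟩)

theorem repQuotient_gen (x : (gensFull n).E) : (repQuotient n).E (sideFull n x) ((gensFull n).src x)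
    ((gensFull n).tgt x) = quo (tetrahedronIdeal n) (quo (relFull n) (gen x)) := by
  classical
  rcases x with x | x <;> exact dif_pos x.2

theorem repQuotient_E (s : Side) (h k : DecLink n) :
    (repQuotient n).E s h k = quo (tetrahedronIdeal n) ((repProduct n).E s h k) := by
  by_cases he : IsEdge s h k
  · cases s
    · exact (repQuotient_gen (Sum.inr ⟨(h, k), isGen_mirror_iff.2 he⟩)).trans
        (congrArg _ (repProduct_gen (Sum.inr ⟨(h, k), isGen_mirror_iff.2 he⟩)).symm)
    · exact (repQuotient_gen (Sum.inl ⟨(h, k), isGen_iff.2 he⟩)).trans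
        (congrArg _ (repProduct_gen (Sum.inl ⟨(h, k), isGen_iff.2 he⟩)).symm)
  · rw [EdgeRep.E_zero _ _ _ _ he, EdgeRep.E_zero _ _ _ _ he, map_zero]

variable (n)

/-- The homomorphism from the quotient of the product algebra to Roberts' algebra. -/
noncomputable def quotientToGamma : QuotientAlg n →+* BGamma n :=
  quoLift (tetrahedronIdeal n) (productToGamma n) fun _ hx => productToGamma_eq_zero hx

/-- The homomorphism from Roberts' algebra to the quotient of the product algebra. -/
noncomputable def gammaToQuotient : BGamma n →+* QuotientAlg n :=
  quoLift (relGamma n) (repQuotient n).gamma.lift fun _ hx => repQuotient_gammaRels.lift_relGamma hx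

variable {n}

theorem productToGamma_idem (u : DecLink n) :
    productToGamma n (quo (relFull n) (idem u)) = quo (relGamma n) (idem u) :=
  (repGamma n).full.lift_idem u

theorem productToGamma_gen (x : (gensFull n).E) : productToGamma n (quo (relFull n) (gen x)) =
    (repGamma n).E (sideFull n x) ((gensFull n).src x) ((gensFull n).tgt x) := by
  refine ((repGamma n).full.lift_gen x).trans ?_
  rcases x with x | x <;> rfl

theorem productToGamma_E (s : Side) (h k : DecLink n) :
    productToGamma n ((repProduct n).E s h k) = (repGamma n).E s h k := by
  by_cases he : IsEdge s h k
  · cases s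
    · exact (congrArg _ (repProduct_gen (Sum.inr ⟨(h, k), isGen_mirror_iff.2 he⟩))).trans
        (productToGamma_gen _)
    · exact (congrArg _ (repProduct_gen (Sum.inl ⟨(h, k), isGen_iff.2 he⟩))).trans
        (productToGamma_gen _)
  · rw [EdgeRep.E_zero _ _ _ _ he, EdgeRep.E_zero _ _ _ _ he, map_zero]

theorem gammaToQuotient_gen (x : (gensGamma n).E) :
    gammaToQuotient n (quo (relGamma n) (gen x)) = (repQuotient n).E x.1.1 x.1.2.1 x.1.2.2 :=
  (repQuotient n).gamma.lift_gen x

theorem gammaToQuotient_E (s : Side) (h k : DecLink n) :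
    gammaToQuotient n ((repGamma n).E s h k) = (repQuotient n).E s h k := by
  by_cases he : IsEdge s h k
  · exact (congrArg _ (repGamma_gen ⟨(s, h, k), he⟩)).trans (gammaToQuotient_gen _)
  · rw [EdgeRep.E_zero _ _ _ _ he, EdgeRep.E_zero _ _ _ _ he, map_zero]

theorem gammaToQuotient_idem (u : DecLink n) : gammaToQuotient n (quo (relGamma n) (idem u)) =
    quo (tetrahedronIdeal n) (quo (relFull n) (idem u)) := (repQuotient n).gamma.lift_idem u

theorem quotientToGamma_gammaToQuotient (x : BGamma n) :
    quotientToGamma n (gammaToQuotient n x) = x := by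
  have h : (quotientToGamma n).comp (gammaToQuotient n) = RingHom.id _ := by
    refine quo_hom_ext (fun u => ?_) fun x => ?_
    · exact (congrArg _ (gammaToQuotient_idem u)).trans (productToGamma_idem u)
    · refine (congrArg _ ((gammaToQuotient_gen x).trans (repQuotient_E _ _ _))).trans ?_
      exact (productToGamma_E _ _ _).trans (repGamma_gen x)
  exact congrArg (fun f : BGamma n →+* BGamma n => f x) h

theorem gammaToQuotient_productToGamma (x : ProductAlg n) :
    gammaToQuotient n (productToGamma n x) = quo (tetrahedronIdeal n) x := by
  have h : (gammaToQuotient n).comp (productToGamma n) = quo (tetrahedronIdeal n) := by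
    refine quo_hom_ext (fun u => ?_) fun x => ?_
    · exact (congrArg _ (productToGamma_idem u)).trans (gammaToQuotient_idem u)
    · exact (congrArg _ (productToGamma_gen x)).trans ((gammaToQuotient_E _ _ _).trans (repQuotient_gen x))
  exact congrArg (fun f : ProductAlg n →+* QuotientAlg n => f x) h

variable (n)

/-- The isomorphism from the quotient of the product algebra to Roberts' algebra. -/
noncomputable def quotientEquivGamma : QuotientAlg n ≃+* BGamma n :=
  RingEquiv.ofRingHom (quotientToGamma n) (gammaToQuotient n)
    (RingHom.ext quotientToGamma_gammaToQuotient) (RingHom.ext fun x => by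
      obtain ⟨x, rfl⟩ := quo_surjective _ x
      exact gammaToQuotient_productToGamma x)

variable {n}

theorem productToGamma_D (x : ProductAlg n) :
    productToGamma n ((derProduct n).D x) = (derGamma n).D (productToGamma n x) := by
  have h : (productToGamma n).mapMatrix.comp (derProduct n).mat =
      (derGamma n).mat.comp (productToGamma n) := by
    refine quo_hom_ext (fun u => ?_) fun x => ?_
    · refine (congrArg (productToGamma n).mapMatrix ((derProduct n).mat_idem u)).trans
        (Eq.trans ?_ (congrArg (derGamma n).mat (productToGamma_idem u)).symm)
      rw [(derGamma n).mat_idem u, RingHom.mapMatrix_apply]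
      ext i j
      fin_cases i <;> fin_cases j <;> simp [productToGamma_idem]
    · refine (congrArg (fun y => (productToGamma n).mapMatrix ((derProduct n).mat y))
        (repProduct_gen x).symm).trans
        (Eq.trans ?_ (congrArg (derGamma n).mat (productToGamma_gen x)).symm)
      rw [derProduct_mat_E, derGamma_mat_E, RingHom.mapMatrix_apply]
      have hs : ∀ h k, productToGamma n ((repProduct n).square h k) = (repGamma n).square h k := by
        intro h k
        rw [EdgeRep.square_apply, EdgeRep.square_apply, map_sum]
        refine Finset.sum_congr rfl fun m _ => ?_
        rw [EdgeRep.two, map_mul, productToGamma_E, productToGamma_E]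
        rfl
      ext i j
      cases sideFull n x <;> fin_cases i <;> fin_cases j <;>
        simp [EdgeRep.ProdRels.derRep, productToGamma_E, hs]
  exact congrArg (fun f : ProductAlg n →+* Matrix (Fin 2) (Fin 2) (BGamma n) => f x 0 1) h

theorem D_mem_tetrahedronIdeal {x : ProductAlg n} (hx : x ∈ tetrahedronIdeal n) :
    (derProduct n).D x ∈ tetrahedronIdeal n := by
  rw [← quo_eq_zero, ← gammaToQuotient_productToGamma, productToGamma_D, productToGamma_eq_zero hx,
    map_zero, map_zero]

theorem map_gradingProduct (d : ℚ × ℤ) :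
    ((gradingProduct n d).map (toQuotient n).toAddMonoidHom).map
      (quotientEquivGamma n).toAddEquiv.toAddMonoidHom = gradingGamma n d := by
  apply le_antisymm
  · rintro _ ⟨_, ⟨x, hx, rfl⟩, rfl⟩
    refine map_mem_of_mem_quoGrading (gr := gradingGamma n)
      (fun _ _ _ _ hx hy => quoGrading_mul_mem hx hy) (productToGamma n) (fun u => ?_) (fun y => ?_) hx
    · rw [productToGamma_idem]
      exact isDGAlgebra_gamma.degree_zero ▸ Submodule.subset_span ⟨u, rfl⟩
    · rw [productToGamma_gen, degFull_eq]
      exact repGamma_E_mem _ _ _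
  · intro x hx
    refine ⟨gammaToQuotient n x, ?_, quotientToGamma_gammaToQuotient x⟩
    refine map_mem_of_mem_quoGrading
      (gr := fun d => (gradingProduct n d).map (toQuotient n).toAddMonoidHom)
      ?_ (gammaToQuotient n) (fun u => ?_) (fun y => ?_) hx
    · rintro i j _ _ ⟨a, ha, rfl⟩ ⟨b, hb, rfl⟩
      exact ⟨a * b, quoGrading_mul_mem ha hb, map_mul (toQuotient n) a b⟩
    · rw [gammaToQuotient_idem]
      exact ⟨_, isDGAlgebra_product.degree_zero ▸ Submodule.subset_span ⟨u, rfl⟩, rfl⟩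
    · rw [gammaToQuotient_gen, degGamma_eq, repQuotient_E]
      exact ⟨_, repProduct_E_mem _ _ _, rfl⟩

end isomorphism

end BorderedKh

theorem mainTheorem5 (n : ℕ) :
    ∃ (D : BorderedKh.ProductAlg n →+ BorderedKh.ProductAlg n)
      (DΓ : BorderedKh.BGamma n →+ BorderedKh.BGamma n),
      -- the product algebra is a differential bigraded algebra
      BorderedKh.IsDGAlgebra (BorderedKh.idemProduct n) (BorderedKh.gradingProduct n) D ∧
      BorderedKh.IsProductDifferential n D ∧
      -- Roberts' algebra is a differential bigraded algebra
      BorderedKh.IsDGAlgebra (BorderedKh.idemGamma n) (BorderedKh.gradingGamma n) DΓ ∧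
      BorderedKh.IsGammaDifferential n DΓ ∧
      -- the differential descends to the quotient by the extra relations
      (∀ x ∈ BorderedKh.tetrahedronIdeal n, D x ∈ BorderedKh.tetrahedronIdeal n) ∧
      -- the quotient is isomorphic to Roberts' algebra
      ∃ Φ : BorderedKh.QuotientAlg n ≃+* BorderedKh.BGamma n,
        -- as an algebra over the idempotent ring
        (∀ h, Φ (BorderedKh.toQuotient n (BorderedKh.idemProduct n h)) =
          BorderedKh.idemGamma n h) ∧
        -- respecting the bigradings
        (∀ d, ((BorderedKh.gradingProduct n d).map
            (BorderedKh.toQuotient n).toAddMonoidHom).map Φ.toAddEquiv.toAddMonoidHom =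
          BorderedKh.gradingGamma n d) ∧
        -- respecting the differentials
        (∀ x, Φ (BorderedKh.toQuotient n (D x)) = DΓ (Φ (BorderedKh.toQuotient n x))) ∧
        -- sending generators of `B` and of `m(B)^!` to right-pointing and left-pointing edges
        (∀ x : (BorderedKh.gensFull n).E, ∃ y : (BorderedKh.gensGamma n).E,
          y.1 = (BorderedKh.sideFull n x, (BorderedKh.gensFull n).src x,
            (BorderedKh.gensFull n).tgt x) ∧
          Φ (BorderedKh.toQuotient n (BorderedKh.toProduct n (BorderedKh.TAlg.gen x))) =
            BorderedKh.toBGamma n (BorderedKh.TAlg.gen y)) := by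
  open BorderedKh in
  exact ⟨(derProduct n).D, (derGamma n).D, isDGAlgebra_product, isProductDifferential,
    isDGAlgebra_gamma, isGammaDifferential, fun x => D_mem_tetrahedronIdeal, quotientEquivGamma n,
    productToGamma_idem, map_gradingProduct, productToGamma_D, fun x =>
      ⟨⟨(sideFull n x, (gensFull n).src x, (gensFull n).tgt x), isEdge_full x⟩, rfl,
        (productToGamma_gen x).trans (repGamma_gen
          ⟨(sideFull n x, (gensFull n).src x, (gensFull n).tgt x), isEdge_full x⟩)⟩⟩
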